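/- Let $R>0$, let $B_R(0)\subset\mathbb{R}^2$ be the open disk of radius $R$ about the origin and let $\Omega=\mathbb{R}^2\setminus B_R(0)$, so that $\partial\Omega=\{|x|=R\}\subset\Omega$. Let $0<\alpha<1$. For $f:\Omega\to\mathbb{R}$ put $$\|f\|_{C^{0,\alpha}_{\mathrm{hom}}(\Omega,|x|^{-1})}:=\sup_{x,y\in\Omega,\;x\neq y}\frac{1}{|x|^{-1-\alpha}+|y|^{-1-\alpha}}\,\frac{|f(x)-f(y)|}{|x-y|^{\alpha}}+\sup_{x\in\Omega}|x|\,|f(x)| ,$$ and let $C^{0,\alpha}_{\mathrm{hom}}(\Omega,|x|^{-1})$ be the space of all $f\in C^{0,\alpha}_{\mathrm{loc}}(\Omega)$ for which this is finite. Here $C^{0,\alpha}_{\mathrm{loc}}(\Omega)$ consists of the functions that are $\alpha$-Hölder on every compact subset of the closed set $\Omega$, and $C^{2,\alpha}_{\mathrm{loc}}(\Omega)$ of the functions that are $C^2$ on $\Omega$ up to the boundary with second derivatives in $C^{0,\alpha}_{\mathrm{loc}}(\Omega)$. Write $v\in e^{|x|^2/8}H^2(\Omega)$ if $e^{-|x|^2/8}v$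 lies in the Sobolev space $H^2$ of the interior of $\Omega$, and put $$\mathcal{L}_{\mathcal P}v=\Delta v-\tfrac12\,(x\cdot\nabla v-v).$$ **Proposition.** Let $E\in C^{0,\alpha}_{\mathrm{hom}}(\Omega,|x|^{-1})$ and let $v\in e^{|x|^2/8}H^2(\Omega)\cap C^{2,\alpha}_{\mathrm{loc}}(\Omega)$ satisfy $\mathcal{L}_{\mathcal P}v=E$ on $\Omega$. Then $$D_{x_ix_j}v\in C^{0,\alpha}_{\mathrm{hom}}(\Omega,|x|^{-1}),\qquad i,j\in\{1,2\}.$$ Moreover, if $R>1$, there is a constant $C>0$ depending only on $\alpha$ and on the radius $R$ such that, for all such $E$ and $v$ that in addition satisfy $v=0$ on $\partial\Omega$, and for all $i,j$, $$\|D_{x_ix_j}v\|_{C^{0,\alpha}_{\mathrm{hom}}(\Omega,|x|^{-1})}\le C\,\|E\|_{C^{0,\alpha}_{\mathrm{hom}}(\Omega,|x|^{-1})}.$$ -/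

import Mathlib

open scoped ENNReal NNReal ContDiff
open MeasureTheory

noncomputable section

namespace ExteriorOU

/-- The Euclidean plane. -/
abbrev Plane : Type := EuclideanSpace ℝ (Fin 2)

/-- The exterior domain `ℝ² \ B_R(0)`, where `B_R(0)` is the open disk; the boundary circle
belongs to the domain. -/
def exteriorDomain (R : ℝ) : Set Plane := {x | R ≤ ‖x‖}

/-- The interior `{|x| > R}` of the exterior domain. -/
def exteriorInterior (R : ℝ) : Set Plane := {x | R < ‖x‖}

/-- The partial derivative `D_i f` of a function on `Ω`. On the boundary of an exterior domain
it is the derivative from inside the domain. -/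
def partialD (Ω : Set Plane) (i : Fin 2) (f : Plane → ℝ) : Plane → ℝ :=
  fun x => fderivWithin ℝ f Ω x (EuclideanSpace.single i 1)

/-- The second partial derivative `D_{ij} f = D_i (D_j f)`. -/
def partialD₂ (Ω : Set Plane) (i j : Fin 2) (f : Plane → ℝ) : Plane → ℝ :=
  partialD Ω i (partialD Ω j f)

/-- `L u = Δ u - (1/2) (x · ∇u - u)`. -/
def opL (Ω : Set Plane) (u : Plane → ℝ) : Plane → ℝ :=
  fun x => (∑ i, partialD₂ Ω i i u x) - (1 / 2) * ((∑ i, x i * partialD Ω i u x) - u x)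

/-- `C^{0,α}_loc(Ω)`: Hölder continuous with exponent `α` on every compact subset of `Ω`. For a
closed `Ω`, compact subsets may touch the boundary. -/
def MemHolderLoc (α : ℝ≥0) (Ω : Set Plane) (f : Plane → ℝ) : Prop :=
  ∀ K ⊆ Ω, IsCompact K → ∃ C : ℝ≥0, HolderOnWith C α f K

/-- `C^{2,α}_loc(Ω)`. -/
def MemHolderLoc₂ (α : ℝ≥0) (Ω : Set Plane) (f : Plane → ℝ) : Prop :=
  ContDiffOn ℝ 2 f Ω ∧ ∀ i j, MemHolderLoc α Ω (partialD₂ Ω i j f)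

/-- The weighted Hölder coefficient `[f]_{Ω,α,-k-α}`. -/
def homSeminorm (α : ℝ≥0) (k : ℕ) (Ω : Set Plane) (f : Plane → ℝ) : ℝ≥0∞ :=
  ⨆ x ∈ Ω, ⨆ y ∈ Ω, ⨆ _ : x ≠ y,
    ENNReal.ofReal
      (1 / (‖x‖ ^ (-(k : ℝ) - (α : ℝ)) + ‖y‖ ^ (-(k : ℝ) - (α : ℝ))) *
        (|f x - f y| / ‖x - y‖ ^ (α : ℝ)))

/-- The norm of `C^{0,α}_hom(Ω, |x|^{-k})`, with value `∞` if it is not finite. -/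
def homNorm (α : ℝ≥0) (k : ℕ) (Ω : Set Plane) (f : Plane → ℝ) : ℝ≥0∞ :=
  homSeminorm α k Ω f + ⨆ x ∈ Ω, ENNReal.ofReal (‖x‖ ^ k * |f x|)

/-- `f ∈ C^{0,α}_hom(Ω, |x|^{-k})`. -/
def MemHom (α : ℝ≥0) (k : ℕ) (Ω : Set Plane) (f : Plane → ℝ) : Prop :=
  MemHolderLoc α Ω f ∧ homNorm α k Ω f < ⊤

/-- `g` is the weak partial derivative `D_i w` on the open set `U`. -/
def HasWeakPartial (U : Set Plane) (i : Fin 2) (w g : Plane → ℝ) : Prop :=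
  ∀ φ : Plane → ℝ, ContDiff ℝ ∞ φ → HasCompactSupport φ → tsupport φ ⊆ U →
    ∫ x in U, w x * fderiv ℝ φ x (EuclideanSpace.single i 1) = - ∫ x in U, g x * φ x

/-- The Sobolev space `H^s(U)` of functions with `s` weak derivatives in `L²(U)`. -/
def MemSobolev (U : Set Plane) : ℕ → (Plane → ℝ) → Prop
  | 0, w => MemLp w 2 (volume.restrict U)
  | s + 1, w => MemLp w 2 (volume.restrict U) ∧
      ∀ i, ∃ g, HasWeakPartial U i w g ∧ MemSobolev U s g

/-- `v ∈ e^{|x|²/8} H²` on the exterior of the disk of radius `R`. -/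
def MemExpSobolev₂ (R : ℝ) (v : Plane → ℝ) : Prop :=
  MemSobolev (exteriorInterior R) 2 (fun x => Real.exp (-(‖x‖ ^ 2 / 8)) * v x)

/-- `v ∈ e^{|x|²/8} H²(Ω) ∩ C^{2,α}_loc(Ω)` and `L v = E` on `Ω`, where `Ω` is the exterior of the
disk of radius `R`. -/
def IsSolution (α : ℝ≥0) (R : ℝ) (E v : Plane → ℝ) : Prop :=
  MemExpSobolev₂ R v ∧ MemHolderLoc₂ α (exteriorDomain R) v ∧
    ∀ x ∈ exteriorDomain R, opL (exteriorDomain R) v x = E x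

end ExteriorOU

end

open scoped ENNReal NNReal ContDiff
open MeasureTheory

noncomputable section

namespace ExteriorOU

open Set Filter Topology

/-! ### Partial derivatives and Green's identity -/

/-! Write `L v = Δ v - (x · ∇v - v) / 2` (`ou` below). One principle carries all the Schauder-type
estimates. A second derivative of `u` at `x` is the limit, at scale zero, of `s ^ (-2)` times an
average of `u` against a second derivative of a kernel. The scale derivative of this quantity is an
average of the source against a kernel of mean zero. Hölder continuity of the source makes it
integrable in the scale, so second derivatives are estimated by comparing functions of one real
variable with powers of `s`.

Whole plane (`exists_far_estimate`). With `q = (1 + s² / 2) ^ (-1/2) = e ^ (-t/2)`, Mehler's formula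
says that `ouMean` is, up to the mass of the Gaussian, `D_ij e^{tL} w`. Its `s`-derivative is the
same expression with `w` replaced by `L w`, times `dt/ds = s q²` (`hasDerivAt_ouMean`). If `L v` is
Hölder with weight `|x| ^ (-1-α)`, this derivative is bounded by multiples of `|x| ^ (-1-α) s ^
(α-1)` and of `s ^ (-2)`. Switching at `s = |x|` gives `|D_ij v| ≤ C / |x|`. For a difference one
gains a factor `|x-x'| / s` beyond `s = |x-x'|`, which gives the weighted Hölder bound. The boundary
term at `s = ∞` vanishes, and cutoffs at infinity are harmless, because `v` grows more slowly than
the Gaussian kernel decays.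

Growth (`exists_growth`). The function `u = e^{-|x|²/8} v` lies in `L²` and solves an equation
without drift whose potential grows quadratically. Local bounds give polynomial growth of `u` and
`∇u`, hence `|v|, |∇v| ≤ B e^{5|x|²/32}`.

Exterior domain (`exists_homBound`). Cut `v` off near the circle and apply the whole-plane estimate.
The new source is controlled by `L v` and by a `C^{2,α}` bound of `v` on an annulus. For the first
claim that bound is finite because `v` is `C^{2,α}` up to the circle.

For the second claim it must be linear in the norm of `E`, which takes two ingredients. The function
`|x| - a/|x|` with `1 < a ≤ R²` is a nonnegative supersolution, available exactly because `R > 1`;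
comparison gives `|v| ≤ C ‖E‖ |x|` (`abs_le_barrier`). Then a boundary Schauder estimate
(`exists_boundary_bound`): remove the drift by the Gaussian weight, flatten the circle by the
conformal map `R e^{s+iθ}`, and reflect oddly. The reflected source jumps across the line but
remains Hölder along it. This controls all second derivatives except the purely normal one, which
the equation supplies (`exists_tangential_bound`, `exists_flat_hessian_bound`). -/

/-- The `i`-th partial derivative. -/
def pd (i : Fin 2) (f : Plane → ℝ) : Plane → ℝ :=
  fun x => fderiv ℝ f x (EuclideanSpace.single i 1)

/-- The Laplacian. -/
def lap (f : Plane → ℝ) : Plane → ℝ := fun x => ∑ i, pd i (pd i f) x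

lemma fderiv_apply_eq_sum_pd (f : Plane → ℝ) (x v : Plane) :
    fderiv ℝ f x v = ∑ i, v i * pd i f x := by
  have hv : v = ∑ i, v i • EuclideanSpace.single i (1 : ℝ) := by
    ext j
    fin_cases j <;> simp [Fin.sum_univ_two]
  conv_lhs => rw [hv]
  simp [pd, Fin.sum_univ_two]

lemma abs_pd_le_norm_fderiv (i : Fin 2) (f : Plane → ℝ) (x : Plane) :
    |pd i f x| ≤ ‖fderiv ℝ f x‖ := by
  have := (fderiv ℝ f x).le_opNorm (EuclideanSpace.single i (1 : ℝ))
  simpa [pd] using this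

lemma abs_coord_le_norm (x : Plane) (i : Fin 2) : |x i| ≤ ‖x‖ := by
  simpa using PiLp.norm_apply_le x i

lemma norm_fderiv_le_of_pd {f : Plane → ℝ} {x : Plane} {C : ℝ} (hC : ∀ i, |pd i f x| ≤ C) :
    ‖fderiv ℝ f x‖ ≤ 2 * C := by
  have hC0 : 0 ≤ C := (abs_nonneg _).trans (hC 0)
  refine ContinuousLinearMap.opNorm_le_bound _ (by positivity) fun v => ?_
  rw [fderiv_apply_eq_sum_pd, Fin.sum_univ_two, Real.norm_eq_abs]
  have h0 : |v 0 * pd 0 f x| ≤ ‖v‖ * C := by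
    rw [abs_mul]; gcongr; exacts [abs_coord_le_norm v 0, hC 0]
  have h1 : |v 1 * pd 1 f x| ≤ ‖v‖ * C := by
    rw [abs_mul]; gcongr; exacts [abs_coord_le_norm v 1, hC 1]
  exact (abs_add_le _ _).trans (by linarith)

lemma contDiffOn_pd {U : Set Plane} (hU : IsOpen U) {f : Plane → ℝ} {n m : ℕ∞ω}
    (hf : ContDiffOn ℝ n f U) (hmn : m + 1 ≤ n) (i : Fin 2) : ContDiffOn ℝ m (pd i f) U :=
  (hf.fderiv_of_isOpen hU hmn).clm_apply contDiffOn_const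

lemma contDiff_pd {f : Plane → ℝ} {n m : ℕ∞ω}
    (hf : ContDiff ℝ n f) (hmn : m + 1 ≤ n) (i : Fin 2) : ContDiff ℝ m (pd i f) :=
  (hf.fderiv_right hmn).clm_apply contDiff_const

lemma contDiff_infty_pd {f : Plane → ℝ} (hf : ContDiff ℝ ∞ f) (i : Fin 2) :
    ContDiff ℝ ∞ (pd i f) := contDiff_pd hf (by simp) i

lemma contDiffAt_pd {f : Plane → ℝ} {n m : ℕ∞ω} {x : Plane}
    (hf : ContDiffAt ℝ n f x) (hmn : m + 1 ≤ n) (i : Fin 2) : ContDiffAt ℝ m (pd i f) x :=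
  (hf.fderiv_right hmn).clm_apply contDiffAt_const

lemma pd_congr {f g : Plane → ℝ} {x : Plane} (h : f =ᶠ[𝓝 x] g) (i : Fin 2) :
    pd i f x = pd i g x := by simp only [pd, h.fderiv_eq]

lemma pd_eventuallyEq {f g : Plane → ℝ} {x : Plane} (h : f =ᶠ[𝓝 x] g) (i : Fin 2) :
    pd i f =ᶠ[𝓝 x] pd i g := by
  filter_upwards [h.fderiv (𝕜 := ℝ)] with y hy
  simp only [pd, hy]

lemma lap_congr {f g : Plane → ℝ} {x : Plane} (h : f =ᶠ[𝓝 x] g) : lap f x = lap g x :=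
  Finset.sum_congr rfl fun i _ => pd_congr (pd_eventuallyEq h i) i

lemma pd_add {f g : Plane → ℝ} {x : Plane} (hf : DifferentiableAt ℝ f x)
    (hg : DifferentiableAt ℝ g x) (i : Fin 2) :
    pd i (fun y => f y + g y) x = pd i f x + pd i g x := by
  simp [pd, fderiv_fun_add hf hg]

lemma pd_sub {f g : Plane → ℝ} {x : Plane} (hf : DifferentiableAt ℝ f x)
    (hg : DifferentiableAt ℝ g x) (i : Fin 2) :
    pd i (fun y => f y - g y) x = pd i f x - pd i g x := by
  simp [pd, fderiv_fun_sub hf hg]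

lemma pd_mul {f g : Plane → ℝ} {x : Plane} (hf : DifferentiableAt ℝ f x)
    (hg : DifferentiableAt ℝ g x) (i : Fin 2) :
    pd i (fun y => f y * g y) x = pd i f x * g x + f x * pd i g x := by
  simp [pd, fderiv_fun_mul hf hg]; ring

lemma pd_const_mul {f : Plane → ℝ} {x : Plane} (hf : DifferentiableAt ℝ f x) (c : ℝ)
    (i : Fin 2) : pd i (fun y => c * f y) x = c * pd i f x := by
  simp [pd, fderiv_const_mul hf]

lemma pd_const (c : ℝ) (i : Fin 2) (x : Plane) : pd i (fun _ => c) x = 0 := by simp [pd]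

lemma pd_coord (i j : Fin 2) (x : Plane) :
    pd i (fun y => y j) x = if j = i then 1 else 0 := by
  have : (fun y : Plane => y j) = EuclideanSpace.proj (𝕜 := ℝ) j := rfl
  simp only [pd]
  rw [this, ContinuousLinearMap.fderiv]
  simp

lemma differentiable_coord (j : Fin 2) : Differentiable ℝ fun y : Plane => y j :=
  (EuclideanSpace.proj (𝕜 := ℝ) j).differentiable

lemma contDiff_coord (j : Fin 2) {n : ℕ∞ω} : ContDiff ℝ n fun y : Plane => y j :=
  (EuclideanSpace.proj (𝕜 := ℝ) j).contDiff

lemma pd_comp_real {h : ℝ → ℝ} {f : Plane → ℝ} {x : Plane} {h' : ℝ} (hh : HasDerivAt h h' (f x))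
    (hf : DifferentiableAt ℝ f x) (i : Fin 2) : pd i (fun y => h (f y)) x = h' * pd i f x := by
  have := (hh.comp_hasFDerivAt x hf.hasFDerivAt).fderiv
  simp only [pd]
  rw [show (fun y => h (f y)) = h ∘ f from rfl, this]
  simp

lemma pd_normSq (i : Fin 2) (x : Plane) : pd i (fun y => ‖y‖ ^ 2) x = 2 * x i := by
  simp only [pd]
  rw [show (fun y : Plane => ‖y‖ ^ 2) = fun y => ‖y‖ ^ 2 from rfl, fderiv_norm_sq_apply]
  simp [PiLp.inner_apply]

lemma normSq_eq (x : Plane) : ‖x‖ ^ 2 = x 0 ^ 2 + x 1 ^ 2 := by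
  simp [EuclideanSpace.norm_sq_eq, Fin.sum_univ_two]

lemma contDiff_normSq {n : ℕ∞ω} : ContDiff ℝ n fun y : Plane => ‖y‖ ^ 2 := contDiff_norm_sq ℝ

lemma pd_comp_affine {f : Plane → ℝ} (a : Plane) (s : ℝ) {z : Plane}
    (hf : DifferentiableAt ℝ f (a + s • z)) (i : Fin 2) :
    pd i (fun z => f (a + s • z)) z = s * pd i f (a + s • z) := by
  have h1 : HasFDerivAt (fun z : Plane => a + s • z) (s • ContinuousLinearMap.id ℝ Plane) z := by
    simpa using ((hasFDerivAt_id z).const_smul s).const_add a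
  have := (hf.hasFDerivAt.comp z h1).fderiv
  simp only [pd]
  rw [show (fun z => f (a + s • z)) = f ∘ fun z => a + s • z from rfl, this]
  simp

lemma pd_comm {f : Plane → ℝ} {x : Plane} (hf : ContDiffAt ℝ 2 f x) (i j : Fin 2) :
    pd i (pd j f) x = pd j (pd i f) x := by
  have hs := hf.isSymmSndFDerivAt (by simp)
  have hd : DifferentiableAt ℝ (fderiv ℝ f) x :=
    (hf.fderiv_right (m := 1) (by norm_num)).differentiableAt (by norm_num)
  have key : ∀ a b : Fin 2, pd a (pd b f) x =
      fderiv ℝ (fderiv ℝ f) x (EuclideanSpace.single a 1) (EuclideanSpace.single b 1) := by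
    intro a b
    change fderiv ℝ (fun y => fderiv ℝ f y (EuclideanSpace.single b 1)) x _ = _
    rw [fderiv_clm_apply hd (differentiableAt_const _)]
    simp
  rw [key, key]
  exact hs _ _

lemma lap_comp_affine {f : Plane → ℝ} (hf : ContDiff ℝ 2 f) (a : Plane) (s : ℝ) (z : Plane) :
    lap (fun z => f (a + s • z)) z = s ^ 2 * lap f (a + s • z) := by
  have h1 : ∀ i, pd i (fun z => f (a + s • z)) = fun z => s * pd i f (a + s • z) := fun i =>
    funext fun z => pd_comp_affine a s (hf.differentiable (by norm_num) _) i
  have hd : ∀ i, Differentiable ℝ (pd i f) := fun i =>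
    (contDiff_pd hf (m := 1) (by norm_num) i).differentiable (by norm_num)
  simp only [lap, Finset.mul_sum]
  refine Finset.sum_congr rfl fun i _ => ?_
  have hd' : Differentiable ℝ fun z => pd i f (a + s • z) :=
    (hd i).comp ((differentiable_id.const_smul s).const_add a)
  rw [h1, pd_const_mul (hd' z), pd_comp_affine a s (hd i _)]
  ring

lemma tsupport_pd_subset (i : Fin 2) (f : Plane → ℝ) : tsupport (pd i f) ⊆ tsupport f := by
  refine closure_minimal (fun x hx => ?_) (isClosed_tsupport f)
  by_contra h
  apply hx
  rw [notMem_tsupport_iff_eventuallyEq] at h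
  rw [pd_congr h]
  simp [pd]

lemma tsupport_lap_subset (f : Plane → ℝ) : tsupport (lap f) ⊆ tsupport f := by
  refine closure_minimal (fun x hx => ?_) (isClosed_tsupport f)
  by_contra h
  apply hx
  refine Finset.sum_eq_zero fun i _ => image_eq_zero_of_notMem_tsupport fun h' => h ?_
  exact tsupport_pd_subset i f (tsupport_pd_subset i _ h')

lemma hasCompactSupport_pd {f : Plane → ℝ} (hf : HasCompactSupport f) (i : Fin 2) :
    HasCompactSupport (pd i f) :=
  IsCompact.of_isClosed_subset hf (isClosed_tsupport _) (tsupport_pd_subset i f)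

lemma hasCompactSupport_lap {f : Plane → ℝ} (hf : HasCompactSupport f) :
    HasCompactSupport (lap f) :=
  IsCompact.of_isClosed_subset hf (isClosed_tsupport _) (tsupport_lap_subset f)

lemma continuous_lap {f : Plane → ℝ} (hf : ContDiff ℝ 2 f) : Continuous (lap f) :=
  continuous_finsetSum _ fun i _ =>
    (contDiff_pd (contDiff_pd hf (m := 1) (by norm_num) i) (m := 0) (by norm_num) i).continuous

/-- Nothing is assumed about `u` off `U`: since the support of `χ` lies in `U`, the product extended
by zero is continuous with compact support. This lets solutions known only on an open set be tested
on the whole plane. -/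
lemma integrable_mul_of_tsupport_subset {u χ : Plane → ℝ} {U : Set Plane} (hU : IsOpen U)
    (hu : ContinuousOn u U) (hχ : Continuous χ) (hc : HasCompactSupport χ) (hs : tsupport χ ⊆ U) :
    Integrable fun x => u x * χ x := by
  have hcont : Continuous fun x => u x * χ x := by
    rw [continuous_iff_continuousAt]
    intro x
    by_cases hx : x ∈ U
    · exact (hu.continuousAt (hU.mem_nhds hx)).mul hχ.continuousAt
    · have h0 : χ =ᶠ[𝓝 x] 0 := notMem_tsupport_iff_eventuallyEq.1 fun h => hx (hs h)
      refine (continuousAt_const (y := (0 : ℝ))).congr ?_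
      filter_upwards [h0] with y hy
      simp [hy]
  exact hcont.integrable_of_hasCompactSupport hc.mul_left

lemma integral_mul_pd {u χ : Plane → ℝ} {U : Set Plane} (hU : IsOpen U)
    (hu : ContDiffOn ℝ 1 u U) (hχ : ContDiff ℝ 1 χ) (hc : HasCompactSupport χ)
    (hs : tsupport χ ⊆ U) (i : Fin 2) :
    ∫ x, u x * pd i χ x = - ∫ x, pd i u x * χ x := by
  have hpu : ContinuousOn (pd i u) U := (contDiffOn_pd hU hu (m := 0) (by norm_num) i).continuousOn
  refine integral_mul_fderiv_eq_neg_fderiv_mul_of_integrable ?_ ?_ ?_ ?_ ?_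
  · exact integrable_mul_of_tsupport_subset hU hpu hχ.continuous hc hs
  · exact integrable_mul_of_tsupport_subset hU hu.continuousOn
      (contDiff_pd hχ (m := 0) (by norm_num) i).continuous (hasCompactSupport_pd hc i)
      ((tsupport_pd_subset i χ).trans hs)
  · exact integrable_mul_of_tsupport_subset hU hu.continuousOn hχ.continuous hc hs
  · exact fun x hx => (hu.contDiffAt (hU.mem_nhds (hs hx))).differentiableAt (by norm_num)
  · exact fun x _ => hχ.differentiable (by norm_num) x

lemma integral_mul_pd_pd {u χ : Plane → ℝ} {U : Set Plane} (hU : IsOpen U)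
    (hu : ContDiffOn ℝ 2 u U) (hχ : ContDiff ℝ 2 χ) (hc : HasCompactSupport χ)
    (hs : tsupport χ ⊆ U) (i j : Fin 2) :
    ∫ x, u x * pd i (pd j χ) x = ∫ x, pd j (pd i u) x * χ x := by
  rw [integral_mul_pd hU (hu.of_le (by norm_num)) (contDiff_pd hχ (by norm_num) j)
    (hasCompactSupport_pd hc j) ((tsupport_pd_subset j χ).trans hs) i,
    integral_mul_pd hU (contDiffOn_pd hU hu (by norm_num) i) (hχ.of_le (by norm_num)) hc hs j,
    neg_neg]

/-- Green's identity for a compactly supported test function. -/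
lemma integral_mul_lap {u χ : Plane → ℝ} {U : Set Plane} (hU : IsOpen U)
    (hu : ContDiffOn ℝ 2 u U) (hχ : ContDiff ℝ 2 χ) (hc : HasCompactSupport χ)
    (hs : tsupport χ ⊆ U) : ∫ x, u x * lap χ x = ∫ x, lap u x * χ x := by
  have h1 : ∀ i : Fin 2, Integrable fun x => u x * pd i (pd i χ) x := fun i =>
    integrable_mul_of_tsupport_subset hU hu.continuousOn
      (contDiff_pd (contDiff_pd hχ (m := 1) (by norm_num) i) (m := 0) (by norm_num) i).continuous
      (hasCompactSupport_pd (hasCompactSupport_pd hc i) i)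
      (((tsupport_pd_subset i _).trans (tsupport_pd_subset i χ)).trans hs)
  have h2 : ∀ i : Fin 2, Integrable fun x => pd i (pd i u) x * χ x := fun i =>
    integrable_mul_of_tsupport_subset hU (contDiffOn_pd hU
      (contDiffOn_pd hU hu (m := 1) (by norm_num) i) (m := 0) (by norm_num) i).continuousOn
      hχ.continuous hc hs
  simp only [lap, Finset.mul_sum, Finset.sum_mul]
  rw [integral_finsetSum _ fun i _ => h1 i, integral_finsetSum _ fun i _ => h2 i]
  exact Finset.sum_congr rfl fun i _ => integral_mul_pd_pd hU hu hχ hc hs i i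

lemma pd_radial {h h1 : ℝ → ℝ} {x : Plane} (hh : HasDerivAt h (h1 (‖x‖ ^ 2)) (‖x‖ ^ 2))
    (i : Fin 2) : pd i (fun y => h (‖y‖ ^ 2)) x = 2 * x i * h1 (‖x‖ ^ 2) := by
  rw [pd_comp_real hh (contDiff_normSq.differentiable (n := 1) (by norm_num) x), pd_normSq]
  ring

lemma lap_radial {h h1 : ℝ → ℝ} {h2 : ℝ} {x : Plane}
    (hh : ∀ᶠ t in 𝓝 (‖x‖ ^ 2), HasDerivAt h (h1 t) t) (hh1 : HasDerivAt h1 h2 (‖x‖ ^ 2)) :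
    lap (fun y => h (‖y‖ ^ 2)) x = 4 * h1 (‖x‖ ^ 2) + 4 * ‖x‖ ^ 2 * h2 := by
  have hd : DifferentiableAt ℝ (fun y : Plane => ‖y‖ ^ 2) x :=
    contDiff_normSq.differentiable (n := 1) (by norm_num) x
  have hc : Tendsto (fun y : Plane => ‖y‖ ^ 2) (𝓝 x) (𝓝 (‖x‖ ^ 2)) := hd.continuousAt
  have hd1 : DifferentiableAt ℝ (fun y : Plane => h1 (‖y‖ ^ 2)) x :=
    (hh1.differentiableAt).comp x hd
  have key : ∀ i, pd i (pd i fun y => h (‖y‖ ^ 2)) x =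
      2 * h1 (‖x‖ ^ 2) + 4 * x i ^ 2 * h2 := by
    intro i
    have h3 : pd i (fun y => h (‖y‖ ^ 2)) =ᶠ[𝓝 x] fun y => (2 * y i) * h1 (‖y‖ ^ 2) := by
      filter_upwards [hc.eventually hh] with y hy
      exact pd_radial hy i
    rw [pd_congr h3, pd_mul ((differentiable_coord i x).const_mul 2) hd1,
      pd_const_mul (differentiable_coord i x), pd_coord, pd_comp_real hh1 hd, pd_normSq]
    simp; ring
  simp only [lap, key, Fin.sum_univ_two]
  linear_combination (-4 * h2) * normSq_eq x

/-! ### Kernel pairs and a compactly supported mollifier -/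

/-- The relation between `κ` and `λ` which makes `s ↦ s ^ (-m) ∫ u (x + s z) κ z` have the
derivative `s ^ (1 - m) ∫ (Δ u) (x + s z) λ z`. -/
structure KernelPair (m : ℕ) (κ l : Plane → ℝ) : Prop where
  smooth_left : ContDiff ℝ ∞ κ
  smooth_right : ContDiff ℝ ∞ l
  lap_eq : ∀ z, lap l z = -(2 + m) * κ z - ∑ i, z i * pd i κ z

lemma contDiff_two_of_infty {f : Plane → ℝ} (hf : ContDiff ℝ ∞ f) : ContDiff ℝ 2 f :=
  contDiff_infty.1 hf 2

lemma pd_comm_fun {f : Plane → ℝ} (hf : ContDiff ℝ ∞ f) (i j : Fin 2) :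
    pd i (pd j f) = pd j (pd i f) :=
  funext fun _ => pd_comm ((contDiff_two_of_infty hf).contDiffAt) i j

lemma pd_lap {f : Plane → ℝ} (hf : ContDiff ℝ ∞ f) (k : Fin 2) (z : Plane) :
    pd k (lap f) z = lap (pd k f) z := by
  have hd : ∀ i, Differentiable ℝ (pd i (pd i f)) := fun i =>
    (contDiff_infty_pd (contDiff_infty_pd hf i) i).differentiable (by simp)
  have h1 : lap f = fun x => pd 0 (pd 0 f) x + pd 1 (pd 1 f) x := by
    funext x; simp [lap, Fin.sum_univ_two]
  rw [h1, pd_add (hd 0 z) (hd 1 z)]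
  simp only [lap, Fin.sum_univ_two]
  rw [pd_comm_fun (contDiff_infty_pd hf 0) k 0, pd_comm_fun (contDiff_infty_pd hf 1) k 1,
    pd_comm_fun hf k 0, pd_comm_fun hf k 1]

/-- `∂_k` commutes with the Laplacian, and `∂_k (z · ∇κ) = ∂_k κ + z · ∇ ∂_k κ`; the extra term
raises `m` by one. So one scalar pair yields pairs for all derivative kernels, and their partners
are again derivatives, which gives them mean zero. -/
lemma KernelPair.pd {m : ℕ} {κ l : Plane → ℝ} (h : KernelPair m κ l) (k : Fin 2) :
    KernelPair (m + 1) (pd k κ) (pd k l) where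
  smooth_left := contDiff_infty_pd h.smooth_left k
  smooth_right := contDiff_infty_pd h.smooth_right k
  lap_eq z := by
    have hκ : Differentiable ℝ κ := h.smooth_left.differentiable (by simp)
    have hpκ : ∀ i, Differentiable ℝ (ExteriorOU.pd i κ) := fun i =>
      (contDiff_infty_pd h.smooth_left i).differentiable (by simp)
    have h1 : lap l = fun z => -(2 + m) * κ z -
        (z 0 * ExteriorOU.pd 0 κ z + z 1 * ExteriorOU.pd 1 κ z) := by
      funext z; rw [h.lap_eq, Fin.sum_univ_two]
    have hm : ∀ i : Fin 2, Differentiable ℝ fun z : Plane => z i * ExteriorOU.pd i κ z :=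
      fun i => (differentiable_coord i).mul (hpκ i)
    rw [← pd_lap h.smooth_right, h1, pd_sub ((hκ z).const_mul _) ((hm 0 z).fun_add (hm 1 z)),
      pd_const_mul (hκ z), pd_add (hm 0 z) (hm 1 z), pd_mul (differentiable_coord 0 z) (hpκ 0 z),
      pd_mul (differentiable_coord 1 z) (hpκ 1 z), pd_coord, pd_coord, Fin.sum_univ_two,
      pd_comm_fun h.smooth_left k 0, pd_comm_fun h.smooth_left k 1]
    fin_cases k <;> simp <;> ring

/-- A radial bump `φ`, with a potential `ψ` such that `∇ ψ = - z φ`. -/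
lemma exists_mollifier : ∃ φ ψ : Plane → ℝ, KernelPair 0 φ ψ ∧ tsupport φ ⊆ Metric.closedBall 0 1 ∧
    tsupport ψ ⊆ Metric.closedBall 0 1 ∧ 0 < ∫ z, φ z := by
  let b : ContDiffBump (0 : ℝ) := ⟨1 / 2, 1, by norm_num, by norm_num⟩
  have hb : ContDiff ℝ ∞ b := b.contDiff
  -- `Ψ' = -b / 2` makes `∇ (Ψ (|z|²)) = -z b (|z|²)`, whose divergence is `-2 φ - z · ∇φ`, the
  -- required relation with `m = 0`. Integrating up to `1` keeps the support in the unit ball.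
  let Ψ : ℝ → ℝ := fun t => (1 / 2) * ∫ τ in t..1, b τ
  have hΨ : ∀ t, HasDerivAt Ψ (-(1 / 2) * b t) t := by
    intro t
    have := intervalIntegral.integral_hasDerivAt_left (hb.continuous.intervalIntegrable t 1)
      (hb.continuous.stronglyMeasurableAtFilter _ _) hb.continuous.continuousAt
    refine (this.const_mul (1 / 2)).congr_deriv (by ring)
  have hΨs : ContDiff ℝ ∞ Ψ := by
    rw [contDiff_infty_iff_deriv]
    refine ⟨fun t => (hΨ t).differentiableAt, ?_⟩
    have : deriv Ψ = fun t => -(1 / 2) * b t := funext fun t => (hΨ t).deriv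
    rw [this]
    exact contDiff_const.mul hb
  have hbz : ∀ t : ℝ, 1 ≤ t → b t = 0 := fun t ht =>
    b.zero_of_le_dist (by simpa [Real.dist_eq, abs_of_nonneg (zero_le_one.trans ht)] using ht)
  have hΨz : ∀ t : ℝ, 1 ≤ t → Ψ t = 0 := by
    intro t ht
    have : ∫ τ in t..1, b τ = ∫ τ in t..1, (0 : ℝ) := by
      refine intervalIntegral.integral_congr fun τ hτ => ?_
      rw [uIcc_of_ge ht] at hτ
      exact hbz τ hτ.1
    simp [Ψ, this]
  have hsupp : ∀ h : ℝ → ℝ, (∀ t, 1 ≤ t → h t = 0) →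
      tsupport (fun z : Plane => h (‖z‖ ^ 2)) ⊆ Metric.closedBall 0 1 := by
    intro h hh
    refine closure_minimal (fun z hz => ?_) Metric.isClosed_closedBall
    by_contra hz'
    apply hz
    apply hh
    simp only [Metric.mem_closedBall, dist_zero_right, not_le] at hz'
    nlinarith
  have hφs : ContDiff ℝ ∞ fun z : Plane => b (‖z‖ ^ 2) := hb.comp contDiff_normSq
  refine ⟨fun z => b (‖z‖ ^ 2), fun z => Ψ (‖z‖ ^ 2),
    ⟨hφs, hΨs.comp contDiff_normSq, ?_⟩, hsupp _ hbz, hsupp _ hΨz, ?_⟩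
  · intro z
    have hbd : ∀ t, HasDerivAt b (deriv b t) t := fun t =>
      (hb.differentiable (by simp) t).hasDerivAt
    rw [lap_radial (h1 := fun t => -(1 / 2) * b t) (Eventually.of_forall hΨ)
      ((hbd _).const_mul _), Fin.sum_univ_two, pd_radial (hbd _), pd_radial (hbd _)]
    have := normSq_eq z
    push_cast
    linear_combination (-2 * deriv b (‖z‖ ^ 2)) * this
  · refine Continuous.integral_pos_of_hasCompactSupport_nonneg_nonzero (x := 0) hφs.continuous
      (IsCompact.of_isClosed_subset (isCompact_closedBall _ _) (isClosed_tsupport _)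
        (hsupp _ hbz)) (fun z => b.nonneg) ?_
    have : b (‖(0 : Plane)‖ ^ 2) = 1 := b.one_of_mem_closedBall (by simp [b])
    rw [this]; norm_num

/-! ### The Gaussian, its second derivatives and their decay -/

/-- The Gaussian `exp (-|z|² / 2)`. -/
def gauss (z : Plane) : ℝ := Real.exp (-(1 / 2) * ‖z‖ ^ 2)

lemma contDiff_gauss {n : ℕ∞ω} : ContDiff ℝ n gauss :=
  (contDiff_const.mul contDiff_normSq).exp

lemma hasDerivAt_exp_mul (c t : ℝ) :
    HasDerivAt (fun t => Real.exp (c * t)) (c * Real.exp (c * t)) t := by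
  have := ((hasDerivAt_id t).const_mul c).exp
  simpa [mul_comm] using this

lemma pd_gauss (i : Fin 2) : pd i gauss = fun z => -z i * gauss z := by
  funext z
  rw [show gauss = fun z => Real.exp (-(1 / 2) * ‖z‖ ^ 2) from rfl]
  rw [pd_radial (h := fun t => Real.exp (-(1 / 2) * t))
    (h1 := fun t => -(1 / 2) * Real.exp (-(1 / 2) * t)) (hasDerivAt_exp_mul _ _)]
  ring

/-- Since `∇ gauss = -z gauss`, the Gaussian is its own partner. Hence so are its second
derivatives, with `m = 2`, and this self-pairing is what is compatible with the drift of the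
Ornstein-Uhlenbeck operator. -/
lemma kernelPair_gauss : KernelPair 0 gauss gauss where
  smooth_left := contDiff_gauss
  smooth_right := contDiff_gauss
  lap_eq z := by
    have := lap_radial (h := fun t => Real.exp (-(1 / 2) * t))
      (h1 := fun t => -(1 / 2) * Real.exp (-(1 / 2) * t)) (x := z)
      (Eventually.of_forall (hasDerivAt_exp_mul _)) ((hasDerivAt_exp_mul _ _).const_mul _)
    rw [show (fun y : Plane => Real.exp (-(1 / 2) * ‖y‖ ^ 2)) = gauss from rfl] at this
    rw [this, Fin.sum_univ_two, pd_gauss, pd_gauss]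
    have h2 := normSq_eq z
    simp only [gauss]
    push_cast
    linear_combination (Real.exp (-(1 / 2) * ‖z‖ ^ 2)) * h2

/-- `(1 + t) ^ n ≤ e ^ (n t)`, and completing the square gives `n t ≤ n² / (4 c) + c t²`. -/
lemma one_add_pow_le_exp (n : ℕ) {c : ℝ} (hc : 0 < c) :
    ∃ C : ℝ, 0 < C ∧ ∀ t : ℝ, 0 ≤ t → (1 + t) ^ n ≤ C * Real.exp (c * t ^ 2) := by
  refine ⟨Real.exp (n ^ 2 / (4 * c)), Real.exp_pos _, fun t ht => ?_⟩
  calc (1 + t) ^ n ≤ Real.exp t ^ n := by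
        gcongr; linarith [Real.add_one_le_exp t]
    _ = Real.exp (n * t) := by rw [← Real.exp_nat_mul]
    _ ≤ _ := by
        rw [← Real.exp_add]
        apply Real.exp_le_exp.2
        have h : (n : ℝ) ^ 2 / (4 * c) + c * t ^ 2 - n * t = (n - 2 * c * t) ^ 2 / (4 * c) := by
          field_simp; ring
        have : 0 ≤ ((n : ℝ) - 2 * c * t) ^ 2 / (4 * c) := by positivity
        linarith

lemma integrable_exp_neg_normSq {c : ℝ} (hc : 0 < c) :
    Integrable fun z : Plane => Real.exp (-c * ‖z‖ ^ 2) := by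
  have := (GaussianFourier.integrable_cexp_neg_mul_sq_norm_add (V := Plane) (b := (c : ℂ))
    (by simpa using hc) 0 0).norm
  refine this.congr (Eventually.of_forall fun z => ?_)
  simp [Complex.norm_exp, ← Complex.ofReal_pow]

lemma integrable_pow_mul_exp_neg_normSq (n : ℕ) {c : ℝ} (hc : 0 < c) :
    Integrable fun z : Plane => (1 + ‖z‖) ^ n * Real.exp (-c * ‖z‖ ^ 2) := by
  obtain ⟨C, hC, h⟩ := one_add_pow_le_exp n (half_pos hc)
  refine ((integrable_exp_neg_normSq (half_pos hc)).const_mul C).mono'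
    (by fun_prop) (Eventually.of_forall fun z => ?_)
  rw [Real.norm_of_nonneg (by positivity)]
  calc _ ≤ C * Real.exp (c / 2 * ‖z‖ ^ 2) * Real.exp (-c * ‖z‖ ^ 2) := by
        gcongr; exact h _ (norm_nonneg z)
    _ = _ := by rw [mul_assoc, ← Real.exp_add]; ring_nf

lemma integral_gauss_pos : 0 < ∫ z, gauss z := by
  have := GaussianFourier.integral_rexp_neg_mul_sq_norm (V := Plane) (b := 1 / 2) (by norm_num)
  simp only [gauss]
  rw [this]
  positivity

/-- The second derivatives of the Gaussian. -/
def gauss₂ (i j : Fin 2) : Plane → ℝ := pd i (pd j gauss)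

lemma gauss₂_eq (i j : Fin 2) :
    gauss₂ i j = fun z => (z j * z i - if j = i then 1 else 0) * gauss z := by
  funext z
  have h0 : (pd j gauss) = fun z => -1 * (z j * gauss z) := by rw [pd_gauss]; funext z; ring
  have hg : Differentiable ℝ gauss := contDiff_gauss.differentiable (n := 1) (by norm_num)
  rw [gauss₂, h0, pd_const_mul ((differentiable_coord j z).fun_mul (hg z)),
    pd_mul (differentiable_coord j z) (hg z), pd_gauss, pd_coord]
  ring

lemma contDiff_gauss₂ (i j : Fin 2) : ContDiff ℝ ∞ (gauss₂ i j) :=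
  contDiff_infty_pd (contDiff_infty_pd contDiff_gauss j) i

lemma kernelPair_gauss₂ (i j : Fin 2) : KernelPair 2 (gauss₂ i j) (gauss₂ i j) :=
  (kernelPair_gauss.pd j).pd i

lemma gauss_pos (z : Plane) : 0 < gauss z := Real.exp_pos _

lemma abs_gauss₂_le (i j : Fin 2) (z : Plane) : |gauss₂ i j z| ≤ (1 + ‖z‖) ^ 2 * gauss z := by
  rw [gauss₂_eq, abs_mul, abs_of_pos (gauss_pos z)]
  have hi := abs_coord_le_norm z i
  have hj := abs_coord_le_norm z j
  have h1 : |z j * z i| ≤ ‖z‖ * ‖z‖ := by rw [abs_mul]; gcongr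
  have h2 : |(if j = i then (1 : ℝ) else 0)| ≤ 1 := by split_ifs <;> simp
  gcongr
  · exact (gauss_pos z).le
  · nlinarith [abs_sub (z j * z i) (if j = i then (1 : ℝ) else 0), norm_nonneg z]

lemma abs_pd_gauss₂_le (k i j : Fin 2) (z : Plane) :
    |pd k (gauss₂ i j) z| ≤ 3 * (1 + ‖z‖) ^ 3 * gauss z := by
  have hg : Differentiable ℝ gauss := contDiff_gauss.differentiable (n := 1) (by norm_num)
  have hc := differentiable_coord
  rw [gauss₂_eq, pd_mul (((hc j z).fun_mul (hc i z)).fun_sub (differentiableAt_const _)) (hg z),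
    pd_sub ((hc j z).fun_mul (hc i z)) (differentiableAt_const _), pd_const,
    pd_mul (hc j z) (hc i z), pd_gauss, pd_coord, pd_coord]
  have hz := norm_nonneg z
  have hi := abs_coord_le_norm z i
  have hj := abs_coord_le_norm z j
  have hk := abs_coord_le_norm z k
  have h1 : |z j * z i| ≤ ‖z‖ * ‖z‖ := by rw [abs_mul]; gcongr
  have h2 : ∀ a b : Fin 2, |(if a = b then (1 : ℝ) else 0)| ≤ 1 := by
    intro a b; split_ifs <;> simp
  have h3 : |z j * z i - if j = i then 1 else 0| ≤ ‖z‖ * ‖z‖ + 1 :=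
    (abs_sub _ _).trans (add_le_add h1 (h2 j i))
  have h4 : |(z j * z i - if j = i then 1 else 0) * -z k| ≤ (‖z‖ * ‖z‖ + 1) * ‖z‖ := by
    rw [abs_mul, abs_neg]; gcongr
  have h5 : |(if j = k then (1 : ℝ) else 0) * z i| ≤ 1 * ‖z‖ := by
    rw [abs_mul]; gcongr; exact h2 j k
  have h6 : |z j * (if i = k then (1 : ℝ) else 0)| ≤ ‖z‖ * 1 := by
    rw [abs_mul]; gcongr; exact h2 i k
  have e : ((if j = k then (1 : ℝ) else 0) * z i + z j * (if i = k then 1 else 0) - 0) * gauss z +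
      (z j * z i - if j = i then 1 else 0) * (-z k * gauss z) =
      (((if j = k then (1 : ℝ) else 0) * z i + z j * (if i = k then 1 else 0)) +
        (z j * z i - if j = i then 1 else 0) * -z k) * gauss z := by ring
  rw [e, abs_mul, abs_of_pos (gauss_pos z)]
  refine mul_le_mul_of_nonneg_right ?_ (gauss_pos z).le
  refine (abs_add_le _ _).trans ((add_le_add ((abs_add_le _ _).trans (add_le_add h5 h6))
    h4).trans ?_)
  nlinarith [pow_nonneg hz 3, pow_nonneg hz 2]

/-- Mean value inequality on the ball of radius `‖a‖` around `z`. The Gaussian rate drops from `1/2`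
to `1/4` to absorb the cubic factor, and then to `1/8` because `|z| ≤ |y| + 1` gives `|z|² ≤ 2 |y|²
+ 2`. -/
lemma gauss₂_translate (i j : Fin 2) : ∃ C : ℝ, 0 < C ∧ ∀ z a : Plane, ‖a‖ ≤ 1 →
    |gauss₂ i j z - gauss₂ i j (z - a)| ≤ C * ‖a‖ * Real.exp (-(1 / 8) * ‖z‖ ^ 2) := by
  obtain ⟨C, hC, h⟩ := one_add_pow_le_exp 3 (c := 1 / 4) (by norm_num)
  refine ⟨6 * C * Real.exp (1 / 4), by positivity, fun z a ha => ?_⟩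
  have hd : Differentiable ℝ (gauss₂ i j) := (contDiff_gauss₂ i j).differentiable (by simp)
  have key : ∀ y ∈ Metric.closedBall z ‖a‖, ‖fderiv ℝ (gauss₂ i j) y‖ ≤
      6 * C * Real.exp (1 / 4) * Real.exp (-(1 / 8) * ‖z‖ ^ 2) := by
    intro y hy
    have hzy : ‖z‖ ≤ ‖y‖ + 1 := by
      have : ‖y - z‖ ≤ ‖a‖ := by simpa [dist_eq_norm] using hy
      have h2 := norm_sub_norm_le z y
      rw [norm_sub_rev] at h2
      linarith
    have hb : ∀ k, |pd k (gauss₂ i j) y| ≤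
        3 * C * Real.exp (1 / 4) * Real.exp (-(1 / 8) * ‖z‖ ^ 2) := by
      intro k
      refine (abs_pd_gauss₂_le k i j y).trans ?_
      calc _ ≤ 3 * (C * Real.exp (1 / 4 * ‖y‖ ^ 2)) * gauss y := by
            gcongr
            · exact (gauss_pos y).le
            · exact h _ (norm_nonneg y)
        _ = 3 * C * Real.exp (-(1 / 4) * ‖y‖ ^ 2) := by
            rw [gauss, ← mul_assoc, mul_assoc _ (Real.exp _), ← Real.exp_add]; ring_nf
        _ ≤ 3 * C * Real.exp (1 / 4 + -(1 / 8) * ‖z‖ ^ 2) := by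
            gcongr
            nlinarith [norm_nonneg z, norm_nonneg y, sq_nonneg (‖y‖ - 1)]
        _ = _ := by rw [Real.exp_add]; ring
    refine (norm_fderiv_le_of_pd hb).trans (le_of_eq (by ring))
  have := (convex_closedBall z ‖a‖).norm_image_sub_le_of_norm_fderiv_le (fun y _ => hd y) key
    (x := z - a) (y := z) (by simp) (by simp)
  rw [Real.norm_eq_abs] at this
  refine this.trans (le_of_eq ?_)
  rw [sub_sub_cancel]; ring

/-! ### Comparison of a function with powers through its derivative -/

/-- A differential form of `|∫ N'| ≤ ∫ B'`: no integrability in the scale variable has to be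
checked, only an antiderivative of the bound is needed. -/
lemma abs_sub_le_of_deriv_le {N N' B B' : ℝ → ℝ} {a b : ℝ} (hab : a ≤ b)
    (hN : ∀ s ∈ Icc a b, HasDerivAt N (N' s) s) (hB : ∀ s ∈ Icc a b, HasDerivAt B (B' s) s)
    (h : ∀ s ∈ Icc a b, |N' s| ≤ B' s) : |N b - N a| ≤ B b - B a := by
  have := image_norm_le_of_norm_deriv_right_le_deriv_boundary' (f := fun s => N s - N a)
    (f' := N') (B := fun s => B s - B a) (B' := B') (a := a) (b := b)
    (fun s hs => ((hN s hs).continuousAt.continuousWithinAt).sub continuousWithinAt_const)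
    (fun s hs => ((hN s ⟨hs.1, hs.2.le⟩).sub_const _).hasDerivWithinAt) (by simp)
    (fun s hs => ((hB s hs).continuousAt.continuousWithinAt).sub continuousWithinAt_const)
    (fun s hs => ((hB s ⟨hs.1, hs.2.le⟩).sub_const _).hasDerivWithinAt)
    (fun s hs => h s ⟨hs.1, hs.2.le⟩) (right_mem_Icc.2 hab)
  simpa using this

lemma abs_sub_le_of_deriv_le_rpow {N N' : ℝ → ℝ} {L K β T : ℝ} (hβ : 0 < β) (hT : 0 < T)
    (hK : 0 ≤ K) (hN : ∀ s, 0 < s → s ≤ T → HasDerivAt N (N' s) s)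
    (h : ∀ s, 0 < s → s ≤ T → |N' s| ≤ K * s ^ (β - 1)) (hL : Tendsto N (𝓝[>] 0) (𝓝 L)) :
    |N T - L| ≤ K * T ^ β / β := by
  have h1 : Tendsto (fun a => |N T - N a|) (𝓝[>] 0) (𝓝 |N T - L|) :=
    (tendsto_const_nhds.sub hL).abs
  refine le_of_tendsto h1 ?_
  filter_upwards [Ioc_mem_nhdsGT hT] with a ha
  have hB : ∀ s ∈ Icc a T, HasDerivAt (fun s => K * s ^ β / β) (K * s ^ (β - 1)) s := by
    intro s hs
    have := ((Real.hasDerivAt_rpow_const (p := β) (Or.inl (ha.1.trans_le hs.1).ne')).const_mul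
      K).div_const β
    refine this.congr_deriv ?_
    field_simp
  refine (abs_sub_le_of_deriv_le ha.2 (fun s hs => hN s (ha.1.trans_le hs.1) hs.2) hB
    fun s hs => h s (ha.1.trans_le hs.1) hs.2).trans ?_
  have := ha.1.le
  have : 0 ≤ K * a ^ β / β := by positivity
  linarith

lemma abs_sub_le_of_deriv_le_rpow_sub {N N' : ℝ → ℝ} {K β δ T : ℝ} (hβ : β < 1)
    (hδ : 0 < δ) (hδT : δ ≤ T) (hK : 0 ≤ K)
    (hN : ∀ s, δ ≤ s → s ≤ T → HasDerivAt N (N' s) s)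
    (h : ∀ s, δ ≤ s → s ≤ T → |N' s| ≤ K * s ^ (β - 2)) :
    |N T - N δ| ≤ K * δ ^ (β - 1) / (1 - β) := by
  have hβ' : 0 < 1 - β := by linarith
  have hB : ∀ s ∈ Icc δ T, HasDerivAt (fun s => -(K * s ^ (β - 1) / (1 - β)))
      (K * s ^ (β - 2)) s := by
    intro s hs
    have := (((Real.hasDerivAt_rpow_const (p := β - 1)
      (Or.inl (hδ.trans_le hs.1).ne')).const_mul K).div_const (1 - β)).neg
    refine this.congr_deriv ?_
    rw [show β - 1 - 1 = β - 2 by ring]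
    field_simp
    ring
  refine (abs_sub_le_of_deriv_le hδT (fun s hs => hN s hs.1 hs.2) hB
    fun s hs => h s hs.1 hs.2).trans ?_
  have hT : 0 < T := hδ.trans_le hδT
  have : 0 ≤ K * T ^ (β - 1) / (1 - β) := by positivity
  linarith

/-- The usual interpolation behind Hölder estimates. Below `δ` each of two points is estimated
separately; above `δ` their difference gains `δ / s`. Both ranges contribute a multiple of `δ ^ β`,
independently of `T`; convergence at infinity is where `β < 1` enters. -/
lemma abs_sub_le_of_deriv_le_min {N N' : ℝ → ℝ} {L K β δ T : ℝ} (hβ : 0 < β) (hβ1 : β < 1)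
    (hδ : 0 < δ) (hδT : δ ≤ T) (hK : 0 ≤ K)
    (hN : ∀ s, 0 < s → s ≤ T → HasDerivAt N (N' s) s)
    (h1 : ∀ s, 0 < s → s ≤ δ → |N' s| ≤ K * s ^ (β - 1))
    (h2 : ∀ s, δ ≤ s → s ≤ T → |N' s| ≤ K * δ * s ^ (β - 2))
    (hL : Tendsto N (𝓝[>] 0) (𝓝 L)) :
    |N T - L| ≤ K * (1 / β + 1 / (1 - β)) * δ ^ β := by
  have a1 := abs_sub_le_of_deriv_le_rpow hβ hδ hK (fun s h h' => hN s h (h'.trans hδT)) h1 hL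
  have a2 := abs_sub_le_of_deriv_le_rpow_sub hβ1 hδ hδT (mul_nonneg hK hδ.le)
    (fun s h h' => hN s (hδ.trans_le h) h') h2
  have h3 : δ * δ ^ (β - 1) = δ ^ β := by
    rw [Real.rpow_sub_one hδ.ne']; field_simp
  calc |N T - L| ≤ |N T - N δ| + |N δ - L| := abs_sub_le _ _ _
    _ ≤ _ := add_le_add a2 a1
    _ = _ := by rw [mul_assoc K, h3]; ring

/-! ### Scaled means -/

/-- The mean of `u` against the kernel `κ`, placed at `x` and scaled to size `s`. -/
def smean (m : ℕ) (κ u : Plane → ℝ) (x : Plane) (s : ℝ) : ℝ :=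
  (s ^ m)⁻¹ * ∫ z, u (x + s • z) * κ z

lemma integral_comp_affine (F : Plane → ℝ) (x : Plane) (s : ℝ) :
    ∫ z, F (x + s • z) = (s ^ 2)⁻¹ * ∫ y, F y := by
  have h := Measure.integral_comp_smul (volume : Measure Plane) (fun z => F (x + z)) s
  rw [h, integral_add_left_eq_self (fun y => F y) x]
  simp

lemma integral_comp_affine' (u κ : Plane → ℝ) (x : Plane) {s : ℝ}
    (hs : 0 < s) : ∫ z, u (x + s • z) * κ z = (s ^ 2)⁻¹ * ∫ y, u y * κ (s⁻¹ • (y - x)) := by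
  rw [← integral_comp_affine _ x _]
  simp [smul_smul, hs.ne']

/-- `Δ u = f` on the plane in the sense of distributions. -/
def WeakLap (u f : Plane → ℝ) : Prop :=
  ∀ χ : Plane → ℝ, ContDiff ℝ ∞ χ → HasCompactSupport χ → ∫ x, u x * lap χ x = ∫ x, f x * χ x

lemma weakLap_of_contDiff {u : Plane → ℝ} (hu : ContDiff ℝ 2 u) : WeakLap u (lap u) :=
  fun _ hχ hc => integral_mul_lap isOpen_univ hu.contDiffOn (contDiff_two_of_infty hχ) hc
    (subset_univ _)

lemma hasCompactSupport_of_tsupport {κ : Plane → ℝ} (h : tsupport κ ⊆ Metric.closedBall 0 1) :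
    HasCompactSupport κ :=
  IsCompact.of_isClosed_subset (isCompact_closedBall _ _) (isClosed_tsupport _) h

lemma contDiff_affine (a : Plane) (s : ℝ) {n : ℕ∞ω} : ContDiff ℝ n fun z : Plane => a + s • z :=
  contDiff_const.add (contDiff_id.const_smul s)

lemma notMem_tsupport_scale {κ : Plane → ℝ} (hκs : tsupport κ ⊆ Metric.closedBall 0 1) {x y : Plane}
    {s : ℝ} (hs : 0 < s) (hy : y ∉ Metric.closedBall x s) : s⁻¹ • (y - x) ∉ tsupport κ := by
  intro hmem
  have := hκs hmem
  rw [mem_closedBall_zero_iff, norm_smul, norm_inv, Real.norm_of_nonneg hs.le,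
    inv_mul_le_one₀ hs] at this
  exact hy (by simpa [dist_eq_norm] using this)

lemma hasCompactSupport_scale {κ : Plane → ℝ} (hκs : tsupport κ ⊆ Metric.closedBall 0 1)
    (x : Plane) {s : ℝ} (hs : 0 < s) : HasCompactSupport fun y => κ (s⁻¹ • (y - x)) :=
  HasCompactSupport.intro (isCompact_closedBall x s) fun _ hy =>
    image_eq_zero_of_notMem_tsupport (notMem_tsupport_scale hκs hs hy)

/-- In the variable `y = x + s z` the scale enters through the smooth kernel only, so continuity of
`u` suffices. For scales in `[s/2, 2s]` all supports lie in the ball of radius `2s`, which supplies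
the dominating function. -/
lemma hasDerivAt_integral_scale {κ u : Plane → ℝ} (hκ : ContDiff ℝ ∞ κ)
    (hκs : tsupport κ ⊆ Metric.closedBall 0 1) (hu : Continuous u) (x : Plane) {s : ℝ}
    (hs : 0 < s) :
    HasDerivAt (fun s => ∫ y, u y * κ (s⁻¹ • (y - x)))
      (∫ y, u y * fderiv ℝ κ (s⁻¹ • (y - x)) (-(s ^ 2)⁻¹ • (y - x))) s := by
  have hs2 : Icc (s / 2) (2 * s) ∈ 𝓝 s := Icc_mem_nhds (by linarith) (by linarith)
  have hpos : ∀ t ∈ Icc (s / 2) (2 * s), 0 < t := fun t ht => (half_pos hs).trans_le ht.1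
  have hdκ : Continuous (fderiv ℝ κ) := hκ.continuous_fderiv (by simp)
  have hcont : ContinuousOn (fun p : ℝ × Plane =>
      u p.2 * fderiv ℝ κ (p.1⁻¹ • (p.2 - x)) (-(p.1 ^ 2)⁻¹ • (p.2 - x)))
      (Icc (s / 2) (2 * s) ×ˢ Metric.closedBall x (2 * s)) := by
    have h1 : ContinuousOn (fun p : ℝ × Plane => p.1⁻¹)
        (Icc (s / 2) (2 * s) ×ˢ Metric.closedBall x (2 * s)) :=
      continuousOn_fst.inv₀ fun p hp => (hpos _ hp.1).ne'
    have h2 : ContinuousOn (fun p : ℝ × Plane => -(p.1 ^ 2)⁻¹)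
        (Icc (s / 2) (2 * s) ×ˢ Metric.closedBall x (2 * s)) :=
      ((continuousOn_fst.pow 2).inv₀ fun p hp => (pow_pos (hpos _ hp.1) 2).ne').neg
    have h3 : ContinuousOn (fun p : ℝ × Plane => p.2 - x)
        (Icc (s / 2) (2 * s) ×ˢ Metric.closedBall x (2 * s)) :=
      continuousOn_snd.sub continuousOn_const
    exact (hu.comp_continuousOn continuousOn_snd).mul
      ((hdκ.comp_continuousOn (h1.smul h3)).clm_apply (h2.smul h3))
  obtain ⟨C, hC⟩ := (isCompact_Icc.prod (isCompact_closedBall x (2 * s))).exists_bound_of_continuousOn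
    hcont
  have hz : ∀ t ∈ Icc (s / 2) (2 * s), ∀ y ∉ Metric.closedBall x (2 * s),
      t⁻¹ • (y - x) ∉ tsupport κ := by
    exact fun t ht y hy => notMem_tsupport_scale hκs (hpos t ht) fun h =>
      hy (Metric.closedBall_subset_closedBall ht.2 h)
  have hmeas : ∀ t : ℝ, Continuous fun y => u y * κ (t⁻¹ • (y - x)) := fun t =>
    hu.mul (hκ.continuous.comp (by fun_prop))
  refine (hasDerivAt_integral_of_dominated_loc_of_deriv_le hs2
    (bound := (Metric.closedBall x (2 * s)).indicator fun _ => C)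
    (F := fun s y => u y * κ (s⁻¹ • (y - x)))
    (F' := fun s y => u y * fderiv ℝ κ (s⁻¹ • (y - x)) (-(s ^ 2)⁻¹ • (y - x)))
    (Eventually.of_forall fun t => (hmeas t).aestronglyMeasurable)
    ((hmeas s).integrable_of_hasCompactSupport (hasCompactSupport_scale hκs x hs).mul_left) ?_ ?_ ?_ ?_).2
  · exact (hu.mul ((hdκ.comp (by fun_prop)).clm_apply (by fun_prop))).aestronglyMeasurable
  · refine Eventually.of_forall fun y t ht => ?_
    by_cases hy : y ∈ Metric.closedBall x (2 * s)
    · rw [indicator_of_mem hy]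
      exact hC (t, y) ⟨ht, hy⟩
    · rw [indicator_of_notMem hy]
      have h0 := hz t ht y hy
      have : fderiv ℝ κ (t⁻¹ • (y - x)) = 0 := by
        rw [(notMem_tsupport_iff_eventuallyEq.1 h0).fderiv_eq]; simp
      simp [this]
  · exact (integrable_indicator_iff Metric.isClosed_closedBall.measurableSet).2
      (integrableOn_const (isCompact_closedBall x (2 * s)).measure_ne_top)
  · refine Eventually.of_forall fun y t ht => ?_
    have ht0 := hpos t ht
    have h1 : HasDerivAt (fun t : ℝ => t⁻¹ • (y - x)) (-(t ^ 2)⁻¹ • (y - x)) t :=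
      (hasDerivAt_inv ht0.ne').smul_const _
    have h2 := ((hκ.differentiable (by simp) _).hasFDerivAt.comp_hasDerivAt t h1).const_mul (u y)
    exact h2

/-- With `z = (y - x) / s`, the `s`-derivative of `s ^ (-(m+2)) κ z` is `s ^ (-(m+3))` times `-(m+2)
κ - z · ∇κ = Δ l` at `z`. This equals `s ^ (-(m+1)) Δ_y (l ((y-x)/s))`, a Laplacian of a test
function, so the weak equation turns it into a mean of `f` against `l`. -/
lemma hasDerivAt_smean {m : ℕ} {κ l u f : Plane → ℝ} (hp : KernelPair m κ l)
    (hκs : tsupport κ ⊆ Metric.closedBall 0 1) (hls : tsupport l ⊆ Metric.closedBall 0 1)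
    (hu : Continuous u) (hw : WeakLap u f) (x : Plane) {s : ℝ} (hs : 0 < s) :
    HasDerivAt (smean m κ u x) (s * (s ^ m)⁻¹ * ∫ z, f (x + s • z) * l z) s := by
  have hκ := hp.smooth_left
  have h0 : smean m κ u x =ᶠ[𝓝 s] fun s => (s ^ (m + 2))⁻¹ * ∫ y, u y * κ (s⁻¹ • (y - x)) := by
    filter_upwards [eventually_gt_nhds hs] with t ht
    rw [smean, integral_comp_affine' u κ x ht, pow_add, mul_inv]
    ring
  have h1 : HasDerivAt (fun s : ℝ => (s ^ (m + 2))⁻¹) (-(m + 2) * (s ^ (m + 3))⁻¹) s := by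
    refine ((hasDerivAt_pow (m + 2) s).inv (pow_ne_zero _ hs.ne')).congr_deriv ?_
    have : s ≠ 0 := hs.ne'
    rw [show m + 2 - 1 = m + 1 from rfl]
    push_cast
    field_simp
    ring
  have h2 := h1.mul (hasDerivAt_integral_scale hκ hκs hu x hs)
  refine (h2.congr_of_eventuallyEq h0).congr_deriv ?_
  have hχ : ContDiff ℝ ∞ fun y => l (s⁻¹ • (y - x)) :=
    hp.smooth_right.comp ((contDiff_id.sub contDiff_const).const_smul _)
  have hχc := hasCompactSupport_scale hls x hs
  have hlap : ∀ y, lap (fun y => l (s⁻¹ • (y - x))) y = (s⁻¹) ^ 2 * lap l (s⁻¹ • (y - x)) := by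
    intro y
    have e : ∀ y, s⁻¹ • (y - x) = (-s⁻¹) • x + s⁻¹ • y := fun y => by module
    simp only [e]
    exact lap_comp_affine (contDiff_two_of_infty hp.smooth_right) _ _ _
  have hweak := hw _ hχ hχc
  simp only [hlap, hp.lap_eq] at hweak
  rw [integral_comp_affine' f l x hs, ← hweak, ← integral_const_mul]
  have i1 : Integrable fun y => u y * κ (s⁻¹ • (y - x)) :=
    (hu.mul (hκ.continuous.comp (by fun_prop))).integrable_of_hasCompactSupport
      (hasCompactSupport_scale hκs x hs).mul_left
  have i2 : Integrable fun y => u y * fderiv ℝ κ (s⁻¹ • (y - x)) (-(s ^ 2)⁻¹ • (y - x)) := by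
    have hdκ : Continuous (fderiv ℝ κ) := hκ.continuous_fderiv (by simp)
    have hg : Continuous fun y => u y * fderiv ℝ κ (s⁻¹ • (y - x)) (-(s ^ 2)⁻¹ • (y - x)) :=
      hu.mul ((hdκ.comp (g := fderiv ℝ κ) (f := fun y => s⁻¹ • (y - x))
        (by fun_prop)).clm_apply (by fun_prop))
    refine hg.integrable_of_hasCompactSupport (HasCompactSupport.mul_left ?_)
    refine HasCompactSupport.intro (isCompact_closedBall x s) fun y hy => ?_
    rw [(notMem_tsupport_iff_eventuallyEq.1 (notMem_tsupport_scale hκs hs hy)).fderiv_eq]; simp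
  rw [← integral_const_mul, ← integral_const_mul, ← integral_add (i1.const_mul _) (i2.const_mul _),
    ← integral_const_mul]
  congr 1
  funext y
  have h3 : fderiv ℝ κ (s⁻¹ • (y - x)) (-(s ^ 2)⁻¹ • (y - x)) =
      -s⁻¹ * ∑ i, (s⁻¹ • (y - x)) i * pd i κ (s⁻¹ • (y - x)) := by
    rw [← fderiv_apply_eq_sum_pd]
    rw [show -(s ^ 2)⁻¹ • (y - x) = (-s⁻¹) • (s⁻¹ • (y - x)) by
      rw [smul_smul]; congr 1; ring]
    rw [map_smul, smul_eq_mul]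
  rw [h3]
  have hs' := hs.ne'
  field_simp
  ring

/-! ### The limit at scale zero -/

lemma tendsto_integral_scale {h φ : Plane → ℝ} {U : Set Plane} (hU : IsOpen U) {x : Plane}
    (hx : x ∈ U) (hh : ContinuousOn h U) (hφ : Continuous φ)
    (hφs : tsupport φ ⊆ Metric.closedBall 0 1) :
    Tendsto (fun s : ℝ => ∫ z, h (x + s • z) * φ z) (𝓝[>] 0) (𝓝 (h x * ∫ z, φ z)) := by
  obtain ⟨ρ, hρ, hball⟩ := Metric.nhds_basis_closedBall.mem_iff.1 (hU.mem_nhds hx)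
  obtain ⟨C, hC⟩ := (isCompact_closedBall x ρ).exists_bound_of_continuousOn (hh.mono hball)
  have hmaps : ∀ s ∈ Ioc 0 ρ, ∀ z ∈ tsupport φ, x + s • z ∈ Metric.closedBall x ρ := by
    intro s hs z hz
    have h1 : ‖z‖ ≤ 1 := by simpa using hφs hz
    simp only [Metric.mem_closedBall, dist_eq_norm, add_sub_cancel_left, norm_smul,
      Real.norm_of_nonneg hs.1.le]
    nlinarith [hs.1, hs.2, norm_nonneg z]
  have hφi : Integrable φ := hφ.integrable_of_hasCompactSupport (hasCompactSupport_of_tsupport hφs)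
  rw [← integral_const_mul]
  refine tendsto_integral_filter_of_dominated_convergence (fun z => C * ‖φ z‖) ?_ ?_
    (hφi.norm.const_mul C) ?_
  · filter_upwards [Ioc_mem_nhdsGT hρ] with s hs
    have hc : Continuous fun z : Plane => x + s • z := by fun_prop
    refine (integrable_mul_of_tsupport_subset (u := fun z => h (x + s • z)) (hU.preimage hc)
      (hh.comp hc.continuousOn fun z hz => hz) hφ (hasCompactSupport_of_tsupport hφs)
      fun z hz => hball (hmaps s hs z hz)).aestronglyMeasurable
  · filter_upwards [Ioc_mem_nhdsGT hρ] with s hs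
    refine Eventually.of_forall fun z => ?_
    by_cases hz : z ∈ tsupport φ
    · rw [norm_mul]
      gcongr
      exact hC _ (hmaps s hs z hz)
    · simp [image_eq_zero_of_notMem_tsupport hz]
  · refine Eventually.of_forall fun z => Tendsto.mul_const _ ?_
    have hc : Continuous fun s : ℝ => x + s • z := by fun_prop
    have h0 : Tendsto (fun s : ℝ => x + s • z) (𝓝[>] 0) (𝓝 x) := by
      have := hc.tendsto 0
      simp only [zero_smul, add_zero] at this
      exact this.mono_left nhdsWithin_le_nhds
    exact ((hh.continuousAt (hU.mem_nhds hx)).tendsto).comp h0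

lemma eventually_scale_subset {φ : Plane → ℝ} {U : Set Plane} (hU : IsOpen U) {x : Plane}
    (hx : x ∈ U) (hφs : tsupport φ ⊆ Metric.closedBall 0 1) :
    ∀ᶠ s : ℝ in 𝓝[>] 0, 0 < s ∧ tsupport φ ⊆ (fun z : Plane => x + s • z) ⁻¹' U := by
  obtain ⟨ρ, hρ, hball⟩ := Metric.nhds_basis_closedBall.mem_iff.1 (hU.mem_nhds hx)
  filter_upwards [Ioc_mem_nhdsGT hρ] with s hs
  refine ⟨hs.1, fun z hz => hball ?_⟩
  have h1 : ‖z‖ ≤ 1 := by simpa using hφs hz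
  simp only [Metric.mem_closedBall, dist_eq_norm, add_sub_cancel_left, norm_smul,
    Real.norm_of_nonneg hs.1.le]
  nlinarith [hs.1, hs.2, norm_nonneg z]

lemma tendsto_smean_zero {u φ : Plane → ℝ} {U : Set Plane} (hU : IsOpen U) {x : Plane}
    (hx : x ∈ U) (hu : ContinuousOn u U) (hφ : ContDiff ℝ ∞ φ)
    (hφs : tsupport φ ⊆ Metric.closedBall 0 1) :
    Tendsto (smean 0 φ u x) (𝓝[>] 0) (𝓝 (u x * ∫ z, φ z)) := by
  refine (tendsto_integral_scale hU hx hu hφ.continuous hφs).congr fun s => ?_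
  simp [smean]

lemma integral_comp_affine_mul_pd {u φ : Plane → ℝ} {U : Set Plane} (hU : IsOpen U) {x : Plane}
    {s : ℝ} (hu : ContDiffOn ℝ 1 u U) (hφ : ContDiff ℝ 1 φ) (hc : HasCompactSupport φ)
    (hs : tsupport φ ⊆ (fun z : Plane => x + s • z) ⁻¹' U) (i : Fin 2) :
    ∫ z, u (x + s • z) * pd i φ z = -(s * ∫ z, pd i u (x + s • z) * φ z) := by
  have hcont : Continuous fun z : Plane => x + s • z := by fun_prop
  have hV := hU.preimage hcont
  rw [integral_mul_pd hV (u := fun z => u (x + s • z))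
    (hu.comp (contDiff_affine x s).contDiffOn fun z hz => hz) hφ hc hs, ← integral_const_mul]
  congr 2
  funext z
  by_cases hz : z ∈ tsupport φ
  · rw [pd_comp_affine x s ((hu.contDiffAt (hU.mem_nhds (hs hz))).differentiableAt (by norm_num))]
    ring
  · simp [image_eq_zero_of_notMem_tsupport hz]

lemma integral_comp_affine_mul_pd_pd {u φ : Plane → ℝ} {U : Set Plane} (hU : IsOpen U) {x : Plane}
    {s : ℝ} (hu : ContDiffOn ℝ 2 u U) (hφ : ContDiff ℝ 2 φ) (hc : HasCompactSupport φ)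
    (hs : tsupport φ ⊆ (fun z : Plane => x + s • z) ⁻¹' U) (i j : Fin 2) :
    ∫ z, u (x + s • z) * pd i (pd j φ) z = s ^ 2 * ∫ z, pd j (pd i u) (x + s • z) * φ z := by
  rw [integral_comp_affine_mul_pd hU (hu.of_le (by norm_num)) (contDiff_pd hφ (by norm_num) j)
    (hasCompactSupport_pd hc j) ((tsupport_pd_subset j φ).trans hs),
    integral_comp_affine_mul_pd hU (contDiffOn_pd hU hu (by norm_num) i) (hφ.of_le (by norm_num))
    hc hs]
  ring

/-- Integration by parts moves each derivative of the kernel onto `u` and produces a factor `-s`.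
These factors cancel `s ^ (-m)` and leave an ordinary mollification. Differentiability is needed
only near `x`, so `u` may be rough elsewhere. -/
lemma tendsto_smean_one {u φ : Plane → ℝ} {U : Set Plane} (hU : IsOpen U) {x : Plane}
    (hx : x ∈ U) (hu : ContDiffOn ℝ 1 u U) (hφ : ContDiff ℝ ∞ φ)
    (hφs : tsupport φ ⊆ Metric.closedBall 0 1) (i : Fin 2) :
    Tendsto (smean 1 (pd i φ) u x) (𝓝[>] 0) (𝓝 (-(pd i u x * ∫ z, φ z))) := by
  refine (tendsto_integral_scale hU hx (contDiffOn_pd hU hu (m := 0) (by norm_num) i).continuousOn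
    hφ.continuous hφs).neg.congr' ?_
  filter_upwards [eventually_scale_subset hU hx hφs] with s hs
  rw [smean, integral_comp_affine_mul_pd hU hu ((contDiff_two_of_infty hφ).of_le (by norm_num))
    (hasCompactSupport_of_tsupport hφs) hs.2]
  have := hs.1.ne'
  field_simp

lemma tendsto_smean_two {u φ : Plane → ℝ} {U : Set Plane} (hU : IsOpen U) {x : Plane}
    (hx : x ∈ U) (hu : ContDiffOn ℝ 2 u U) (hφ : ContDiff ℝ ∞ φ)
    (hφs : tsupport φ ⊆ Metric.closedBall 0 1) (i j : Fin 2) :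
    Tendsto (smean 2 (pd i (pd j φ)) u x) (𝓝[>] 0) (𝓝 (pd j (pd i u) x * ∫ z, φ z)) := by
  refine (tendsto_integral_scale hU hx (contDiffOn_pd hU (contDiffOn_pd hU hu (m := 1)
    (by norm_num) i) (m := 0) (by norm_num) j).continuousOn hφ.continuous hφs).congr' ?_
  filter_upwards [eventually_scale_subset hU hx hφs] with s hs
  rw [smean, integral_comp_affine_mul_pd_pd hU hu (contDiff_two_of_infty hφ)
    (hasCompactSupport_of_tsupport hφs) hs.2]
  have := hs.1.ne'
  field_simp

/-! ### The Ornstein-Uhlenbeck operator and Gaussian means -/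

/-- `Δ w - (x · ∇ w - w) / 2`. -/
def ou (w : Plane → ℝ) : Plane → ℝ :=
  fun x => lap w x - 1 / 2 * ((∑ i, x i * pd i w x) - w x)

/-- The contraction factor `(1 + s² / 2) ^ (-1/2)`. -/
def contr (s : ℝ) : ℝ := (Real.sqrt (1 + s ^ 2 / 2))⁻¹

lemma contr_pos (s : ℝ) : 0 < contr s := inv_pos.2 (Real.sqrt_pos.2 (by positivity))

lemma contr_sq (s : ℝ) : contr s ^ 2 * (1 + s ^ 2 / 2) = 1 := by
  rw [contr, inv_pow, Real.sq_sqrt (by positivity)]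
  exact inv_mul_cancel₀ (by positivity)

lemma contr_le_one (s : ℝ) : contr s ≤ 1 := by
  have := contr_sq s
  nlinarith [contr_pos s, sq_nonneg s, sq_nonneg (contr s * s)]

lemma contr_mul_sq_le (s : ℝ) : (contr s * s) ^ 2 ≤ 2 := by
  have := contr_sq s
  nlinarith [sq_nonneg (contr s)]

lemma contr_mul_le (s : ℝ) : contr s * s ≤ 2 := by
  nlinarith [contr_mul_sq_le s]

lemma inv_contr_le {s : ℝ} (hs : 0 < s) : (contr s)⁻¹ ≤ 1 + s := by
  rw [contr, inv_inv]
  refine Real.sqrt_le_iff.2 ⟨by linarith, by nlinarith⟩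

lemma hasDerivAt_contr (s : ℝ) : HasDerivAt contr (-(1 / 2) * s * contr s ^ 3) s := by
  have h1 : HasDerivAt (fun s : ℝ => 1 + s ^ 2 / 2) s s := by
    refine (((hasDerivAt_pow 2 s).div_const 2).const_add 1).congr_deriv ?_
    norm_num
  have hp : (0 : ℝ) < Real.sqrt (1 + s ^ 2 / 2) := Real.sqrt_pos.2 (by positivity)
  refine ((h1.sqrt (by positivity)).inv hp.ne').congr_deriv ?_
  rw [contr]
  field_simp

lemma continuous_contr : Continuous contr :=
  continuous_iff_continuousAt.2 fun s => (hasDerivAt_contr s).continuousAt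

/-- `(q s)' = q - s² q³ / 2 = q³ (q⁻² - s² / 2)`, and `q⁻² = 1 + s² / 2`. -/
lemma hasDerivAt_contr_mul (s : ℝ) : HasDerivAt (fun s => contr s * s) (contr s ^ 3) s := by
  refine ((hasDerivAt_contr s).mul (hasDerivAt_id s)).congr_deriv ?_
  have := contr_sq s
  simp only [id]
  linear_combination (-contr s) * this

lemma integrable_gauss₂_weight (n : ℕ) (i j : Fin 2) :
    Integrable fun z => (1 + ‖z‖) ^ n * |gauss₂ i j z| := by
  refine (integrable_pow_mul_exp_neg_normSq (n + 2) (c := 1 / 2) (by norm_num)).mono'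
    ((by fun_prop : Continuous fun z : Plane => (1 + ‖z‖) ^ n).mul
      (contDiff_gauss₂ i j).continuous.abs).aestronglyMeasurable
    (Eventually.of_forall fun z => ?_)
  rw [Real.norm_of_nonneg (by positivity), pow_add, mul_assoc]
  gcongr
  exact abs_gauss₂_le i j z

lemma integrable_gauss₂ (i j : Fin 2) : Integrable (gauss₂ i j) := by
  have := integrable_gauss₂_weight 0 i j
  simp only [pow_zero, one_mul] at this
  exact (integrable_norm_iff (contDiff_gauss₂ i j).continuous.aestronglyMeasurable).1 this

lemma integrable_gauss : Integrable gauss := integrable_exp_neg_normSq (by norm_num)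

lemma integrable_pd_gauss (j : Fin 2) : Integrable (pd j gauss) := by
  refine (integrable_pow_mul_exp_neg_normSq 1 (c := 1 / 2) (by norm_num)).mono'
    (contDiff_pd (contDiff_gauss (n := 1)) (m := 0) (by norm_num) j).continuous.aestronglyMeasurable
    (Eventually.of_forall fun z => ?_)
  rw [pd_gauss, Real.norm_eq_abs, abs_mul, abs_of_pos (gauss_pos z), abs_neg, gauss]
  gcongr
  simpa using (abs_coord_le_norm z j).trans (by linarith)

lemma integral_gauss₂ (i j : Fin 2) : ∫ z, gauss₂ i j z = 0 := by
  have h := integral_mul_fderiv_eq_neg_fderiv_mul_of_integrable (μ := (volume : Measure Plane))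
    (f := fun _ => (1 : ℝ)) (g := pd j gauss) (v := EuclideanSpace.single i 1) (by simp)
    (by simp only [one_mul]; exact integrable_gauss₂ i j) (by simpa using integrable_pd_gauss j)
    (fun _ _ => differentiableAt_const _)
    (fun x _ => (contDiff_infty_pd contDiff_gauss j).differentiable (by simp) x)
  simpa [gauss₂, pd] using h

/-- Integrating by parts, the left side is `∫ W (-2 G - z · ∇G)` with `G = gauss₂ i j`. The pair
relation `ΔG = -4 G - z · ∇G` rewrites this as `∫ W (ΔG + 2 G)`, and Green's identity finishes. It
trades the first-order term in `z`, which appears when the scale is differentiated, for a Laplacian.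
-/
lemma integral_euler_mul_gauss₂ {W : Plane → ℝ} (hW : ContDiff ℝ 2 W) (hc : HasCompactSupport W)
    (i j : Fin 2) : ∫ z, (∑ k, z k * pd k W z) * gauss₂ i j z =
      (∫ z, lap W z * gauss₂ i j z) + 2 * ∫ z, W z * gauss₂ i j z := by
  set G := gauss₂ i j with hG
  have hGs : ContDiff ℝ ∞ G := contDiff_gauss₂ i j
  have hGd : Differentiable ℝ G := hGs.differentiable (by simp)
  have hpW : ∀ k, Continuous (pd k W) := fun k => (contDiff_pd hW (m := 1) (by norm_num) k).continuous
  have hpG : ∀ k, Continuous (pd k G) := fun k => (contDiff_infty_pd hGs k).continuous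
  have hck : ∀ k : Fin 2, Continuous fun z : Plane => z k := fun k =>
    (differentiable_coord k).continuous
  have i1 : ∀ k : Fin 2, Integrable fun z => z k * G z * pd k W z := fun k =>
    (((hck k).mul hGs.continuous).mul (hpW k)).integrable_of_hasCompactSupport
      (hasCompactSupport_pd hc k).mul_left
  have i2 : ∀ k : Fin 2, Integrable fun z => z k * pd k G z * W z := fun k =>
    (((hck k).mul (hpG k)).mul hW.continuous).integrable_of_hasCompactSupport hc.mul_left
  have i3 : Integrable fun z => G z * W z :=
    (hGs.continuous.mul hW.continuous).integrable_of_hasCompactSupport hc.mul_left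
  have h1 : ∀ k : Fin 2, ∫ z, z k * G z * pd k W z = -((∫ z, G z * W z) + ∫ z, z k * pd k G z * W z) := by
    intro k
    rw [integral_mul_pd (u := fun z => z k * G z) isOpen_univ
      ((contDiff_coord k).mul (hGs.of_le (by simp))).contDiffOn (hW.of_le (by norm_num)) hc
      (subset_univ _) k, ← integral_add i3 (i2 k)]
    congr 2
    funext z
    rw [pd_mul (differentiable_coord k z) (hGd z), pd_coord]
    simp only [if_true]; ring
  have h2 := integral_mul_lap (u := G) isOpen_univ (contDiff_two_of_infty hGs).contDiffOn hW hc
    (subset_univ _)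
  have h3 : ∫ z, lap G z * W z = -4 * (∫ z, G z * W z) - ((∫ z, z 0 * pd 0 G z * W z) +
      ∫ z, z 1 * pd 1 G z * W z) := by
    have i4 : Integrable fun z => z 0 * pd 0 G z * W z + z 1 * pd 1 G z * W z :=
      (i2 0).add (i2 1)
    rw [← integral_const_mul, ← integral_add (i2 0) (i2 1), ← integral_sub (i3.const_mul _) i4]
    congr 1
    funext z
    rw [(kernelPair_gauss₂ i j).lap_eq, Fin.sum_univ_two, ← hG]
    push_cast; ring
  have h4 : ∫ z, (∑ k, z k * pd k W z) * G z = (∫ z, z 0 * G z * pd 0 W z) +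
      ∫ z, z 1 * G z * pd 1 W z := by
    rw [← integral_add (i1 0) (i1 1)]
    congr 1
    funext z
    rw [Fin.sum_univ_two]; ring
  have e1 : ∫ z, W z * G z = ∫ z, G z * W z := by simp only [mul_comm]
  have e2 : ∫ z, lap W z * G z = ∫ z, G z * lap W z := by simp only [mul_comm]
  rw [h4, h1, h1, e1, e2, h2, h3]
  ring

/-- The Gaussian mean of `w` along the flow of the Ornstein-Uhlenbeck operator. -/
def ouMean (i j : Fin 2) (w : Plane → ℝ) (x : Plane) (s : ℝ) : ℝ :=
  (s ^ 2)⁻¹ * (contr s)⁻¹ * ∫ z, w (contr s • x + (contr s * s) • z) * gauss₂ i j z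

lemma exists_bound_of_hasCompactSupport {w : Plane → ℝ} (hw : Continuous w)
    (hc : HasCompactSupport w) : ∃ C : ℝ, 0 ≤ C ∧ ∀ x, |w x| ≤ C := by
  obtain ⟨C, hC⟩ := hc.exists_bound_of_continuous hw
  exact ⟨C, (norm_nonneg _).trans (hC 0), hC⟩

lemma integrable_comp_mul_gauss₂ {w : Plane → ℝ} (hw : Continuous w) (hc : HasCompactSupport w)
    (p : Plane) (t : ℝ) (i j : Fin 2) : Integrable fun z => w (p + t • z) * gauss₂ i j z := by
  obtain ⟨C, -, hC⟩ := exists_bound_of_hasCompactSupport hw hc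
  refine (integrable_gauss₂ i j).bdd_mul (c := C)
    (hw.comp (by fun_prop : Continuous fun z : Plane => p + t • z)).aestronglyMeasurable
    (Eventually.of_forall fun z => hC _)

lemma hasDerivAt_integral_contr {w : Plane → ℝ} (hw : ContDiff ℝ 1 w) (hc : HasCompactSupport w)
    (x : Plane) {s : ℝ} (hs : 0 < s) (i j : Fin 2) :
    HasDerivAt (fun s => ∫ z, w (contr s • x + (contr s * s) • z) * gauss₂ i j z)
      (∫ z, fderiv ℝ w (contr s • x + (contr s * s) • z)
        ((-(1 / 2) * s * contr s ^ 3) • x + contr s ^ 3 • z) * gauss₂ i j z) s := by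
  have hdw : Continuous (fderiv ℝ w) := hw.continuous_fderiv (by norm_num)
  obtain ⟨C, hC⟩ := (hc.fderiv (𝕜 := ℝ)).exists_bound_of_continuous hdw
  have hC0 : 0 ≤ C := (norm_nonneg _).trans (hC 0)
  have hs2 : Icc (s / 2) (2 * s) ∈ 𝓝 s := Icc_mem_nhds (by linarith) (by linarith)
  have hGc : Continuous (gauss₂ i j) := (contDiff_gauss₂ i j).continuous
  refine (hasDerivAt_integral_of_dominated_loc_of_deriv_le hs2
    (bound := fun z => (C * (s * ‖x‖ + 1)) * ((1 + ‖z‖) ^ 1 * |gauss₂ i j z|))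
    (F := fun s z => w (contr s • x + (contr s * s) • z) * gauss₂ i j z)
    (F' := fun s z => fderiv ℝ w (contr s • x + (contr s * s) • z)
        ((-(1 / 2) * s * contr s ^ 3) • x + contr s ^ 3 • z) * gauss₂ i j z)
    (Eventually.of_forall fun t => ?_) (integrable_comp_mul_gauss₂ hw.continuous hc _ _ i j)
    ?_ ?_ ((integrable_gauss₂_weight 1 i j).const_mul _) ?_).2
  · exact (integrable_comp_mul_gauss₂ hw.continuous hc _ _ i j).aestronglyMeasurable
  · exact (((hdw.comp (g := fderiv ℝ w) (f := fun z => contr s • x + (contr s * s) • z)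
      (by fun_prop)).clm_apply (by fun_prop)).mul hGc).aestronglyMeasurable
  · refine Eventually.of_forall fun z t ht => ?_
    have ht0 : 0 < t := (half_pos hs).trans_le ht.1
    have hq := contr_pos t
    have hq3 : contr t ^ 3 ≤ 1 := pow_le_one₀ hq.le (contr_le_one t)
    rw [norm_mul, Real.norm_eq_abs (gauss₂ i j z), ← mul_assoc]
    refine mul_le_mul_of_nonneg_right ?_ (abs_nonneg _)
    refine ((fderiv ℝ w _).le_opNorm _).trans ?_
    rw [mul_assoc C]
    refine mul_le_mul (hC _) ?_ (norm_nonneg _) hC0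
    refine (norm_add_le _ _).trans ?_
    rw [norm_smul, norm_smul, Real.norm_eq_abs, Real.norm_eq_abs, abs_of_pos (pow_pos hq 3),
      abs_mul, abs_of_pos (pow_pos hq 3), abs_mul, abs_of_pos ht0]
    norm_num
    have h1 : 1 / 2 * t * contr t ^ 3 ≤ s := by
      calc 1 / 2 * t * contr t ^ 3 ≤ 1 / 2 * t * 1 := by gcongr
        _ ≤ s := by linarith [ht.2]
    have h2 : 1 / 2 * t * contr t ^ 3 * ‖x‖ ≤ s * ‖x‖ := by gcongr
    have h3 : contr t ^ 3 * ‖z‖ ≤ 1 * ‖z‖ := by gcongr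
    nlinarith [norm_nonneg x, norm_nonneg z, mul_nonneg (mul_nonneg hs.le (norm_nonneg x))
      (norm_nonneg z)]
  · refine Eventually.of_forall fun z t _ => ?_
    have h1 : HasDerivAt (fun t : ℝ => contr t • x + (contr t * t) • z)
        ((-(1 / 2) * t * contr t ^ 3) • x + contr t ^ 3 • z) t :=
      ((hasDerivAt_contr t).smul_const x).add ((hasDerivAt_contr_mul t).smul_const z)
    exact ((hw.differentiable (by norm_num) _).hasFDerivAt.comp_hasDerivAt t h1).mul_const _

/-- Up to the mass of the Gaussian, `ouMean` is `D_ij e^{tL} w (x)` by Mehler's formula, where `e^t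
= 1 + s² / 2`. The identity says that `L` commutes with its semigroup, with `dt/ds = s q²`. It is
verified directly: the drift of the operator comes from the motion of the point `q x + q s z`, the
Laplacian from `integral_euler_mul_gauss₂`. -/
lemma hasDerivAt_ouMean {w : Plane → ℝ} (hw : ContDiff ℝ 2 w) (hc : HasCompactSupport w)
    (x : Plane) {s : ℝ} (hs : 0 < s) (i j : Fin 2) :
    HasDerivAt (ouMean i j w x)
      (s⁻¹ * contr s * ∫ z, ou w (contr s • x + (contr s * s) • z) * gauss₂ i j z) s := by
  have hq := contr_pos s
  have hpc : HasDerivAt (fun s => (s ^ 2)⁻¹ * (contr s)⁻¹)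
      (-2 * (s ^ 3)⁻¹ * (contr s)⁻¹ + 1 / 2 * s⁻¹ * contr s) s := by
    refine (((hasDerivAt_pow 2 s).inv (pow_ne_zero _ hs.ne')).mul
      ((hasDerivAt_contr s).inv hq.ne')).congr_deriv ?_
    have := hs.ne'
    have := hq.ne'
    simp only [Pi.inv_apply]
    field_simp
    norm_num
    ring
  refine (hpc.mul (hasDerivAt_integral_contr (hw.of_le (by norm_num)) hc x hs i j)).congr_deriv ?_
  set q := contr s with hqdef
  set G := gauss₂ i j
  set y : Plane → Plane := fun z => q • x + (q * s) • z with hy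
  set Y := ∫ z, (∑ k, (y z) k * pd k w (y z)) * G z with hY
  set Z := ∫ z, (∑ k, z k * pd k w (y z)) * G z with hZ
  set H := ∫ z, w (y z) * G z with hH
  set Λ := ∫ z, lap w (y z) * G z with hΛ
  have hqs : q * s ≠ 0 := (mul_pos hq hs).ne'
  have hyc : Continuous y := by fun_prop
  have hW : ContDiff ℝ 2 fun z => w (y z) := hw.comp (contDiff_affine _ _)
  have hpw : ∀ k, ContDiff ℝ 1 (pd k w) := fun k => contDiff_pd hw (by norm_num) k
  have hWc : HasCompactSupport fun z => w (y z) := by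
    have := hc.comp_homeomorph ((Homeomorph.smulOfNeZero (q * s) hqs).trans
      (Homeomorph.addLeft (q • x)))
    exact this
  have hcoord : ∀ k : Fin 2, Continuous fun z : Plane => z k := fun k =>
    (differentiable_coord k).continuous
  have iH : Integrable fun z => w (y z) * G z :=
    integrable_comp_mul_gauss₂ hw.continuous hc _ _ i j
  have iΛ : Integrable fun z => lap w (y z) * G z :=
    integrable_comp_mul_gauss₂ (continuous_lap hw) (hasCompactSupport_lap hc) _ _ i j
  have iY : Integrable fun z => (∑ k, (y z) k * pd k w (y z)) * G z := by
    refine integrable_comp_mul_gauss₂ (w := fun x => ∑ k, x k * pd k w x)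
      (continuous_finsetSum _ fun k _ => (hcoord k).mul (hpw k).continuous) ?_ _ _ i j
    simp only [Fin.sum_univ_two]
    exact (hasCompactSupport_pd hc 0).mul_left.add (hasCompactSupport_pd hc 1).mul_left
  -- The velocity of `y = q x + q s z` is split as `-(s q² / 2) y + q z`: the first part is the
  -- drift, the second is handled by the Gaussian identity.
  have e1 : ∀ z, fderiv ℝ w (y z) ((-(1 / 2) * s * q ^ 3) • x + q ^ 3 • z) =
      (-(1 / 2) * s * q ^ 2) * (∑ k, (y z) k * pd k w (y z)) + q * ∑ k, z k * pd k w (y z) := by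
    intro z
    rw [fderiv_apply_eq_sum_pd]
    have hyk : ∀ k, (y z) k = q * x k + q * s * z k := fun k => by simp [hy]
    simp only [Fin.sum_univ_two, hyk, PiLp.add_apply, PiLp.smul_apply, smul_eq_mul]
    have hq2 := contr_sq s
    rw [← hqdef] at hq2
    have e2 : q ^ 3 + 1 / 2 * s ^ 2 * q ^ 3 - q = 0 := by linear_combination q * hq2
    linear_combination (z 0 * pd 0 w (y z) + z 1 * pd 1 w (y z)) * e2
  have e3 : ∀ z, ∑ k, z k * pd k (fun z => w (y z)) z = (q * s) * ∑ k, z k * pd k w (y z) := by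
    intro z
    rw [Finset.mul_sum]
    refine Finset.sum_congr rfl fun k _ => ?_
    rw [pd_comp_affine _ _ (hw.differentiable (by norm_num) _)]
    ring
  have hcomp := integral_euler_mul_gauss₂ hW hWc i j
  have hl : ∀ z, lap (fun z => w (y z)) z = (q * s) ^ 2 * lap w (y z) := fun z =>
    lap_comp_affine hw _ _ z
  simp only [e3, hl, mul_assoc, integral_const_mul] at hcomp
  have iZ : Integrable fun z => (∑ k, z k * pd k w (y z)) * G z := by
    have h1 : Continuous fun z : Plane => (∑ k, z k * pd k w (y z)) :=
      continuous_finsetSum _ fun k _ => (hcoord k).mul ((hpw k).continuous.comp hyc)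
    refine (h1.mul (contDiff_gauss₂ i j).continuous).integrable_of_hasCompactSupport
      (HasCompactSupport.mul_right ?_)
    have h2 : ∀ k, HasCompactSupport fun z => pd k w (y z) := fun k =>
      (hasCompactSupport_pd hc k).comp_homeomorph ((Homeomorph.smulOfNeZero (q * s) hqs).trans
        (Homeomorph.addLeft (q • x)))
    simp only [Fin.sum_univ_two]
    exact (h2 0).mul_left.add (h2 1).mul_left
  have e4 : ∫ z, fderiv ℝ w (y z) ((-(1 / 2) * s * q ^ 3) • x + q ^ 3 • z) * G z =
      (-(1 / 2) * s * q ^ 2) * Y + q * Z := by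
    rw [hY, hZ, ← integral_const_mul, ← integral_const_mul, ← integral_add (iY.const_mul _)
      (iZ.const_mul _)]
    congr 1; funext z; rw [e1]; ring
  have e5 : ∫ z, ou w (y z) * G z = Λ - 1 / 2 * (Y - H) := by
    have i5 : Integrable fun z => 1 / 2 * ((∑ k, (y z) k * pd k w (y z)) * G z - w (y z) * G z) :=
      (iY.sub iH).const_mul _
    rw [hΛ, hY, hH, ← integral_sub iY iH, ← integral_const_mul, ← integral_sub iΛ i5]
    congr 1; funext z; simp only [ou]; ring
  have e6 : q * (s * Z) = (q * s) ^ 2 * Λ + 2 * H := by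
    rw [hZ, hΛ, hH]
    exact hcomp
  rw [e4, e5]
  -- After elimination of `Z`, its `2 H` cancels the term `-2 s⁻³ q⁻¹ H` from the derivative of the
  -- prefactor. What remains of the prefactor, `s⁻¹ q H / 2`, is the zero-order term of the
  -- operator.
  have e7 : Z = (q * s)⁻¹ * ((q * s) ^ 2 * Λ + 2 * H) := by
    rw [← e6]; field_simp
  rw [e7]
  have := hs.ne'
  have := hq.ne'
  field_simp
  ring

lemma pd_pd_mul {f g : Plane → ℝ} {x : Plane} (hf : ContDiffAt ℝ 2 f x) (hg : ContDiffAt ℝ 2 g x)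
    (i j : Fin 2) : pd i (pd j fun y => f y * g y) x =
      pd i (pd j f) x * g x + pd j f x * pd i g x + pd i f x * pd j g x + f x * pd i (pd j g) x := by
  have ev : ∀ {h : Plane → ℝ}, ContDiffAt ℝ 2 h x → ∀ᶠ y in 𝓝 x, DifferentiableAt ℝ h y := by
    intro h hh
    filter_upwards [hh.eventually (by simp)] with y hy
    exact hy.differentiableAt (by norm_num)
  have h1 : (pd j fun y => f y * g y) =ᶠ[𝓝 x] fun y => pd j f y * g y + f y * pd j g y := by
    filter_upwards [ev hf, ev hg] with y h1 h2
    exact pd_mul h1 h2 j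
  have df := hf.differentiableAt (by norm_num)
  have dg := hg.differentiableAt (by norm_num)
  have dpf := (contDiffAt_pd hf (m := 1) (by norm_num) j).differentiableAt (by norm_num)
  have dpg := (contDiffAt_pd hg (m := 1) (by norm_num) j).differentiableAt (by norm_num)
  rw [pd_congr h1, pd_add (dpf.fun_mul dg) (df.fun_mul dpg), pd_mul dpf dg, pd_mul df dpg]
  ring

lemma ou_mul {f g : Plane → ℝ} {x : Plane} (hf : ContDiffAt ℝ 2 f x) (hg : ContDiffAt ℝ 2 g x) :
    ou (fun y => f y * g y) x = f x * ou g x + 2 * (∑ i, pd i f x * pd i g x) +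
      g x * (lap f x - 1 / 2 * ∑ i, x i * pd i f x) := by
  have df := hf.differentiableAt (by norm_num)
  have dg := hg.differentiableAt (by norm_num)
  simp only [ou, lap, pd_pd_mul hf hg, pd_mul df dg, Fin.sum_univ_two]
  ring

lemma ou_congr {f g : Plane → ℝ} {x : Plane} (h : f =ᶠ[𝓝 x] g) : ou f x = ou g x := by
  simp only [ou, lap_congr h, h.self_of_nhds]
  congr 3
  exact Finset.sum_congr rfl fun i _ => by rw [pd_congr h]

lemma continuous_ou {w : Plane → ℝ} (hw : ContDiff ℝ 2 w) : Continuous (ou w) := by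
  have h1 : ∀ k, Continuous (pd k w) := fun k => (contDiff_pd hw (m := 1) (by norm_num) k).continuous
  exact (continuous_lap hw).sub (continuous_const.mul ((continuous_finsetSum _ fun k _ =>
    (differentiable_coord k).continuous.mul (h1 k)).sub hw.continuous))

/-! ### Weighted Hölder sources against Gaussian kernels -/

/-- The weight `max 1 |x| ^ (-1 - α)`. -/
def wt (α : ℝ) (x : Plane) : ℝ := (max 1 ‖x‖) ^ (-1 - α)

/-- Hölder continuity with the weight `wt`. -/
def HomHolder (α A : ℝ) (E : Plane → ℝ) : Prop :=
  ∀ x y, |E x - E y| ≤ A * (wt α x + wt α y) * ‖x - y‖ ^ α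

lemma wt_pos (α : ℝ) (x : Plane) : 0 < wt α x := Real.rpow_pos_of_pos (by positivity) _

lemma wt_le_one {α : ℝ} (hα : 0 < α) (x : Plane) : wt α x ≤ 1 :=
  Real.rpow_le_one_of_one_le_of_nonpos (le_max_left _ _) (by linarith)

/-- The mean at scale `s` is centred at `q x`, closer to the origin, where the weight is larger. The
power `q ^ (1+α)` that accompanies it in the derivative of the mean compensates exactly. -/
lemma rpow_mul_wt_le {α q : ℝ} (hα : 0 < α) (hq : 0 < q) {x : Plane} (hx : x ≠ 0) :
    q ^ (1 + α) * wt α (q • x) ≤ ‖x‖ ^ (-1 - α) := by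
  have hx' : 0 < ‖x‖ := norm_pos_iff.2 hx
  have h1 : wt α (q • x) ≤ (q * ‖x‖) ^ (-1 - α) := by
    refine Real.rpow_le_rpow_of_nonpos (by positivity) ?_ (by linarith)
    rw [norm_smul, Real.norm_of_nonneg hq.le]
    exact le_max_right _ _
  calc _ ≤ q ^ (1 + α) * (q * ‖x‖) ^ (-1 - α) := by gcongr
    _ = _ := by
      rw [Real.mul_rpow hq.le hx'.le, ← mul_assoc, ← Real.rpow_add hq]
      simp

/-- A Peetre-type inequality: for `t ≤ 2`, `max 1 |p| ≤ max 1 |p + t z| (1 + 2 |z|)`, raised to a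
power `1 + α ≤ 2`. The polynomial loss in `z` is absorbed by the Gaussian kernels. -/
lemma wt_add_le {α : ℝ} (hα : 0 < α) (hα1 : α < 1) (p z : Plane) {t : ℝ} (ht : 0 < t)
    (ht2 : t ≤ 2) : wt α (p + t • z) ≤ wt α p * (1 + 2 * ‖z‖) ^ 2 := by
  have hz := norm_nonneg z
  have h1 : max 1 ‖p‖ ≤ max 1 ‖p + t • z‖ * (1 + 2 * ‖z‖) := by
    have a1 : ‖p‖ ≤ ‖p + t • z‖ + 2 * ‖z‖ := by
      have := norm_sub_le (p + t • z) (t • z)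
      rw [add_sub_cancel_right, norm_smul, Real.norm_of_nonneg ht.le] at this
      nlinarith
    have a2 := le_max_left 1 ‖p + t • z‖
    have a3 := le_max_right 1 ‖p + t • z‖
    refine max_le ?_ ?_ <;> nlinarith
  have hm1 : (0 : ℝ) < max 1 ‖p‖ := by positivity
  have hm2 : (0 : ℝ) < max 1 ‖p + t • z‖ := by positivity
  have e : wt α p * (max 1 ‖p‖) ^ (1 + α) = 1 := by
    rw [wt, ← Real.rpow_add hm1]; simp
  have e2 : wt α (p + t • z) * (max 1 ‖p + t • z‖) ^ (1 + α) = 1 := by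
    rw [wt, ← Real.rpow_add hm2]; simp
  have h2 : (max 1 ‖p‖) ^ (1 + α) ≤ (max 1 ‖p + t • z‖) ^ (1 + α) * (1 + 2 * ‖z‖) ^ 2 := by
    calc (max 1 ‖p‖) ^ (1 + α) ≤ (max 1 ‖p + t • z‖ * (1 + 2 * ‖z‖)) ^ (1 + α) := by gcongr
      _ = (max 1 ‖p + t • z‖) ^ (1 + α) * (1 + 2 * ‖z‖) ^ (1 + α) :=
        Real.mul_rpow hm2.le (by positivity)
      _ ≤ _ := by
        gcongr
        rw [← Real.rpow_natCast]
        exact Real.rpow_le_rpow_of_exponent_le (by linarith) (by push_cast; linarith)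
  have hP : (0 : ℝ) < (max 1 ‖p‖) ^ (1 + α) := by positivity
  calc wt α (p + t • z) = wt α (p + t • z) * (wt α p * (max 1 ‖p‖) ^ (1 + α)) := by rw [e, mul_one]
    _ ≤ wt α (p + t • z) * (wt α p * ((max 1 ‖p + t • z‖) ^ (1 + α) * (1 + 2 * ‖z‖) ^ 2)) := by
      have := (wt_pos α (p + t • z)).le
      have := (wt_pos α p).le
      gcongr
    _ = (wt α (p + t • z) * (max 1 ‖p + t • z‖) ^ (1 + α)) * (wt α p * (1 + 2 * ‖z‖) ^ 2) := by ring
    _ = _ := by rw [e2, one_mul]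

lemma HomHolder.abs_sub_le {α A : ℝ} {E : Plane → ℝ} (hE : HomHolder α A E) (hA : 0 ≤ A)
    (hα : 0 < α) (hα1 : α < 1) (p z : Plane) {t : ℝ} (ht : 0 < t) (ht2 : t ≤ 2) :
    |E (p + t • z) - E p| ≤ 16 * A * wt α p * t ^ α * (1 + ‖z‖) ^ 3 := by
  have hz := norm_nonneg z
  have h1 := hE (p + t • z) p
  have h2 := wt_add_le hα hα1 p z ht ht2
  have hw := (wt_pos α p).le
  have h3 : ‖p + t • z - p‖ ^ α ≤ t ^ α * (1 + 2 * ‖z‖) := by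
    rw [add_sub_cancel_left, norm_smul, Real.norm_of_nonneg ht.le, Real.mul_rpow ht.le hz]
    gcongr
    calc ‖z‖ ^ α ≤ (1 + 2 * ‖z‖) ^ α := by gcongr; linarith
      _ ≤ (1 + 2 * ‖z‖) ^ (1 : ℝ) := Real.rpow_le_rpow_of_exponent_le (by linarith) hα1.le
      _ = _ := Real.rpow_one _
  have h4 : wt α (p + t • z) + wt α p ≤ 2 * wt α p * (1 + 2 * ‖z‖) ^ 2 := by
    nlinarith [mul_nonneg hw (mul_nonneg hz (by linarith : (0 : ℝ) ≤ 4 + 4 * ‖z‖))]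
  calc _ ≤ A * (2 * wt α p * (1 + 2 * ‖z‖) ^ 2) * (t ^ α * (1 + 2 * ‖z‖)) := by
        refine h1.trans ?_
        gcongr
    _ = 2 * A * wt α p * t ^ α * (1 + 2 * ‖z‖) ^ 3 := by ring
    _ ≤ 2 * A * wt α p * t ^ α * (2 * (1 + ‖z‖)) ^ 3 := by gcongr; linarith
    _ = _ := by ring

/-- The kernel has mean zero, so `E p` may be subtracted from `E (p + t z)`; the Hölder condition
then gives `t ^ α` and the weight at the centre `p`. -/
lemma HomHolder.integral_le {α A : ℝ} {E κ : Plane → ℝ} (hE : HomHolder α A E) (hA : 0 ≤ A)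
    (hα : 0 < α) (hα1 : α < 1) (hEc : Continuous E) (hκc : Continuous κ)
    (hκ : Integrable fun z => (1 + ‖z‖) ^ 3 * |κ z|) (hκ0 : ∫ z, κ z = 0) (hκi : Integrable κ)
    (p : Plane) {t : ℝ} (ht : 0 < t) (ht2 : t ≤ 2) :
    (Integrable fun z => E (p + t • z) * κ z) ∧ |∫ z, E (p + t • z) * κ z| ≤
      16 * A * wt α p * t ^ α * ∫ z, (1 + ‖z‖) ^ 3 * |κ z| := by
  have hb : ∀ z, ‖(E (p + t • z) - E p) * κ z‖ ≤
      16 * A * wt α p * t ^ α * ((1 + ‖z‖) ^ 3 * |κ z|) := by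
    intro z
    rw [norm_mul, Real.norm_eq_abs, Real.norm_eq_abs, ← mul_assoc]
    gcongr
    exact hE.abs_sub_le hA hα hα1 p z ht ht2
  have hc : Continuous fun z => (E (p + t • z) - E p) * κ z :=
    ((hEc.comp (by fun_prop : Continuous fun z : Plane => p + t • z)).sub continuous_const).mul hκc
  have hi : Integrable fun z => (E (p + t • z) - E p) * κ z :=
    (hκ.const_mul _).mono' hc.aestronglyMeasurable (Eventually.of_forall hb)
  have hs : (fun z => E (p + t • z) * κ z) = fun z => (E (p + t • z) - E p) * κ z + E p * κ z := by
    funext z; ring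
  refine ⟨?_, ?_⟩
  · rw [hs]; exact hi.add (hκi.const_mul _)
  · rw [hs, integral_add hi (hκi.const_mul _), integral_const_mul, hκ0, mul_zero, add_zero,
      ← integral_const_mul, ← Real.norm_eq_abs]
    exact norm_integral_le_of_norm_le (hκ.const_mul _) (Eventually.of_forall hb)

lemma exists_gauss₂_shift (i j : Fin 2) : ∃ C : ℝ, 0 < C ∧ ∀ a : Plane, ‖a‖ ≤ 1 →
    (Integrable fun z => (1 + ‖z‖) ^ 3 * |gauss₂ i j z - gauss₂ i j (z - a)|) ∧
    ∫ z, (1 + ‖z‖) ^ 3 * |gauss₂ i j z - gauss₂ i j (z - a)| ≤ C * ‖a‖ := by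
  obtain ⟨C, hC, h⟩ := gauss₂_translate i j
  have hI := integrable_pow_mul_exp_neg_normSq 3 (c := 1 / 8) (by norm_num)
  have hI0 : 0 ≤ ∫ z : Plane, (1 + ‖z‖) ^ 3 * Real.exp (-(1 / 8) * ‖z‖ ^ 2) :=
    integral_nonneg fun z => by positivity
  refine ⟨C * ((∫ z : Plane, (1 + ‖z‖) ^ 3 * Real.exp (-(1 / 8) * ‖z‖ ^ 2)) + 1), by positivity,
    fun a ha => ?_⟩
  have hG : Continuous (gauss₂ i j) := (contDiff_gauss₂ i j).continuous
  have hc : Continuous fun z : Plane => (1 + ‖z‖) ^ 3 * |gauss₂ i j z - gauss₂ i j (z - a)| :=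
    (by fun_prop : Continuous fun z : Plane => (1 + ‖z‖) ^ 3).mul
      (hG.sub (hG.comp (by fun_prop))).abs
  have hb : ∀ z : Plane, ‖(1 + ‖z‖) ^ 3 * |gauss₂ i j z - gauss₂ i j (z - a)|‖ ≤
      (C * ‖a‖) * ((1 + ‖z‖) ^ 3 * Real.exp (-(1 / 8) * ‖z‖ ^ 2)) := by
    intro z
    rw [Real.norm_of_nonneg (by positivity)]
    calc _ ≤ (1 + ‖z‖) ^ 3 * (C * ‖a‖ * Real.exp (-(1 / 8) * ‖z‖ ^ 2)) := by
          gcongr; exact h z a ha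
      _ = _ := by ring
  refine ⟨(hI.const_mul _).mono' hc.aestronglyMeasurable (Eventually.of_forall hb), ?_⟩
  have := norm_integral_le_of_norm_le (hI.const_mul _) (Eventually.of_forall hb)
  rw [integral_const_mul] at this
  refine (le_abs_self _).trans (this.trans ?_)
  nlinarith [mul_nonneg hC.le (norm_nonneg a)]

/-- The contribution of a function supported far away is small. -/
lemma exists_far_error (i j : Fin 2) : ∃ C : ℝ, 0 < C ∧ ∀ (e : Plane → ℝ) (B N : ℝ),
    0 ≤ B → 0 < N → Continuous e → (∀ y, ‖y‖ < N → e y = 0) →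
    (∀ y, |e y| ≤ B * Real.exp (3 / 16 * ‖y‖ ^ 2)) → ∀ (p : Plane) (t : ℝ), 0 < t → t ^ 2 ≤ 2 →
    100 * ‖p‖ ≤ N → (Integrable fun z => e (p + t • z) * gauss₂ i j z) ∧
      |∫ z, e (p + t • z) * gauss₂ i j z| ≤ C * B * t ^ 2 * (N ^ 2)⁻¹ := by
  have hI := integrable_pow_mul_exp_neg_normSq 4 (c := 1 / 10) (by norm_num)
  have hI0 : 0 ≤ ∫ z : Plane, (1 + ‖z‖) ^ 4 * Real.exp (-(1 / 10) * ‖z‖ ^ 2) :=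
    integral_nonneg fun z => by positivity
  refine ⟨2 * ((∫ z : Plane, (1 + ‖z‖) ^ 4 * Real.exp (-(1 / 10) * ‖z‖ ^ 2)) + 1), by positivity,
    fun e B N hB hN hec he0 heB p t ht ht2 hpN => ?_⟩
  have hb : ∀ z, ‖e (p + t • z) * gauss₂ i j z‖ ≤ (2 * B * t ^ 2 * (N ^ 2)⁻¹) *
      ((1 + ‖z‖) ^ 4 * Real.exp (-(1 / 10) * ‖z‖ ^ 2)) := by
    intro z
    have hz := norm_nonneg z
    by_cases hy : ‖p + t • z‖ < N
    · rw [he0 _ hy, zero_mul, norm_zero]; positivity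
    · rw [not_lt] at hy
      have h1 : ‖p + t • z‖ ≤ ‖p‖ + t * ‖z‖ := by
        refine (norm_add_le _ _).trans ?_
        rw [norm_smul, Real.norm_of_nonneg ht.le]
      have htz : 0 ≤ t * ‖z‖ := by positivity
      have h2 : 99 / 100 * N ≤ t * ‖z‖ := by linarith
      have h3 : ‖p + t • z‖ ≤ 100 / 99 * (t * ‖z‖) := by linarith
      -- From `t² ≤ 2` and `2 (100/99)² ≤ 32/15`. The growth exponent becomes `3/16 · 32/15 = 2/5`,
      -- which leaves the decay `-1/10` against the Gaussian rate `1/2`.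
      have h4 : ‖p + t • z‖ ^ 2 ≤ 32 / 15 * ‖z‖ ^ 2 := by
        have := pow_le_pow_left₀ (norm_nonneg _) h3 2
        nlinarith [sq_nonneg ‖z‖]
      -- On the support `t |z|` is comparable to `N`, so the factor `t² / N²` can be inserted at the
      -- price of `|z|²`.
      have h5 : 1 ≤ 2 * t ^ 2 * (N ^ 2)⁻¹ * ‖z‖ ^ 2 := by
        have : N ^ 2 ≤ 2 * (t ^ 2 * ‖z‖ ^ 2) := by nlinarith
        have hN2 : 0 < N ^ 2 := by positivity
        rw [show 2 * t ^ 2 * (N ^ 2)⁻¹ * ‖z‖ ^ 2 = (2 * (t ^ 2 * ‖z‖ ^ 2)) / N ^ 2 by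
          field_simp]
        rwa [le_div_iff₀ hN2, one_mul]
      have h6 : ‖z‖ ^ 2 ≤ (1 + ‖z‖) ^ 2 := by gcongr; linarith
      rw [norm_mul, Real.norm_eq_abs, Real.norm_eq_abs]
      calc _ ≤ (B * Real.exp (3 / 16 * (32 / 15 * ‖z‖ ^ 2))) * ((1 + ‖z‖) ^ 2 * gauss z) := by
            refine mul_le_mul ((heB _).trans ?_) (abs_gauss₂_le i j z) (abs_nonneg _)
              (by positivity)
            gcongr
        _ = B * (1 + ‖z‖) ^ 2 * Real.exp (-(1 / 10) * ‖z‖ ^ 2) := by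
            rw [gauss, show B * Real.exp (3 / 16 * (32 / 15 * ‖z‖ ^ 2)) * ((1 + ‖z‖) ^ 2 *
              Real.exp (-(1 / 2) * ‖z‖ ^ 2)) = B * (1 + ‖z‖) ^ 2 *
              (Real.exp (3 / 16 * (32 / 15 * ‖z‖ ^ 2)) * Real.exp (-(1 / 2) * ‖z‖ ^ 2)) by ring,
              ← Real.exp_add]
            ring_nf
        _ ≤ B * (1 + ‖z‖) ^ 2 * Real.exp (-(1 / 10) * ‖z‖ ^ 2) *
              (2 * t ^ 2 * (N ^ 2)⁻¹ * (1 + ‖z‖) ^ 2) := by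
            refine le_mul_of_one_le_right (by positivity) (h5.trans ?_)
            gcongr
        _ = _ := by ring
  have hG : Continuous (gauss₂ i j) := (contDiff_gauss₂ i j).continuous
  have hc : Continuous fun z => e (p + t • z) * gauss₂ i j z :=
    (hec.comp (by fun_prop : Continuous fun z : Plane => p + t • z)).mul hG
  refine ⟨(hI.const_mul _).mono' hc.aestronglyMeasurable (Eventually.of_forall hb), ?_⟩
  have := norm_integral_le_of_norm_le (hI.const_mul _) (Eventually.of_forall hb)
  rw [integral_const_mul] at this
  refine this.trans ?_
  have h0 : 0 ≤ B * t ^ 2 * (N ^ 2)⁻¹ := by positivity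
  nlinarith

/-- The displacement satisfies `(q s)² ≤ 2`, so growth of rate `3/16` costs about `3/8 < 9/20 < 1/2`
in the Gaussian exponent at every scale, and the integral stays bounded in `s`. The prefactor `s⁻²
q⁻¹ ≤ (1 + s) / s²` then kills the mean as `s → ∞`. -/
lemma exists_ouMean_le (i j : Fin 2) : ∃ C : ℝ, 0 < C ∧ ∀ (w : Plane → ℝ) (B : ℝ), 0 ≤ B →
    (∀ y, |w y| ≤ B * Real.exp (3 / 16 * ‖y‖ ^ 2)) → ∀ (x : Plane) (s : ℝ), 0 < s →
    |ouMean i j w x s| ≤ C * B * Real.exp (3 * ‖x‖ ^ 2) * ((1 + s) / s ^ 2) := by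
  have hI := integrable_pow_mul_exp_neg_normSq 2 (c := 1 / 20) (by norm_num)
  have hI0 : 0 ≤ ∫ z : Plane, (1 + ‖z‖) ^ 2 * Real.exp (-(1 / 20) * ‖z‖ ^ 2) :=
    integral_nonneg fun z => by positivity
  refine ⟨(∫ z : Plane, (1 + ‖z‖) ^ 2 * Real.exp (-(1 / 20) * ‖z‖ ^ 2)) + 1, by positivity,
    fun w B hB hw x s hs => ?_⟩
  have hq := contr_pos s
  have hq1 := contr_le_one s
  have hb : ∀ z, ‖w (contr s • x + (contr s * s) • z) * gauss₂ i j z‖ ≤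
      (B * Real.exp (3 * ‖x‖ ^ 2)) * ((1 + ‖z‖) ^ 2 * Real.exp (-(1 / 20) * ‖z‖ ^ 2)) := by
    intro z
    have h1 : ‖contr s • x + (contr s * s) • z‖ ≤ ‖x‖ + contr s * s * ‖z‖ := by
      refine (norm_add_le _ _).trans ?_
      rw [norm_smul, norm_smul, Real.norm_of_nonneg hq.le, Real.norm_of_nonneg (by positivity)]
      gcongr
      exact mul_le_of_le_one_left (norm_nonneg _) hq1
    have h2 : 3 / 16 * ‖contr s • x + (contr s * s) • z‖ ^ 2 ≤ 3 * ‖x‖ ^ 2 + 9 / 20 * ‖z‖ ^ 2 := by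
      have a1 := pow_le_pow_left₀ (norm_nonneg _) h1 2
      have a2 : (contr s * s * ‖z‖) ^ 2 ≤ 2 * ‖z‖ ^ 2 := by
        rw [mul_pow]; gcongr; exact contr_mul_sq_le s
      nlinarith [sq_nonneg (5 * ‖x‖ - contr s * s * ‖z‖), sq_nonneg ‖x‖]
    rw [norm_mul, Real.norm_eq_abs, Real.norm_eq_abs]
    calc _ ≤ (B * Real.exp (3 * ‖x‖ ^ 2 + 9 / 20 * ‖z‖ ^ 2)) * ((1 + ‖z‖) ^ 2 * gauss z) := by
          refine mul_le_mul ((hw _).trans ?_) (abs_gauss₂_le i j z) (abs_nonneg _) (by positivity)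
          gcongr
      _ = _ := by
          rw [gauss, Real.exp_add, show B * (Real.exp (3 * ‖x‖ ^ 2) * Real.exp (9 / 20 * ‖z‖ ^ 2)) *
            ((1 + ‖z‖) ^ 2 * Real.exp (-(1 / 2) * ‖z‖ ^ 2)) = B * Real.exp (3 * ‖x‖ ^ 2) *
            ((1 + ‖z‖) ^ 2 * (Real.exp (9 / 20 * ‖z‖ ^ 2) * Real.exp (-(1 / 2) * ‖z‖ ^ 2))) by
            ring, ← Real.exp_add]
          ring_nf
  have h3 := norm_integral_le_of_norm_le (hI.const_mul _) (Eventually.of_forall hb)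
  rw [integral_const_mul, Real.norm_eq_abs] at h3
  rw [ouMean, abs_mul, abs_mul, abs_of_pos (inv_pos.2 hq), abs_of_pos (by positivity)]
  have h4 := inv_contr_le hs
  have h5 : 0 ≤ B * Real.exp (3 * ‖x‖ ^ 2) := by positivity
  calc _ ≤ (s ^ 2)⁻¹ * (1 + s) * (B * Real.exp (3 * ‖x‖ ^ 2) *
        ∫ z : Plane, (1 + ‖z‖) ^ 2 * Real.exp (-(1 / 20) * ‖z‖ ^ 2)) := by gcongr
    _ ≤ (s ^ 2)⁻¹ * (1 + s) * (B * Real.exp (3 * ‖x‖ ^ 2) *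
        ((∫ z : Plane, (1 + ‖z‖) ^ 2 * Real.exp (-(1 / 20) * ‖z‖ ^ 2)) + 1)) := by
        gcongr; linarith
    _ = _ := by field_simp

/-- Two integrations by parts move the derivatives from the Gaussian to `w` and cancel `s ^ (-2)`;
what remains is continuous at scale zero. -/
lemma tendsto_ouMean {w : Plane → ℝ} (hw : ContDiff ℝ 2 w) (hc : HasCompactSupport w)
    (x : Plane) (i j : Fin 2) :
    Tendsto (ouMean i j w x) (𝓝[>] 0) (𝓝 (pd j (pd i w) x * ∫ z, gauss z)) := by
  have hD : Continuous (pd j (pd i w)) :=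
    (contDiff_pd (contDiff_pd hw (m := 1) (by norm_num) i) (m := 0) (by norm_num) j).continuous
  obtain ⟨C, hC0, hC⟩ := exists_bound_of_hasCompactSupport hD
    (hasCompactSupport_pd (hasCompactSupport_pd hc i) j)
  have h1 : ∀ s : ℝ, 0 < s → ouMean i j w x s =
      contr s * ∫ z, pd j (pd i w) (contr s • x + (contr s * s) • z) * gauss z := by
    intro s hs
    have hq := contr_pos s
    have hqs : contr s * s ≠ 0 := (mul_pos hq hs).ne'
    have hWc : HasCompactSupport fun z => w (contr s • x + (contr s * s) • z) :=
      hc.comp_homeomorph ((Homeomorph.smulOfNeZero (contr s * s) hqs).trans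
        (Homeomorph.addLeft (contr s • x)))
    have hW : ContDiff ℝ 2 fun z => w (contr s • x + (contr s * s) • z) :=
      hw.comp (contDiff_affine _ _)
    have h2 := integral_mul_pd_pd (u := gauss) isOpen_univ contDiff_gauss.contDiffOn hW hWc
      (subset_univ _) j i
    have h3 : ∀ z, pd j (pd i fun z => w (contr s • x + (contr s * s) • z)) z =
        (contr s * s) ^ 2 * pd j (pd i w) (contr s • x + (contr s * s) • z) := by
      intro z
      have e : (pd i fun z => w (contr s • x + (contr s * s) • z)) =
          fun z => (contr s * s) * pd i w (contr s • x + (contr s * s) • z) :=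
        funext fun z => pd_comp_affine _ _ (hw.differentiable (by norm_num) _) i
      have hd : Differentiable ℝ (pd i w) :=
        (contDiff_pd hw (m := 1) (by norm_num) i).differentiable (by norm_num)
      have hd' : Differentiable ℝ fun z => pd i w (contr s • x + (contr s * s) • z) :=
        hd.comp ((contDiff_affine (n := 1) (contr s • x) (contr s * s)).differentiable (by norm_num))
      rw [e, pd_const_mul (hd' z), pd_comp_affine _ _ (hd _)]
      ring
    have h4 : ∫ z, w (contr s • x + (contr s * s) • z) * gauss₂ i j z = (contr s * s) ^ 2 *
        ∫ z, pd j (pd i w) (contr s • x + (contr s * s) • z) * gauss z := by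
      rw [← integral_const_mul]
      simp only [gauss₂]
      simp only [mul_comm (w _)]
      rw [← h2]
      congr 1; funext z; rw [h3]; ring
    rw [ouMean, h4]
    have := hs.ne'
    have := hq.ne'
    field_simp
  have hq0 : contr 0 = 1 := by simp [contr]
  have h5 : Tendsto (fun s => ∫ z, pd j (pd i w) (contr s • x + (contr s * s) • z) * gauss z)
      (𝓝 0) (𝓝 (∫ z, pd j (pd i w) (contr 0 • x + (contr 0 * 0) • z) * gauss z)) := by
    refine tendsto_integral_filter_of_dominated_convergence (fun z => C * gauss z) ?_ ?_
      (integrable_gauss.const_mul C) ?_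
    · refine Eventually.of_forall fun s => ?_
      exact ((hD.comp (by fun_prop : Continuous fun z : Plane => contr s • x + (contr s * s) • z)).mul
        (contDiff_gauss (n := 0)).continuous).aestronglyMeasurable
    · refine Eventually.of_forall fun s => Eventually.of_forall fun z => ?_
      rw [norm_mul, Real.norm_of_nonneg (gauss_pos z).le]
      have := (gauss_pos z).le
      gcongr
      exact hC _
    · refine Eventually.of_forall fun z => Tendsto.mul_const _ ?_
      have hcc := continuous_contr
      exact (hD.comp (by fun_prop : Continuous fun s : ℝ => contr s • x + (contr s * s) • z)).tendsto 0
  have h6 := (continuous_contr.tendsto 0).mul h5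
  simp only [hq0, one_smul, mul_zero, zero_smul, add_zero, one_mul, integral_const_mul] at h6
  refine (h6.mono_left nhdsWithin_le_nhds).congr' ?_
  filter_upwards [self_mem_nhdsWithin] with s hs
  exact (h1 s hs).symm

/-! ### Cutoffs at infinity and bounds for the scale derivative -/

/-- Compactly supported approximations, with control on the Ornstein-Uhlenbeck operator. -/
lemma exists_cutoff_approx {v : Plane → ℝ} {B : ℝ} (hv : ContDiff ℝ 2 v) (hB : 0 ≤ B)
    (hv0 : ∀ x, |v x| ≤ B * Real.exp (3 / 16 * ‖x‖ ^ 2))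
    (hv1 : ∀ i x, |pd i v x| ≤ B * Real.exp (3 / 16 * ‖x‖ ^ 2))
    (hv2 : ∀ x, |ou v x| ≤ B * Real.exp (3 / 16 * ‖x‖ ^ 2)) :
    ∃ B' : ℝ, 0 ≤ B' ∧ ∀ N : ℝ, 1 ≤ N → ∃ w : Plane → ℝ, ContDiff ℝ 2 w ∧ HasCompactSupport w ∧
      (∀ x, ‖x‖ < N → w =ᶠ[𝓝 x] v) ∧ (∀ x, |w x| ≤ B * Real.exp (3 / 16 * ‖x‖ ^ 2)) ∧
      ∀ x, |ou w x - ou v x| ≤ B' * Real.exp (3 / 16 * ‖x‖ ^ 2) := by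
  let b : ContDiffBump (0 : Plane) := ⟨1, 2, by norm_num, by norm_num⟩
  have hb : ContDiff ℝ ∞ b := b.contDiff
  have hbc : HasCompactSupport b := b.hasCompactSupport
  have hpb : ∀ k, Continuous (pd k b) := fun k => (contDiff_infty_pd hb k).continuous
  have hex : ∃ C : ℝ, 0 ≤ C ∧ ∀ k x, |pd k b x| ≤ C := by
    obtain ⟨C0, h0, h0'⟩ := exists_bound_of_hasCompactSupport (hpb 0) (hasCompactSupport_pd hbc 0)
    obtain ⟨C1, h1, h1'⟩ := exists_bound_of_hasCompactSupport (hpb 1) (hasCompactSupport_pd hbc 1)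
    refine ⟨C0 + C1, by positivity, fun k x => ?_⟩
    fin_cases k
    · exact (h0' x).trans (by linarith)
    · exact (h1' x).trans (by linarith)
  obtain ⟨C1, hC1, hC1'⟩ := hex
  obtain ⟨C2, hC2, hC2'⟩ := exists_bound_of_hasCompactSupport
    (continuous_lap (contDiff_two_of_infty hb)) (hasCompactSupport_lap hbc)
  have hec : HasCompactSupport fun x : Plane => ∑ k, x k * pd k b x := by
    simp only [Fin.sum_univ_two]
    exact (hasCompactSupport_pd hbc 0).mul_left.add (hasCompactSupport_pd hbc 1).mul_left
  obtain ⟨C3, hC3, hC3'⟩ := exists_bound_of_hasCompactSupport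
    (continuous_finsetSum _ fun k _ => (differentiable_coord k).continuous.mul (hpb k)) hec
  refine ⟨B * (1 + 4 * C1 + C2 + C3), by positivity, fun N hN => ?_⟩
  have hN0 : 0 < N := by linarith
  have hNi : N⁻¹ ≤ 1 := inv_le_one_of_one_le₀ hN
  have hNi0 : 0 < N⁻¹ := inv_pos.2 hN0
  let η : Plane → ℝ := fun x => b (0 + N⁻¹ • x)
  have hη : ContDiff ℝ ∞ η := hb.comp (contDiff_affine 0 N⁻¹)
  have hη2 := contDiff_two_of_infty hη
  have hηc : HasCompactSupport η :=
    hbc.comp_homeomorph ((Homeomorph.smulOfNeZero N⁻¹ hNi0.ne').trans (Homeomorph.addLeft 0))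
  have hη01 : ∀ x, 0 ≤ η x ∧ η x ≤ 1 := fun x => ⟨b.nonneg, b.le_one⟩
  have hpη : ∀ k x, pd k η x = N⁻¹ * pd k b (0 + N⁻¹ • x) := fun k x =>
    pd_comp_affine 0 N⁻¹ (hb.differentiable (by simp) _) k
  have hlη : ∀ x, lap η x = N⁻¹ ^ 2 * lap b (0 + N⁻¹ • x) := fun x =>
    lap_comp_affine (contDiff_two_of_infty hb) 0 N⁻¹ x
  -- The drift term `x · ∇η` is invariant under dilation, so it does not blow up with `N` although
  -- `x` is of size `N` there. This is why `B'` is independent of `N`.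
  have heη : ∀ x : Plane, ∑ k, x k * pd k η x = ∑ k, (0 + N⁻¹ • x) k * pd k b (0 + N⁻¹ • x) := by
    intro x
    refine Finset.sum_congr rfl fun k _ => ?_
    rw [hpη]
    simp
    ring
  refine ⟨fun x => η x * v x, hη2.mul hv, hηc.mul_right, ?_, ?_, ?_⟩
  · intro x hx
    filter_upwards [(continuous_norm.tendsto x).eventually (gt_mem_nhds hx)] with y hy
    have : η y = 1 := b.one_of_mem_closedBall (by
      simp only [zero_add, mem_closedBall_zero_iff, norm_smul, Real.norm_of_nonneg hNi0.le]
      exact (inv_mul_le_one₀ hN0).2 (le_of_lt hy))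
    rw [this, one_mul]
  · intro x
    rw [abs_mul, abs_of_nonneg (hη01 x).1]
    exact (mul_le_of_le_one_left (abs_nonneg _) (hη01 x).2).trans (hv0 x)
  · intro x
    rw [ou_mul hη2.contDiffAt hv.contDiffAt, heη, hlη, Fin.sum_univ_two]
    set e := Real.exp (3 / 16 * ‖x‖ ^ 2)
    have he : 0 < e := Real.exp_pos _
    have a1 : |(η x - 1) * ou v x| ≤ B * e := by
      rw [abs_mul]
      refine (mul_le_of_le_one_left (abs_nonneg _) ?_).trans (hv2 x)
      rw [abs_le]
      constructor <;> linarith [(hη01 x).1, (hη01 x).2]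
    have a2 : ∀ k, |pd k η x * pd k v x| ≤ C1 * (B * e) := by
      intro k
      rw [abs_mul]
      refine mul_le_mul ?_ (hv1 k x) (abs_nonneg _) hC1
      rw [hpη, abs_mul, abs_of_pos hNi0]
      exact (mul_le_of_le_one_left (abs_nonneg _) hNi).trans (hC1' k _)
    have a3 : |v x * (N⁻¹ ^ 2 * lap b (0 + N⁻¹ • x) -
        1 / 2 * ∑ k, (0 + N⁻¹ • x) k * pd k b (0 + N⁻¹ • x))| ≤ (B * e) * (C2 + C3) := by
      rw [abs_mul]
      refine mul_le_mul (hv0 x) ?_ (abs_nonneg _) (by positivity)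
      refine (abs_sub _ _).trans (add_le_add ?_ ?_)
      · rw [abs_mul, abs_of_pos (by positivity)]
        exact (mul_le_of_le_one_left (abs_nonneg _) (pow_le_one₀ hNi0.le hNi)).trans (hC2' _)
      · rw [abs_mul, abs_of_pos (by norm_num)]
        have : |∑ k, (0 + N⁻¹ • x) k * pd k b (0 + N⁻¹ • x)| ≤ C3 := hC3' (0 + N⁻¹ • x)
        have := abs_nonneg (∑ k, (0 + N⁻¹ • x) k * pd k b (0 + N⁻¹ • x))
        linarith
    have e1 : ∀ a b c d o : ℝ, a * o + 2 * (b + c) + d - o = (a - 1) * o + 2 * b + 2 * c + d := by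
      intros; ring
    rw [e1]
    have b0 := a2 0
    have b1 := a2 1
    rw [abs_le] at a1 a3 b0 b1 ⊢
    constructor <;> nlinarith

/-- The derivative of the Gaussian mean. -/
def ouMeanDeriv (i j : Fin 2) (F : Plane → ℝ) (x : Plane) (s : ℝ) : ℝ :=
  s⁻¹ * contr s * ∫ z, F (contr s • x + (contr s * s) • z) * gauss₂ i j z

/-- Bounds for the mean of a weighted Hölder function, up to a small far contribution. -/
lemma exists_ouMeanDeriv_le {α : ℝ} (hα : 0 < α) (hα1 : α < 1) (i j : Fin 2) :
    ∃ C : ℝ, 0 < C ∧ ∀ (E F : Plane → ℝ) (A B N : ℝ), 0 ≤ A → 0 ≤ B → 0 < N → Continuous E →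
      Continuous F → HomHolder α A E → (∀ y, ‖y‖ < N → F y - E y = 0) →
      (∀ y, |F y - E y| ≤ B * Real.exp (3 / 16 * ‖y‖ ^ 2)) →
      (∀ x s, x ≠ 0 → 0 < s → 100 * ‖x‖ ≤ N →
        |ouMeanDeriv i j F x s| ≤ C * A * ‖x‖ ^ (-1 - α) * s ^ (α - 1) + C * B * (N ^ 2)⁻¹ * s ∧
        |ouMeanDeriv i j F x s| ≤ C * A * s ^ (-2 : ℝ) + C * B * (N ^ 2)⁻¹ * s) ∧
      ∀ x x' s, x ≠ 0 → 0 < s → 100 * ‖x‖ ≤ N → 100 * ‖x'‖ ≤ N → ‖x - x'‖ ≤ s →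
        |ouMeanDeriv i j F x s - ouMeanDeriv i j F x' s| ≤
          C * A * ‖x‖ ^ (-1 - α) * ‖x - x'‖ * s ^ (α - 2) + C * B * (N ^ 2)⁻¹ * s := by
  obtain ⟨C1, hC1, hshift⟩ := exists_gauss₂_shift i j
  obtain ⟨C2, hC2, hfar⟩ := exists_far_error i j
  have hI := integrable_gauss₂_weight 3 i j
  set I := ∫ z, (1 + ‖z‖) ^ 3 * |gauss₂ i j z| with hIdef
  have hI0 : 0 ≤ I := integral_nonneg fun z => by positivity
  refine ⟨64 * I + 16 * C1 + 2 * C2, by positivity,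
    fun E F A B N hA hB hN hEc hFc hE hF0 hFB => ?_⟩
  have hGc : Continuous (gauss₂ i j) := (contDiff_gauss₂ i j).continuous
  have hec : Continuous fun y => F y - E y := hFc.sub hEc
  have hfar' := hfar (fun y => F y - E y) B N hB hN hec hF0 hFB
  -- `F - E` lives beyond radius `N` and contributes only `ε`, of size `N⁻² s`; the rest of the
  -- argument concerns the Hölder source `E`.
  have split : ∀ x s, 0 < s → 100 * ‖x‖ ≤ N → ∃ ε : ℝ, |ε| ≤ C2 * B * (N ^ 2)⁻¹ * s ∧
      ouMeanDeriv i j F x s = ouMeanDeriv i j E x s + ε := by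
    intro x s hs hx
    have hq := contr_pos s
    have hq1 := contr_le_one s
    have hp : 100 * ‖contr s • x‖ ≤ N := by
      rw [norm_smul, Real.norm_of_nonneg hq.le]
      nlinarith [norm_nonneg x]
    obtain ⟨i1, b1⟩ := hfar' (contr s • x) (contr s * s) (mul_pos hq hs) (contr_mul_sq_le s) hp
    obtain ⟨i2, -⟩ := hE.integral_le hA hα hα1 hEc hGc hI (integral_gauss₂ i j)
      (integrable_gauss₂ i j) (contr s • x) (mul_pos hq hs) (contr_mul_le s)
    refine ⟨s⁻¹ * contr s * ∫ z, (F (contr s • x + (contr s * s) • z) -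
      E (contr s • x + (contr s * s) • z)) * gauss₂ i j z, ?_, ?_⟩
    · rw [abs_mul, abs_of_pos (by positivity)]
      calc _ ≤ s⁻¹ * contr s * (C2 * B * (contr s * s) ^ 2 * (N ^ 2)⁻¹) := by gcongr
        _ = contr s ^ 3 * (C2 * B * (N ^ 2)⁻¹ * s) := by field_simp
        _ ≤ 1 * (C2 * B * (N ^ 2)⁻¹ * s) := by
          gcongr; exact pow_le_one₀ hq.le hq1
        _ = _ := one_mul _
    · rw [ouMeanDeriv, ouMeanDeriv, ← mul_add, ← integral_add i2 i1]
      congr 2; funext z; ring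
  have hqw : ∀ x s, x ≠ 0 → 0 < s → contr s ^ (1 + α) * wt α (contr s • x) ≤ ‖x‖ ^ (-1 - α) :=
    fun x s hx _ => rpow_mul_wt_le hα (contr_pos s) hx
  have hexp : ∀ s, 0 < s → ∀ X, s⁻¹ * contr s * (X * (contr s * s) ^ α) =
      X * (contr s ^ (1 + α) * s ^ (α - 1)) := by
    intro s hs X
    have hq := contr_pos s
    rw [Real.mul_rpow hq.le hs.le, Real.rpow_add hq, Real.rpow_one, Real.rpow_sub_one hs.ne']
    field_simp
  have hmain : ∀ x s, 0 < s → |ouMeanDeriv i j E x s| ≤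
      16 * A * I * (wt α (contr s • x) * contr s ^ (1 + α)) * s ^ (α - 1) := by
    intro x s hs
    have hq := contr_pos s
    obtain ⟨-, b2⟩ := hE.integral_le hA hα hα1 hEc hGc hI (integral_gauss₂ i j)
      (integrable_gauss₂ i j) (contr s • x) (mul_pos hq hs) (contr_mul_le s)
    rw [ouMeanDeriv, abs_mul, abs_of_pos (by positivity)]
    calc _ ≤ s⁻¹ * contr s * (16 * A * wt α (contr s • x) * (contr s * s) ^ α * I) := by gcongr
      _ = s⁻¹ * contr s * ((16 * A * wt α (contr s • x) * I) * (contr s * s) ^ α) := by ring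
      _ = _ := by rw [hexp s hs]; ring
  have hεle : ∀ s, 0 < s → C2 * B * (N ^ 2)⁻¹ * s ≤ (64 * I + 16 * C1 + 2 * C2) * B * (N ^ 2)⁻¹ * s := by
    intro s hs
    gcongr
    linarith
  refine ⟨fun x s hx hs hxN => ?_, fun x x' s hx hs hxN hxN' hxx => ?_⟩
  · obtain ⟨ε, hε, he⟩ := split x s hs hxN
    have hq := contr_pos s
    have hε' := hε.trans (hεle s hs)
    have hadd : |ouMeanDeriv i j F x s| ≤ |ouMeanDeriv i j E x s| + |ε| := by
      rw [he]; exact abs_add_le _ _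
    have hs1 : 0 < s ^ (α - 1) := Real.rpow_pos_of_pos hs _
    constructor
    · refine hadd.trans (add_le_add ((hmain x s hs).trans ?_) hε')
      have h1 := hqw x s hx hs
      have h2 : 0 ≤ ‖x‖ ^ (-1 - α) := by positivity
      calc _ ≤ 16 * A * I * (‖x‖ ^ (-1 - α)) * s ^ (α - 1) := by
            gcongr; rwa [mul_comm]
        _ = (16 * I) * (A * ‖x‖ ^ (-1 - α) * s ^ (α - 1)) := by ring
        _ ≤ (64 * I + 16 * C1 + 2 * C2) * (A * ‖x‖ ^ (-1 - α) * s ^ (α - 1)) := by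
            gcongr; linarith
        _ = _ := by ring
    · refine hadd.trans (add_le_add ((hmain x s hs).trans ?_) hε')
      -- For large scales the weight is bounded by `1` and the contraction itself decays: `q ^ (1+α)
      -- s ^ (α-1) ≤ 4 s ^ (-2)`. This bound does not degenerate in `x`.
      have h1 : contr s ≤ 2 / s := by
        rw [le_div_iff₀ hs]; exact contr_mul_le s
      have h2 : contr s ^ (1 + α) * s ^ (α - 1) ≤ 4 * s ^ (-2 : ℝ) := by
        calc _ ≤ (2 / s) ^ (1 + α) * s ^ (α - 1) := by gcongr
          _ = 2 ^ (1 + α) * s ^ (-2 : ℝ) := by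
            rw [Real.div_rpow (by norm_num) hs.le, div_eq_mul_inv, ← Real.rpow_neg hs.le, mul_assoc,
              ← Real.rpow_add hs]
            ring_nf
          _ ≤ 2 ^ (2 : ℝ) * s ^ (-2 : ℝ) := by
            gcongr
            · norm_num
            · linarith
          _ = _ := by norm_num
      calc _ = 16 * A * I * wt α (contr s • x) * (contr s ^ (1 + α) * s ^ (α - 1)) := by ring
        _ ≤ 16 * A * I * 1 * (4 * s ^ (-2 : ℝ)) := by
            gcongr
            exact wt_le_one hα _
        _ = (64 * I) * (A * s ^ (-2 : ℝ)) := by ring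
        _ ≤ (64 * I + 16 * C1 + 2 * C2) * (A * s ^ (-2 : ℝ)) := by
            gcongr; linarith
        _ = _ := by ring
  · obtain ⟨ε, hε, he⟩ := split x s hs hxN
    obtain ⟨ε', hε', he'⟩ := split x' s hs hxN'
    have hq := contr_pos s
    -- Moving the centre from `x` to `x'` amounts to translating the kernel by `a`. The difference
    -- of kernels again has mean zero, and its weighted mass is at most a constant times `‖a‖ =
    -- |x-x'| / s`.
    set a : Plane := s⁻¹ • (x' - x) with ha
    have ha' : ‖a‖ = s⁻¹ * ‖x - x'‖ := by
      rw [ha, norm_smul, norm_inv, Real.norm_of_nonneg hs.le, norm_sub_rev]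
    have ha1 : ‖a‖ ≤ 1 := by rw [ha', inv_mul_le_one₀ hs]; exact hxx
    obtain ⟨i3, b3⟩ := hshift a ha1
    have hiG : Integrable fun z => gauss₂ i j (z - a) := (integrable_gauss₂ i j).comp_sub_right a
    have h0 : ∫ z, (gauss₂ i j z - gauss₂ i j (z - a)) = 0 := by
      rw [integral_sub (integrable_gauss₂ i j) hiG, integral_sub_right_eq_self (gauss₂ i j) a,
        integral_gauss₂, sub_zero]
    obtain ⟨i4, b4⟩ := hE.integral_le hA hα hα1 hEc (κ := fun z => gauss₂ i j z - gauss₂ i j (z - a))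
      (hGc.sub (hGc.comp (by fun_prop))) i3 h0 ((integrable_gauss₂ i j).sub hiG) (contr s • x)
      (mul_pos hq hs) (contr_mul_le s)
    obtain ⟨i5, -⟩ := hE.integral_le hA hα hα1 hEc hGc hI (integral_gauss₂ i j)
      (integrable_gauss₂ i j) (contr s • x) (mul_pos hq hs) (contr_mul_le s)
    have e1 : ∫ z, E (contr s • x' + (contr s * s) • z) * gauss₂ i j z =
        ∫ z, E (contr s • x + (contr s * s) • z) * gauss₂ i j (z - a) := by
      rw [← integral_sub_right_eq_self (fun z => E (contr s • x' + (contr s * s) • z) *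
        gauss₂ i j z) a]
      congr 1; funext z
      congr 2
      rw [ha, smul_sub (contr s * s) z, smul_smul, mul_assoc, mul_inv_cancel₀ hs.ne', mul_one]
      module
    have e2 : ouMeanDeriv i j E x s - ouMeanDeriv i j E x' s = s⁻¹ * contr s *
        ∫ z, E (contr s • x + (contr s * s) • z) * (gauss₂ i j z - gauss₂ i j (z - a)) := by
      have i6 : Integrable fun z => E (contr s • x + (contr s * s) • z) * gauss₂ i j (z - a) := by
        refine (i5.sub i4).congr (Eventually.of_forall fun z => ?_)
        simp only [Pi.sub_apply]; ring
      rw [ouMeanDeriv, ouMeanDeriv, e1, ← mul_sub, ← integral_sub i5 i6]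
      congr 2; funext z; ring
    have b5 : |ouMeanDeriv i j E x s - ouMeanDeriv i j E x' s| ≤
        16 * C1 * (A * ‖x‖ ^ (-1 - α) * ‖x - x'‖ * s ^ (α - 2)) := by
      rw [e2, abs_mul, abs_of_pos (by positivity)]
      have hw := (wt_pos α (contr s • x)).le
      calc _ ≤ s⁻¹ * contr s * (16 * A * wt α (contr s • x) * (contr s * s) ^ α * (C1 * ‖a‖)) := by
            gcongr
            exact b4.trans (by gcongr)
        _ = s⁻¹ * contr s * ((16 * A * wt α (contr s • x) * (C1 * ‖a‖)) * (contr s * s) ^ α) := by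
            ring
        _ = 16 * A * C1 * ‖x - x'‖ * (contr s ^ (1 + α) * wt α (contr s • x)) *
              (s⁻¹ * s ^ (α - 1)) := by
            rw [hexp s hs, ha']; ring
        _ ≤ 16 * A * C1 * ‖x - x'‖ * ‖x‖ ^ (-1 - α) * (s⁻¹ * s ^ (α - 1)) := by
            gcongr
            exact hqw x s hx hs
        _ = _ := by
            rw [show s⁻¹ * s ^ (α - 1) = s ^ (α - 2) by
              rw [show α - 2 = α - 1 - 1 by ring, Real.rpow_sub_one hs.ne' (α - 1)]; field_simp]
            ring
    have e3 : ouMeanDeriv i j F x s - ouMeanDeriv i j F x' s =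
        (ouMeanDeriv i j E x s - ouMeanDeriv i j E x' s) + (ε - ε') := by rw [he, he']; ring
    rw [e3]
    refine (abs_add_le _ _).trans (add_le_add (b5.trans ?_) ((abs_sub _ _).trans ?_))
    · rw [show ∀ K : ℝ, K * A * ‖x‖ ^ (-1 - α) * ‖x - x'‖ * s ^ (α - 2) =
        K * (A * ‖x‖ ^ (-1 - α) * ‖x - x'‖ * s ^ (α - 2)) by intro K; ring]
      gcongr
      linarith
    · calc |ε| + |ε'| ≤ (2 * C2) * (B * (N ^ 2)⁻¹ * s) := by linarith
        _ ≤ (64 * I + 16 * C1 + 2 * C2) * (B * (N ^ 2)⁻¹ * s) := by gcongr; linarith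
        _ = _ := by ring

/-! ### Integration over all scales: the whole-plane estimate -/

lemma exists_ge_mul_inv_sq_le (N₀ Q : ℝ) {η : ℝ} (hη : 0 < η) :
    ∃ N : ℝ, N₀ ≤ N ∧ Q * (N ^ 2)⁻¹ ≤ η := by
  have h : Tendsto (fun N : ℝ => Q * (N ^ 2)⁻¹) atTop (𝓝 (Q * 0)) :=
    ((tendsto_inv_atTop_zero.comp (tendsto_pow_atTop two_ne_zero)).const_mul Q)
  rw [mul_zero] at h
  obtain ⟨N, h1, h2⟩ := ((eventually_ge_atTop N₀).and (h.eventually (gt_mem_nhds hη))).exists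
  exact ⟨N, h1, h2.le⟩

lemma exists_ge_mul_div_sq_le (S₀ Q : ℝ) {η : ℝ} (hη : 0 < η) :
    ∃ S : ℝ, S₀ ≤ S ∧ Q * ((1 + S) / S ^ 2) ≤ η := by
  have h1 : Tendsto (fun S : ℝ => (S⁻¹ + 1) * S⁻¹) atTop (𝓝 ((0 + 1) * 0)) :=
    (tendsto_inv_atTop_zero.add_const 1).mul tendsto_inv_atTop_zero
  have h : Tendsto (fun S : ℝ => Q * ((1 + S) / S ^ 2)) atTop (𝓝 (Q * 0)) := by
    refine Tendsto.const_mul Q ?_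
    rw [mul_zero] at h1
    refine h1.congr' ?_
    filter_upwards [eventually_gt_atTop 0] with S hS
    field_simp
  rw [mul_zero] at h
  obtain ⟨S, h1, h2⟩ := ((eventually_ge_atTop S₀).and (h.eventually (gt_mem_nhds hη))).exists
  exact ⟨S, h1, h2.le⟩

/-- If the two points are not close relative to either norm, the pointwise bound suffices: `|y|⁻¹ =
|y| ^ (-1-α) |y| ^ α`, and `|y| < 2 |x-x'|` for both points. -/
lemma weighted_holder_of_local {α k : ℝ} {D : Plane → ℝ} (hα : 0 < α) (hα1 : α < 1) (hk : 0 ≤ k)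
    (hfirst : ∀ x, x ≠ 0 → |D x| ≤ k * ‖x‖⁻¹)
    (hnear : ∀ x x', x ≠ 0 → x ≠ x' → ‖x - x'‖ ≤ ‖x‖ / 2 →
      |D x - D x'| ≤ k * ‖x‖ ^ (-1 - α) * ‖x - x'‖ ^ α) (x x' : Plane) (hx : x ≠ 0) (hx' : x' ≠ 0) :
    |D x - D x'| ≤ 4 * k * (‖x‖ ^ (-1 - α) + ‖x'‖ ^ (-1 - α)) * ‖x - x'‖ ^ α := by
  rcases eq_or_ne x x' with rfl | hxx'
  · rw [sub_self, abs_zero]; positivity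
  have hδ : 0 < ‖x - x'‖ := norm_pos_iff.2 (sub_ne_zero.2 hxx')
  have a1 : 0 ≤ k * ‖x‖ ^ (-1 - α) * ‖x - x'‖ ^ α := by positivity
  have a2 : 0 ≤ k * ‖x'‖ ^ (-1 - α) * ‖x - x'‖ ^ α := by positivity
  have e : 4 * k * (‖x‖ ^ (-1 - α) + ‖x'‖ ^ (-1 - α)) * ‖x - x'‖ ^ α =
      4 * (k * ‖x‖ ^ (-1 - α) * ‖x - x'‖ ^ α) + 4 * (k * ‖x'‖ ^ (-1 - α) * ‖x - x'‖ ^ α) := by ring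
  rw [e]
  by_cases h1 : ‖x - x'‖ ≤ ‖x‖ / 2
  · have := hnear x x' hx hxx' h1
    linarith
  by_cases h2 : ‖x - x'‖ ≤ ‖x'‖ / 2
  · rw [abs_sub_comm]
    have := hnear x' x hx' hxx'.symm (by rwa [norm_sub_rev])
    rw [norm_sub_rev x' x] at this
    linarith
  rw [not_le] at h1 h2
  have key : ∀ y : Plane, y ≠ 0 → ‖y‖ / 2 < ‖x - x'‖ → |D y| ≤
      2 * (k * ‖y‖ ^ (-1 - α) * ‖x - x'‖ ^ α) := by
    intro y hy hyx
    have hy0 : 0 < ‖y‖ := norm_pos_iff.2 hy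
    have e1 : ‖y‖⁻¹ = ‖y‖ ^ (-1 - α) * ‖y‖ ^ α := by
      rw [← Real.rpow_add hy0, show -1 - α + α = -1 by ring, Real.rpow_neg_one]
    have e2 : ‖y‖ ^ α ≤ 2 * ‖x - x'‖ ^ α := by
      calc ‖y‖ ^ α ≤ (2 * ‖x - x'‖) ^ α := by gcongr; linarith
        _ = 2 ^ α * ‖x - x'‖ ^ α := Real.mul_rpow (by norm_num) hδ.le
        _ ≤ 2 ^ (1 : ℝ) * ‖x - x'‖ ^ α := by
          gcongr
          norm_num
        _ = _ := by rw [Real.rpow_one]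
    refine (hfirst y hy).trans ?_
    rw [e1]
    calc _ ≤ k * (‖y‖ ^ (-1 - α) * (2 * ‖x - x'‖ ^ α)) := by gcongr
      _ = _ := by ring
  have := key x hx h1
  have := key x' hx' h2
  have := abs_sub (D x) (D x')
  linarith

/-- Weighted Hölder estimate for the second derivatives of a solution on the whole plane. -/
theorem exists_far_estimate {α : ℝ} (hα : 0 < α) (hα1 : α < 1) (i j : Fin 2) :
    ∃ C : ℝ, 0 < C ∧ ∀ (v : Plane → ℝ) (A B : ℝ), 0 ≤ A → 0 ≤ B → ContDiff ℝ 2 v →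
      HomHolder α A (ou v) →
      (∀ x, |v x| ≤ B * Real.exp (3 / 16 * ‖x‖ ^ 2)) →
      (∀ i x, |pd i v x| ≤ B * Real.exp (3 / 16 * ‖x‖ ^ 2)) →
      (∀ x, |ou v x| ≤ B * Real.exp (3 / 16 * ‖x‖ ^ 2)) →
      (∀ x, x ≠ 0 → |pd j (pd i v) x| ≤ C * A * ‖x‖⁻¹) ∧
      ∀ x x', x ≠ 0 → x' ≠ 0 → |pd j (pd i v) x - pd j (pd i v) x'| ≤
        C * A * (‖x‖ ^ (-1 - α) + ‖x'‖ ^ (-1 - α)) * ‖x - x'‖ ^ α := by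
  obtain ⟨K, hK, hKd⟩ := exists_ouMeanDeriv_le hα hα1 i j
  obtain ⟨K2, hK2, hKm⟩ := exists_ouMean_le i j
  set g := ∫ z, gauss z with hg
  have hg0 : 0 < g := integral_gauss_pos
  have hα1' : 0 < 1 - α := by linarith
  set c := 1 / α + 1 / (1 - α) with hc
  have hc0 : 0 < c := by positivity
  have hc1 : 1 ≤ c := by
    have : 1 ≤ 1 / α := by rw [le_div_iff₀ hα]; linarith
    have : 0 ≤ 1 / (1 - α) := by positivity
    linarith
  have hαc : 1 / α ≤ c := by
    have : 0 ≤ 1 / (1 - α) := by positivity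
    linarith
  -- `5 K` comes from the difference estimate, `c` from integrating the two powers of `s`, `g`
  -- normalises the Gaussian, and `4` comes from `weighted_holder_of_local`.
  refine ⟨5 * K * c / g * 4, by positivity, fun v A B hA hB hv hE hv0 hv1 hv2 => ?_⟩
  obtain ⟨B', hB', happ⟩ := exists_cutoff_approx hv hB hv0 hv1 hv2
  set D := pd j (pd i v) with hD
  have happ' : ∀ N : ℝ, 1 ≤ N → ∃ w : Plane → ℝ, (∀ x s, 0 < s →
      HasDerivAt (ouMean i j w x) (ouMeanDeriv i j (ou w) x s) s) ∧
      (∀ x, ‖x‖ < N → Tendsto (ouMean i j w x) (𝓝[>] 0) (𝓝 (D x * g))) ∧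
      (∀ x s, 0 < s → |ouMean i j w x s| ≤ K2 * B * Real.exp (3 * ‖x‖ ^ 2) * ((1 + s) / s ^ 2)) ∧
      Continuous (ou w) ∧ (∀ y, ‖y‖ < N → ou w y - ou v y = 0) ∧
      ∀ x, |ou w x - ou v x| ≤ B' * Real.exp (3 / 16 * ‖x‖ ^ 2) := by
    intro N hN
    obtain ⟨w, hw, hwc, hwv, hw0, hw1⟩ := happ N hN
    refine ⟨w, fun x s hs => hasDerivAt_ouMean hw hwc x hs i j, fun x hx => ?_,
      fun x s hs => hKm w B hB hw0 x s hs, continuous_ou hw, fun y hy => ?_, hw1⟩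
    · have := tendsto_ouMean hw hwc x i j
      rwa [pd_congr (pd_eventuallyEq (hwv x hx) i)] at this
    · rw [ou_congr (hwv y hy), sub_self]
  -- The far error grows linearly in `s`. On `(0, S]` it is dominated by any power `s ^ n` with `n ≤
  -- 1` times a constant depending on `S`, so it fits into the same comparison lemmas.
  have hpow : ∀ {s S : ℝ} (n : ℝ), 0 < s → s ≤ S → n ≤ 1 → s ≤ S ^ (1 - n) * s ^ n := by
    intro s S n hs hsS hn
    calc s = s ^ (1 - n) * s ^ n := by rw [← Real.rpow_add hs]; simp
      _ ≤ S ^ (1 - n) * s ^ n := by gcongr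
  have hfirst : ∀ x, x ≠ 0 → |D x| ≤ (2 * K * c / g) * A * ‖x‖⁻¹ := by
    intro x hx
    have hr : 0 < ‖x‖ := norm_pos_iff.2 hx
    set r := ‖x‖ with hrdef
    have hgoal : |D x| * g ≤ 2 * K * c * A * r⁻¹ := by
      refine le_of_forall_pos_le_add fun η hη => ?_
      -- Order of choices: first `S`, so large that the mean at scale `S` is negligible uniformly in
      -- the cutoff; then the cutoff radius `N`, depending on `S`, to make the far error negligible
      -- on `(0, S]`.
      obtain ⟨S, hrS, hS⟩ := exists_ge_mul_div_sq_le r (K2 * B * Real.exp (3 * r ^ 2)) (half_pos hη)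
      have hS0 : 0 < S := hr.trans_le hrS
      set Q := K * B' * (S ^ (1 - (α - 1)) * r ^ α / α + S ^ (1 - (-2 : ℝ)) * r⁻¹) with hQ
      obtain ⟨N, hN0, hN⟩ := exists_ge_mul_inv_sq_le (max 1 (100 * r)) Q (half_pos hη)
      have hN1 : 1 ≤ N := (le_max_left _ _).trans hN0
      have hN2 : 100 * r ≤ N := (le_max_right _ _).trans hN0
      obtain ⟨w, hd, hl, hm, hwc, hw0, hw1⟩ := happ' N hN1
      obtain ⟨hb, -⟩ := hKd (ou v) (ou w) A B' N hA hB' (by linarith) (continuous_ou hv) hwc hE hw0 hw1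
      set ε := K * B' * (N ^ 2)⁻¹ with hε
      have hε0 : 0 ≤ ε := by positivity
      have h1 := abs_sub_le_of_deriv_le_rpow (N := ouMean i j w x) (L := D x * g)
        (K := K * A * r ^ (-1 - α) + ε * S ^ (1 - (α - 1))) hα hr (by positivity)
        (fun s hs _ => hd x s hs) (fun s hs hsr => (hb x s hx hs hN2).1.trans (by
          have := hpow (α - 1) hs (hsr.trans hrS) (by linarith)
          have := mul_le_mul_of_nonneg_left this hε0
          rw [add_mul]
          linarith)) (hl x (by linarith))
      -- With `β = 0` the bound `s ^ (-2)` integrates from `r` to infinity as `r⁻¹`, the same power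
      -- that `r ^ (-1-α) s ^ (α-1)` yields below `r`.
      have h2 := abs_sub_le_of_deriv_le_rpow_sub (N := ouMean i j w x) (β := 0)
        (K := K * A + ε * S ^ (1 - (-2 : ℝ))) zero_lt_one hr hrS (by positivity)
        (fun s hs _ => hd x s (hr.trans_le hs)) (fun s hs hsS => (hb x s hx (hr.trans_le hs)
          hN2).2.trans (by
          have := hpow (-2) (hr.trans_le hs) hsS (by norm_num)
          have := mul_le_mul_of_nonneg_left this hε0
          rw [add_mul, zero_sub]
          linarith))
      have h3 := hm x S hS0
      have e1 : r ^ (-1 - α) * r ^ α = r⁻¹ := by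
        rw [← Real.rpow_add hr, show -1 - α + α = -1 by ring, Real.rpow_neg_one]
      have e2 : (K * A * r ^ (-1 - α) + ε * S ^ (1 - (α - 1))) * r ^ α / α =
          K * A * r⁻¹ * (1 / α) + ε * (S ^ (1 - (α - 1)) * r ^ α / α) := by
        rw [← e1]; ring
      have e3 : (K * A + ε * S ^ (1 - (-2 : ℝ))) * r ^ ((0 : ℝ) - 1) / (1 - 0) =
          K * A * r⁻¹ + ε * (S ^ (1 - (-2 : ℝ)) * r⁻¹) := by
        rw [zero_sub, Real.rpow_neg_one]; ring
      rw [e2] at h1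
      rw [e3] at h2
      have h4 : ε * (S ^ (1 - (α - 1)) * r ^ α / α) + ε * (S ^ (1 - (-2 : ℝ)) * r⁻¹) ≤ η / 2 := by
        refine le_trans (le_of_eq ?_) hN
        rw [hQ, hε]; ring
      have h5 : |D x * g| ≤ |ouMean i j w x r - D x * g| + |ouMean i j w x S - ouMean i j w x r| +
          |ouMean i j w x S| := by
        have := abs_sub_abs_le_abs_sub (D x * g) (ouMean i j w x r)
        have := abs_sub_abs_le_abs_sub (ouMean i j w x r) (ouMean i j w x S)
        rw [abs_sub_comm] at this
        rw [abs_sub_comm (ouMean i j w x r)]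
        linarith
      rw [abs_mul, abs_of_pos hg0] at h5
      have h6 : K * A * r⁻¹ * (1 / α) ≤ K * A * r⁻¹ * c := by gcongr
      have h7 : K * A * r⁻¹ * 1 ≤ K * A * r⁻¹ * c := by gcongr
      linarith
    rw [show 2 * K * c / g * A * r⁻¹ = 2 * K * c * A * r⁻¹ / g by ring, le_div_iff₀ hg0]
    exact hgoal
  have hnear : ∀ x x', x ≠ 0 → x ≠ x' → ‖x - x'‖ ≤ ‖x‖ / 2 → |D x - D x'| ≤
      (5 * K * c / g) * A * ‖x‖ ^ (-1 - α) * ‖x - x'‖ ^ α := by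
    intro x x' hx hxx' hle
    have hr : 0 < ‖x‖ := norm_pos_iff.2 hx
    have hr' : ‖x‖ / 2 ≤ ‖x'‖ := by
      have := norm_sub_norm_le x x'
      linarith
    have hx' : x' ≠ 0 := norm_pos_iff.1 (by linarith)
    have hδ : 0 < ‖x - x'‖ := norm_pos_iff.2 (sub_ne_zero.2 hxx')
    set r := ‖x‖ with hrdef
    set δ := ‖x - x'‖ with hδdef
    have hrr : ‖x'‖ ^ (-1 - α) ≤ 4 * r ^ (-1 - α) := by
      calc ‖x'‖ ^ (-1 - α) ≤ (r / 2) ^ (-1 - α) :=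
            Real.rpow_le_rpow_of_nonpos (by positivity) hr' (by linarith)
        _ = 2 ^ (1 + α) * r ^ (-1 - α) := by
            rw [Real.div_rpow hr.le (by norm_num), div_eq_mul_inv, ← Real.rpow_neg (by norm_num),
              mul_comm]
            ring_nf
        _ ≤ 2 ^ (2 : ℝ) * r ^ (-1 - α) := by
            gcongr
            · norm_num
            · linarith
        _ = _ := by norm_num
    have hgoal : |D x - D x'| * g ≤ 5 * K * c * A * r ^ (-1 - α) * δ ^ α := by
      refine le_of_forall_pos_le_add fun η hη => ?_
      obtain ⟨S, hrS, hS⟩ := exists_ge_mul_div_sq_le r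
        (K2 * B * (Real.exp (3 * r ^ 2) + Real.exp (3 * ‖x'‖ ^ 2))) (half_pos hη)
      have hS0 : 0 < S := hr.trans_le hrS
      set Q := K * B' * ((2 * S ^ (1 - (α - 1)) + δ⁻¹ * S ^ (1 - (α - 2))) * c * δ ^ α) with hQ
      obtain ⟨N, hN0, hN⟩ := exists_ge_mul_inv_sq_le (max 1 (100 * (r + ‖x'‖))) Q (half_pos hη)
      have hN1 : 1 ≤ N := (le_max_left _ _).trans hN0
      have hN2' : 100 * (r + ‖x'‖) ≤ N := (le_max_right _ _).trans hN0
      have hN2 : 100 * r ≤ N := by linarith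
      have hN3 : 100 * ‖x'‖ ≤ N := by linarith
      obtain ⟨w, hd, hl, hm, hwc, hw0, hw1⟩ := happ' N hN1
      obtain ⟨hb, hb2⟩ := hKd (ou v) (ou w) A B' N hA hB' (by linarith) (continuous_ou hv) hwc hE
        hw0 hw1
      set ε := K * B' * (N ^ 2)⁻¹ with hε
      have hε0 : 0 ≤ ε := by positivity
      -- `5 = 1 + 4`, the `4` being the cost of replacing the weight at `x'` by that at `x`. The
      -- factor `δ⁻¹` offsets the `δ` that the lemma puts in front of `s ^ (α-2)`.
      have h1 := abs_sub_le_of_deriv_le_min (N := fun s => ouMean i j w x s - ouMean i j w x' s)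
        (L := D x * g - D x' * g) (T := S)
        (K := 5 * K * A * r ^ (-1 - α) + ε * (2 * S ^ (1 - (α - 1)) + δ⁻¹ * S ^ (1 - (α - 2))))
        hα hα1 hδ (by linarith) (by positivity)
        (fun s hs _ => (hd x s hs).sub (hd x' s hs)) (fun s hs hsδ => by
          have b1 := (hb x s hx hs hN2).1
          have b2 := (hb x' s hx' hs hN3).1
          have b3 := hpow (α - 1) hs (show s ≤ S by linarith) (by linarith)
          have b4 := mul_le_mul_of_nonneg_left b3 hε0
          have hsα : 0 ≤ s ^ (α - 1) := by positivity
          have b5 : K * A * ‖x'‖ ^ (-1 - α) * s ^ (α - 1) ≤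
              K * A * (4 * r ^ (-1 - α)) * s ^ (α - 1) := by gcongr
          have b6 : 0 ≤ ε * (δ⁻¹ * S ^ (1 - (α - 2))) * s ^ (α - 1) := by positivity
          refine (abs_sub _ _).trans ?_
          nlinarith) (fun s hs hsS => by
          have hs0 := hδ.trans_le hs
          have b1 := hb2 x x' s hx hs0 hN2 hN3 hs
          have b3 := hpow (α - 2) hs0 hsS (by linarith)
          have b4 := mul_le_mul_of_nonneg_left b3 hε0
          have b6 : 0 ≤ ε * (2 * S ^ (1 - (α - 1))) * δ * s ^ (α - 2) := by positivity
          have b7 : 0 ≤ K * A * r ^ (-1 - α) * δ * s ^ (α - 2) := by positivity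
          refine b1.trans ?_
          have e : (5 * K * A * r ^ (-1 - α) + ε * (2 * S ^ (1 - (α - 1)) +
              δ⁻¹ * S ^ (1 - (α - 2)))) * δ * s ^ (α - 2) =
              5 * (K * A * r ^ (-1 - α) * δ * s ^ (α - 2)) +
              ε * (2 * S ^ (1 - (α - 1))) * δ * s ^ (α - 2) +
              ε * (S ^ (1 - (α - 2)) * s ^ (α - 2)) * (δ⁻¹ * δ) := by ring
          rw [e, inv_mul_cancel₀ hδ.ne']
          linarith) ((hl x (by linarith)).sub (hl x' (by linarith [norm_nonneg x'])))
      have h3 := hm x S hS0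
      have h3' := hm x' S hS0
      have h4 : ε * ((2 * S ^ (1 - (α - 1)) + δ⁻¹ * S ^ (1 - (α - 2))) * c * δ ^ α) ≤ η / 2 := by
        refine le_trans (le_of_eq ?_) hN
        rw [hQ, hε]; ring
      have h5 : |D x * g - D x' * g| ≤ |(ouMean i j w x S - ouMean i j w x' S) -
          (D x * g - D x' * g)| + (|ouMean i j w x S| + |ouMean i j w x' S|) := by
        have a1 := abs_sub_abs_le_abs_sub (D x * g - D x' * g)
          (ouMean i j w x S - ouMean i j w x' S)
        have a2 := abs_sub (ouMean i j w x S) (ouMean i j w x' S)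
        rw [abs_sub_comm (D x * g - D x' * g)] at a1
        linarith
      rw [← sub_mul, abs_mul, abs_of_pos hg0] at h5
      rw [← sub_mul] at h1
      rw [← hc] at h1
      have h6 : K2 * B * (Real.exp (3 * r ^ 2) + Real.exp (3 * ‖x'‖ ^ 2)) * ((1 + S) / S ^ 2) =
          K2 * B * Real.exp (3 * r ^ 2) * ((1 + S) / S ^ 2) +
          K2 * B * Real.exp (3 * ‖x'‖ ^ 2) * ((1 + S) / S ^ 2) := by ring
      have h7 : (5 * K * A * r ^ (-1 - α) + ε * (2 * S ^ (1 - (α - 1)) +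
          δ⁻¹ * S ^ (1 - (α - 2)))) * c * δ ^ α = 5 * K * c * A * r ^ (-1 - α) * δ ^ α +
          ε * ((2 * S ^ (1 - (α - 1)) + δ⁻¹ * S ^ (1 - (α - 2))) * c * δ ^ α) := by ring
      linarith
    rw [show 5 * K * c / g * A * r ^ (-1 - α) * δ ^ α = 5 * K * c * A * r ^ (-1 - α) * δ ^ α / g by
      ring, le_div_iff₀ hg0]
    exact hgoal
  have hk : 0 ≤ 5 * K * c / g * A := by positivity
  have hfirst' : ∀ x, x ≠ 0 → |D x| ≤ (5 * K * c / g * A) * ‖x‖⁻¹ := by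
    intro x hx
    refine (hfirst x hx).trans ?_
    gcongr
    norm_num
  refine ⟨fun x hx => (hfirst' x hx).trans ?_, fun x x' hx hx' => ?_⟩
  · gcongr
    exact le_mul_of_one_le_right (by positivity) (by norm_num)
  · refine (weighted_holder_of_local hα hα1 hk hfirst' hnear x x' hx hx').trans (le_of_eq ?_)
    ring

/-! ### Interior bounds at unit scale -/

lemma abs_integral_mul_le {h κ : Plane → ℝ} {m : ℝ} (hκ : Continuous κ)
    (hκs : tsupport κ ⊆ Metric.closedBall 0 1) (hm : ∀ z ∈ Metric.closedBall (0 : Plane) 1, |h z| ≤ m) :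
    |∫ z, h z * κ z| ≤ m * ∫ z, |κ z| := by
  have hi : Integrable κ := hκ.integrable_of_hasCompactSupport (hasCompactSupport_of_tsupport hκs)
  rw [← integral_const_mul, ← Real.norm_eq_abs]
  refine norm_integral_le_of_norm_le (hi.abs.const_mul m) (Eventually.of_forall fun z => ?_)
  rw [norm_mul, Real.norm_eq_abs, Real.norm_eq_abs]
  by_cases hz : z ∈ tsupport κ
  · gcongr
    exact hm z (hκs hz)
  · simp [image_eq_zero_of_notMem_tsupport hz]

lemma add_smul_mem_closedBall {x z : Plane} {s T : ℝ} (hs : 0 ≤ s) (hsT : s ≤ T)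
    (hz : z ∈ Metric.closedBall (0 : Plane) 1) : x + s • z ∈ Metric.closedBall x T := by
  rw [mem_closedBall_zero_iff] at hz
  simp only [Metric.mem_closedBall, dist_eq_norm, add_sub_cancel_left, norm_smul,
    Real.norm_of_nonneg hs]
  nlinarith [norm_nonneg z]

/-- Gradient bound for a weak solution of Poisson's equation. -/
lemma exists_gradient_bound : ∃ C : ℝ, 0 < C ∧ ∀ (u f : Plane → ℝ) (U : Set Plane) (x : Plane)
    (m : ℝ), Continuous u → WeakLap u f → IsOpen U → x ∈ U → ContDiffOn ℝ 1 u U → 0 ≤ m →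
    (∀ y ∈ Metric.closedBall x 1, |u y| ≤ m) → (∀ y ∈ Metric.closedBall x 1, |f y| ≤ m) →
    ∀ k, |pd k u x| ≤ C * m := by
  obtain ⟨φ, ψ, hp, hφs, hψs, hc⟩ := exists_mollifier
  set c := ∫ z, φ z
  have hφ := hp.smooth_left
  have hψ := hp.smooth_right
  set J := (∑ k, ∫ z, |pd k φ z|) + ∑ k, ∫ z, |pd k ψ z| with hJ
  have hnn : ∀ (h : Plane → ℝ) k, 0 ≤ ∫ z, |pd k h z| := fun h k => integral_nonneg fun z => abs_nonneg _
  have hJ0 : 0 ≤ J := add_nonneg (Finset.sum_nonneg fun k _ => hnn φ k)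
    (Finset.sum_nonneg fun k _ => hnn ψ k)
  refine ⟨(J + 1) / c, by positivity, fun u f U x m hu hw hU hx hu1 hm hum hfm k => ?_⟩
  have hφk := (tsupport_pd_subset k φ).trans hφs
  have hψk := (tsupport_pd_subset k ψ).trans hψs
  have h1 := abs_sub_le_of_deriv_le_rpow (N := smean 1 (pd k φ) u x) (β := 1) (T := 1)
    (K := m * ∫ z, |pd k ψ z|) one_pos one_pos (mul_nonneg hm (hnn ψ k))
    (fun s hs _ => hasDerivAt_smean (hp.pd k) hφk hψk hu hw x hs) (fun s hs hs1 => by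
      have := abs_integral_mul_le (contDiff_infty_pd hψ k).continuous hψk
        (h := fun z => f (x + s • z)) (m := m) fun z hz => hfm _ (add_smul_mem_closedBall hs.le hs1 hz)
      simpa [hs.ne'] using this)
    (tendsto_smean_one hU hx hu1 hφ hφs k)
  have h2 : |smean 1 (pd k φ) u x 1| ≤ m * ∫ z, |pd k φ z| := by
    have := abs_integral_mul_le (contDiff_infty_pd hφ k).continuous hφk
        (h := fun z => u (x + (1 : ℝ) • z)) (m := m)
        fun z hz => hum _ (add_smul_mem_closedBall zero_le_one le_rfl hz)
    simpa [smean] using this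
  have h3 : |pd k u x| * c ≤ J * m := by
    have a1 : |pd k u x| * c = |-(pd k u x * c)| := by rw [abs_neg, abs_mul, abs_of_pos hc]
    have a2 := abs_sub_abs_le_abs_sub (-(pd k u x * c)) (smean 1 (pd k φ) u x 1)
    rw [abs_sub_comm] at a2
    have a3 : (∫ z, |pd k φ z|) + ∫ z, |pd k ψ z| ≤ J := add_le_add
      (Finset.single_le_sum (f := fun k => ∫ z, |pd k φ z|) (fun k _ => hnn φ k) (Finset.mem_univ k))
      (Finset.single_le_sum (f := fun k => ∫ z, |pd k ψ z|) (fun k _ => hnn ψ k) (Finset.mem_univ k))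
    have a4 := mul_le_mul_of_nonneg_left a3 hm
    rw [Real.one_rpow, mul_one, div_one] at h1
    rw [a1]
    nlinarith
  rw [div_mul_eq_mul_div, le_div_iff₀ hc]
  nlinarith

/-- `s |u κ| ≤ s² u² + κ²`. The factor `s²` is precisely the Jacobian of `z ↦ x + s z`, so the first
term is a square integral of `u` over the ball of radius `s`, bounded uniformly as `s → 0`. The
factor `s` on the left is the one in the scale derivative of a mean with `m = 0`. -/
lemma abs_integral_mul_le_sq {u κ : Plane → ℝ} (hu : Continuous u) (hκ : Continuous κ)
    (hκs : tsupport κ ⊆ Metric.closedBall 0 1) (x : Plane) {s : ℝ} (hs : 0 < s) (hs1 : s ≤ 1) :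
    s * |∫ z, u (x + s • z) * κ z| ≤ (∫ y in Metric.closedBall x 1, u y ^ 2) + ∫ z, κ z ^ 2 := by
  have hκc := hasCompactSupport_of_tsupport hκs
  have hi2 : Integrable fun z => κ z ^ 2 := (hκ.pow 2).integrable_of_hasCompactSupport (by
    simp only [sq]; exact hκc.mul_left)
  let F : Plane → ℝ := (Metric.closedBall x s).indicator fun y => u y ^ 2
  have hFi : Integrable F := (integrable_indicator_iff Metric.isClosed_closedBall.measurableSet).2
    ((hu.pow 2).continuousOn.integrableOn_compact (isCompact_closedBall x s))
  have hFaff : Integrable fun z => F (x + s • z) := by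
    have h1 : Integrable fun z => F (x + z) := hFi.comp_add_left x
    exact h1.comp_smul hs.ne'
  have hF : ∀ z ∈ Metric.closedBall (0 : Plane) 1, F (x + s • z) = u (x + s • z) ^ 2 := fun z hz =>
    indicator_of_mem (add_smul_mem_closedBall hs.le le_rfl hz) _
  have hF0 : ∀ y, 0 ≤ F y := fun y => indicator_nonneg (fun _ _ => sq_nonneg _) y
  have hb : ∀ z, ‖s * (u (x + s • z) * κ z)‖ ≤ s ^ 2 * F (x + s • z) + κ z ^ 2 := by
    intro z
    by_cases hz : z ∈ tsupport κ
    · rw [hF z (hκs hz), Real.norm_eq_abs, abs_le]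
      constructor <;> nlinarith [sq_nonneg (s * u (x + s • z) + κ z),
        sq_nonneg (s * u (x + s • z) - κ z), sq_nonneg (κ z), sq_nonneg (s * u (x + s • z))]
    · rw [image_eq_zero_of_notMem_tsupport hz]
      simp only [mul_zero, norm_zero]
      have := hF0 (x + s • z)
      positivity
  have h := norm_integral_le_of_norm_le ((hFaff.const_mul (s ^ 2)).add hi2) (Eventually.of_forall hb)
  rw [integral_const_mul, norm_mul, Real.norm_of_nonneg hs.le, Real.norm_eq_abs] at h
  refine h.trans ?_
  have e : ∫ z, (s ^ 2 * F (x + s • z) + κ z ^ 2) = (∫ y, F y) + ∫ z, κ z ^ 2 := by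
    rw [integral_add (hFaff.const_mul _) hi2, integral_const_mul, integral_comp_affine F x _]
    have := hs.ne'
    field_simp
  have e2 : ∫ y, F y ≤ ∫ y in Metric.closedBall x 1, u y ^ 2 := by
    rw [integral_indicator Metric.isClosed_closedBall.measurableSet]
    exact setIntegral_mono_set
      ((hu.pow 2).continuousOn.integrableOn_compact (isCompact_closedBall x 1))
      (Eventually.of_forall fun y => sq_nonneg _)
      (Metric.closedBall_subset_closedBall hs1).eventuallyLE
  simp only [Pi.add_apply]
  rw [e]
  linarith

/-- A local bound by square integrals. -/
lemma exists_value_bound : ∃ C : ℝ, 0 < C ∧ ∀ (u : Plane → ℝ) (x : Plane), ContDiff ℝ 2 u →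
    |u x| ≤ C * (1 + (∫ y in Metric.closedBall x 1, u y ^ 2) +
      ∫ y in Metric.closedBall x 1, lap u y ^ 2) := by
  obtain ⟨φ, ψ, hp, hφs, hψs, hc⟩ := exists_mollifier
  set c := ∫ z, φ z
  have hφ := hp.smooth_left
  have hψ := hp.smooth_right
  have i1 : 0 ≤ ∫ z, φ z ^ 2 := integral_nonneg fun z => sq_nonneg _
  have i2 : 0 ≤ ∫ z, ψ z ^ 2 := integral_nonneg fun z => sq_nonneg _
  refine ⟨(1 + (∫ z, φ z ^ 2) + ∫ z, ψ z ^ 2) / c, by positivity, fun u x hu => ?_⟩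
  have i3 : 0 ≤ ∫ y in Metric.closedBall x 1, u y ^ 2 := integral_nonneg fun z => sq_nonneg _
  have i4 : 0 ≤ ∫ y in Metric.closedBall x 1, lap u y ^ 2 := integral_nonneg fun z => sq_nonneg _
  have h1 := abs_sub_le_of_deriv_le_rpow (N := smean 0 φ u x) (β := 1) (T := 1)
    (K := (∫ y in Metric.closedBall x 1, lap u y ^ 2) + ∫ z, ψ z ^ 2) one_pos one_pos (by positivity)
    (fun s hs _ => hasDerivAt_smean hp hφs hψs hu.continuous (weakLap_of_contDiff hu) x hs)
    (fun s hs hs1 => by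
      have := abs_integral_mul_le_sq (continuous_lap hu) hψ.continuous hψs x hs hs1
      simpa [abs_mul, abs_of_pos hs] using this)
    (tendsto_smean_zero isOpen_univ (mem_univ x) hu.continuous.continuousOn hφ hφs)
  have h2 : |smean 0 φ u x 1| ≤ (∫ y in Metric.closedBall x 1, u y ^ 2) + ∫ z, φ z ^ 2 := by
    have := abs_integral_mul_le_sq hu.continuous hφ.continuous hφs x one_pos le_rfl
    simpa [smean] using this
  have a1 : |u x| * c = |u x * c| := by rw [abs_mul, abs_of_pos hc]
  have a2 := abs_sub_abs_le_abs_sub (u x * c) (smean 0 φ u x 1)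
  rw [abs_sub_comm] at a2
  norm_num at h1
  rw [div_mul_eq_mul_div, le_div_iff₀ hc, a1]
  nlinarith [mul_nonneg i1 i3, mul_nonneg i1 i4, mul_nonneg i2 i3, mul_nonneg i2 i4]

/-! ### Cutoffs in the exterior of a disk -/

lemma exists_exterior_cutoff {ρ₀ ρ₁ : ℝ} (h0 : 0 ≤ ρ₀) (h1 : ρ₀ < ρ₁) : ∃ χ : Plane → ℝ,
    ContDiff ℝ ∞ χ ∧ (∀ x, 0 ≤ χ x ∧ χ x ≤ 1) ∧ (∀ x, ‖x‖ ≤ ρ₀ → χ x = 0) ∧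
      ∀ x, ρ₁ ≤ ‖x‖ → χ x = 1 := by
  have hpos : 0 < ρ₁ ^ 2 - ρ₀ ^ 2 := by nlinarith
  refine ⟨fun x => Real.smoothTransition ((‖x‖ ^ 2 - ρ₀ ^ 2) / (ρ₁ ^ 2 - ρ₀ ^ 2)),
    Real.smoothTransition.contDiff.comp ((contDiff_normSq.sub contDiff_const).div_const _),
    fun x => ⟨Real.smoothTransition.nonneg _, Real.smoothTransition.le_one _⟩, fun x hx => ?_,
    fun x hx => ?_⟩
  · refine Real.smoothTransition.zero_of_nonpos (div_nonpos_of_nonpos_of_nonneg ?_ hpos.le)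
    nlinarith [norm_nonneg x]
  · refine Real.smoothTransition.one_of_one_le ?_
    rw [le_div_iff₀ hpos]
    nlinarith [norm_nonneg x]

lemma isOpen_exteriorInterior (R : ℝ) : IsOpen (exteriorInterior R) :=
  isOpen_lt continuous_const continuous_norm

lemma contDiff_cutoff_mul {R ρ₀ : ℝ} (hR : R < ρ₀) {χ v : Plane → ℝ} (hχ : ContDiff ℝ ∞ χ)
    (hχ0 : ∀ x, ‖x‖ ≤ ρ₀ → χ x = 0) (hv : ContDiffOn ℝ 2 v (exteriorInterior R)) :
    ContDiff ℝ 2 fun x => χ x * v x := by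
  rw [contDiff_iff_contDiffAt]
  intro x
  by_cases hx : R < ‖x‖
  · exact (contDiff_two_of_infty hχ).contDiffAt.mul
      (hv.contDiffAt ((isOpen_exteriorInterior R).mem_nhds hx))
  · have hx' : ‖x‖ < ρ₀ := by linarith [not_lt.1 hx]
    refine contDiffAt_const (c := (0 : ℝ)) |>.congr_of_eventuallyEq ?_
    filter_upwards [(continuous_norm.tendsto x).eventually (gt_mem_nhds hx')] with y hy
    rw [hχ0 y (le_of_lt hy), zero_mul]

/-! ### Conjugation with a Gaussian -/

/-- The weight `exp (-|x|² / 8)`. -/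
def halfGauss (x : Plane) : ℝ := Real.exp (-(1 / 8) * ‖x‖ ^ 2)

lemma contDiff_halfGauss {n : ℕ∞ω} : ContDiff ℝ n halfGauss :=
  (contDiff_const.mul contDiff_normSq).exp

lemma halfGauss_pos (x : Plane) : 0 < halfGauss x := Real.exp_pos _

lemma halfGauss_le_one (x : Plane) : halfGauss x ≤ 1 := by
  rw [halfGauss, Real.exp_le_one_iff]
  nlinarith [sq_nonneg ‖x‖]

lemma pd_halfGauss (i : Fin 2) (x : Plane) : pd i halfGauss x = -(1 / 4) * x i * halfGauss x := by
  have := pd_radial (h := fun t => Real.exp (-(1 / 8) * t))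
    (h1 := fun t => -(1 / 8) * Real.exp (-(1 / 8) * t)) (x := x) (hasDerivAt_exp_mul _ _) i
  rw [show halfGauss = fun y : Plane => Real.exp (-(1 / 8) * ‖y‖ ^ 2) from rfl, this]
  ring

lemma lap_halfGauss (x : Plane) : lap halfGauss x = (-(1 / 2) + ‖x‖ ^ 2 / 16) * halfGauss x := by
  have := lap_radial (h := fun t => Real.exp (-(1 / 8) * t))
    (h1 := fun t => -(1 / 8) * Real.exp (-(1 / 8) * t)) (x := x)
    (Eventually.of_forall (hasDerivAt_exp_mul _)) ((hasDerivAt_exp_mul _ _).const_mul _)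
  rw [show halfGauss = fun y : Plane => Real.exp (-(1 / 8) * ‖y‖ ^ 2) from rfl, this]
  ring

lemma lap_mul {f g : Plane → ℝ} {x : Plane} (hf : ContDiffAt ℝ 2 f x) (hg : ContDiffAt ℝ 2 g x) :
    lap (fun y => f y * g y) x = f x * lap g x + 2 * (∑ i, pd i f x * pd i g x) + g x * lap f x := by
  simp only [lap, pd_pd_mul hf hg, Fin.sum_univ_two]
  ring

/-- Conjugation removes the drift. -/
lemma lap_halfGauss_mul {v : Plane → ℝ} {x : Plane} (hv : ContDiffAt ℝ 2 v x) :
    lap (fun y => halfGauss y * v y) x =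
      halfGauss x * ou v x - (1 - ‖x‖ ^ 2 / 16) * (halfGauss x * v x) := by
  rw [lap_mul contDiff_halfGauss.contDiffAt hv, lap_halfGauss, ou]
  simp only [pd_halfGauss, Fin.sum_univ_two]
  ring

/-! ### Pointwise growth from weighted square integrability -/

lemma norm_bounds_of_mem_closedBall {x y : Plane} {d : ℝ} (hy : y ∈ Metric.closedBall x d) :
    ‖x‖ - d ≤ ‖y‖ ∧ ‖y‖ ≤ ‖x‖ + d := by
  rw [Metric.mem_closedBall, dist_eq_norm] at hy
  have h1 := norm_sub_norm_le x y
  have h2 := norm_sub_norm_le y x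
  rw [norm_sub_rev] at h1
  constructor <;> linarith

/-- On unit balls the differential inequality turns the `L²` bound on `u` into a polynomial `L²`
bound on the Laplacian, and `exists_value_bound` makes it pointwise. The gradient follows from
`exists_gradient_bound`. The constant may depend on `u`: only the type of growth is used later. -/
lemma exists_growth_of_sq_integrable {u : Plane → ℝ} {M I ρ : ℝ} (hu : ContDiff ℝ 2 u)
    (hM : 0 ≤ M) (hI0 : 0 ≤ I) (hρ : 0 ≤ ρ) (hlap : ∀ x, ρ ≤ ‖x‖ → |lap u x| ≤ M + (1 + ‖x‖) ^ 2 * |u x|)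
    (hI : ∀ x, ρ + 1 ≤ ‖x‖ → ∫ y in Metric.closedBall x 1, u y ^ 2 ≤ I) :
    ∃ B : ℝ, 0 ≤ B ∧ ∀ x, ρ + 2 ≤ ‖x‖ → |u x| ≤ B * (1 + ‖x‖) ^ 6 ∧
      ∀ i, |pd i u x| ≤ B * (1 + ‖x‖) ^ 6 := by
  obtain ⟨C, hC, hval⟩ := exists_value_bound
  obtain ⟨C', hC', hgrad⟩ := exists_gradient_bound
  set V := (volume : Measure Plane).real (Metric.closedBall (0 : Plane) 1) with hV
  have hV0 : 0 ≤ V := measureReal_nonneg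
  have hVx : ∀ x : Plane, volume.real (Metric.closedBall x 1) = V := fun x => by
    simp only [hV, Measure.real, Measure.addHaar_closedBall_center]
  set K := C * (1 + I + (2 * M ^ 2 * V + 32 * I)) with hK
  have hK0 : 0 ≤ K := by positivity
  have h1 : ∀ x, ρ + 1 ≤ ‖x‖ → |u x| ≤ K * (1 + ‖x‖) ^ 4 := by
    intro x hx
    have hn := norm_nonneg x
    have hi : IntegrableOn (fun y => u y ^ 2) (Metric.closedBall x 1) :=
      (hu.continuous.pow 2).continuousOn.integrableOn_compact (isCompact_closedBall x 1)
    have hic : IntegrableOn (fun _ : Plane => 2 * M ^ 2) (Metric.closedBall x 1) :=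
      integrableOn_const measure_closedBall_lt_top.ne
    have a1 : ∫ y in Metric.closedBall x 1, lap u y ^ 2 ≤
        2 * M ^ 2 * V + 2 * (2 + ‖x‖) ^ 4 * I := by
      calc ∫ y in Metric.closedBall x 1, lap u y ^ 2
          ≤ ∫ y in Metric.closedBall x 1, (2 * M ^ 2 + 2 * (2 + ‖x‖) ^ 4 * u y ^ 2) := by
            refine setIntegral_mono_on
              (((continuous_lap hu).pow 2).continuousOn.integrableOn_compact (isCompact_closedBall x 1))
              (hic.add (hi.const_mul _))
              Metric.isClosed_closedBall.measurableSet fun y hy => ?_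
            obtain ⟨b1, b2⟩ := norm_bounds_of_mem_closedBall hy
            have b3 := hlap y (by linarith)
            have b4 : |lap u y| ≤ M + (2 + ‖x‖) ^ 2 * |u y| := b3.trans (by
              have : 1 + ‖y‖ ≤ 2 + ‖x‖ := by linarith
              gcongr)
            rw [← sq_abs, ← sq_abs (u y)]
            calc |lap u y| ^ 2 ≤ (M + (2 + ‖x‖) ^ 2 * |u y|) ^ 2 := by gcongr
              _ ≤ _ := by nlinarith [sq_nonneg (M - (2 + ‖x‖) ^ 2 * |u y|)]
        _ = 2 * M ^ 2 * V + 2 * (2 + ‖x‖) ^ 4 * ∫ y in Metric.closedBall x 1, u y ^ 2 := by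
            rw [integral_add hic (hi.const_mul _), setIntegral_const, hVx,
              smul_eq_mul, integral_const_mul]
            ring
        _ ≤ _ := by gcongr; exact hI x hx
    have a2 : (2 + ‖x‖) ^ 4 ≤ 16 * (1 + ‖x‖) ^ 4 := by
      calc (2 + ‖x‖) ^ 4 ≤ (2 * (1 + ‖x‖)) ^ 4 := by gcongr; linarith
        _ = _ := by ring
    have a3 : 1 ≤ (1 + ‖x‖) ^ 4 := one_le_pow₀ (by linarith)
    calc |u x| ≤ C * (1 + I + (2 * M ^ 2 * V + 2 * (16 * (1 + ‖x‖) ^ 4) * I)) := by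
          refine (hval u x hu).trans ?_
          gcongr
          · exact hI x hx
          · refine a1.trans ?_
            gcongr
      _ ≤ C * ((1 + I + (2 * M ^ 2 * V + 32 * I)) * (1 + ‖x‖) ^ 4) := by
          gcongr
          nlinarith [mul_nonneg hI0 (sub_nonneg.2 a3), mul_nonneg (mul_nonneg (sq_nonneg M) hV0) (sub_nonneg.2 a3)]
      _ = _ := by rw [hK]; ring
  set K' := M + 64 * K with hK'
  have hK'0 : 0 ≤ K' := by positivity
  refine ⟨K + C' * K' + C' * (16 * K), by positivity, fun x hx => ?_⟩
  have hn := norm_nonneg x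
  have e1 : 1 ≤ (1 + ‖x‖) ^ 6 := one_le_pow₀ (by linarith)
  have e2 : (1 + ‖x‖) ^ 4 ≤ (1 + ‖x‖) ^ 6 := pow_le_pow_right₀ (by linarith) (by norm_num)
  have b1 : |u x| ≤ K * (1 + ‖x‖) ^ 6 :=
    (h1 x (by linarith)).trans (mul_le_mul_of_nonneg_left e2 hK0)
  have hm : ∀ y ∈ Metric.closedBall x 1, |u y| ≤ 16 * K * (1 + ‖x‖) ^ 4 ∧
      (1 + ‖y‖) ^ 2 ≤ 4 * (1 + ‖x‖) ^ 2 := by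
    intro y hy
    obtain ⟨c1, c2⟩ := norm_bounds_of_mem_closedBall hy
    have c3 : 1 + ‖y‖ ≤ 2 * (1 + ‖x‖) := by linarith
    have c0 := norm_nonneg y
    constructor
    · calc |u y| ≤ K * (1 + ‖y‖) ^ 4 := h1 y (by linarith)
        _ ≤ K * (2 * (1 + ‖x‖)) ^ 4 := by gcongr
        _ = _ := by ring
    · calc (1 + ‖y‖) ^ 2 ≤ (2 * (1 + ‖x‖)) ^ 2 := by gcongr
        _ = _ := by ring
  have b2 : ∀ i, |pd i u x| ≤ C' * ((K' + 16 * K) * (1 + ‖x‖) ^ 6) := by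
    refine hgrad u (lap u) univ x _ hu.continuous (weakLap_of_contDiff hu) isOpen_univ (mem_univ x)
      (hu.contDiffOn.of_le (by norm_num)) (by positivity) (fun y hy => ?_) fun y hy => ?_
    · refine (hm y hy).1.trans ?_
      nlinarith [mul_le_mul_of_nonneg_left e2 (by positivity : 0 ≤ 16 * K),
        mul_nonneg hK'0 (by positivity : 0 ≤ (1 + ‖x‖) ^ 6)]
    · obtain ⟨c1, c2⟩ := norm_bounds_of_mem_closedBall hy
      calc |lap u y| ≤ M + (1 + ‖y‖) ^ 2 * |u y| := hlap y (by linarith)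
        _ ≤ M + 4 * (1 + ‖x‖) ^ 2 * (16 * K * (1 + ‖x‖) ^ 4) := by
          gcongr
          exacts [(hm y hy).2, (hm y hy).1]
        _ = M * 1 + 64 * K * (1 + ‖x‖) ^ 6 := by ring
        _ ≤ M * (1 + ‖x‖) ^ 6 + 64 * K * (1 + ‖x‖) ^ 6 := by gcongr
        _ ≤ _ := by
          rw [hK']
          nlinarith [mul_nonneg hK0 (by positivity : 0 ≤ (1 + ‖x‖) ^ 6)]
  have p6 : 0 ≤ (1 + ‖x‖) ^ 6 := by positivity
  refine ⟨b1.trans ?_, fun i => (b2 i).trans (le_of_eq_of_le (b := (C' * K' + C' * (16 * K)) * (1 + ‖x‖) ^ 6) (by ring) ?_)⟩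
  · have : 0 ≤ C' * K' + C' * (16 * K) := by positivity
    gcongr
    linarith
  · gcongr
    linarith

/-- Solutions in the weighted `L²` space with bounded right-hand side grow at most like
`exp (5 |x|² / 32)`, together with their gradient. -/
lemma exists_growth {R M ρ : ℝ} {v : Plane → ℝ} (hR : 0 ≤ R)
    (hv : ContDiffOn ℝ 2 v (exteriorInterior R)) (hM : ∀ x, R < ‖x‖ → |ou v x| ≤ M)
    (hL : MemLp (fun x => Real.exp (-(‖x‖ ^ 2 / 8)) * v x) 2 (volume.restrict (exteriorInterior R)))
    (hρ : R < ρ) : ∃ B : ℝ, 0 ≤ B ∧ ∀ x, ρ ≤ ‖x‖ → |v x| ≤ B * Real.exp (5 / 32 * ‖x‖ ^ 2) ∧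
      ∀ i, |pd i v x| ≤ B * Real.exp (5 / 32 * ‖x‖ ^ 2) := by
  have hM0 : 0 ≤ M := by
    obtain ⟨x, hx⟩ := exists_norm_eq Plane (by linarith : 0 ≤ ρ)
    exact (abs_nonneg _).trans (hM x (by linarith))
  obtain ⟨χ, hχ, hχ01, hχ0, hχ1⟩ := exists_exterior_cutoff (ρ₀ := (R + ρ) / 2) (ρ₁ := ρ)
    (by linarith) (by linarith)
  set u : Plane → ℝ := fun x => halfGauss x * (χ x * v x) with hu_def
  have hu : ContDiff ℝ 2 u := contDiff_halfGauss.mul (contDiff_cutoff_mul (by linarith) hχ hχ0 hv)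
  have hev : ∀ x, ρ < ‖x‖ → u =ᶠ[𝓝 x] fun y => halfGauss y * v y := by
    intro x hx
    filter_upwards [(continuous_norm.tendsto x).eventually (lt_mem_nhds hx)] with y hy
    rw [hu_def]
    simp only [hχ1 y (le_of_lt hy), one_mul]
  have hvat : ∀ x, R < ‖x‖ → ContDiffAt ℝ 2 v x := fun x hx =>
    hv.contDiffAt ((isOpen_exteriorInterior R).mem_nhds hx)
  have hI := hL.integrable_sq
  set I := ∫ x in exteriorInterior R, (Real.exp (-(‖x‖ ^ 2 / 8)) * v x) ^ 2
  obtain ⟨B, hB, hbound⟩ := exists_growth_of_sq_integrable (u := u) (M := M) (I := I) (ρ := ρ + 1) hu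
    hM0 (integral_nonneg fun _ => sq_nonneg _) (by linarith) (fun x hx => by
      rw [lap_congr (hev x (by linarith)), lap_halfGauss_mul (hvat x (by linarith)),
        (hev x (by linarith)).self_of_nhds]
      have h1 : |halfGauss x * ou v x| ≤ M := by
        rw [abs_mul, abs_of_pos (halfGauss_pos x)]
        nlinarith [halfGauss_le_one x, hM x (by linarith), abs_nonneg (ou v x), halfGauss_pos x]
      have h2 : |1 - ‖x‖ ^ 2 / 16| ≤ (1 + ‖x‖) ^ 2 := by
        have := norm_nonneg x
        rw [abs_le]; constructor <;> nlinarith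
      refine (abs_sub _ _).trans (add_le_add h1 ?_)
      rw [abs_mul]
      gcongr) (fun x hx => by
      have hsub : Metric.closedBall x 1 ⊆ exteriorInterior R := fun y hy => by
        have := (norm_bounds_of_mem_closedBall hy).1
        change R < ‖y‖
        linarith
      refine le_of_eq_of_le (setIntegral_congr_fun Metric.isClosed_closedBall.measurableSet
        fun y hy => ?_) (setIntegral_mono_set hI (Eventually.of_forall fun y => sq_nonneg _)
          hsub.eventuallyLE)
      have := (norm_bounds_of_mem_closedBall hy).1
      simp only [(hev y (by linarith)).self_of_nhds]
      rw [halfGauss]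
      ring_nf)
  -- Undoing the weight `e^{-|x|²/8}` and absorbing polynomials in `e^{|x|²/32}` gives the rate `1/8
  -- + 1/32 = 5/32`. It is strictly below the rate `3/16` used in the comparison function and in the
  -- Gaussian means. Degree `7` is `6` plus one factor from differentiating the weight.
  obtain ⟨K, hK⟩ : ∃ K, ∀ t : ℝ, 0 ≤ t → (1 + t) ^ 7 ≤ K * Real.exp (1 / 32 * t ^ 2) := by
    obtain ⟨K, -, hK⟩ := one_add_pow_le_exp 7 (c := 1 / 32) (by norm_num)
    exact ⟨K, hK⟩
  have hcomp : IsCompact {x : Plane | ρ ≤ ‖x‖ ∧ ‖x‖ ≤ ρ + 3} := by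
    refine (isCompact_closedBall (0 : Plane) (ρ + 3)).of_isClosed_subset
      ((isClosed_le continuous_const continuous_norm).inter
        (isClosed_le continuous_norm continuous_const)) fun x hx => ?_
    simpa using hx.2
  have hann : {x : Plane | ρ ≤ ‖x‖ ∧ ‖x‖ ≤ ρ + 3} ⊆ exteriorInterior R := fun x hx =>
    lt_of_lt_of_le hρ hx.1
  obtain ⟨B0, hB0⟩ := hcomp.exists_bound_of_continuousOn (hv.continuousOn.mono hann)
  have hB1 : ∀ i, ∃ B1, ∀ x ∈ {x : Plane | ρ ≤ ‖x‖ ∧ ‖x‖ ≤ ρ + 3}, ‖pd i v x‖ ≤ B1 := fun i =>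
    hcomp.exists_bound_of_continuousOn ((contDiffOn_pd (isOpen_exteriorInterior R) hv (m := 0)
      (by norm_num) i).continuousOn.mono hann)
  choose B1 hB1 using hB1
  have hK0 : 0 ≤ K := by
    have := hK 0 le_rfl
    norm_num at this
    linarith
  refine ⟨|B0| + |B1 0| + |B1 1| + 2 * B * K, by positivity, fun x hx => ?_⟩
  have hn := norm_nonneg x
  have hexp1 : 1 ≤ Real.exp (5 / 32 * ‖x‖ ^ 2) := Real.one_le_exp (by positivity)
  by_cases hx3 : ‖x‖ ≤ ρ + 3
  · have hBK : 0 ≤ 2 * B * K := by positivity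
    have p0 := abs_nonneg B0
    have p1 := abs_nonneg (B1 0)
    have p2 := abs_nonneg (B1 1)
    have key : ∀ t c : ℝ, |t| ≤ c → c ≤ |B0| + |B1 0| + |B1 1| + 2 * B * K →
        |t| ≤ (|B0| + |B1 0| + |B1 1| + 2 * B * K) * Real.exp (5 / 32 * ‖x‖ ^ 2) := by
      intro t c h1 h2
      have h3 := h1.trans h2
      exact h3.trans (le_mul_of_one_le_right ((abs_nonneg t).trans h3) hexp1)
    refine ⟨key _ _ (hB0 x ⟨hx, hx3⟩) (by linarith [le_abs_self B0]), fun i => ?_⟩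
    refine key _ _ (hB1 i x ⟨hx, hx3⟩) ?_
    fin_cases i
    · simp only [Fin.zero_eta]; linarith [le_abs_self (B1 0)]
    · simp only [Fin.mk_one]; linarith [le_abs_self (B1 1)]
  · have hx3 := not_le.1 hx3
    obtain ⟨c1, c2⟩ := hbound x (by linarith)
    have hg := halfGauss_pos x
    have hgi : (halfGauss x)⁻¹ = Real.exp (1 / 8 * ‖x‖ ^ 2) := by
      rw [halfGauss, ← Real.exp_neg]; ring_nf
    have hexp : Real.exp (5 / 32 * ‖x‖ ^ 2) =
        (halfGauss x)⁻¹ * Real.exp (1 / 32 * ‖x‖ ^ 2) := by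
      rw [hgi, ← Real.exp_add]; ring_nf
    have e6 : (1 + ‖x‖) ^ 6 ≤ (1 + ‖x‖) ^ 7 := pow_le_pow_right₀ (by linarith) (by norm_num)
    have key : ∀ t : ℝ, |halfGauss x * t| ≤ 2 * B * (1 + ‖x‖) ^ 7 →
        |t| ≤ (|B0| + |B1 0| + |B1 1| + 2 * B * K) * Real.exp (5 / 32 * ‖x‖ ^ 2) := by
      intro t ht
      rw [abs_mul, abs_of_pos hg] at ht
      have h1 : |t| ≤ (halfGauss x)⁻¹ * (2 * B * (K * Real.exp (1 / 32 * ‖x‖ ^ 2))) := by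
        rw [le_inv_mul_iff₀ hg]
        exact ht.trans (mul_le_mul_of_nonneg_left (hK _ hn) (by positivity))
      refine h1.trans ?_
      rw [hexp]
      have : (halfGauss x)⁻¹ * (2 * B * (K * Real.exp (1 / 32 * ‖x‖ ^ 2))) =
        (2 * B * K) * ((halfGauss x)⁻¹ * Real.exp (1 / 32 * ‖x‖ ^ 2)) := by ring
      rw [this]
      gcongr
      have := abs_nonneg B0
      have := abs_nonneg (B1 0)
      have := abs_nonneg (B1 1)
      linarith
    have hux := (hev x (by linarith)).self_of_nhds
    refine ⟨key _ ?_, fun i => key _ ?_⟩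
    · simp only at hux
      rw [← hux]
      refine c1.trans ?_
      nlinarith [mul_le_mul_of_nonneg_left e6 hB, mul_nonneg hB (by positivity : 0 ≤ (1 + ‖x‖) ^ 7)]
    · have hp := c2 i
      have hpd : pd i u x = pd i halfGauss x * v x + halfGauss x * pd i v x := by
        rw [pd_congr (hev x (by linarith)) i]
        exact pd_mul (contDiff_halfGauss (n := 1).differentiable (by norm_num) x)
          ((hvat x (by linarith)).differentiableAt (by norm_num)) i
      have h3 : halfGauss x * pd i v x = pd i u x + 1 / 4 * x i * u x := by
        simp only at hux
        rw [hpd, pd_halfGauss, hux]; ring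
      rw [h3]
      refine (abs_add_le _ _).trans ?_
      have h4 : |1 / 4 * x i * u x| ≤ (1 + ‖x‖) * (B * (1 + ‖x‖) ^ 6) := by
        rw [abs_mul, abs_mul]
        have := abs_coord_le_norm x i
        have h5 : |(1 / 4 : ℝ)| * |x i| ≤ 1 + ‖x‖ := by
          rw [abs_of_pos (by norm_num)]
          linarith [abs_nonneg (x i)]
        gcongr
      have h5 : (1 + ‖x‖) * (B * (1 + ‖x‖) ^ 6) = B * (1 + ‖x‖) ^ 7 := by ring
      rw [h5] at h4
      linarith [mul_le_mul_of_nonneg_left e6 hB]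

/-! ### Comparison with barriers -/

lemma pd_neg (f : Plane → ℝ) (i : Fin 2) (x : Plane) : pd i (fun y => -f y) x = -pd i f x := by
  simp [pd, fderiv_fun_neg]

lemma ou_neg (f : Plane → ℝ) (x : Plane) : ou (fun y => -f y) x = -ou f x := by
  have h : ∀ i, pd i (fun y => -f y) = fun y => -pd i f y := fun i => funext (pd_neg f i)
  simp only [ou, lap, h, pd_neg, Fin.sum_univ_two]
  ring

lemma ou_sub_const_mul {f g : Plane → ℝ} {x : Plane} (hf : ContDiffAt ℝ 2 f x)
    (hg : ContDiffAt ℝ 2 g x) (t : ℝ) : ou (fun y => f y - t * g y) x = ou f x - t * ou g x := by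
  have ev : ∀ {h : Plane → ℝ}, ContDiffAt ℝ 2 h x → ∀ᶠ y in 𝓝 x, DifferentiableAt ℝ h y := by
    intro h hh
    filter_upwards [hh.eventually (by simp)] with y hy
    exact hy.differentiableAt (by norm_num)
  have h1 : ∀ i, pd i (fun y => f y - t * g y) =ᶠ[𝓝 x] fun y => pd i f y - t * pd i g y := by
    intro i
    filter_upwards [ev hf, ev hg] with y h1 h2
    rw [pd_sub h1 (h2.const_mul t), pd_const_mul h2]
  have hd : ∀ {h : Plane → ℝ}, ContDiffAt ℝ 2 h x → ∀ i, DifferentiableAt ℝ (pd i h) x :=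
    fun hh i => (contDiffAt_pd hh (m := 1) (by norm_num) i).differentiableAt (by norm_num)
  have h2 : ∀ i, pd i (pd i (fun y => f y - t * g y)) x = pd i (pd i f) x - t * pd i (pd i g) x := by
    intro i
    rw [pd_congr (h1 i), pd_sub (hd hf i) ((hd hg i).const_mul t), pd_const_mul (hd hg i)]
  have h3 : ∀ i, pd i (fun y => f y - t * g y) x = pd i f x - t * pd i g x :=
    fun i => (h1 i).self_of_nhds
  simp only [ou, lap, h2, h3, Fin.sum_univ_two]
  ring

lemma pd_eq_zero_of_isLocalMax {h : Plane → ℝ} {x : Plane} (hm : IsLocalMax h x) (i : Fin 2) :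
    pd i h x = 0 := by
  simp [pd, hm.fderiv_eq_zero]

/-- A positive second derivative would make the point a local minimum along the coordinate line.
Being also a local maximum, the restriction would be constant near it, with vanishing second
derivative. -/
lemma pd_pd_nonpos_of_isLocalMax {h : Plane → ℝ} {x : Plane} (hc : ContDiffAt ℝ 2 h x)
    (hm : IsLocalMax h x) (i : Fin 2) : pd i (pd i h) x ≤ 0 := by
  by_contra! hpos
  set e : Plane := EuclideanSpace.single i 1
  have hl : ∀ t : ℝ, HasDerivAt (fun t : ℝ => x + t • e) e t := fun t => by
    simpa using ((hasDerivAt_id t).smul_const e).const_add x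
  have hlc : Tendsto (fun t : ℝ => x + t • e) (𝓝 0) (𝓝 x) := by
    simpa using (hl 0).continuousAt.tendsto
  set g : ℝ → ℝ := fun t => h (x + t • e)
  have hcomp : ∀ {f : Plane → ℝ} {t : ℝ}, DifferentiableAt ℝ f (x + t • e) →
      HasDerivAt (fun t => f (x + t • e)) (pd i f (x + t • e)) t := fun {f t} hf =>
    hf.hasFDerivAt.comp_hasDerivAt t (hl t)
  have hg1 : deriv g =ᶠ[𝓝 0] fun t => pd i h (x + t • e) := by
    filter_upwards [hlc.eventually (hc.eventually (by simp))] with t ht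
    exact (hcomp (ht.differentiableAt (by norm_num))).deriv
  have hg2 : deriv (deriv g) 0 = pd i (pd i h) x := by
    rw [hg1.deriv_eq]
    have hd : DifferentiableAt ℝ (pd i h) (x + (0 : ℝ) • e) := by
      rw [zero_smul, add_zero]
      exact (contDiffAt_pd hc (m := 1) (by norm_num) i).differentiableAt (by norm_num)
    rw [(hcomp hd).deriv, zero_smul, add_zero]
  have hg0 : deriv g 0 = 0 := by
    have h1 := hg1.self_of_nhds
    simp only [zero_smul, add_zero, pd_eq_zero_of_isLocalMax hm] at h1
    exact h1
  have hgc : ContinuousAt g 0 := by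
    have : ContinuousAt h (x + (0 : ℝ) • e) := by
      rw [zero_smul, add_zero]; exact hc.continuousAt
    exact ContinuousAt.comp (f := fun t : ℝ => x + t • e) this (hl 0).continuousAt
  have hmin := isLocalMin_of_deriv_deriv_pos (by rw [hg2]; exact hpos) hg0 hgc
  have hconst : g =ᶠ[𝓝 0] fun _ => g 0 := by
    have hmax : ∀ᶠ t in 𝓝 (0 : ℝ), g t ≤ g 0 := by
      have := hlc.eventually hm
      simpa [g] using this
    filter_upwards [hmin, hmax] with t h1 h2
    exact le_antisymm h2 h1
  have h3 : deriv (deriv g) 0 = 0 := by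
    rw [hconst.deriv.deriv_eq]
    simp
  rw [hg2] at h3
  exact hpos.ne' h3

lemma ou_nonpos_of_isLocalMax {h : Plane → ℝ} {x : Plane} (hc : ContDiffAt ℝ 2 h x)
    (hm : IsLocalMax h x) (h0 : h x = 0) : ou h x ≤ 0 := by
  have h1 := fun i => pd_pd_nonpos_of_isLocalMax hc hm i
  have h2 := fun i => pd_eq_zero_of_isLocalMax hm i
  simp only [ou, lap, h2, h0, Fin.sum_univ_two, mul_zero, add_zero, sub_zero]
  linarith [h1 0, h1 1]

/-- Comparison with a strict supersolution. -/
lemma le_of_strict_supersolution {v P : Plane → ℝ} {ρ : ℝ}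
    (hv : ContinuousOn v (exteriorDomain ρ)) (hv2 : ContDiffOn ℝ 2 v (exteriorInterior ρ))
    (hP : ContinuousOn P (exteriorDomain ρ)) (hP2 : ContDiffOn ℝ 2 P (exteriorInterior ρ))
    (hpos : ∀ x ∈ exteriorDomain ρ, 0 < P x)
    (hlt : ∀ x ∈ exteriorInterior ρ, ou P x < -|ou v x|)
    (hb : ∀ x, ‖x‖ = ρ → v x ≤ P x) {ρ₁ : ℝ} (hfar : ∀ x, ρ₁ ≤ ‖x‖ → ρ ≤ ‖x‖ → v x ≤ P x) :
    ∀ x ∈ exteriorDomain ρ, v x ≤ P x := by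
  intro x₀ hx₀
  by_contra! hlt₀
  set S : Set Plane := {x | ρ ≤ ‖x‖ ∧ ‖x‖ ≤ max ρ₁ ‖x₀‖}
  have hSc : IsCompact S := by
    refine (isCompact_closedBall (0 : Plane) (max ρ₁ ‖x₀‖)).of_isClosed_subset
      ((isClosed_le continuous_const continuous_norm).inter
        (isClosed_le continuous_norm continuous_const)) fun x hx => ?_
    rw [mem_closedBall_zero_iff]
    exact hx.2
  have hSΩ : S ⊆ exteriorDomain ρ := fun x hx => hx.1
  -- The term `+ v / 2` has the wrong sign for the maximum principle. It is neutralised by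
  -- maximising the quotient `v / P`: with `t` its maximum, `v - t P` has the local maximum value
  -- zero, so the zero-order term drops out there.
  obtain ⟨x₁, hx₁, hmax⟩ := hSc.exists_isMaxOn ⟨x₀, hx₀, le_max_right _ _⟩
    ((hv.mono hSΩ).div (hP.mono hSΩ) fun x hx => (hpos x (hSΩ hx)).ne')
  set t := v x₁ / P x₁ with ht
  have hP1 := hpos x₁ (hSΩ hx₁)
  have ht1 : 1 < t := by
    have h1 : v x₀ / P x₀ ≤ t := hmax ⟨hx₀, le_max_right _ _⟩
    have h2 : 1 < v x₀ / P x₀ := (one_lt_div (hpos x₀ hx₀)).2 hlt₀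
    linarith
  have hv1 : P x₁ < v x₁ := (one_lt_div hP1).1 ht1
  have hx₁i : x₁ ∈ exteriorInterior ρ := by
    refine lt_of_le_of_ne hx₁.1 fun h => ?_
    exact absurd (hb x₁ h.symm) (not_le.2 hv1)
  have hx₁f : ‖x₁‖ < ρ₁ := by
    by_contra! h
    exact absurd (hfar x₁ h hx₁.1) (not_le.2 hv1)
  have hc1 := hv2.contDiffAt ((isOpen_exteriorInterior ρ).mem_nhds hx₁i)
  have hc2 := hP2.contDiffAt ((isOpen_exteriorInterior ρ).mem_nhds hx₁i)
  have hloc : IsLocalMax (fun y => v y - t * P y) x₁ := by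
    filter_upwards [(isOpen_exteriorInterior ρ).mem_nhds hx₁i,
      (continuous_norm.tendsto x₁).eventually (gt_mem_nhds hx₁f)] with y h1 h2
    have hyS : y ∈ S := ⟨le_of_lt h1, (le_of_lt h2).trans (le_max_left _ _)⟩
    have h3 : v y / P y ≤ t := hmax hyS
    rw [div_le_iff₀ (hpos y (hSΩ hyS))] at h3
    have h4 : v x₁ - t * P x₁ = 0 := by rw [ht, div_mul_cancel₀ _ hP1.ne', sub_self]
    rw [h4]
    linarith
  have h5 := ou_nonpos_of_isLocalMax (hc1.sub (contDiffAt_const.mul hc2)) hloc (by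
    rw [ht, div_mul_cancel₀ _ hP1.ne', sub_self])
  rw [ou_sub_const_mul hc1 hc2] at h5
  have h6 := hlt x₁ hx₁i
  have h7 := neg_abs_le (ou v x₁)
  have h8 := abs_nonneg (ou v x₁)
  nlinarith

lemma ou_radial {h h1 : ℝ → ℝ} {h2 : ℝ} {x : Plane}
    (hh : ∀ᶠ t in 𝓝 (‖x‖ ^ 2), HasDerivAt h (h1 t) t) (hh1 : HasDerivAt h1 h2 (‖x‖ ^ 2)) :
    ou (fun y => h (‖y‖ ^ 2)) x = (4 - ‖x‖ ^ 2) * h1 (‖x‖ ^ 2) + 4 * ‖x‖ ^ 2 * h2 +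
      1 / 2 * h (‖x‖ ^ 2) := by
  simp only [ou, lap_radial hh hh1, pd_radial hh.self_of_nhds, Fin.sum_univ_two]
  linear_combination h1 (‖x‖ ^ 2) * normSq_eq x

/-- The barrier `|x| - a / |x|`. -/
def barrier (a : ℝ) (x : Plane) : ℝ := ‖x‖ - a / ‖x‖

lemma contDiffAt_barrier (a : ℝ) {x : Plane} (hx : x ≠ 0) {n : ℕ∞ω} : ContDiffAt ℝ n (barrier a) x :=
  have h := contDiffAt_norm ℝ hx (n := n)
  h.sub (contDiffAt_const.div h (norm_ne_zero_iff.2 hx))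

/-- `L |x| = 1 / |x|`, since `|x|` is homogeneous of degree one, while `L (-a / |x|) = -a / |x| - a
/ |x|³`. The sum is negative of order `1 / |x|` when `a > 1`; positivity of the barrier asks for `a
≤ |x|²`. -/
lemma ou_barrier (a : ℝ) {x : Plane} (hx : x ≠ 0) :
    ou (barrier a) x = -(a - 1) / ‖x‖ - a / ‖x‖ ^ 3 := by
  have hx' := norm_pos_iff.2 hx
  have hpos : 0 < ‖x‖ ^ 2 := by positivity
  have hb : barrier a = fun y => (fun s => √s - a * (√s)⁻¹) (‖y‖ ^ 2) := by
    ext y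
    simp [barrier, Real.sqrt_sq, div_eq_mul_inv]
  have hd : ∀ s : ℝ, 0 < s → HasDerivAt (fun s => √s - a * (√s)⁻¹)
      (1 / 2 * (√s)⁻¹ + a / 2 * ((√s)⁻¹) ^ 3) s := by
    intro s hs
    have h1 := Real.hasDerivAt_sqrt hs.ne'
    refine (h1.sub ((h1.fun_inv (Real.sqrt_pos.2 hs).ne').const_mul a)).congr_deriv ?_
    have := (Real.sqrt_pos.2 hs).ne'
    field_simp
    ring
  have hd2 : HasDerivAt (fun s => 1 / 2 * (√s)⁻¹ + a / 2 * ((√s)⁻¹) ^ 3)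
      (-(1 / 4) * (‖x‖⁻¹) ^ 3 - 3 * a / 4 * (‖x‖⁻¹) ^ 5) (‖x‖ ^ 2) := by
    have h1 := (Real.hasDerivAt_sqrt hpos.ne').fun_inv (Real.sqrt_pos.2 hpos).ne'
    refine ((h1.const_mul (1 / 2)).add ((h1.fun_pow 3).const_mul (a / 2))).congr_deriv ?_
    rw [Real.sqrt_sq hx'.le]
    field_simp
    norm_num
    field_simp
    ring
  rw [hb, ou_radial ((eventually_gt_nhds hpos).mono hd) hd2, Real.sqrt_sq hx'.le]
  field_simp
  ring

lemma ou_exp_normSq (x : Plane) : ou (fun y => Real.exp (3 / 16 * ‖y‖ ^ 2)) x =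
    (5 / 4 - 3 / 64 * ‖x‖ ^ 2) * Real.exp (3 / 16 * ‖x‖ ^ 2) := by
  rw [ou_radial (h := fun t => Real.exp (3 / 16 * t)) (Eventually.of_forall (hasDerivAt_exp_mul _))
    ((hasDerivAt_exp_mul _ _).const_mul _)]
  ring

/-- The exponential is a supersolution only for `|x|² ≥ 80/3`. Below that, `3/16 · 80/3 = 5 < 6`
bounds it by `e^6`, and the excess is small enough to be paid by a multiple of the barrier. -/
lemma ou_exp_normSq_lt (x : Plane) (hx : x ≠ 0) :
    ou (fun y => Real.exp (3 / 16 * ‖y‖ ^ 2)) x < 8 * Real.exp 6 / ‖x‖ := by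
  have hx' := norm_pos_iff.2 hx
  have he := Real.exp_pos 6
  rw [ou_exp_normSq, lt_div_iff₀ hx']
  have hE := Real.exp_pos (3 / 16 * ‖x‖ ^ 2)
  by_cases h : ‖x‖ ^ 2 ≤ 80 / 3
  · have h1 : ‖x‖ ≤ 6 := by nlinarith
    have h2 : Real.exp (3 / 16 * ‖x‖ ^ 2) ≤ Real.exp 6 := by gcongr; linarith
    have h3 : (5 / 4 - 3 / 64 * ‖x‖ ^ 2) * Real.exp (3 / 16 * ‖x‖ ^ 2) ≤ 5 / 4 * Real.exp 6 := by
      nlinarith [sq_nonneg ‖x‖]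
    calc _ ≤ 5 / 4 * Real.exp 6 * ‖x‖ := by gcongr
      _ ≤ 5 / 4 * Real.exp 6 * 6 := by gcongr
      _ < _ := by linarith
  · have h := not_le.1 h
    have h3 : (5 / 4 - 3 / 64 * ‖x‖ ^ 2) * Real.exp (3 / 16 * ‖x‖ ^ 2) ≤ 0 :=
      mul_nonpos_of_nonpos_of_nonneg (by linarith) hE.le
    nlinarith

lemma barrier_nonneg {a : ℝ} {x : Plane} (hx : 0 < ‖x‖) (ha : a ≤ ‖x‖ ^ 2) : 0 ≤ barrier a x := by
  rw [barrier, sub_nonneg, div_le_iff₀ hx]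
  nlinarith

/-- The comparison function is the barrier plus `ε (c · barrier + e^{3|x|²/16})`. The exponential
dominates the growth `e^{5|x|²/32}` of `v` at infinity and makes the supersolution strict; finally
`ε → 0`. -/
lemma le_barrier {a ρ M K B : ℝ} {v : Plane → ℝ} (ha : 1 < a) (hρ : 0 < ρ) (haρ : a ≤ ρ ^ 2)
    (hK : 0 ≤ K) (hMK : M ≤ K * (a - 1)) (hv : ContinuousOn v (exteriorDomain ρ))
    (hv2 : ContDiffOn ℝ 2 v (exteriorInterior ρ)) (hE : ∀ x, ρ < ‖x‖ → |ou v x| ≤ M / ‖x‖)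
    (hb : ∀ x, ‖x‖ = ρ → v x ≤ K * barrier a x) {ρ₀ : ℝ}
    (hfar : ∀ x, ρ₀ ≤ ‖x‖ → |v x| ≤ B * Real.exp (5 / 32 * ‖x‖ ^ 2)) :
    ∀ x, ρ ≤ ‖x‖ → v x ≤ K * barrier a x := by
  intro x hx
  have hx0 : ∀ {y : Plane}, ρ ≤ ‖y‖ → y ≠ 0 := fun hy => norm_pos_iff.1 (hρ.trans_le hy)
  -- Chosen so that `c (a - 1) / |x|` equals the bound in `ou_exp_normSq_lt`.
  set c := 8 * Real.exp 6 / (a - 1) with hc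
  have ha1 : 0 < a - 1 := by linarith
  have hc0 : 0 < c := by have := Real.exp_pos 6; positivity
  have hbar0 : ∀ {y : Plane}, ρ ≤ ‖y‖ → 0 ≤ barrier a y := fun hy =>
    barrier_nonneg (hρ.trans_le hy) (haρ.trans (by gcongr))
  set G : Plane → ℝ := fun y => Real.exp (3 / 16 * ‖y‖ ^ 2) with hG
  have hGs : ContDiff ℝ 2 G := (contDiff_const.mul contDiff_normSq).exp
  have key : ∀ ε > 0, v x ≤ (K + ε * c) * barrier a x + ε * G x := by
    intro ε hε
    have hPc : ∀ y, ρ ≤ ‖y‖ →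
        ContDiffAt ℝ 2 (fun y => (K + ε * c) * barrier a y + ε * G y) y := fun y hy =>
      (contDiffAt_const.mul (contDiffAt_barrier a (hx0 hy))).add (contDiffAt_const.mul hGs.contDiffAt)
    have hP0 : ∀ y, ρ ≤ ‖y‖ → 0 < (K + ε * c) * barrier a y + ε * G y := fun y hy => by
      have := hbar0 hy
      have := Real.exp_pos (3 / 16 * ‖y‖ ^ 2)
      positivity
    have hou : ∀ y, ρ ≤ ‖y‖ → ou (fun y => (K + ε * c) * barrier a y + ε * G y) y =
        (K + ε * c) * ou (barrier a) y + ε * ou G y := by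
      intro y hy
      have h1 := ou_sub_const_mul (t := -ε) (contDiffAt_const.mul (contDiffAt_barrier a (hx0 hy)))
        hGs.contDiffAt (f := fun y => (K + ε * c) * barrier a y) (g := G) (x := y)
      have h2 := ou_sub_const_mul (t := -(K + ε * c)) (contDiffAt_const (c := (0 : ℝ)))
        (contDiffAt_barrier a (hx0 hy)) (x := y)
      have h3 : ou (fun _ : Plane => (0 : ℝ)) y = 0 := by
        have h4 : ∀ i, pd i (fun _ : Plane => (0 : ℝ)) = fun _ => 0 := fun i => funext (pd_const 0 i)
        simp [ou, lap, h4]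
      simp only [neg_mul, h3, sub_neg_eq_add, zero_add] at h1 h2
      rw [h1, h2]
    have hlog : ∃ ρ₂, ∀ t, ρ₂ ≤ t → B * Real.exp (5 / 32 * t ^ 2) ≤ ε * Real.exp (3 / 16 * t ^ 2) := by
      have h1 : Tendsto (fun t : ℝ => ε * Real.exp (1 / 32 * t ^ 2)) atTop atTop :=
        (Real.tendsto_exp_atTop.comp ((tendsto_pow_atTop two_ne_zero).const_mul_atTop
          (by norm_num))).const_mul_atTop hε
      obtain ⟨ρ₂, h2⟩ := eventually_atTop.1 (h1.eventually (eventually_ge_atTop B))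
      refine ⟨ρ₂, fun t ht => ?_⟩
      have h3 : Real.exp (3 / 16 * t ^ 2) =
          Real.exp (1 / 32 * t ^ 2) * Real.exp (5 / 32 * t ^ 2) := by
        rw [← Real.exp_add]; ring_nf
      rw [h3, ← mul_assoc]
      gcongr
      exact h2 t ht
    obtain ⟨ρ₂, hρ₂⟩ := hlog
    refine le_of_strict_supersolution (ρ := ρ) (ρ₁ := max ρ₀ ρ₂) hv hv2
      (fun y hy => (hPc y hy).continuousAt.continuousWithinAt)
      (fun y hy => (hPc y (le_of_lt hy)).contDiffWithinAt) (fun y hy => hP0 y hy) (fun y hy => ?_)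
      (fun y hy => ?_) (fun y hy hy' => ?_) x hx
    · have hy' : ρ < ‖y‖ := hy
      have hyp := hρ.trans hy'
      have h1 := ou_exp_normSq_lt y (hx0 hy'.le)
      have h2 := hE y hy'
      have h3 : 0 ≤ a / ‖y‖ ^ 3 := by positivity
      have h4 : c * ((a - 1) / ‖y‖) = 8 * Real.exp 6 / ‖y‖ := by
        rw [hc]; field_simp
      have h5 : M / ‖y‖ ≤ K * ((a - 1) / ‖y‖) := by
        rw [← mul_div_assoc]; gcongr
      rw [hou y hy'.le, ou_barrier a (hx0 hy'.le), neg_div]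
      have h6 : 0 ≤ (K + ε * c) * (a / ‖y‖ ^ 3) := by positivity
      have h7 := mul_lt_mul_of_pos_left h1 hε
      rw [← h4] at h7
      simp only [hG]
      linarith
    · refine (hb y hy).trans ?_
      have h1 := hbar0 hy.ge
      have h2 := Real.exp_pos (3 / 16 * ‖y‖ ^ 2)
      have h3 : 0 ≤ ε * c * barrier a y := by positivity
      have h4 : 0 < ε * G y := by positivity
      linarith
    · have h1 := hfar y ((le_max_left _ _).trans hy)
      have h2 := hρ₂ _ ((le_max_right _ _).trans hy)
      have h3 := hbar0 hy'
      have h4 : 0 ≤ (K + ε * c) * barrier a y := by positivity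
      have h5 := le_abs_self (v y)
      simp only [hG]
      linarith
  have hlim : Tendsto (fun ε : ℝ => (K + ε * c) * barrier a x + ε * G x) (𝓝[>] 0)
      (𝓝 ((K + 0 * c) * barrier a x + 0 * G x)) :=
    (Continuous.tendsto (by fun_prop) 0).mono_left nhdsWithin_le_nhds
  have := ge_of_tendsto hlim (eventually_mem_nhdsWithin.mono fun ε hε => key ε hε)
  simpa using this

lemma abs_le_barrier {a ρ M K B : ℝ} {v : Plane → ℝ} (ha : 1 < a) (hρ : 0 < ρ) (haρ : a ≤ ρ ^ 2)
    (hK : 0 ≤ K) (hMK : M ≤ K * (a - 1)) (hv : ContinuousOn v (exteriorDomain ρ))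
    (hv2 : ContDiffOn ℝ 2 v (exteriorInterior ρ)) (hE : ∀ x, ρ < ‖x‖ → |ou v x| ≤ M / ‖x‖)
    (hb : ∀ x, ‖x‖ = ρ → |v x| ≤ K * barrier a x) {ρ₀ : ℝ}
    (hfar : ∀ x, ρ₀ ≤ ‖x‖ → |v x| ≤ B * Real.exp (5 / 32 * ‖x‖ ^ 2)) (x : Plane)
    (hx : ρ ≤ ‖x‖) : |v x| ≤ K * barrier a x := by
  rw [abs_le']
  refine ⟨le_barrier ha hρ haρ hK hMK hv hv2 hE (fun y hy => (le_abs_self _).trans (hb y hy))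
    hfar x hx, le_barrier (v := fun y => -v y) (ρ₀ := ρ₀) (B := B) ha hρ haρ hK hMK hv.neg hv2.neg (fun y hy => ?_)
    (fun y hy => (neg_le_abs _).trans (hb y hy)) (fun y hy => ?_) x hx⟩
  · rw [ou_neg, abs_neg]; exact hE y hy
  · rw [abs_neg]; exact hfar y hy

/-! ### From bounds near the boundary to weighted bounds -/

/-- Bounds for the two parts of the homogeneous norm, in the interior of the exterior domain. -/
structure HomBound (α R M : ℝ) (f : Plane → ℝ) : Prop where
  sup : ∀ x, R < ‖x‖ → |f x| ≤ M * ‖x‖⁻¹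
  holder : ∀ x y, R < ‖x‖ → R < ‖y‖ →
    |f x - f y| ≤ M * (‖x‖ ^ (-1 - α) + ‖y‖ ^ (-1 - α)) * ‖x - y‖ ^ α

/-- A bound for the unweighted `C^{2,α}` norm on the annulus `R < |x| ≤ R + 3`. -/
structure AnnulusBound (α R M : ℝ) (v : Plane → ℝ) : Prop where
  value : ∀ x, R < ‖x‖ → ‖x‖ ≤ R + 3 → |v x| ≤ M
  grad : ∀ i x, R < ‖x‖ → ‖x‖ ≤ R + 3 → |pd i v x| ≤ M
  hess : ∀ i j x, R < ‖x‖ → ‖x‖ ≤ R + 3 → |pd j (pd i v) x| ≤ M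
  holder : ∀ i j x y, R < ‖x‖ → ‖x‖ ≤ R + 3 → R < ‖y‖ → ‖y‖ ≤ R + 3 →
    |pd j (pd i v) x - pd j (pd i v) y| ≤ M * ‖x - y‖ ^ α

lemma exists_lipschitz_bound {f : Plane → ℝ} (hf : ContDiff ℝ 1 f) (ρ : ℝ) : ∃ L : ℝ, 0 ≤ L ∧
    ∀ x y, ‖x‖ ≤ ρ → ‖y‖ ≤ ρ → |f x| ≤ L ∧ |f x - f y| ≤ L * ‖x - y‖ := by
  have hc := isCompact_closedBall (0 : Plane) ρ
  obtain ⟨A, hA⟩ := hc.exists_bound_of_continuousOn hf.continuous.continuousOn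
  obtain ⟨B, hB⟩ := hc.exists_bound_of_continuousOn
    (hf.continuous_fderiv (by norm_num)).continuousOn
  refine ⟨|A| + |B|, by positivity, fun x y hx hy => ?_⟩
  rw [← mem_closedBall_zero_iff] at hx hy
  constructor
  · have := hA x hx
    rw [Real.norm_eq_abs] at this
    linarith [le_abs_self A, abs_nonneg B]
  · have h := (convex_closedBall (0 : Plane) ρ).norm_image_sub_le_of_norm_fderiv_le (𝕜 := ℝ)
      (fun z _ => hf.differentiable (by norm_num) z) hB hy hx
    rw [Real.norm_eq_abs] at h
    refine h.trans ?_
    gcongr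
    linarith [le_abs_self B, abs_nonneg A]

lemma abs_mul_sub_mul_le {a a' b b' A A' B B' : ℝ} (ha : |a| ≤ A) (hb' : |b'| ≤ B)
    (hd : |a - a'| ≤ A') (hd' : |b - b'| ≤ B') : |a * b - a' * b'| ≤ A * B' + A' * B := by
  have h : a * b - a' * b' = a * (b - b') + (a - a') * b' := by ring
  rw [h]
  refine (abs_add_le _ _).trans ?_
  rw [abs_mul, abs_mul]
  have hA := (abs_nonneg a).trans ha
  have hA' := (abs_nonneg _).trans hd
  gcongr

lemma abs_add_two_mul_add_le {a b b' c A B C : ℝ} (ha : |a| ≤ A) (hb : |b| ≤ B) (hb' : |b'| ≤ B)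
    (hc : |c| ≤ C) : |a + 2 * (b + b') + c| ≤ A + 4 * B + C := by
  rw [abs_le] at *
  constructor <;> linarith [ha.1, ha.2, hb.1, hb.2, hb'.1, hb'.2, hc.1, hc.2]

lemma inv_sq_le_rpow {α ρ t : ℝ} (hα1 : α < 1) (ht : 0 < t) (hα : 0 < α) (hρ : 1 ≤ ρ) (htρ : t ≤ ρ) :
    (ρ ^ 2)⁻¹ ≤ t ^ (-1 - α) := by
  calc (ρ ^ 2)⁻¹ = ρ ^ (-2 : ℝ) := by
        rw [Real.rpow_neg (by linarith), Real.rpow_two]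
    _ ≤ ρ ^ (-1 - α) := Real.rpow_le_rpow_of_exponent_le hρ (by linarith)
    _ ≤ t ^ (-1 - α) := Real.rpow_le_rpow_of_nonpos ht htρ (by linarith)

/-- Away from the origin the homogeneous weight and `wt` are comparable. The latter is needed
because the whole-plane estimate also sees points near the origin. -/
lemma rpow_le_mul_wt {α R : ℝ} (hα : 0 < α) (hα1 : α < 1) (hR : 0 < R) {x : Plane} (hx : R ≤ ‖x‖) :
    ‖x‖ ^ (-1 - α) ≤ (max 1 R⁻¹) ^ 2 * wt α x := by
  set k := max 1 R⁻¹ with hk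
  have hk1 : 1 ≤ k := le_max_left _ _
  have hx0 : 0 < ‖x‖ := hR.trans_le hx
  have h1 : max 1 ‖x‖ ≤ k * ‖x‖ := by
    refine max_le ?_ (le_mul_of_one_le_left hx0.le hk1)
    calc (1 : ℝ) = R⁻¹ * R := by field_simp
      _ ≤ k * ‖x‖ := by gcongr; exact le_max_right _ _
  have h2 : (k * ‖x‖) ^ (-1 - α) ≤ wt α x :=
    Real.rpow_le_rpow_of_nonpos (by positivity) h1 (by linarith)
  rw [Real.mul_rpow (by positivity) hx0.le] at h2
  have h3 := inv_sq_le_rpow hα1 (by linarith : 0 < k) hα hk1 le_rfl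
  have h4 : (k ^ 2)⁻¹ * ‖x‖ ^ (-1 - α) ≤ wt α x := (by gcongr : _ ≤ _).trans h2
  rwa [inv_mul_le_iff₀ (by positivity)] at h4

lemma le_rpow_of_le_one {α t : ℝ} (hα1 : α < 1) (ht : 0 ≤ t) (ht1 : t ≤ 1) : t ≤ t ^ α := by
  rcases ht.eq_or_lt with rfl | h
  · exact Real.rpow_nonneg le_rfl _
  · calc t = t ^ (1 : ℝ) := (Real.rpow_one t).symm
      _ ≤ t ^ α := Real.rpow_le_rpow_of_exponent_ge h ht1 hα1.le

set_option maxHeartbeats 1000000 in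
/-- The source of the cut off solution. -/
lemma exists_cutoff_source_bound {α R : ℝ} (hα : 0 < α) (hα1 : α < 1) (hR : 0 < R) {χ : Plane → ℝ}
    (hχ : ContDiff ℝ ∞ χ) (hχ0 : ∀ x, ‖x‖ ≤ R + 1 / 4 → χ x = 0)
    (hχ1 : ∀ x, R + 1 ≤ ‖x‖ → χ x = 1) : ∃ C : ℝ, 0 < C ∧ ∀ (v : Plane → ℝ) (M : ℝ), 0 ≤ M →
      ContDiffOn ℝ 2 v (exteriorInterior R) → HomBound α R M (ou v) → AnnulusBound α R M v →
      HomHolder α (C * M) (ou fun x => χ x * v x) ∧ ∀ x, |ou (fun x => χ x * v x) x| ≤ C * M := by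
  set g : Plane → ℝ := fun x => lap χ x - 1 / 2 * ∑ i, x i * pd i χ x with hg_def
  have hp : ∀ i, ContDiff ℝ ∞ (pd i χ) := contDiff_infty_pd hχ
  have hgs : ContDiff ℝ 1 g := by
    have h1 : ContDiff ℝ 1 (lap χ) := ContDiff.sum fun i _ =>
      (contDiff_infty_pd (hp i) i).of_le (by norm_cast)
    refine h1.sub (contDiff_const.mul (ContDiff.sum fun i _ => (contDiff_coord i).mul
      ((hp i).of_le (by norm_cast))))
  obtain ⟨Lc, hLc0, hLc⟩ := exists_lipschitz_bound
    (hχ.of_le (by norm_cast) : ContDiff ℝ 1 χ) (R + 3)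
  obtain ⟨Lg, hLg0, hLg⟩ := exists_lipschitz_bound hgs (R + 3)
  have hLp : ∀ i, ∃ L : ℝ, 0 ≤ L ∧ ∀ x y, ‖x‖ ≤ R + 3 → ‖y‖ ≤ R + 3 → |pd i χ x| ≤ L ∧
      |pd i χ x - pd i χ y| ≤ L * ‖x - y‖ := fun i =>
    exists_lipschitz_bound ((hp i).of_le (by norm_cast)) (R + 3)
  choose Lp hLp0 hLp using hLp
  set L := Lc + Lg + Lp 0 + Lp 1 with hL
  have hL0 : 0 ≤ L := by have := hLp0 0; have := hLp0 1; positivity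
  have hle : Lc ≤ L ∧ Lg ≤ L ∧ ∀ i, Lp i ≤ L := by
    have h0 := hLp0 0
    have h1 := hLp0 1
    refine ⟨by linarith, by linarith, fun i => ?_⟩
    fin_cases i
    · simp only [Fin.zero_eta]; linarith
    · simp only [Fin.mk_one]; linarith
  set Q := R⁻¹ + 2 * R ^ (-1 - α) + 1 with hQ
  have hQ0 : 0 < Q := by positivity
  -- bounds on the unit scale
  set S := L * Q + 5 * L + R⁻¹ with hS
  have hS0 : 0 < S := by positivity
  set W := L * Q + L * Q + 15 * L with hW
  have hW0 : 0 ≤ W := by positivity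
  -- `W` serves pairs closer than `1/8`; `16 S` serves the others, where the difference is at most
  -- `2 S M` and `|x-y| ^ α ≥ 1/8`. The factor `(R + 3) ^ 2` in `C` then comes from the lower bound
  -- for the weight near the disk.
  set C₀ := 16 * S + W + 1 with hC₀
  set C := (R + 3) ^ 2 * C₀ + (max 1 R⁻¹) ^ 2 with hC
  have hC₀0 : 0 < C₀ := by positivity
  have hRR : 1 ≤ (R + 3) ^ 2 := by nlinarith
  refine ⟨C, by positivity, fun v M hM hv hE hA => ?_⟩
  have hvat : ∀ x, R < ‖x‖ → ContDiffAt ℝ 2 v x := fun x hx =>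
    hv.contDiffAt ((isOpen_exteriorInterior R).mem_nhds hx)
  have hform : ∀ x, R < ‖x‖ → ou (fun x => χ x * v x) x =
      χ x * ou v x + 2 * (∑ i, pd i χ x * pd i v x) + v x * g x := fun x hx =>
    ou_mul (contDiff_two_of_infty hχ).contDiffAt (hvat x hx)
  have hfar : ∀ x, R + 1 < ‖x‖ → ou (fun x => χ x * v x) x = ou v x := fun x hx => by
    refine ou_congr ?_
    filter_upwards [(continuous_norm.tendsto x).eventually (lt_mem_nhds hx)] with y hy
    rw [hχ1 y (le_of_lt hy), one_mul]
  have hzero : ∀ x, ‖x‖ < R + 1 / 4 → ou (fun x => χ x * v x) x = 0 := fun x hx => by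
    have h1 : (fun x => χ x * v x) =ᶠ[𝓝 x] fun _ => 0 := by
      filter_upwards [(continuous_norm.tendsto x).eventually (gt_mem_nhds hx)] with y hy
      rw [hχ0 y (le_of_lt hy), zero_mul]
    rw [ou_congr h1]
    have h4 : ∀ i, pd i (fun _ : Plane => (0 : ℝ)) = fun _ => 0 := fun i => funext (pd_const 0 i)
    simp [ou, lap, h4]
  have hEM : ∀ x, R < ‖x‖ → |ou v x| ≤ Q * M := fun x hx => by
    refine (hE.sup x hx).trans ?_
    rw [mul_comm]
    have : ‖x‖⁻¹ ≤ R⁻¹ := by gcongr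
    have h2 : 0 ≤ R ^ (-1 - α) := by positivity
    gcongr
    linarith
  have hsup : ∀ x, |ou (fun x => χ x * v x) x| ≤ S * M := by
    intro x
    by_cases hx : R < ‖x‖
    · by_cases hx3 : ‖x‖ ≤ R + 3
      · rw [hform x hx, Fin.sum_univ_two]
        have a1 : |χ x * ou v x| ≤ L * (Q * M) := by
          rw [abs_mul]; gcongr
          exacts [(hLc x x hx3 hx3).1.trans hle.1, hEM x hx]
        have a2 : ∀ i, |pd i χ x * pd i v x| ≤ L * M := fun i => by
          rw [abs_mul]; gcongr
          exacts [(hLp i x x hx3 hx3).1.trans (hle.2.2 i), hA.grad i x hx hx3]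
        have a3 : |v x * g x| ≤ M * L := by
          rw [abs_mul]; gcongr
          exacts [hA.value x hx hx3, (hLg x x hx3 hx3).1.trans hle.2.1]
        have hRM : 0 ≤ R⁻¹ * M := by positivity
        calc _ ≤ L * (Q * M) + 4 * (L * M) + M * L := abs_add_two_mul_add_le a1 (a2 0) (a2 1) a3
          _ = (L * Q + 5 * L) * M := by ring
          _ ≤ S * M := by
            gcongr
            have : 0 < R⁻¹ := by positivity
            linarith
      · rw [hfar x (by linarith [not_le.1 hx3])]
        refine (hE.sup x hx).trans ?_
        rw [mul_comm]
        have : ‖x‖⁻¹ ≤ R⁻¹ := by gcongr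
        have : 0 ≤ L * Q := by positivity
        gcongr
        linarith
    · rw [hzero x (by linarith [not_lt.1 hx]), abs_zero]
      positivity
  have hloc : ∀ x y, ‖x‖ ≤ R + 2 → ‖y‖ ≤ R + 2 → |ou (fun x => χ x * v x) x -
      ou (fun x => χ x * v x) y| ≤ C₀ * M * ‖x - y‖ ^ α := by
    intro x y hx hy
    by_cases hd : ‖x - y‖ < 1 / 8
    · by_cases h0 : ‖x‖ ≤ R + 1 / 8 ∨ ‖y‖ ≤ R + 1 / 8
      · have n1 := norm_sub_norm_le x y
        have n2 := norm_sub_norm_le y x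
        rw [norm_sub_rev] at n2
        have hxy : ‖x‖ < R + 1 / 4 ∧ ‖y‖ < R + 1 / 4 := by
          rcases h0 with h | h <;> constructor <;> linarith
        rw [hzero x hxy.1, hzero y hxy.2, sub_zero, abs_zero]
        positivity
      · obtain ⟨hx1, hy1⟩ := not_or.1 h0
        rw [not_le] at hx1 hy1
        have hball : ∀ z ∈ Metric.ball x (1 / 8 : ℝ), R < ‖z‖ ∧ ‖z‖ ≤ R + 3 := fun z hz => by
          obtain ⟨a, b⟩ := norm_bounds_of_mem_closedBall (Metric.ball_subset_closedBall hz)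
          constructor <;> linarith
        have hxb : x ∈ Metric.ball x (1 / 8 : ℝ) := Metric.mem_ball_self (by norm_num)
        have hyb : y ∈ Metric.ball x (1 / 8 : ℝ) := by
          rwa [Metric.mem_ball, dist_comm, dist_eq_norm]
        have hlip : ∀ f : Plane → ℝ, (∀ z ∈ Metric.ball x (1 / 8 : ℝ), DifferentiableAt ℝ f z) →
            (∀ z ∈ Metric.ball x (1 / 8 : ℝ), ∀ i, |pd i f z| ≤ M) →
            |f x - f y| ≤ 2 * M * ‖x - y‖ := fun f hf hb => by
          have := (convex_ball x (1 / 8 : ℝ)).norm_image_sub_le_of_norm_fderiv_le (𝕜 := ℝ) hf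
            (fun z hz => norm_fderiv_le_of_pd (hb z hz)) hyb hxb
          rwa [Real.norm_eq_abs] at this
        have hbx := hball x hxb
        have hby := hball y hyb
        have hdn := norm_nonneg (x - y)
        have hd1 : ‖x - y‖ ≤ ‖x - y‖ ^ α := le_rpow_of_le_one hα1 hdn (by linarith)
        have hvl := hlip v (fun z hz => (hvat z (hball z hz).1).differentiableAt (by norm_num))
          fun z hz i => hA.grad i z (hball z hz).1 (hball z hz).2
        have hpl : ∀ i, |pd i v x - pd i v y| ≤ 2 * M * ‖x - y‖ := fun i =>
          hlip (pd i v) (fun z hz => (contDiffAt_pd (hvat z (hball z hz).1) (m := 1) (by norm_num)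
            i).differentiableAt (by norm_num)) fun z hz j => hA.hess i j z (hball z hz).1 (hball z hz).2
        have hEl : |ou v x - ou v y| ≤ Q * M * ‖x - y‖ ^ α := by
          refine (hE.holder x y hbx.1 hby.1).trans ?_
          have e1 : ‖x‖ ^ (-1 - α) ≤ R ^ (-1 - α) :=
            Real.rpow_le_rpow_of_nonpos hR hbx.1.le (by linarith)
          have e2 : ‖y‖ ^ (-1 - α) ≤ R ^ (-1 - α) :=
            Real.rpow_le_rpow_of_nonpos hR hby.1.le (by linarith)
          have e3 : 0 < R⁻¹ := by positivity
          rw [mul_comm M]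
          gcongr
          linarith
        set d := ‖x - y‖
        set D := d ^ α
        have hD0 : 0 ≤ D := hdn.trans hd1
        have mono : ∀ {t : ℝ}, 0 ≤ t → t * d ≤ t * D := fun ht => mul_le_mul_of_nonneg_left hd1 ht
        have c1 : |χ x * ou v x - χ y * ou v y| ≤ L * (Q * M * D) + L * D * (Q * M) :=
          abs_mul_sub_mul_le ((hLc x y hbx.2 hby.2).1.trans hle.1) (hEM y hby.1)
            ((hLc x y hbx.2 hby.2).2.trans ((mul_le_mul_of_nonneg_right hle.1 hdn).trans (mono hL0))) hEl
        have c2 : ∀ i, |pd i χ x * pd i v x - pd i χ y * pd i v y| ≤ L * (2 * M * D) + L * D * M :=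
          fun i => abs_mul_sub_mul_le ((hLp i x y hbx.2 hby.2).1.trans (hle.2.2 i))
            (hA.grad i y hby.1 hby.2) ((hLp i x y hbx.2 hby.2).2.trans
              ((mul_le_mul_of_nonneg_right (hle.2.2 i) hdn).trans (mono hL0)))
            ((hpl i).trans (mono (by positivity)))
        have c3 : |v x * g x - v y * g y| ≤ M * (L * D) + 2 * M * D * L :=
          abs_mul_sub_mul_le (hA.value x hbx.1 hbx.2) ((hLg y y hby.2 hby.2).1.trans hle.2.1)
            (hvl.trans (mono (by positivity))) ((hLg x y hbx.2 hby.2).2.trans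
              ((mul_le_mul_of_nonneg_right hle.2.1 hdn).trans (mono hL0)))
        rw [hform x hbx.1, hform y hby.1, Fin.sum_univ_two, Fin.sum_univ_two]
        calc _ = |(χ x * ou v x - χ y * ou v y) + 2 * ((pd 0 χ x * pd 0 v x - pd 0 χ y * pd 0 v y) +
              (pd 1 χ x * pd 1 v x - pd 1 χ y * pd 1 v y)) + (v x * g x - v y * g y)| := by
              congr 1; ring
          _ ≤ L * (Q * M * D) + L * D * (Q * M) + 4 * (L * (2 * M * D) + L * D * M) +
              (M * (L * D) + 2 * M * D * L) := abs_add_two_mul_add_le c1 (c2 0) (c2 1) c3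
          _ = W * M * D := by rw [hW]; ring
          _ ≤ C₀ * M * D := by
            gcongr
            rw [hC₀]; linarith
    · have hd := not_lt.1 hd
      have h1 : (1 / 8 : ℝ) ≤ ‖x - y‖ ^ α :=
        (le_rpow_of_le_one hα1 (by norm_num) (by norm_num)).trans
          (Real.rpow_le_rpow (by norm_num) hd hα.le)
      have h2 := abs_sub (ou (fun x => χ x * v x) x) (ou (fun x => χ x * v x) y)
      have h3 := hsup x
      have h4 := hsup y
      have h5 : C₀ * M * (1 / 8) ≤ C₀ * M * ‖x - y‖ ^ α := by gcongr
      have h6 : 16 * S * M ≤ C₀ * M := by gcongr; rw [hC₀]; linarith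
      linarith
  have hwt : ∀ x : Plane, ‖x‖ ≤ R + 3 → 1 ≤ (R + 3) ^ 2 * wt α x := by
    intro x hx
    have := inv_sq_le_rpow hα1 (by positivity : 0 < max 1 ‖x‖) hα (by linarith : 1 ≤ R + 3)
      (max_le (by linarith) hx)
    rw [inv_le_iff_one_le_mul₀ (by positivity), mul_comm] at this
    exact this
  have hfin : ∀ x y, ‖x‖ ≤ R + 1 → |ou (fun x => χ x * v x) x - ou (fun x => χ x * v x) y| ≤
      C * M * (wt α x + wt α y) * ‖x - y‖ ^ α := by
    intro x y hx
    have hy0 := wt_pos α y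
    have hx1 := hwt x (by linarith)
    have key : C₀ * M * ‖x - y‖ ^ α ≤ C * M * (wt α x + wt α y) * ‖x - y‖ ^ α := by
      refine mul_le_mul_of_nonneg_right ?_ (by positivity)
      calc C₀ * M ≤ C₀ * M * ((R + 3) ^ 2 * wt α x) := le_mul_of_one_le_right (by positivity) hx1
        _ = ((R + 3) ^ 2 * C₀) * M * wt α x := by ring
        _ ≤ C * M * (wt α x + wt α y) := by
          gcongr
          · have := wt_pos α x; positivity
          · rw [hC]; linarith [sq_nonneg (max 1 R⁻¹)]
          · linarith
    refine le_trans ?_ key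
    by_cases hy : ‖y‖ ≤ R + 2
    · exact hloc x y (by linarith) hy
    · have n2 := norm_sub_norm_le y x
      rw [norm_sub_rev] at n2
      have h1 : 1 ≤ ‖x - y‖ ^ α := Real.one_le_rpow (by linarith [not_le.1 hy]) hα.le
      have h2 := abs_sub (ou (fun x => χ x * v x) x) (ou (fun x => χ x * v x) y)
      have h3 := hsup x
      have h4 := hsup y
      have h5 : C₀ * M * 1 ≤ C₀ * M * ‖x - y‖ ^ α := by gcongr
      have h6 : 16 * S * M ≤ C₀ * M := by gcongr; rw [hC₀]; linarith
      have h7 : 0 ≤ S * M := by positivity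
      linarith
  refine ⟨fun x y => ?_, fun x => (hsup x).trans ?_⟩
  · by_cases hx : ‖x‖ ≤ R + 1
    · exact hfin x y hx
    by_cases hy : ‖y‖ ≤ R + 1
    · rw [abs_sub_comm, norm_sub_rev, add_comm (wt α x)]
      exact hfin y x hy
    have hx := not_le.1 hx
    have hy := not_le.1 hy
    rw [hfar x hx, hfar y hy]
    refine (hE.holder x y (by linarith) (by linarith)).trans ?_
    have h1 := rpow_le_mul_wt hα hα1 hR (by linarith : R ≤ ‖x‖)
    have h2 := rpow_le_mul_wt hα hα1 hR (by linarith : R ≤ ‖y‖)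
    have h3 := wt_pos α x
    have h4 := wt_pos α y
    gcongr ?_ * _
    calc M * (‖x‖ ^ (-1 - α) + ‖y‖ ^ (-1 - α))
        ≤ M * ((max 1 R⁻¹) ^ 2 * wt α x + (max 1 R⁻¹) ^ 2 * wt α y) := by gcongr
      _ = (max 1 R⁻¹) ^ 2 * M * (wt α x + wt α y) := by ring
      _ ≤ C * M * (wt α x + wt α y) := by
        gcongr
        rw [hC]
        have : 0 ≤ (R + 3) ^ 2 * C₀ := by positivity
        linarith
  · gcongr
    have h1 : C₀ ≤ (R + 3) ^ 2 * C₀ := le_mul_of_one_le_left hC₀0.le hRR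
    rw [hC]
    linarith [sq_nonneg (max 1 R⁻¹)]

/-- The annulus bound rules for `|x| ≤ R + 3`, the whole-plane estimate of the cut off function for
`|x| > R + 1`. A pair contained in neither region is at distance at least one, so the pointwise
bounds suffice for it. The growth hypothesis enters only qualitatively: `B` does not affect the
constant. -/
lemma exists_homBound {α R : ℝ} (hα : 0 < α) (hα1 : α < 1) (hR : 0 < R) (i j : Fin 2) :
    ∃ C : ℝ, 0 < C ∧ ∀ (v : Plane → ℝ) (M : ℝ), 0 ≤ M → ContDiffOn ℝ 2 v (exteriorInterior R) →
      HomBound α R M (ou v) → AnnulusBound α R M v →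
      (∃ B : ℝ, 0 ≤ B ∧ ∀ x, R + 1 ≤ ‖x‖ → |v x| ≤ B * Real.exp (5 / 32 * ‖x‖ ^ 2) ∧
        ∀ i, |pd i v x| ≤ B * Real.exp (5 / 32 * ‖x‖ ^ 2)) →
      HomBound α R (C * M) (pd j (pd i v)) := by
  obtain ⟨χ, hχ, hχ01, hχ0, hχ1⟩ := exists_exterior_cutoff (ρ₀ := R + 1 / 4) (ρ₁ := R + 1)
    (by linarith) (by linarith)
  obtain ⟨C₁, hC₁, hsrc⟩ := exists_cutoff_source_bound hα hα1 hR hχ hχ0 hχ1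
  obtain ⟨C₂, hC₂, hest⟩ := exists_far_estimate hα hα1 i j
  set C₃ := C₂ * C₁ + (R + 1) with hC₃
  have hC₃0 : 0 < C₃ := by positivity
  have hR1 : 1 ≤ (R + 1) ^ 2 := by nlinarith
  set C₄ := C₃ + (R + 1) ^ 2 * (1 + 2 * C₃ * R⁻¹) with hC₄
  have hC₄0 : 0 < C₄ := by positivity
  refine ⟨C₄, hC₄0, fun v M hM hv hE hA ⟨B, hB, hgrow⟩ => ?_⟩
  obtain ⟨s1, s2⟩ := hsrc v M hM hv hE hA
  set w : Plane → ℝ := fun x => χ x * v x with hw_def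
  have hw : ContDiff ℝ 2 w := contDiff_cutoff_mul (by linarith) hχ hχ0 hv
  have hev : ∀ x, R + 1 < ‖x‖ → w =ᶠ[𝓝 x] v := fun x hx => by
    filter_upwards [(continuous_norm.tendsto x).eventually (lt_mem_nhds hx)] with y hy
    rw [hw_def]
    simp only [hχ1 y (le_of_lt hy), one_mul]
  have hc := isCompact_closedBall (0 : Plane) (R + 1)
  obtain ⟨B₀, hB₀⟩ := hc.exists_bound_of_continuousOn hw.continuous.continuousOn
  have hB₁ : ∀ k, ∃ B₁, ∀ x ∈ Metric.closedBall (0 : Plane) (R + 1), ‖pd k w x‖ ≤ B₁ := fun k =>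
    hc.exists_bound_of_continuousOn (contDiff_pd hw (m := 1) (by norm_num) k).continuous.continuousOn
  choose B₁ hB₁ using hB₁
  set B' := |B₀| + |B₁ 0| + |B₁ 1| + B + C₁ * M with hB'
  have hB'0 : 0 ≤ B' := by positivity
  have hB₁' : ∀ k, |B₁ k| ≤ |B₁ 0| + |B₁ 1| := fun k => by
    have := abs_nonneg (B₁ 0)
    have := abs_nonneg (B₁ 1)
    fin_cases k
    · simp only [Fin.zero_eta]; linarith
    · simp only [Fin.mk_one]; linarith
  have p0 := abs_nonneg B₀
  have p1 := abs_nonneg (B₁ 0)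
  have p2 := abs_nonneg (B₁ 1)
  have p3 : 0 ≤ C₁ * M := by positivity
  have hexp : ∀ x : Plane, 1 ≤ Real.exp (3 / 16 * ‖x‖ ^ 2) := fun x => Real.one_le_exp (by positivity)
  have hexp2 : ∀ x : Plane, Real.exp (5 / 32 * ‖x‖ ^ 2) ≤ Real.exp (3 / 16 * ‖x‖ ^ 2) := fun x =>
    Real.exp_le_exp.2 (by nlinarith [sq_nonneg ‖x‖])
  have hle1 : ∀ {t c : ℝ} (x : Plane), t ≤ c → c ≤ B' → t ≤ B' * Real.exp (3 / 16 * ‖x‖ ^ 2) :=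
    fun x h1 h2 => (h1.trans h2).trans (le_mul_of_one_le_right hB'0 (hexp x))
  have hle2 : ∀ {t : ℝ} (x : Plane), t ≤ B * Real.exp (5 / 32 * ‖x‖ ^ 2) →
      t ≤ B' * Real.exp (3 / 16 * ‖x‖ ^ 2) := fun x h => h.trans
    (mul_le_mul (by linarith) (hexp2 x) (Real.exp_pos _).le hB'0)
  obtain ⟨f1, f2⟩ := hest w (C₁ * M) B' p3 hB'0 hw s1 (by
    intro x
    by_cases hx : ‖x‖ ≤ R + 1
    · have hx' : x ∈ Metric.closedBall (0 : Plane) (R + 1) := by rwa [mem_closedBall_zero_iff]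
      exact hle1 x ((hB₀ x hx').trans (le_abs_self _)) (by linarith)
    · rw [(hev x (not_le.1 hx)).self_of_nhds]
      exact hle2 x (hgrow x (not_le.1 hx).le).1) (by
    intro k x
    by_cases hx : ‖x‖ ≤ R + 1
    · have hx' : x ∈ Metric.closedBall (0 : Plane) (R + 1) := by rwa [mem_closedBall_zero_iff]
      exact hle1 x ((hB₁ k x hx').trans (le_abs_self _)) (by linarith [hB₁' k])
    · rw [pd_congr (hev x (not_le.1 hx))]
      exact hle2 x ((hgrow x (not_le.1 hx).le).2 k)) (fun x => hle1 x (s2 x) (by linarith))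
  have hDw : ∀ x, R + 1 < ‖x‖ → pd j (pd i w) x = pd j (pd i v) x := fun x hx =>
    pd_congr (pd_eventuallyEq (hev x hx) i) j
  have hx0 : ∀ {x : Plane}, R < ‖x‖ → x ≠ 0 := fun hx => norm_pos_iff.1 (hR.trans hx)
  have hsup : ∀ x, R < ‖x‖ → |pd j (pd i v) x| ≤ C₃ * M * ‖x‖⁻¹ := by
    intro x hx
    have hxp := hR.trans hx
    by_cases hx1 : ‖x‖ ≤ R + 1
    · refine (hA.hess i j x hx (by linarith)).trans ?_
      rw [le_mul_inv_iff₀ hxp, mul_comm]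
      gcongr
      have : 0 ≤ C₂ * C₁ := by positivity
      linarith
    · rw [← hDw x (not_le.1 hx1)]
      refine (f1 x (hx0 hx)).trans ?_
      rw [← mul_assoc]
      gcongr
      linarith
  have hfin : ∀ x y, R < ‖x‖ → R < ‖y‖ → ‖x‖ ≤ R + 1 → |pd j (pd i v) x - pd j (pd i v) y| ≤
      C₄ * M * (‖x‖ ^ (-1 - α) + ‖y‖ ^ (-1 - α)) * ‖x - y‖ ^ α := by
    intro x y hx hy hx1
    have h1 := inv_sq_le_rpow hα1 (hR.trans hx) hα (by linarith : 1 ≤ R + 1) hx1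
    rw [inv_le_iff_one_le_mul₀' (by positivity)] at h1
    have hyp : 0 ≤ ‖y‖ ^ (-1 - α) := by positivity
    have key : (1 + 2 * C₃ * R⁻¹) * M * ‖x - y‖ ^ α ≤
        C₄ * M * (‖x‖ ^ (-1 - α) + ‖y‖ ^ (-1 - α)) * ‖x - y‖ ^ α := by
      refine mul_le_mul_of_nonneg_right ?_ (by positivity)
      calc (1 + 2 * C₃ * R⁻¹) * M
          ≤ (1 + 2 * C₃ * R⁻¹) * M * ((R + 1) ^ 2 * ‖x‖ ^ (-1 - α)) :=
            le_mul_of_one_le_right (by positivity) h1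
        _ = ((R + 1) ^ 2 * (1 + 2 * C₃ * R⁻¹)) * M * ‖x‖ ^ (-1 - α) := by ring
        _ ≤ C₄ * M * (‖x‖ ^ (-1 - α) + ‖y‖ ^ (-1 - α)) := by
          gcongr
          · rw [hC₄]; linarith
          · linarith
    refine le_trans ?_ key
    have hC₃R : 0 ≤ 2 * C₃ * R⁻¹ := by positivity
    by_cases hy3 : ‖y‖ ≤ R + 3
    · refine (hA.holder i j x y hx (by linarith) hy hy3).trans ?_
      gcongr
      nlinarith
    · have n2 := norm_sub_norm_le y x
      rw [norm_sub_rev] at n2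
      have h3 : 1 ≤ ‖x - y‖ ^ α := Real.one_le_rpow (by linarith [not_le.1 hy3]) hα.le
      have h4 := abs_sub (pd j (pd i v) x) (pd j (pd i v) y)
      have h5 : ∀ {z : Plane}, R < ‖z‖ → C₃ * M * ‖z‖⁻¹ ≤ C₃ * M * R⁻¹ := fun hz => by gcongr
      have h6 := (hsup x hx).trans (h5 hx)
      have h7 := (hsup y hy).trans (h5 hy)
      calc _ ≤ 2 * C₃ * R⁻¹ * M * 1 := by linarith
        _ ≤ _ := by gcongr; linarith
  refine ⟨fun x hx => (hsup x hx).trans ?_, fun x y hx hy => ?_⟩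
  · gcongr
    have : 0 ≤ (R + 1) ^ 2 * (1 + 2 * C₃ * R⁻¹) := by positivity
    linarith
  · by_cases hx1 : ‖x‖ ≤ R + 1
    · exact hfin x y hx hy hx1
    by_cases hy1 : ‖y‖ ≤ R + 1
    · rw [abs_sub_comm, norm_sub_rev, add_comm (‖x‖ ^ _)]
      exact hfin y x hy hx hy1
    rw [← hDw x (not_le.1 hx1), ← hDw y (not_le.1 hy1)]
    refine (f2 x y (hx0 hx) (hx0 hy)).trans ?_
    rw [← mul_assoc]
    gcongr
    have : 0 ≤ (R + 1) ^ 2 * (1 + 2 * C₃ * R⁻¹) := by positivity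
    linarith

/-! ### Tangential second derivatives -/

/-- The projection onto the first coordinate axis. -/
def proj₀ (z : Plane) : Plane := z 0 • EuclideanSpace.single 0 1

lemma measurable_proj₀ : Measurable proj₀ :=
  ((contDiff_coord 0 (n := 0)).continuous.smul continuous_const).measurable

lemma norm_proj₀_le (z : Plane) : ‖proj₀ z‖ ≤ ‖z‖ := by
  rw [proj₀, norm_smul]
  simpa using abs_coord_le_norm z 0

lemma norm_sub_proj₀_le (z : Plane) : ‖z - proj₀ z‖ ≤ ‖z‖ := by
  have h : ‖z - proj₀ z‖ ^ 2 ≤ ‖z‖ ^ 2 := by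
    rw [normSq_eq, normSq_eq]
    simp [proj₀]
    positivity
  exact le_of_sq_le_sq h (norm_nonneg _)

lemma integrable_mul_of_bounded {f κ : Plane → ℝ} {m : ℝ} (hf : Measurable f) (hκ : Continuous κ)
    (hκs : HasCompactSupport κ) (hm : ∀ z ∈ tsupport κ, |f z| ≤ m) :
    Integrable fun z => f z * κ z := by
  refine ((hκ.integrable_of_hasCompactSupport hκs).norm.const_mul m).mono'
    (hf.mul hκ.measurable).aestronglyMeasurable (Eventually.of_forall fun z => ?_)
  rw [norm_mul]
  by_cases hz : z ∈ tsupport κ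
  · gcongr
    exact hm z hz
  · simp [image_eq_zero_of_notMem_tsupport hz]

/-- A function of the first coordinate is orthogonal to second partial derivatives. -/
lemma integral_comp_proj₀_mul_pd {f ν : Plane → ℝ} {m : ℝ} (hf : Measurable f)
    (hν : ContDiff ℝ 1 ν) (hνs : HasCompactSupport ν) (hm : ∀ z ∈ tsupport ν, |f (proj₀ z)| ≤ m) :
    ∫ z, f (proj₀ z) * pd 1 ν z = 0 := by
  have hfm := hf.comp measurable_proj₀
  have h := integral_bilinear_hasLineDerivAt_right_eq_neg_left_of_integrable
    (μ := (volume : Measure Plane)) (f := fun z => f (proj₀ z)) (f' := fun _ => 0) (g := ν)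
    (g' := pd 1 ν) (v := EuclideanSpace.single 1 1) (B := ContinuousLinearMap.mul ℝ ℝ) (by simp)
    (integrable_mul_of_bounded hfm (contDiff_pd hν (m := 0) (by norm_num) 1).continuous
      (hasCompactSupport_pd hνs 1) fun z hz => hm z (tsupport_pd_subset 1 ν hz))
    (integrable_mul_of_bounded hfm hν.continuous hνs hm) (fun z _ => by
      have : (fun t : ℝ => f (proj₀ (z + t • EuclideanSpace.single 1 1))) = fun _ => f (proj₀ z) := by
        ext t; simp [proj₀]
      rw [HasLineDerivAt, this]
      exact hasDerivAt_const _ _) (fun z _ =>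
      (hν.differentiable (by norm_num) z).hasFDerivAt.hasLineDerivAt _)
  simpa using h

/-- Hölder continuity in the second variable controls integrals against second partial derivatives. -/
lemma abs_integral_mul_pd_one_le {α m s : ℝ} {f ν : Plane → ℝ} {x : Plane} (hα : 0 < α) (hα1 : α < 1)
    (hs : 0 < s) (hs1 : s ≤ 1) (hf : Measurable f) (hν : ContDiff ℝ 1 ν)
    (hνs : tsupport ν ⊆ Metric.closedBall 0 2) (hfm : ∀ y ∈ Metric.closedBall x 3, |f y| ≤ m)
    (hfα : ∀ y ∈ Metric.closedBall x 3, ∀ y' ∈ Metric.closedBall x 3, y 0 = y' 0 →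
      |f y - f y'| ≤ m * ‖y - y'‖ ^ α) :
    |∫ z, f (x + s • z) * pd 1 ν z| ≤ 2 * m * s ^ α * ∫ z, |pd 1 ν z| := by
  have hm0 : 0 ≤ m := (abs_nonneg _).trans (hfm x (Metric.mem_closedBall_self (by norm_num)))
  have hνc : HasCompactSupport ν :=
    IsCompact.of_isClosed_subset (isCompact_closedBall _ _) (isClosed_tsupport _) hνs
  have hpc : Continuous (pd 1 ν) := (contDiff_pd hν (m := 0) (by norm_num) 1).continuous
  have hpcs := hasCompactSupport_pd hνc 1
  have hball : ∀ z : Plane, ‖z‖ ≤ 2 → x + s • z ∈ Metric.closedBall x 3 := fun z hz => by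
    simp only [Metric.mem_closedBall, dist_eq_norm, add_sub_cancel_left, norm_smul,
      Real.norm_of_nonneg hs.le]
    nlinarith [norm_nonneg z]
  have hz2 : ∀ z ∈ tsupport ν, ‖z‖ ≤ 2 := fun z hz => mem_closedBall_zero_iff.1 (hνs hz)
  have hmeas : Measurable fun z => f (x + s • z) := hf.comp (by fun_prop)
  have h0 := integral_comp_proj₀_mul_pd (f := fun z => f (x + s • z)) (m := m) hmeas hν hνc
    fun z hz => hfm _ (hball _ ((norm_proj₀_le z).trans (hz2 z hz)))
  have i1 := integrable_mul_of_bounded (f := fun z => f (x + s • z)) (m := m) hmeas hpc hpcs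
    fun z hz => hfm _ (hball _ (hz2 z (tsupport_pd_subset 1 ν hz)))
  have i2 := integrable_mul_of_bounded (f := fun z => f (x + s • proj₀ z)) (m := m)
    (hmeas.comp measurable_proj₀) hpc hpcs
    fun z hz => hfm _ (hball _ ((norm_proj₀_le z).trans (hz2 z (tsupport_pd_subset 1 ν hz))))
  -- Subtracting `f` at the projected point costs nothing, since a function of the first coordinate
  -- integrates to zero against `∂_1 ν`. The remaining difference involves two points with the same
  -- first coordinate.
  have h1 : ∫ z, f (x + s • z) * pd 1 ν z =
      ∫ z, (f (x + s • z) - f (x + s • proj₀ z)) * pd 1 ν z := by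
    simp only [sub_mul]
    rw [integral_sub i1 i2, h0, sub_zero]
  rw [h1, ← integral_const_mul, ← Real.norm_eq_abs]
  refine norm_integral_le_of_norm_le
    ((hpc.integrable_of_hasCompactSupport hpcs).abs.const_mul _) (Eventually.of_forall fun z => ?_)
  rw [norm_mul, Real.norm_eq_abs, Real.norm_eq_abs]
  by_cases hz : z ∈ tsupport (pd 1 ν)
  · have hzn := hz2 z (tsupport_pd_subset 1 ν hz)
    gcongr
    refine (hfα _ (hball z hzn) _ (hball _ ((norm_proj₀_le z).trans hzn))
      (by simp [proj₀])).trans ?_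
    have h2 : x + s • z - (x + s • proj₀ z) = s • (z - proj₀ z) := by module
    rw [h2, norm_smul, Real.norm_of_nonneg hs.le, Real.mul_rpow hs.le (norm_nonneg _)]
    have h3 : ‖z - proj₀ z‖ ^ α ≤ 2 := by
      calc ‖z - proj₀ z‖ ^ α ≤ 2 ^ α :=
            Real.rpow_le_rpow (norm_nonneg _) ((norm_sub_proj₀_le z).trans hzn) hα.le
        _ ≤ 2 ^ (1 : ℝ) := Real.rpow_le_rpow_of_exponent_le (by norm_num) hα1.le
        _ = 2 := Real.rpow_one 2
    calc m * (s ^ α * ‖z - proj₀ z‖ ^ α) ≤ m * (s ^ α * 2) := by gcongr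
      _ = 2 * m * s ^ α := by ring
  · simp [image_eq_zero_of_notMem_tsupport hz]

lemma tsupport_translate_subset {κ : Plane → ℝ} (hκs : tsupport κ ⊆ Metric.closedBall 0 1) {a : Plane}
    (ha : ‖a‖ ≤ 1) : tsupport (fun z => κ z - κ (z - a)) ⊆ Metric.closedBall 0 2 := by
  refine closure_minimal (fun z hz => ?_) Metric.isClosed_closedBall
  rw [mem_closedBall_zero_iff]
  by_contra! h
  apply hz
  have h1 : z ∉ tsupport κ := fun h' => by
    have := hκs h'
    rw [mem_closedBall_zero_iff] at this
    linarith
  have h2 : z - a ∉ tsupport κ := fun h' => by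
    have := hκs h'
    rw [mem_closedBall_zero_iff] at this
    linarith [norm_sub_norm_le z a]
  simp [image_eq_zero_of_notMem_tsupport h1, image_eq_zero_of_notMem_tsupport h2]

lemma exists_integral_abs_translate_le {κ : Plane → ℝ} (hκ : ContDiff ℝ 1 κ)
    (hκs : tsupport κ ⊆ Metric.closedBall 0 1) : ∃ L : ℝ, 0 ≤ L ∧ ∀ a : Plane, ‖a‖ ≤ 1 →
      ∫ z, |κ z - κ (z - a)| ≤ L * ‖a‖ := by
  obtain ⟨L, hL, h⟩ := exists_lipschitz_bound hκ 3
  refine ⟨L * volume.real (Metric.closedBall (0 : Plane) 2), by positivity, fun a ha => ?_⟩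
  have hsub := tsupport_translate_subset hκs ha
  have h1 : ∀ z, |κ z - κ (z - a)| ≤
      (Metric.closedBall (0 : Plane) 2).indicator (fun _ => L * ‖a‖) z := by
    intro z
    by_cases hz : z ∈ Metric.closedBall (0 : Plane) 2
    · rw [indicator_of_mem hz]
      rw [mem_closedBall_zero_iff] at hz
      have := (h z (z - a) (by linarith) ((norm_sub_le z a).trans (by linarith))).2
      rwa [sub_sub_cancel] at this
    · rw [indicator_of_notMem hz]
      have : (fun z => κ z - κ (z - a)) z = 0 := image_eq_zero_of_notMem_tsupport
        (f := fun z => κ z - κ (z - a)) fun h' => hz (hsub h')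
      simp only at this
      rw [this, abs_zero]
  have hi : Integrable ((Metric.closedBall (0 : Plane) 2).indicator fun _ : Plane => L * ‖a‖) :=
    (integrable_indicator_iff Metric.isClosed_closedBall.measurableSet).2
      (integrableOn_const measure_closedBall_lt_top.ne)
  refine (integral_mono_of_nonneg (Eventually.of_forall fun z => abs_nonneg _) hi
    (Eventually.of_forall h1)).trans (le_of_eq ?_)
  rw [integral_indicator Metric.isClosed_closedBall.measurableSet, setIntegral_const, smul_eq_mul]
  ring

lemma pd_translate {κ : Plane → ℝ} (hκ : ContDiff ℝ 1 κ) (a : Plane) (i : Fin 2) (z : Plane) :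
    pd i (fun z => κ z - κ (z - a)) z = pd i κ z - pd i κ (z - a) := by
  have hd := hκ.differentiable (by norm_num)
  have h := pd_comp_affine (f := κ) (-a) 1 (z := z) (hd _) i
  have h2 : ∀ z : Plane, -a + (1 : ℝ) • z = z - a := fun z => by module
  simp only [h2, one_mul] at h
  have hd' : DifferentiableAt ℝ (fun z => κ (z - a)) z :=
    (hd _).comp z (by fun_prop : DifferentiableAt ℝ (fun z : Plane => z - a) z)
  rw [pd_sub (hd z) hd', h]

/-- Transfers a change of centre to the kernel, so that smoothness of `κ`, not regularity of `h`,
yields the gain `‖a‖`. -/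
lemma integral_shift_sub {h κ : Plane → ℝ} {x x' a : Plane} {s : ℝ} (ha : x' = x + s • a)
    (h1 : Integrable fun z => h (x + s • z) * κ z) (h2 : Integrable fun z => h (x' + s • z) * κ z) :
    (∫ z, h (x + s • z) * κ z) - ∫ z, h (x' + s • z) * κ z =
      ∫ z, h (x + s • z) * (κ z - κ (z - a)) := by
  have e1 : ∀ z, h (x' + s • (z - a)) * κ (z - a) = h (x + s • z) * κ (z - a) := fun z => by
    congr 2; rw [ha]; module
  have h3 : Integrable fun z => h (x + s • z) * κ (z - a) := by
    have := h2.comp_sub_right a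
    simpa only [e1] using this
  have e2 := integral_sub_right_eq_self (μ := (volume : Measure Plane))
    (fun z => h (x' + s • z) * κ z) a
  simp only [e1] at e2
  rw [← e2, ← integral_sub h1 h3]
  simp only [mul_sub]

/-- Control of a function and of its Hölder seminorm in the second variable on a ball. -/
structure TangentialBound (α m : ℝ) (f : Plane → ℝ) (x : Plane) : Prop where
  sup : ∀ y ∈ Metric.closedBall x 3, |f y| ≤ m
  holder : ∀ y ∈ Metric.closedBall x 3, ∀ y' ∈ Metric.closedBall x 3, y 0 = y' 0 →
    |f y - f y'| ≤ m * ‖y - y'‖ ^ α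

lemma TangentialBound.integrable {α m s : ℝ} {f κ : Plane → ℝ} {x : Plane}
    (h : TangentialBound α m f x) (hf : Measurable f) (hκ : Continuous κ)
    (hκs : tsupport κ ⊆ Metric.closedBall 0 1) (hs : 0 < s) (hs1 : s ≤ 1) :
    Integrable fun z => f (x + s • z) * κ z := by
  refine integrable_mul_of_bounded (f := fun z => f (x + s • z)) (m := m) (hf.comp (by fun_prop)) hκ
    (hasCompactSupport_of_tsupport hκs) fun z hz => h.sup _ ?_
  have := add_smul_mem_closedBall (x := x) hs.le hs1 (hκs hz)
  exact Metric.closedBall_subset_closedBall (by norm_num) this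

/-- Hölder bounds for second derivatives involving the second variable, for weak solutions of
Poisson's equation whose right-hand side is Hölder continuous in the second variable only. -/
lemma exists_tangential_bound {α : ℝ} (hα : 0 < α) (hα1 : α < 1) (k : Fin 2) : ∃ C : ℝ, 0 < C ∧
    ∀ (u f : Plane → ℝ) (U : Set Plane) (m : ℝ), Continuous u → WeakLap u f → Measurable f →
      IsOpen U → ContDiffOn ℝ 2 u U →
      (∀ x ∈ U, (∀ y ∈ Metric.closedBall x 3, |u y| ≤ m) → TangentialBound α m f x →
        |pd k (pd 1 u) x| ≤ C * m) ∧
      ∀ x ∈ U, ∀ x' ∈ U, ‖x - x'‖ ≤ 1 → (∀ y ∈ Metric.closedBall x 3, |u y| ≤ m) →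
        TangentialBound α m f x → TangentialBound α m f x' →
        |pd k (pd 1 u) x - pd k (pd 1 u) x'| ≤ C * m * ‖x - x'‖ ^ α := by
  obtain ⟨φ, ψ, hp, hφs, hψs, hc⟩ := exists_mollifier
  set c := ∫ z, φ z
  -- The outer derivative `∂_1` is inherited by the partner `∂_1 μ`, which annihilates functions of
  -- the first coordinate. Hence Hölder continuity of `f` in the second variable alone is enough,
  -- and `f` may jump across a vertical line.
  set κ := pd 1 (pd k φ) with hκ_def
  set μ := pd k ψ with hμ_def
  have hp2 : KernelPair 2 κ (pd 1 μ) := (hp.pd k).pd 1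
  have hμ : ContDiff ℝ ∞ μ := contDiff_infty_pd hp.smooth_right k
  have hμs : tsupport μ ⊆ Metric.closedBall 0 1 := (tsupport_pd_subset k ψ).trans hψs
  have hμ2 : tsupport μ ⊆ Metric.closedBall 0 2 :=
    hμs.trans (Metric.closedBall_subset_closedBall (by norm_num))
  have hμ1s : tsupport (pd 1 μ) ⊆ Metric.closedBall 0 1 := (tsupport_pd_subset 1 μ).trans hμs
  have hκs : tsupport κ ⊆ Metric.closedBall 0 1 :=
    (tsupport_pd_subset 1 _).trans ((tsupport_pd_subset k φ).trans hφs)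
  have hκ : ContDiff ℝ ∞ κ := hp2.smooth_left
  have one_le : (1 : ℕ∞ω) ≤ ((⊤ : ℕ∞) : ℕ∞ω) := by norm_cast
  obtain ⟨L, hL0, hL⟩ := exists_integral_abs_translate_le (κ := pd 1 μ)
    (hp2.smooth_right.of_le one_le) hμ1s
  obtain ⟨L', hL'0, hL'⟩ := exists_integral_abs_translate_le (κ := κ) (hκ.of_le one_le) hκs
  have j1 : 0 ≤ ∫ z, |pd 1 μ z| := integral_nonneg fun z => abs_nonneg _
  have j2 : 0 ≤ ∫ z, |κ z| := integral_nonneg fun z => abs_nonneg _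
  set J := 4 * (∫ z, |pd 1 μ z|) + 2 * L with hJ
  have hJ0 : 0 ≤ J := by positivity
  have hα1' : 0 < 1 - α := by linarith
  set q := 1 / α + 1 / (1 - α) with hq
  have hq0 : 0 < q := by positivity
  refine ⟨(J / α + (∫ z, |κ z|) + J * q + L' + 1) / c, by positivity,
    fun u f U m hu hw hf hU hu2 => ?_⟩
  have hderiv : ∀ x s, 0 < s → HasDerivAt (smean 2 κ u x)
      (s * (s ^ 2)⁻¹ * ∫ z, f (x + s • z) * pd 1 μ z) s := fun x s hs =>
    hasDerivAt_smean hp2 hκs hμ1s hu hw x hs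
  have hsc : ∀ s : ℝ, 0 < s → s * (s ^ 2)⁻¹ = s⁻¹ := fun s hs => by field_simp
  have hbase : ∀ x, TangentialBound α m f x → ∀ s, 0 < s → s ≤ 1 →
      |s * (s ^ 2)⁻¹ * ∫ z, f (x + s • z) * pd 1 μ z| ≤
        2 * m * (∫ z, |pd 1 μ z|) * s ^ (α - 1) := by
    intro x hx s hs hs1
    have := abs_integral_mul_pd_one_le hα hα1 hs hs1 hf (hμ.of_le one_le) hμ2 hx.sup hx.holder
    rw [hsc s hs, abs_mul, abs_of_pos (inv_pos.2 hs), Real.rpow_sub_one hs.ne', inv_mul_le_iff₀ hs]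
    refine this.trans (le_of_eq ?_)
    field_simp
  have hlim : ∀ x ∈ U, Tendsto (smean 2 κ u x) (𝓝[>] 0) (𝓝 (pd k (pd 1 u) x * c)) := fun x hx =>
    tendsto_smean_two hU hx hu2 hp.smooth_left hφs 1 k
  have h31 : ∀ x : Plane, Metric.closedBall x 1 ⊆ Metric.closedBall x 3 := fun x =>
    Metric.closedBall_subset_closedBall (by norm_num)
  constructor
  · intro x hx hum hfx
    have hm : 0 ≤ m := (abs_nonneg _).trans (hum x (Metric.mem_closedBall_self (by norm_num)))
    have h1 := abs_sub_le_of_deriv_le_rpow (T := 1) (β := α) hα one_pos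
      (by positivity : 0 ≤ 2 * m * ∫ z, |pd 1 μ z|) (fun s hs _ => hderiv x s hs)
      (fun s hs hs1 => hbase x hfx s hs hs1) (hlim x hx)
    rw [Real.one_rpow, mul_one] at h1
    have h2 : |smean 2 κ u x 1| ≤ m * ∫ z, |κ z| := by
      have := abs_integral_mul_le hκ.continuous hκs (h := fun z => u (x + (1 : ℝ) • z)) (m := m)
        fun z hz => hum _ (h31 x (add_smul_mem_closedBall zero_le_one le_rfl hz))
      simpa [smean] using this
    have a1 : |pd k (pd 1 u) x| * c = |pd k (pd 1 u) x * c| := by rw [abs_mul, abs_of_pos hc]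
    have a2 := abs_sub_abs_le_abs_sub (pd k (pd 1 u) x * c) (smean 2 κ u x 1)
    rw [abs_sub_comm] at a2
    rw [div_mul_eq_mul_div, le_div_iff₀ hc, a1]
    have a3 : 2 * m * (∫ z, |pd 1 μ z|) / α ≤ J / α * m := by
      rw [div_mul_eq_mul_div]
      refine div_le_div_of_nonneg_right ?_ hα.le
      rw [hJ]
      have : 0 ≤ m * ∫ z, |pd 1 μ z| := by positivity
      have : 0 ≤ m * L := by positivity
      linarith
    have a4 : 0 ≤ (J * q + L' + 1) * m := by positivity
    linarith
  · intro x hx x' hx' hd hum hfx hfx'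
    have hm : 0 ≤ m := (abs_nonneg _).trans (hum x (Metric.mem_closedBall_self (by norm_num)))
    rcases eq_or_ne x x' with rfl | hne
    · simp only [sub_self, abs_zero, norm_zero]
      rw [Real.zero_rpow hα.ne', mul_zero]
    set δ := ‖x - x'‖ with hδ_def
    have hδ : 0 < δ := norm_pos_iff.2 (sub_ne_zero.2 hne)
    have hi : ∀ x, TangentialBound α m f x → ∀ s : ℝ, 0 < s → s ≤ 1 →
        Integrable fun z => f (x + s • z) * pd 1 μ z := fun x hx s hs hs1 =>
      hx.integrable hf hp2.smooth_right.continuous hμ1s hs hs1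
    have hshift : ∀ s : ℝ, 0 < s → x' = x + s • (s⁻¹ • (x' - x)) := fun s hs => by
      rw [smul_smul, mul_inv_cancel₀ hs.ne', one_smul, add_sub_cancel]
    have hnorm : ∀ s : ℝ, 0 < s → ‖s⁻¹ • (x' - x)‖ = δ / s := fun s hs => by
      rw [norm_smul, norm_inv, Real.norm_of_nonneg hs.le, norm_sub_rev, hδ_def, div_eq_inv_mul]
    have h1 := abs_sub_le_of_deriv_le_min (N := fun s => smean 2 κ u x s - smean 2 κ u x' s)
      (T := 1) (K := J * m) hα hα1 hδ hd (by positivity)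
      (fun s hs _ => (hderiv x s hs).sub (hderiv x' s hs)) (fun s hs hsδ => by
        have b1 := hbase x hfx s hs (hsδ.trans hd)
        have b2 := hbase x' hfx' s hs (hsδ.trans hd)
        have b3 : 0 ≤ 2 * L * m * s ^ (α - 1) := by positivity
        refine (abs_sub _ _).trans ((add_le_add b1 b2).trans ?_)
        rw [hJ]
        linarith) (fun s hsδ hs1 => by
        have hs := hδ.trans_le hsδ
        have ha : ‖s⁻¹ • (x' - x)‖ ≤ 1 := by rw [hnorm s hs, div_le_one hs]; exact hsδ
        rw [← mul_sub, integral_shift_sub (hshift s hs) (hi x hfx s hs hs1) (hi x' hfx' s hs hs1)]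
        have b1 := abs_integral_mul_pd_one_le (ν := fun z => μ z - μ (z - s⁻¹ • (x' - x))) hα hα1 hs
          hs1 hf ((hμ.of_le one_le).sub ((hμ.of_le one_le).comp (contDiff_id.sub contDiff_const)))
          (tsupport_translate_subset hμs ha) hfx.sup hfx.holder
        simp only [pd_translate (hμ.of_le one_le)] at b1
        have b2 := hL _ ha
        rw [hnorm s hs] at b2
        rw [hsc s hs, abs_mul, abs_of_pos (inv_pos.2 hs), inv_mul_le_iff₀ hs]
        have b3 : s * s ^ (α - 2) = s ^ α / s := by
          rw [show α - 2 = α - 1 - 1 by ring, Real.rpow_sub_one hs.ne', Real.rpow_sub_one hs.ne']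
          field_simp
        calc _ ≤ 2 * m * s ^ α * (L * (δ / s)) := b1.trans (by gcongr)
          _ = 2 * L * m * δ * (s ^ α / s) := by ring
          _ ≤ J * m * δ * (s ^ α / s) := by gcongr; rw [hJ]; linarith
          _ = _ := by rw [← b3]; ring) ((hlim x hx).sub (hlim x' hx'))
    rw [← hq] at h1
    have h2 : |smean 2 κ u x 1 - smean 2 κ u x' 1| ≤ m * (L' * δ) := by
      have hic : ∀ x, Integrable fun z => u (x + (1 : ℝ) • z) * κ z := fun x =>
        ((hu.comp (by fun_prop : Continuous fun z : Plane => x + (1 : ℝ) • z)).mul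
          hκ.continuous).integrable_of_hasCompactSupport (hasCompactSupport_of_tsupport hκs).mul_left
      have ha : ‖x' - x‖ ≤ 1 := by rwa [norm_sub_rev]
      have e := integral_shift_sub (s := 1) (a := x' - x) (by module) (hic x) (hic x')
      simp only [smean, one_pow, inv_one, one_mul]
      rw [e, hδ_def, norm_sub_rev x x']
      refine le_trans ?_ (mul_le_mul_of_nonneg_left (hL' _ ha) hm)
      rw [← integral_const_mul, ← Real.norm_eq_abs]
      have hts := tsupport_translate_subset hκs ha
      have hcont : Continuous fun z => κ z - κ (z - (x' - x)) :=
        hκ.continuous.sub (hκ.continuous.comp (by fun_prop))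
      have hcs : HasCompactSupport fun z => κ z - κ (z - (x' - x)) :=
        IsCompact.of_isClosed_subset (isCompact_closedBall _ _) (isClosed_tsupport _) hts
      refine norm_integral_le_of_norm_le ((hcont.integrable_of_hasCompactSupport hcs).abs.const_mul m)
        (Eventually.of_forall fun z => ?_)
      rw [norm_mul, Real.norm_eq_abs, Real.norm_eq_abs]
      by_cases hz : z ∈ tsupport fun z => κ z - κ (z - (x' - x))
      · gcongr
        refine hum _ ?_
        have := mem_closedBall_zero_iff.1 (hts hz)
        simp only [Metric.mem_closedBall, dist_eq_norm, add_sub_cancel_left, one_smul]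
        linarith
      · have := image_eq_zero_of_notMem_tsupport hz
        simp [this]
    have a1 : |pd k (pd 1 u) x - pd k (pd 1 u) x'| * c =
        |pd k (pd 1 u) x * c - pd k (pd 1 u) x' * c| := by
      rw [← sub_mul, abs_mul, abs_of_pos hc]
    have a2 := abs_sub_abs_le_abs_sub (pd k (pd 1 u) x * c - pd k (pd 1 u) x' * c)
      (smean 2 κ u x 1 - smean 2 κ u x' 1)
    rw [abs_sub_comm] at h1
    have a3 : δ ≤ δ ^ α := le_rpow_of_le_one hα1 hδ.le hd
    have a4 : m * (L' * δ) ≤ L' * m * δ ^ α := by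
      calc m * (L' * δ) ≤ m * (L' * δ ^ α) := by gcongr
        _ = _ := by ring
    rw [mul_assoc, div_mul_eq_mul_div, le_div_iff₀ hc, a1]
    have a5 : 0 ≤ (J / α + (∫ z, |κ z|) + 1) * (m * δ ^ α) := by positivity
    linarith

/-! ### Odd reflection -/

/-- The open half plane `y₀ > 0`. -/
def upperHalf : Set Plane := {y | 0 < y 0}

lemma isOpen_upperHalf : IsOpen upperHalf :=
  isOpen_lt continuous_const (contDiff_coord 0 (n := 0)).continuous

/-- The reflection `(y₀, y₁) ↦ (-y₀, y₁)`. -/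
def reflect₀ : Plane ≃ₗᵢ[ℝ] Plane :=
  LinearIsometryEquiv.piLpCongrRight 2 fun i : Fin 2 =>
    if i = 0 then LinearIsometryEquiv.neg ℝ else LinearIsometryEquiv.refl ℝ ℝ

lemma reflect₀_zero (y : Plane) : reflect₀ y 0 = -y 0 := by simp [reflect₀]

lemma reflect₀_one (y : Plane) : reflect₀ y 1 = y 1 := by simp [reflect₀]

lemma reflect₀_reflect₀ (y : Plane) : reflect₀ (reflect₀ y) = y := by
  ext i
  fin_cases i <;> simp [reflect₀_zero, reflect₀_one]

lemma integral_comp_reflect₀ (h : Plane → ℝ) : ∫ y, h (reflect₀ y) = ∫ y, h y :=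
  reflect₀.measurePreserving.integral_comp reflect₀.toHomeomorph.measurableEmbedding h

lemma norm_sub_reflect₀ (y : Plane) : ‖y - reflect₀ y‖ = 2 * |y 0| := by
  have h : y - reflect₀ y = (2 * y 0) • EuclideanSpace.single 0 1 := by
    ext i
    fin_cases i
    · simp [reflect₀_zero]; ring
    · simp [reflect₀_one]
  rw [h, norm_smul]
  simp

/-- The odd extension of a function on the half plane. -/
def oddExt (h : Plane → ℝ) (y : Plane) : ℝ :=
  upperHalf.indicator h y - upperHalf.indicator h (reflect₀ y)

lemma oddExt_of_pos {h : Plane → ℝ} {y : Plane} (hy : 0 < y 0) : oddExt h y = h y := by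
  have h1 : reflect₀ y ∉ upperHalf := by
    simp only [upperHalf, mem_ofPred_eq, reflect₀_zero]; linarith
  rw [oddExt, indicator_of_mem (show y ∈ upperHalf from hy), indicator_of_notMem h1, sub_zero]

lemma oddExt_of_neg {h : Plane → ℝ} {y : Plane} (hy : y 0 < 0) : oddExt h y = -h (reflect₀ y) := by
  have h1 : reflect₀ y ∈ upperHalf := by
    simp only [upperHalf, mem_ofPred_eq, reflect₀_zero]; linarith
  have h2 : y ∉ upperHalf := fun h => by
    have : 0 < y 0 := h
    linarith
  rw [oddExt, indicator_of_mem h1, indicator_of_notMem h2, zero_sub]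

lemma oddExt_of_eq {h : Plane → ℝ} {y : Plane} (hy : y 0 = 0) : oddExt h y = 0 := by
  have h1 : reflect₀ y ∉ upperHalf := by
    simp only [upperHalf, mem_ofPred_eq, reflect₀_zero]; linarith
  have h2 : y ∉ upperHalf := fun h => by
    have : 0 < y 0 := h
    linarith
  rw [oddExt, indicator_of_notMem h1, indicator_of_notMem h2, sub_zero]

lemma measurable_oddExt {h : Plane → ℝ} (hh : Measurable h) : Measurable (oddExt h) := by
  have h1 := hh.indicator isOpen_upperHalf.measurableSet
  exact h1.sub (h1.comp reflect₀.continuous.measurable)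

lemma measurable_pd (i : Fin 2) (f : Plane → ℝ) : Measurable (pd i f) :=
  measurable_fderiv_apply_const ℝ f _

lemma measurable_lap (f : Plane → ℝ) : Measurable (lap f) :=
  Finset.measurable_fun_sum _ fun i _ => measurable_pd i _

/-- At boundary points the linear bound forces the limit zero from inside, which matches the
extension by zero. -/
lemma continuous_indicator_upperHalf {w : Plane → ℝ} (hw : ContinuousOn w upperHalf)
    (hb : ∀ ρ : ℝ, ∃ K, ∀ y, 0 < y 0 → ‖y‖ ≤ ρ → |w y| ≤ K * y 0) :
    Continuous (upperHalf.indicator w) := by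
  have hc0 : Continuous fun y : Plane => y 0 := (contDiff_coord 0 (n := 0)).continuous
  rw [continuous_iff_continuousAt]
  intro y
  rcases lt_trichotomy (y 0) 0 with h | h | h
  · refine (continuousAt_const (y := (0 : ℝ))).congr ?_
    filter_upwards [(hc0.tendsto y).eventually (gt_mem_nhds h)] with z hz
    exact (indicator_of_notMem (fun h' => by
      have : 0 < z 0 := h'
      linarith) w).symm
  · have h0 : upperHalf.indicator w y = 0 := indicator_of_notMem (fun h' => by
      have : 0 < y 0 := h'
      linarith) w
    obtain ⟨K, hK⟩ := hb (‖y‖ + 1)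
    rw [ContinuousAt, h0]
    refine squeeze_zero_norm' (a := fun z : Plane => |K| * |z 0|) ?_ ?_
    · filter_upwards [(continuous_norm.tendsto y).eventually (gt_mem_nhds (lt_add_one ‖y‖))] with z hz
      by_cases hz0 : z ∈ upperHalf
      · rw [indicator_of_mem hz0, Real.norm_eq_abs, ← abs_mul]
        exact (hK z hz0 (le_of_lt hz)).trans (le_abs_self _)
      · rw [indicator_of_notMem hz0, norm_zero]
        positivity
    · have : Continuous fun z : Plane => |K| * |z 0| := continuous_const.mul hc0.abs
      have := this.tendsto y
      simpa [h] using this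
  · refine (hw.continuousAt (isOpen_upperHalf.mem_nhds h)).congr ?_
    filter_upwards [isOpen_upperHalf.mem_nhds h] with z hz
    exact (indicator_of_mem hz w).symm

lemma continuous_oddExt {w : Plane → ℝ} (hw : ContinuousOn w upperHalf)
    (hb : ∀ ρ : ℝ, ∃ K, ∀ y, 0 < y 0 → ‖y‖ ≤ ρ → |w y| ≤ K * y 0) : Continuous (oddExt w) := by
  have h1 := continuous_indicator_upperHalf hw hb
  exact h1.sub (h1.comp reflect₀.continuous)

lemma pd_comp_reflect₀ {f : Plane → ℝ} {y : Plane} (hf : DifferentiableAt ℝ f (reflect₀ y))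
    (i : Fin 2) : pd i (fun y => f (reflect₀ y)) y =
      (if i = 0 then -1 else 1) * pd i f (reflect₀ y) := by
  have h1 : HasFDerivAt (fun y => reflect₀ y) (reflect₀ : Plane →L[ℝ] Plane) y :=
    (reflect₀ : Plane →L[ℝ] Plane).hasFDerivAt
  have h2 := (hf.hasFDerivAt.comp y h1).fderiv
  have h3 : reflect₀ (EuclideanSpace.single i 1) =
      (if i = 0 then -1 else 1 : ℝ) • EuclideanSpace.single i 1 := by
    ext j
    fin_cases i <;> fin_cases j <;> simp [reflect₀_zero, reflect₀_one]
  simp only [pd]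
  rw [show (fun y => f (reflect₀ y)) = f ∘ fun y => reflect₀ y from rfl, h2]
  simp only [ContinuousLinearMap.comp_apply]
  exact (congrArg (fderiv ℝ f (reflect₀ y)) h3).trans (by rw [map_smul, smul_eq_mul])

lemma lap_comp_reflect₀ {f : Plane → ℝ} (hf : ContDiff ℝ 2 f) (y : Plane) :
    lap (fun y => f (reflect₀ y)) y = lap f (reflect₀ y) := by
  have h1 : ∀ i, pd i (fun y => f (reflect₀ y)) =
      fun y => (if i = 0 then -1 else 1) * pd i f (reflect₀ y) := fun i =>
    funext fun y => pd_comp_reflect₀ (hf.differentiable (by norm_num) _) i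
  have h2 : ∀ i, Differentiable ℝ (pd i f) := fun i =>
    (contDiff_pd hf (m := 1) (by norm_num) i).differentiable (by norm_num)
  have h3 : ∀ i, DifferentiableAt ℝ (fun y => pd i f (reflect₀ y)) y := fun i =>
    ((h2 i) _).comp y reflect₀.differentiable.differentiableAt
  simp only [lap, h1, pd_const_mul (h3 _), pd_comp_reflect₀ (h2 _ _)]
  simp [Fin.sum_univ_two]

/-- A smooth transition from `0` on `t ≤ 1/2` to `1` on `t ≥ 1`, with its derivatives. -/
lemma exists_transition : ∃ (τ τ₁ τ₂ : ℝ → ℝ) (T : ℝ), ContDiff ℝ ∞ τ ∧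
    (∀ t, HasDerivAt τ (τ₁ t) t) ∧ (∀ t, HasDerivAt τ₁ (τ₂ t) t) ∧
    (∀ t, |τ t| ≤ 1 ∧ |τ₁ t| ≤ T ∧ |τ₂ t| ≤ T) ∧ (∀ t, t < 1 / 2 → τ t = 0 ∧ τ₁ t = 0 ∧ τ₂ t = 0) ∧
    ∀ t, 1 < t → τ t = 1 ∧ τ₁ t = 0 ∧ τ₂ t = 0 := by
  set τ : ℝ → ℝ := fun t => Real.smoothTransition (2 * t - 1)
  have hτ : ContDiff ℝ ∞ τ := Real.smoothTransition.contDiff.comp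
    ((contDiff_const.mul contDiff_id).sub contDiff_const)
  have hτ1 : ContDiff ℝ ∞ (deriv τ) := (contDiff_infty_iff_deriv.1 hτ).2
  have hτ2 : ContDiff ℝ ∞ (deriv (deriv τ)) := (contDiff_infty_iff_deriv.1 hτ1).2
  have z0 : ∀ t, t < 1 / 2 → τ =ᶠ[𝓝 t] fun _ => 0 := fun t ht => by
    filter_upwards [gt_mem_nhds ht] with s hs
    exact Real.smoothTransition.zero_of_nonpos (by linarith)
  have z1 : ∀ t, 1 < t → τ =ᶠ[𝓝 t] fun _ => 1 := fun t ht => by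
    filter_upwards [lt_mem_nhds ht] with s hs
    exact Real.smoothTransition.one_of_one_le (by linarith)
  have hvan : ∀ t c, τ =ᶠ[𝓝 t] (fun _ => c) → τ t = c ∧ deriv τ t = 0 ∧ deriv (deriv τ) t = 0 := by
    intro t c h
    refine ⟨h.self_of_nhds, ?_, ?_⟩
    · rw [h.deriv_eq]; simp
    · rw [h.deriv.deriv_eq]; simp
  obtain ⟨T1, hT1⟩ := (isCompact_Icc (a := (0 : ℝ)) (b := 1)).exists_bound_of_continuousOn
    hτ1.continuous.continuousOn
  obtain ⟨T2, hT2⟩ := (isCompact_Icc (a := (0 : ℝ)) (b := 1)).exists_bound_of_continuousOn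
    hτ2.continuous.continuousOn
  refine ⟨τ, deriv τ, deriv (deriv τ), |T1| + |T2|, hτ,
    fun t => (hτ.differentiable (by simp) t).hasDerivAt,
    fun t => (hτ1.differentiable (by simp) t).hasDerivAt, fun t => ⟨?_, ?_⟩,
    fun t ht => hvan t 0 (z0 t ht), fun t ht => hvan t 1 (z1 t ht)⟩
  · rw [abs_of_nonneg (Real.smoothTransition.nonneg _)]
    exact Real.smoothTransition.le_one _
  · by_cases h0 : t < 1 / 2
    · rw [(hvan t 0 (z0 t h0)).2.1, (hvan t 0 (z0 t h0)).2.2, abs_zero]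
      constructor <;> positivity
    by_cases h1 : 1 < t
    · rw [(hvan t 1 (z1 t h1)).2.1, (hvan t 1 (z1 t h1)).2.2, abs_zero]
      constructor <;> positivity
    have ht : t ∈ Icc (0 : ℝ) 1 := ⟨by linarith [not_lt.1 h0], not_lt.1 h1⟩
    have b1 := hT1 t ht
    have b2 := hT2 t ht
    rw [Real.norm_eq_abs] at b1 b2
    constructor <;> linarith [le_abs_self T1, le_abs_self T2, abs_nonneg T1, abs_nonneg T2]

lemma pd_comp_mul_coord {g : ℝ → ℝ} {g' a : ℝ} {y : Plane} (hg : HasDerivAt g g' (a * y 0))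
    (i : Fin 2) : pd i (fun y => g (a * y 0)) y = if i = 0 then a * g' else 0 := by
  have hd : DifferentiableAt ℝ (fun y : Plane => a * y 0) y :=
    ((differentiable_coord 0) y).const_mul a
  rw [pd_comp_real (f := fun y : Plane => a * y 0) hg hd, pd_const_mul (differentiable_coord 0 y),
    pd_coord]
  fin_cases i <;> simp [mul_comm]

/-- Green's formula in the half plane for functions that vanish on the boundary. -/
lemma integral_indicator_mul_lap {w η : Plane → ℝ} {L : ℝ} (hw : ContDiffOn ℝ 2 w upperHalf)
    (hb : ∀ ρ : ℝ, ∃ K, ∀ y, 0 < y 0 → ‖y‖ ≤ ρ → |w y| ≤ K * y 0)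
    (hl : ∀ ρ : ℝ, ∃ K, ∀ y, 0 < y 0 → ‖y‖ ≤ ρ → |lap w y| ≤ K) (hη : ContDiff ℝ ∞ η)
    (hηc : HasCompactSupport η) (hη0 : ∀ y, |η y| ≤ L * |y 0|) :
    ∫ y, upperHalf.indicator w y * lap η y = ∫ y, upperHalf.indicator (lap w) y * η y := by
  obtain ⟨τ, τ₁, τ₂, T, hτ, hd1, hd2, hT, hz0, hz1⟩ := exists_transition
  have hη2 := contDiff_two_of_infty hη
  obtain ⟨ρ, hρ⟩ := hηc.isBounded.subset_closedBall 0
  have hsupp : ∀ y, ¬ ‖y‖ ≤ ρ → η y = 0 ∧ (∀ i, pd i η y = 0) ∧ lap η y = 0 := fun y hy => by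
    have h1 : y ∉ tsupport η := fun h => hy (mem_closedBall_zero_iff.1 (hρ h))
    exact ⟨image_eq_zero_of_notMem_tsupport h1,
      fun i => image_eq_zero_of_notMem_tsupport fun h => h1 (tsupport_pd_subset i η h),
      image_eq_zero_of_notMem_tsupport fun h => h1 (tsupport_lap_subset η h)⟩
  obtain ⟨K, hK⟩ := hb ρ
  obtain ⟨K', hK'⟩ := hl ρ
  have hT0 : 0 ≤ T := (abs_nonneg _).trans (hT 0).2.1
  have hL0 : 0 ≤ L := by
    have := (abs_nonneg _).trans (hη0 (EuclideanSpace.single 0 1))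
    simpa using this
  obtain ⟨P, hP0, hP⟩ := exists_bound_of_hasCompactSupport (contDiff_infty_pd hη 0).continuous
    (hasCompactSupport_pd hηc 0)
  obtain ⟨Q, hQ0, hQ⟩ := exists_bound_of_hasCompactSupport (continuous_lap hη2)
    (hasCompactSupport_lap hηc)
  obtain ⟨H, hH0, hH⟩ := exists_bound_of_hasCompactSupport hη.continuous hηc
  set a : ℕ → ℝ := fun n => n + 1 with ha
  have ha0 : ∀ n, 0 < a n := fun n => by simp only [ha]; positivity
  set r : ℕ → Plane → ℝ := fun n y => τ (a n * y 0) with hr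
  have hrs : ∀ n, ContDiff ℝ ∞ (r n) := fun n => hτ.comp (contDiff_const.mul (contDiff_coord 0))
  have hr1 : ∀ n i, pd i (r n) = fun y => if i = 0 then a n * τ₁ (a n * y 0) else 0 := fun n i =>
    funext fun y => pd_comp_mul_coord (hd1 _) i
  have hr2 : ∀ n y, lap (r n) y = a n ^ 2 * τ₂ (a n * y 0) := fun n y => by
    have h1 : HasDerivAt (fun t => a n * τ₁ t) (a n * τ₂ (a n * y 0)) (a n * y 0) :=
      (hd2 _).const_mul _
    have h2 := pd_comp_mul_coord (g := fun t => a n * τ₁ t) h1 0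
    simp only [lap, Fin.sum_univ_two, hr1, if_true, one_ne_zero, if_false, pd_const, add_zero]
    rw [h2]
    simp only [if_true]
    ring
  have hlap : ∀ n y, lap (fun y => η y * r n y) y = η y * (a n ^ 2 * τ₂ (a n * y 0)) +
      2 * (pd 0 η y * (a n * τ₁ (a n * y 0))) + r n y * lap η y := fun n y => by
    rw [lap_mul hη2.contDiffAt (contDiff_two_of_infty (hrs n)).contDiffAt, hr2]
    simp [hr1]
  have hts : ∀ n, tsupport (fun y => η y * r n y) ⊆ upperHalf := fun n => by
    refine (closure_minimal (t := {y : Plane | 1 / 2 ≤ a n * y 0}) (fun y hy => ?_)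
      (isClosed_le continuous_const
        (continuous_const.mul (contDiff_coord 0 (n := 0)).continuous))).trans fun y hy => ?_
    · by_contra h
      exact hy (by simp only [hr, (hz0 _ (not_le.1 h)).1, mul_zero])
    · have h1 : 1 / 2 ≤ a n * y 0 := hy
      exact (pos_iff_pos_of_mul_pos (by linarith : 0 < a n * y 0)).1 (ha0 n)
  have hcs : ∀ n, HasCompactSupport (fun y => η y * r n y) := fun n => hηc.mul_right
  have hsm : ∀ n, ContDiff ℝ 2 (fun y => η y * r n y) := fun n =>
    hη2.mul (contDiff_two_of_infty (hrs n))
  have hgreen : ∀ n, ∫ y, w y * lap (fun y => η y * r n y) y = ∫ y, lap w y * (η y * r n y) :=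
    fun n => integral_mul_lap isOpen_upperHalf hw (hsm n) (hcs n) (hts n)
  have hball : Integrable ((Metric.closedBall (0 : Plane) ρ).indicator
      fun _ : Plane => |K| * (L * T + 2 * (P * T) ) + |K| * |ρ| * Q + |K'| * H) :=
    (integrable_indicator_iff Metric.isClosed_closedBall.measurableSet).2
      (integrableOn_const measure_closedBall_lt_top.ne)
  have hneg : ∀ n y, y ∉ upperHalf → τ (a n * y 0) = 0 ∧ τ₁ (a n * y 0) = 0 ∧ τ₂ (a n * y 0) = 0 :=
    fun n y hy => hz0 _ (by
      have : y 0 ≤ 0 := not_lt.1 hy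
      nlinarith [ha0 n])
  have hev : ∀ y ∈ upperHalf, ∀ᶠ n in atTop, 1 < a n * y 0 := fun y hy => by
    have hy0 : 0 < y 0 := hy
    have : Tendsto (fun n => a n * y 0) atTop atTop :=
      (tendsto_natCast_atTop_atTop.atTop_add tendsto_const_nhds).atTop_mul_const hy0
    exact this.eventually (eventually_gt_atTop 1)
  have lim1 : Tendsto (fun n => ∫ y, w y * lap (fun y => η y * r n y) y) atTop
      (𝓝 (∫ y, upperHalf.indicator w y * lap η y)) := by
    refine tendsto_integral_of_dominated_convergence _ (fun n =>
      (integrable_mul_of_tsupport_subset isOpen_upperHalf hw.continuousOn (continuous_lap (hsm n))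
        (hasCompactSupport_lap (hcs n)) ((tsupport_lap_subset _).trans (hts n))).aestronglyMeasurable)
      hball (fun n => Eventually.of_forall fun y => ?_) (Eventually.of_forall fun y => ?_)
    · rw [hlap]
      by_cases hy : ‖y‖ ≤ ρ
      · rw [indicator_of_mem (mem_closedBall_zero_iff.2 hy)]
        have hKH : 0 ≤ |K'| * H := by positivity
        by_cases hu : y ∈ upperHalf
        · have hy0 : 0 < y 0 := hu
          have hyρ : y 0 ≤ |ρ| := ((le_abs_self _).trans (abs_coord_le_norm y 0)).trans
            (hy.trans (le_abs_self ρ))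
          have hwK : |w y| ≤ |K| * y 0 := (hK y hu hy).trans (by gcongr; exact le_abs_self K)
          -- The derivatives of the cutoff live where `a y₀ ≤ 1`. There their sizes `a` and `a²` are
          -- compensated by the linear vanishing of `w` and, in the second-order term, also of `η`.
          -- This gives a bound uniform in `n`.
          have hs : a n * y 0 * |τ₁ (a n * y 0)| ≤ T ∧ (a n * y 0) ^ 2 * |τ₂ (a n * y 0)| ≤ T := by
            have hp : 0 < a n * y 0 := mul_pos (ha0 n) hy0
            by_cases h1 : 1 < a n * y 0
            · rw [(hz1 _ h1).2.1, (hz1 _ h1).2.2]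
              simpa using hT0
            · have h1 := not_lt.1 h1
              obtain ⟨-, t1, t2⟩ := hT (a n * y 0)
              constructor
              · nlinarith [abs_nonneg (τ₁ (a n * y 0))]
              · have : (a n * y 0) ^ 2 ≤ 1 := by nlinarith
                nlinarith [abs_nonneg (τ₂ (a n * y 0))]
          have e1 : |w y| * |η y * (a n ^ 2 * τ₂ (a n * y 0))| ≤ |K| * (L * T) := by
            rw [abs_mul, abs_mul, abs_of_pos (pow_pos (ha0 n) 2)]
            have := hη0 y
            rw [abs_of_pos hy0] at this
            calc _ ≤ (|K| * y 0) * (L * y 0 * (a n ^ 2 * |τ₂ (a n * y 0)|)) := by gcongr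
              _ = |K| * (L * ((a n * y 0) ^ 2 * |τ₂ (a n * y 0)|)) := by ring
              _ ≤ _ := by gcongr; exact hs.2
          have e2 : |w y| * |pd 0 η y * (a n * τ₁ (a n * y 0))| ≤ |K| * (P * T) := by
            rw [abs_mul, abs_mul, abs_of_pos (ha0 n)]
            calc _ ≤ (|K| * y 0) * (P * (a n * |τ₁ (a n * y 0)|)) := by gcongr; exact hP y
              _ = |K| * (P * (a n * y 0 * |τ₁ (a n * y 0)|)) := by ring
              _ ≤ _ := by gcongr; exact hs.1
          have e3 : |w y| * |r n y * lap η y| ≤ |K| * |ρ| * Q := by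
            rw [abs_mul]
            calc _ ≤ (|K| * |ρ|) * (1 * Q) := by
                  gcongr
                  · exact hwK.trans (by gcongr)
                  · exact (hT _).1
                  · exact hQ y
              _ = _ := by ring
          rw [norm_mul, Real.norm_eq_abs, Real.norm_eq_abs]
          have e4 := abs_add_le (η y * (a n ^ 2 * τ₂ (a n * y 0)) +
            2 * (pd 0 η y * (a n * τ₁ (a n * y 0)))) (r n y * lap η y)
          have e5 := abs_add_le (η y * (a n ^ 2 * τ₂ (a n * y 0)))
            (2 * (pd 0 η y * (a n * τ₁ (a n * y 0))))
          rw [abs_mul 2, abs_two] at e5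
          have e6 := mul_le_mul_of_nonneg_left (e4.trans (add_le_add_left e5 _)) (abs_nonneg (w y))
          linarith
        · obtain ⟨n0, n1, n2⟩ := hneg n y hu
          simp only [hr, n0, n1, n2, mul_zero, zero_mul, add_zero, norm_zero]
          positivity
      · obtain ⟨n0, n1, n2⟩ := hsupp y hy
        rw [indicator_of_notMem (fun h => hy (mem_closedBall_zero_iff.1 h))]
        simp [n0, n1, n2]
    · by_cases hu : y ∈ upperHalf
      · refine tendsto_const_nhds.congr' ?_
        filter_upwards [hev y hu] with n hn
        obtain ⟨n0, n1, n2⟩ := hz1 _ hn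
        rw [hlap, indicator_of_mem hu]
        simp [hr, n0, n1, n2]
      · refine tendsto_const_nhds.congr fun n => ?_
        obtain ⟨n0, n1, n2⟩ := hneg n y hu
        rw [hlap, indicator_of_notMem hu]
        simp [hr, n0, n1, n2]
  have lim2 : Tendsto (fun n => ∫ y, lap w y * (η y * r n y)) atTop
      (𝓝 (∫ y, upperHalf.indicator (lap w) y * η y)) := by
    refine tendsto_integral_of_dominated_convergence _ (fun n =>
      ((measurable_lap w).mul (hsm n).continuous.measurable).aestronglyMeasurable)
      hball (fun n => Eventually.of_forall fun y => ?_) (Eventually.of_forall fun y => ?_)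
    · by_cases hy : ‖y‖ ≤ ρ
      · rw [indicator_of_mem (mem_closedBall_zero_iff.2 hy)]
        have hKH : 0 ≤ |K| * (L * T + 2 * (P * T)) + |K| * |ρ| * Q := by positivity
        by_cases hu : y ∈ upperHalf
        · rw [norm_mul, norm_mul, Real.norm_eq_abs, Real.norm_eq_abs, Real.norm_eq_abs]
          calc _ ≤ |K'| * (H * 1) := mul_le_mul ((hK' y hu hy).trans (le_abs_self _))
                (mul_le_mul (hH y) (hT _).1 (abs_nonneg _) hH0) (by positivity) (abs_nonneg _)
            _ ≤ _ := by linarith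
        · simp only [hr, (hneg n y hu).1, mul_zero, norm_zero]
          positivity
      · rw [indicator_of_notMem (fun h => hy (mem_closedBall_zero_iff.1 h)), (hsupp y hy).1]
        simp
    · by_cases hu : y ∈ upperHalf
      · refine tendsto_const_nhds.congr' ?_
        filter_upwards [hev y hu] with n hn
        rw [indicator_of_mem hu]
        simp [hr, (hz1 _ hn).1]
      · refine tendsto_const_nhds.congr fun n => ?_
        rw [indicator_of_notMem hu]
        simp [hr, (hneg n y hu).1]
  exact tendsto_nhds_unique lim1 (lim2.congr fun n => (hgreen n).symm)

/-- The odd extension solves Poisson's equation across the boundary. -/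
lemma weakLap_oddExt {w : Plane → ℝ} (hw : ContDiffOn ℝ 2 w upperHalf)
    (hb : ∀ ρ : ℝ, ∃ K, ∀ y, 0 < y 0 → ‖y‖ ≤ ρ → |w y| ≤ K * y 0)
    (hl : ∀ ρ : ℝ, ∃ K, ∀ y, 0 < y 0 → ‖y‖ ≤ ρ → |lap w y| ≤ K) :
    WeakLap (oddExt w) (oddExt (lap w)) := by
  intro χ hχ hχc
  have hχ2 := contDiff_two_of_infty hχ
  have hrc : HasCompactSupport fun y => χ (reflect₀ y) :=
    hχc.comp_homeomorph reflect₀.toHomeomorph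
  have hrs : ContDiff ℝ ∞ fun y => χ (reflect₀ y) := hχ.comp reflect₀.contDiff
  -- Testing the odd extension with `χ` is testing on the half plane with the odd part `η` (up to a
  -- factor), which vanishes linearly on the boundary; thus Green's formula has no boundary term.
  set η : Plane → ℝ := fun y => χ y - χ (reflect₀ y) with hη_def
  have hη : ContDiff ℝ ∞ η := hχ.sub hrs
  have hηc : HasCompactSupport η := hχc.sub hrc
  obtain ⟨L, hL⟩ := (hχ.of_le (by norm_cast) : ContDiff ℝ 1 χ).lipschitzWith_of_hasCompactSupport
    hχc (by norm_num)
  have hη0 : ∀ y, |η y| ≤ 2 * L * |y 0| := fun y => by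
    have := hL.dist_le_mul y (reflect₀ y)
    rw [Real.dist_eq, dist_eq_norm, norm_sub_reflect₀] at this
    linarith
  have hlapη : ∀ y, lap η y = lap χ y - lap χ (reflect₀ y) := fun y => by
    have h1 : lap η y = lap χ y - lap (fun y => χ (reflect₀ y)) y := by
      have hd : ∀ {h : Plane → ℝ}, ContDiff ℝ ∞ h → ∀ y, DifferentiableAt ℝ h y := fun hh y =>
        hh.differentiable (by simp) y
      have h2 : ∀ i, pd i η = fun y => pd i χ y - pd i (fun y => χ (reflect₀ y)) y := fun i =>
        funext fun y => pd_sub (hd hχ y) (hd hrs y) i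
      simp only [lap, h2, ← Finset.sum_sub_distrib]
      exact Finset.sum_congr rfl fun i _ =>
        pd_sub (hd (contDiff_infty_pd hχ i) y) (hd (contDiff_infty_pd hrs i) y) i
    rw [h1, lap_comp_reflect₀ hχ2]
  have fold : ∀ (h θ : Plane → ℝ), Continuous θ → HasCompactSupport θ → Measurable (upperHalf.indicator h) →
      (∀ ρ : ℝ, ∃ K, ∀ y, 0 < y 0 → ‖y‖ ≤ ρ → |h y| ≤ K) →
      ∫ y, oddExt h y * θ y = ∫ y, upperHalf.indicator h y * (θ y - θ (reflect₀ y)) := by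
    intro h θ hθ hθc hm hbd
    obtain ⟨ρ, hρ⟩ := hθc.isBounded.subset_closedBall 0
    obtain ⟨K, hK⟩ := hbd ρ
    have hbound : ∀ y, ‖y‖ ≤ ρ → |upperHalf.indicator h y| ≤ |K| := fun y hy => by
      by_cases hu : y ∈ upperHalf
      · rw [indicator_of_mem hu]
        exact (hK y hu hy).trans (le_abs_self _)
      · rw [indicator_of_notMem hu, abs_zero]
        positivity
    have i1 : Integrable fun y => upperHalf.indicator h y * θ y :=
      integrable_mul_of_bounded hm hθ hθc fun y hy => hbound y (mem_closedBall_zero_iff.1 (hρ hy))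
    have i2 : Integrable fun y => upperHalf.indicator h (reflect₀ y) * θ y :=
      integrable_mul_of_bounded (hm.comp reflect₀.continuous.measurable) hθ hθc fun y hy =>
        hbound _ (by rw [reflect₀.norm_map]; exact mem_closedBall_zero_iff.1 (hρ hy))
    have i3 : Integrable fun y => upperHalf.indicator h y * θ (reflect₀ y) := by
      have := (reflect₀.measurePreserving.integrable_comp_emb
        reflect₀.toHomeomorph.measurableEmbedding).2 i2
      simpa [Function.comp_def, reflect₀_reflect₀] using this
    have e1 := integral_comp_reflect₀ fun y => upperHalf.indicator h (reflect₀ y) * θ y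
    simp only [reflect₀_reflect₀] at e1
    simp only [oddExt, sub_mul, mul_sub]
    rw [integral_sub i1 i2, integral_sub i1 i3, e1]
  have hb' : ∀ ρ : ℝ, ∃ K, ∀ y, 0 < y 0 → ‖y‖ ≤ ρ → |w y| ≤ K := fun ρ => by
    obtain ⟨K, hK⟩ := hb ρ
    refine ⟨|K| * |ρ|, fun y hy hyρ => (hK y hy hyρ).trans ?_⟩
    have hyρ : y 0 ≤ |ρ| := ((le_abs_self _).trans (abs_coord_le_norm y 0)).trans
      (hyρ.trans (le_abs_self ρ))
    exact mul_le_mul (le_abs_self K) hyρ hy.le (abs_nonneg K)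
  rw [fold w (lap χ) (continuous_lap hχ2) (hasCompactSupport_lap hχc)
      (continuous_indicator_upperHalf hw.continuousOn hb).measurable hb',
    fold (lap w) χ hχ.continuous hχc
      ((measurable_lap w).indicator isOpen_upperHalf.measurableSet) hl]
  simp only [← hlapη]
  exact integral_indicator_mul_lap hw hb hl hη hηc hη0

/-! ### Hölder bounds on sets -/

/-- A bound for the supremum and for the Hölder coefficient on a set. -/
structure HolderBoundOn (α m : ℝ) (S : Set Plane) (f : Plane → ℝ) : Prop where
  sup : ∀ x ∈ S, |f x| ≤ m
  holder : ∀ x ∈ S, ∀ y ∈ S, |f x - f y| ≤ m * ‖x - y‖ ^ α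

namespace HolderBoundOn

variable {α m n : ℝ} {S T : Set Plane} {f g : Plane → ℝ}

lemma mono (h : HolderBoundOn α m S f) (hmn : m ≤ n) : HolderBoundOn α n S f :=
  ⟨fun x hx => (h.sup x hx).trans hmn, fun x hx y hy => (h.holder x hx y hy).trans (by gcongr)⟩

lemma mono_set (h : HolderBoundOn α m S f) (hT : T ⊆ S) : HolderBoundOn α m T f :=
  ⟨fun x hx => h.sup x (hT hx), fun x hx y hy => h.holder x (hT hx) y (hT hy)⟩

lemma congr (h : HolderBoundOn α m S f) (hfg : ∀ x ∈ S, g x = f x) : HolderBoundOn α m S g :=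
  ⟨fun x hx => by rw [hfg x hx]; exact h.sup x hx,
    fun x hx y hy => by rw [hfg x hx, hfg y hy]; exact h.holder x hx y hy⟩

lemma add (hf : HolderBoundOn α m S f) (hg : HolderBoundOn α n S g) :
    HolderBoundOn α (m + n) S fun x => f x + g x :=
  ⟨fun x hx => (abs_add_le _ _).trans (add_le_add (hf.sup x hx) (hg.sup x hx)),
    fun x hx y hy => by
      rw [add_sub_add_comm, add_mul]
      exact (abs_add_le _ _).trans (add_le_add (hf.holder x hx y hy) (hg.holder x hx y hy))⟩

lemma neg (hf : HolderBoundOn α m S f) : HolderBoundOn α m S fun x => -f x :=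
  ⟨fun x hx => by rw [abs_neg]; exact hf.sup x hx,
    fun x hx y hy => by rw [← neg_sub', abs_neg]; exact hf.holder x hx y hy⟩

lemma sub (hf : HolderBoundOn α m S f) (hg : HolderBoundOn α n S g) :
    HolderBoundOn α (m + n) S fun x => f x - g x := by
  simpa [sub_eq_add_neg] using hf.add hg.neg

lemma mul (hf : HolderBoundOn α m S f) (hg : HolderBoundOn α n S g) (hm : 0 ≤ m) (hn : 0 ≤ n) :
    HolderBoundOn α (2 * m * n) S fun x => f x * g x :=
  ⟨fun x hx => by
      rw [abs_mul]
      have := mul_le_mul (hf.sup x hx) (hg.sup x hx) (abs_nonneg _) hm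
      nlinarith [mul_nonneg hm hn],
    fun x hx y hy => (abs_mul_sub_mul_le (hf.sup x hx) (hg.sup y hy) (hf.holder x hx y hy)
      (hg.holder x hx y hy)).trans (le_of_eq (by ring))⟩

lemma of_local (hα : 0 < α) (hm : 0 ≤ m) (hs : ∀ x ∈ S, |f x| ≤ m)
    (h : ∀ x ∈ S, ∀ y ∈ S, ‖x - y‖ ≤ 1 → |f x - f y| ≤ m * ‖x - y‖ ^ α) :
    HolderBoundOn α (2 * m) S f := by
  refine ⟨fun x hx => (hs x hx).trans (by linarith), fun x hx y hy => ?_⟩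
  by_cases hd : ‖x - y‖ ≤ 1
  · refine (h x hx y hy hd).trans ?_
    gcongr
    linarith
  · have h1 : 1 ≤ ‖x - y‖ ^ α := Real.one_le_rpow (not_le.1 hd).le hα.le
    calc |f x - f y| ≤ |f x| + |f y| := abs_sub _ _
      _ ≤ 2 * m * 1 := by linarith [hs x hx, hs y hy]
      _ ≤ _ := by gcongr

lemma of_lipschitz (hα : 0 < α) (hα1 : α < 1) (hm : 0 ≤ m) (hs : ∀ x ∈ S, |f x| ≤ m)
    (h : ∀ x ∈ S, ∀ y ∈ S, |f x - f y| ≤ m * ‖x - y‖) : HolderBoundOn α (2 * m) S f :=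
  of_local hα hm hs fun x hx y hy hd => (h x hx y hy).trans
    (mul_le_mul_of_nonneg_left (le_rpow_of_le_one hα1 (norm_nonneg _) hd) hm)

end HolderBoundOn

lemma exists_holderBoundOn {α : ℝ} (hα : 0 < α) (hα1 : α < 1) {f : Plane → ℝ} (hf : ContDiff ℝ 1 f)
    (ρ : ℝ) : ∃ L : ℝ, 0 ≤ L ∧ HolderBoundOn α L (Metric.closedBall 0 ρ) f := by
  obtain ⟨L, hL, h⟩ := exists_lipschitz_bound hf ρ
  simp only [← mem_closedBall_zero_iff] at h
  exact ⟨2 * L, by positivity, HolderBoundOn.of_lipschitz hα hα1 hL (fun x hx => (h x x hx hx).1)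
    fun x hx y hy => (h x y hx hy).2⟩

/-! ### Estimates at a flat boundary -/

/-- The part of a closed ball in the open upper half plane. -/
def halfBall (ρ : ℝ) : Set Plane := {y | 0 < y 0 ∧ ‖y‖ ≤ ρ}

lemma halfBall_subset_closedBall (ρ : ℝ) : halfBall ρ ⊆ Metric.closedBall 0 ρ := fun _ hy =>
  mem_closedBall_zero_iff.2 hy.2

lemma halfBall_mono {ρ ρ' : ℝ} (h : ρ ≤ ρ') : halfBall ρ ⊆ halfBall ρ' := fun _ hy =>
  ⟨hy.1, hy.2.trans h⟩

lemma convex_halfBall (ρ : ℝ) : Convex ℝ (halfBall ρ) := by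
  have h1 : Convex ℝ {y : Plane | 0 < y 0} :=
    convex_halfSpace_gt (EuclideanSpace.proj (𝕜 := ℝ) (0 : Fin 2)).toLinearMap.isLinear 0
  have h2 := h1.inter (convex_closedBall (0 : Plane) ρ)
  convert h2 using 1
  ext y
  simp [halfBall]

lemma abs_oddExt_le {h : Plane → ℝ} {m ρ : ℝ} (hm : 0 ≤ m) (hh : ∀ y ∈ halfBall ρ, |h y| ≤ m)
    {y : Plane} (hy : ‖y‖ ≤ ρ) : |oddExt h y| ≤ m := by
  rcases lt_trichotomy (y 0) 0 with h0 | h0 | h0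
  · rw [oddExt_of_neg h0, abs_neg]
    exact hh _ ⟨by rw [reflect₀_zero]; linarith, by rwa [reflect₀.norm_map]⟩
  · rw [oddExt_of_eq h0, abs_zero]; exact hm
  · rw [oddExt_of_pos h0]; exact hh y ⟨h0, hy⟩

/-- Points with the same first coordinate lie on the same side of the line, so the jump of the odd
extension is never seen. This is the reason for asking only tangential regularity. -/
lemma abs_oddExt_sub_le {α m ρ : ℝ} {h : Plane → ℝ} (hm : 0 ≤ m) (hh : HolderBoundOn α m (halfBall ρ) h)
    {y y' : Plane} (hy : ‖y‖ ≤ ρ) (hy' : ‖y'‖ ≤ ρ) (h01 : y 0 = y' 0) :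
    |oddExt h y - oddExt h y'| ≤ m * ‖y - y'‖ ^ α := by
  rcases lt_trichotomy (y 0) 0 with h0 | h0 | h0
  · rw [oddExt_of_neg h0, oddExt_of_neg (h01 ▸ h0), ← neg_sub', abs_neg]
    have := hh.holder (reflect₀ y) ⟨by rw [reflect₀_zero]; linarith, by rwa [reflect₀.norm_map]⟩
      (reflect₀ y') ⟨by rw [reflect₀_zero]; linarith, by rwa [reflect₀.norm_map]⟩
    rwa [← map_sub, reflect₀.norm_map] at this
  · rw [oddExt_of_eq h0, oddExt_of_eq (h01 ▸ h0), sub_zero, abs_zero]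
    positivity
  · rw [oddExt_of_pos h0, oddExt_of_pos (h01 ▸ h0)]
    exact hh.holder y ⟨h0, hy⟩ y' ⟨h01 ▸ h0, hy'⟩

lemma oddExt_eventuallyEq {h : Plane → ℝ} {y : Plane} (hy : y ∈ upperHalf) : oddExt h =ᶠ[𝓝 y] h := by
  filter_upwards [isOpen_upperHalf.mem_nhds hy] with z hz
  exact oddExt_of_pos hz

/-- A function on the half plane that is `C²` inside and vanishes linearly on the boundary, with
locally bounded Laplacian. -/
structure VanishesOnBoundary (w : Plane → ℝ) : Prop where
  contDiffOn : ContDiffOn ℝ 2 w upperHalf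
  linear : ∀ ρ : ℝ, ∃ K, ∀ y, 0 < y 0 → ‖y‖ ≤ ρ → |w y| ≤ K * y 0
  lap_bounded : ∀ ρ : ℝ, ∃ K, ∀ y, 0 < y 0 → ‖y‖ ≤ ρ → |lap w y| ≤ K

lemma exists_flat_gradient_bound : ∃ C : ℝ, 0 < C ∧ ∀ (w : Plane → ℝ) (m ρ : ℝ),
    VanishesOnBoundary w → 0 ≤ m → (∀ y ∈ halfBall (ρ + 1), |w y| ≤ m) →
    (∀ y ∈ halfBall (ρ + 1), |lap w y| ≤ m) → ∀ k, ∀ y ∈ halfBall ρ, |pd k w y| ≤ C * m := by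
  obtain ⟨C, hC, h⟩ := exists_gradient_bound
  refine ⟨C, hC, fun w m ρ hw hm h1 h2 k y hy => ?_⟩
  have hball : ∀ z ∈ Metric.closedBall y 1, ‖z‖ ≤ ρ + 1 := fun z hz =>
    (norm_bounds_of_mem_closedBall hz).2.trans (by linarith [hy.2])
  have := h (oddExt w) (oddExt (lap w)) upperHalf y m (continuous_oddExt hw.contDiffOn.continuousOn
    hw.linear) (weakLap_oddExt hw.contDiffOn hw.linear hw.lap_bounded) isOpen_upperHalf hy.1
    ((hw.contDiffOn.of_le (by norm_num)).congr fun z hz => oddExt_of_pos hz) hm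
    (fun z hz => abs_oddExt_le hm h1 (hball z hz)) (fun z hz => abs_oddExt_le hm h2 (hball z hz)) k
  rwa [pd_congr (oddExt_eventuallyEq hy.1)] at this

/-- Odd reflection and the tangential estimate give `∂_0 ∂_1 w` and `∂_1 ∂_1 w`; symmetry gives `∂_1
∂_0 w`; the equation gives `∂_0 ∂_0 w = Δw - ∂_1 ∂_1 w`. -/
lemma exists_flat_hessian_bound {α : ℝ} (hα : 0 < α) (hα1 : α < 1) : ∃ C : ℝ, 0 < C ∧
    ∀ (w : Plane → ℝ) (m ρ : ℝ), VanishesOnBoundary w → 0 ≤ m →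
      (∀ y ∈ halfBall (ρ + 3), |w y| ≤ m) → HolderBoundOn α m (halfBall (ρ + 3)) (lap w) →
      ∀ j k, HolderBoundOn α (C * m) (halfBall ρ) (pd j (pd k w)) := by
  have h := fun k => exists_tangential_bound hα hα1 k
  choose C hC h using h
  have hC0 := hC 0
  have hC1 := hC 1
  refine ⟨2 * C 0 + 2 * C 1 + 1, by positivity, fun w m ρ hw hm h1 h2 => ?_⟩
  have hball : ∀ y ∈ halfBall ρ, ∀ z ∈ Metric.closedBall y 3, ‖z‖ ≤ ρ + 3 := fun y hy z hz =>
    (norm_bounds_of_mem_closedBall hz).2.trans (by linarith [hy.2])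
  have hu : ∀ y ∈ halfBall ρ, ∀ z ∈ Metric.closedBall y 3, |oddExt w z| ≤ m := fun y hy z hz =>
    abs_oddExt_le hm h1 (hball y hy z hz)
  have ht : ∀ y ∈ halfBall ρ, TangentialBound α m (oddExt (lap w)) y := fun y hy =>
    ⟨fun z hz => abs_oddExt_le hm h2.sup (hball y hy z hz), fun z hz z' hz' h0 =>
      abs_oddExt_sub_le hm h2 (hball y hy z hz) (hball y hy z' hz') h0⟩
  have hk : ∀ k, HolderBoundOn α (2 * (C k * m)) (halfBall ρ) (pd k (pd 1 w)) := fun k => by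
    have hCk := hC k
    obtain ⟨g1, g2⟩ := h k (oddExt w) (oddExt (lap w)) upperHalf m
      (continuous_oddExt hw.contDiffOn.continuousOn hw.linear)
      (weakLap_oddExt hw.contDiffOn hw.linear hw.lap_bounded)
      (measurable_oddExt (measurable_lap w)) isOpen_upperHalf
      (hw.contDiffOn.congr fun z hz => oddExt_of_pos hz)
    have e : ∀ y ∈ halfBall ρ, pd k (pd 1 w) y = pd k (pd 1 (oddExt w)) y := fun y hy =>
      (pd_congr (pd_eventuallyEq (oddExt_eventuallyEq hy.1) 1) k).symm
    refine (HolderBoundOn.of_local hα (by positivity) (fun y hy => g1 y hy.1 (hu y hy) (ht y hy))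
      fun y hy y' hy' hd => ?_).congr e
    exact g2 y hy.1 y' hy'.1 hd (hu y hy) (ht y hy) (ht y' hy')
  have m0 : 0 ≤ C 0 * m := by positivity
  have m1 : 0 ≤ C 1 * m := by positivity
  have h01 := hk 0
  have h11 := hk 1
  have h10 : HolderBoundOn α (2 * (C 0 * m)) (halfBall ρ) (pd 1 (pd 0 w)) :=
    h01.congr fun y hy => pd_comm (hw.contDiffOn.contDiffAt (isOpen_upperHalf.mem_nhds hy.1)) 1 0
  have h00 : HolderBoundOn α (m + 2 * (C 1 * m)) (halfBall ρ) (pd 0 (pd 0 w)) :=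
    ((h2.mono_set (halfBall_mono (by linarith))).sub h11).congr fun y _ => by
      simp [lap, Fin.sum_univ_two]
  intro j k
  fin_cases j <;> fin_cases k
  · exact h00.mono (by linarith)
  · exact h01.mono (by linarith)
  · exact h10.mono (by linarith)
  · exact h11.mono (by linarith)

/-! ### Logarithmic polar coordinates -/

/-- The components of `polar`. -/
def polarComp (R : ℝ) (i : Fin 2) (y : Plane) : ℝ :=
  R * Real.exp (y 0) * if i = 0 then Real.cos (y 1) else Real.sin (y 1)

/-- The conformal map `(s, θ) ↦ R e^s (cos θ, sin θ)`. -/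
def polar (R : ℝ) (y : Plane) : Plane := WithLp.toLp 2 fun i => polarComp R i y

lemma polar_apply (R : ℝ) (y : Plane) (i : Fin 2) : polar R y i = polarComp R i y := rfl

lemma contDiff_polarComp (R : ℝ) (i : Fin 2) {n : ℕ∞ω} : ContDiff ℝ n (polarComp R i) := by
  refine (contDiff_const.mul (contDiff_coord 0).exp).mul ?_
  split_ifs
  exacts [(contDiff_coord 1).cos, (contDiff_coord 1).sin]

lemma contDiff_polar (R : ℝ) {n : ℕ∞ω} : ContDiff ℝ n (polar R) :=
  contDiff_euclidean.2 fun i => contDiff_polarComp R i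

lemma norm_polar {R : ℝ} (hR : 0 < R) (y : Plane) : ‖polar R y‖ = R * Real.exp (y 0) := by
  have h : ‖polar R y‖ ^ 2 = (R * Real.exp (y 0)) ^ 2 := by
    rw [normSq_eq, polar_apply, polar_apply]
    simp only [polarComp, if_true, one_ne_zero, if_false]
    linear_combination (R * Real.exp (y 0)) ^ 2 * Real.cos_sq_add_sin_sq (y 1)
  exact (sq_eq_sq₀ (norm_nonneg _) (by positivity)).1 h

lemma polar_mem {R : ℝ} (hR : 0 < R) {y : Plane} (hy : y ∈ upperHalf) :
    polar R y ∈ exteriorInterior R := by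
  change R < ‖polar R y‖
  rw [norm_polar hR]
  exact lt_mul_of_one_lt_right hR (Real.one_lt_exp_iff.2 hy)

lemma pd_polarComp (R : ℝ) (l i : Fin 2) (y : Plane) : pd l (polarComp R i) y =
    if l = 0 then polarComp R i y else if i = 0 then -polarComp R 1 y else polarComp R 0 y := by
  have h0 := differentiable_coord 0 y
  have h1 := differentiable_coord 1 y
  have he : DifferentiableAt ℝ (fun y : Plane => R * Real.exp (y 0)) y := h0.exp.const_mul R
  have pe : ∀ l, pd l (fun y : Plane => R * Real.exp (y 0)) y =
      R * (Real.exp (y 0) * if (0 : Fin 2) = l then 1 else 0) := fun l => by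
    rw [pd_const_mul h0.exp, pd_comp_real (f := fun y : Plane => y 0) (Real.hasDerivAt_exp _) h0, pd_coord]
  have pc : ∀ l, pd l (fun y : Plane => Real.cos (y 1)) y =
      -Real.sin (y 1) * if (1 : Fin 2) = l then 1 else 0 := fun l => by
    rw [pd_comp_real (f := fun y : Plane => y 1) (Real.hasDerivAt_cos _) h1, pd_coord]
  have ps : ∀ l, pd l (fun y : Plane => Real.sin (y 1)) y =
      Real.cos (y 1) * if (1 : Fin 2) = l then 1 else 0 := fun l => by
    rw [pd_comp_real (f := fun y : Plane => y 1) (Real.hasDerivAt_sin _) h1, pd_coord]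
  have e0 : polarComp R 0 = fun y => R * Real.exp (y 0) * Real.cos (y 1) := rfl
  have e1 : polarComp R 1 = fun y => R * Real.exp (y 0) * Real.sin (y 1) := rfl
  fin_cases i
  · simp only [Fin.zero_eta, e0, e1]
    rw [pd_mul he h1.cos, pe, pc]
    fin_cases l <;> simp
  · simp only [Fin.mk_one, e0, e1]
    rw [pd_mul he h1.sin, pe, ps]
    fin_cases l <;> simp

lemma pd_comp_polar {R : ℝ} {h : Plane → ℝ} {y : Plane} (hh : DifferentiableAt ℝ h (polar R y))
    (l : Fin 2) : pd l (fun y => h (polar R y)) y =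
      pd l (polarComp R 0) y * pd 0 h (polar R y) + pd l (polarComp R 1) y * pd 1 h (polar R y) := by
  have hP : DifferentiableAt ℝ (polar R) y := (contDiff_polar R (n := 1)).differentiable (by norm_num) y
  have h2 := (hh.hasFDerivAt.comp y hP.hasFDerivAt).fderiv
  have h3 : ∀ i, (fderiv ℝ (polar R) y (EuclideanSpace.single l 1)) i = pd l (polarComp R i) y := by
    intro i
    have := ((EuclideanSpace.proj (𝕜 := ℝ) i).hasFDerivAt.comp y hP.hasFDerivAt).fderiv
    rw [pd, show polarComp R i = (EuclideanSpace.proj (𝕜 := ℝ) i) ∘ polar R from rfl, this]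
    rfl
  have h4 : pd l (fun y => h (polar R y)) y =
      fderiv ℝ h (polar R y) (fderiv ℝ (polar R) y (EuclideanSpace.single l 1)) := by
    rw [pd, show (fun y => h (polar R y)) = h ∘ polar R from rfl, h2]
    rfl
  rw [h4, fderiv_apply_eq_sum_pd, Fin.sum_univ_two, h3, h3]

lemma polarComp_sq (R : ℝ) (y : Plane) :
    polarComp R 0 y ^ 2 + polarComp R 1 y ^ 2 = (R * Real.exp (y 0)) ^ 2 := by
  simp only [polarComp, if_true, one_ne_zero, if_false]
  linear_combination (R * Real.exp (y 0)) ^ 2 * Real.cos_sq_add_sin_sq (y 1)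

/-- The coefficients of the inverse of the differential of `polar`. -/
def polarCoef (R : ℝ) (k l : Fin 2) : Plane → ℝ := fun y =>
  (if k = 0 then if l = 0 then polarComp R 0 y else -polarComp R 1 y
    else if l = 0 then polarComp R 1 y else polarComp R 0 y) * ((R ^ 2)⁻¹ * Real.exp (-2 * y 0))

lemma contDiff_polarCoef (R : ℝ) (k l : Fin 2) {n : ℕ∞ω} : ContDiff ℝ n (polarCoef R k l) := by
  refine ContDiff.mul ?_ (contDiff_const.mul (contDiff_const.mul (contDiff_coord 0)).exp)
  split_ifs
  exacts [contDiff_polarComp R 0, (contDiff_polarComp R 1).neg, contDiff_polarComp R 1,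
    contDiff_polarComp R 0]

lemma pd_eq_comp_polar {R : ℝ} (hR : 0 < R) {h : Plane → ℝ} {y : Plane}
    (hh : DifferentiableAt ℝ h (polar R y)) (k : Fin 2) : pd k h (polar R y) =
      polarCoef R k 0 y * pd 0 (fun y => h (polar R y)) y +
        polarCoef R k 1 y * pd 1 (fun y => h (polar R y)) y := by
  have hsq := polarComp_sq R y
  have he : (R ^ 2)⁻¹ * Real.exp (-2 * y 0) * (R * Real.exp (y 0)) ^ 2 = 1 := by
    have : Real.exp (-2 * y 0) * Real.exp (y 0) ^ 2 = 1 := by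
      rw [← Real.exp_nat_mul, ← Real.exp_add]; simp
    calc _ = (R ^ 2)⁻¹ * R ^ 2 * (Real.exp (-2 * y 0) * Real.exp (y 0) ^ 2) := by ring
      _ = 1 := by rw [this, inv_mul_cancel₀ (by positivity), mul_one]
  rw [← hsq] at he
  simp only [pd_comp_polar hh, pd_polarComp]
  fin_cases k
  · simp only [polarCoef, Fin.zero_eta, if_true, one_ne_zero, if_false]
    linear_combination (-pd 0 h (polar R y)) * he
  · simp only [polarCoef, Fin.mk_one, if_true, one_ne_zero, if_false]
    linear_combination (-pd 1 h (polar R y)) * he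

/-- Conformality: the differential is `R e^{y₀}` times a rotation, so the mixed second derivatives
cancel and the pure ones get the same factor. The components are harmonic, so no first-order term
survives. -/
lemma lap_comp_polar {R : ℝ} {h : Plane → ℝ} {y : Plane} (hh : ContDiffAt ℝ 2 h (polar R y)) :
    lap (fun y => h (polar R y)) y = (R * Real.exp (y 0)) ^ 2 * lap h (polar R y) := by
  have hPc : ContinuousAt (polar R) y := (contDiff_polar R (n := 0)).continuous.continuousAt
  have hP : DifferentiableAt ℝ (polar R) y := (contDiff_polar R (n := 1)).differentiable (by norm_num) y
  have hev : ∀ᶠ z in 𝓝 y, DifferentiableAt ℝ h (polar R z) := by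
    filter_upwards [hPc.eventually (hh.eventually (by simp))] with z hz
    exact hz.differentiableAt (by norm_num)
  have h1 : ∀ l, pd l (fun y => h (polar R y)) =ᶠ[𝓝 y] fun y =>
      pd l (polarComp R 0) y * pd 0 h (polar R y) + pd l (polarComp R 1) y * pd 1 h (polar R y) := by
    intro l
    filter_upwards [hev] with z hz
    exact pd_comp_polar hz l
  have hd : ∀ k, DifferentiableAt ℝ (pd k h) (polar R y) := fun k =>
    (contDiffAt_pd hh (m := 1) (by norm_num) k).differentiableAt (by norm_num)
  have hdc : ∀ k, DifferentiableAt ℝ (fun y => pd k h (polar R y)) y := fun k => (hd k).comp y hP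
  have hdp : ∀ l i, DifferentiableAt ℝ (pd l (polarComp R i)) y := fun l i =>
    (contDiff_pd (contDiff_polarComp R i (n := 2)) (m := 1) (by norm_num) l).differentiable
      (by norm_num) y
  have hpp0 : ∀ i, pd 0 (pd 0 (polarComp R i)) y = polarComp R i y := fun i => by
    have : pd 0 (polarComp R i) = polarComp R i := funext fun y => by rw [pd_polarComp]; simp
    rw [this, this]
  have hpp1 : ∀ i, pd 1 (pd 1 (polarComp R i)) y = -polarComp R i y := fun i => by
    have e0 : pd 1 (polarComp R 0) = fun y => -polarComp R 1 y :=
      funext fun y => by rw [pd_polarComp]; simp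
    have e1 : pd 1 (polarComp R 1) = polarComp R 0 := funext fun y => by rw [pd_polarComp]; simp
    fin_cases i
    · simp only [Fin.zero_eta]
      rw [e0, pd_neg, e1]
    · simp only [Fin.mk_one]
      rw [e1, e0]
  have hcomm := pd_comm hh 0 1
  have hsq := polarComp_sq R y
  rw [lap, Fin.sum_univ_two, pd_congr (h1 0), pd_congr (h1 1),
    pd_add ((hdp 0 0).fun_mul (hdc 0)) ((hdp 0 1).fun_mul (hdc 1)),
    pd_add ((hdp 1 0).fun_mul (hdc 0)) ((hdp 1 1).fun_mul (hdc 1)),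
    pd_mul (hdp 0 0) (hdc 0), pd_mul (hdp 0 1) (hdc 1), pd_mul (hdp 1 0) (hdc 0),
    pd_mul (hdp 1 1) (hdc 1), hpp0, hpp0, hpp1, hpp1]
  simp only [pd_comp_polar (hd _), pd_polarComp, if_true, one_ne_zero, if_false]
  rw [lap, Fin.sum_univ_two, ← hsq, hcomm]
  ring

/-! ### Inverting the coordinates -/

/-- Identification of the plane with `ℂ`. -/
def toComplex (x : Plane) : ℂ := ⟨x 0, x 1⟩

lemma norm_toComplex (x : Plane) : ‖toComplex x‖ = ‖x‖ := by
  have h : ‖toComplex x‖ ^ 2 = ‖x‖ ^ 2 := by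
    rw [Complex.sq_norm, Complex.normSq_apply, normSq_eq]
    simp only [toComplex]
    ring
  exact (sq_eq_sq₀ (norm_nonneg _) (norm_nonneg _)).1 h

lemma toComplex_sub (x y : Plane) : toComplex (x - y) = toComplex x - toComplex y := by
  apply Complex.ext <;> simp [toComplex]

lemma toComplex_injective : Function.Injective toComplex := fun x y h => by
  ext i
  fin_cases i
  · exact congrArg Complex.re h
  · exact congrArg Complex.im h

/-- The inverse identification. -/
def ofComplex (z : ℂ) : Plane := WithLp.toLp 2 fun i => if i = 0 then z.re else z.im

lemma toComplex_ofComplex (z : ℂ) : toComplex (ofComplex z) = z := by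
  apply Complex.ext <;> simp [toComplex, ofComplex]

lemma toComplex_polar (R : ℝ) (y : Plane) : toComplex (polar R y) = R * Complex.exp (toComplex y) := by
  have h := Complex.exp_eq_exp_re_mul_sin_add_cos (toComplex y)
  rw [h]
  apply Complex.ext <;>
    simp [toComplex, polar_apply, polarComp, Complex.exp_ofReal_re, Complex.cos_ofReal_re,
      Complex.sin_ofReal_re] <;> ring

/-- Nearby points of an annulus have nearby logarithmic polar coordinates. -/
lemma exists_polar_pair {R : ℝ} (hR : 0 < R) {x x' : Plane} (hx : R < ‖x‖) (hx3 : ‖x‖ ≤ R + 3)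
    (hx' : R < ‖x'‖) (hx'3 : ‖x'‖ ≤ R + 3) (hd : ‖x - x'‖ ≤ R / 2) :
    ∃ y ∈ halfBall (Real.log ((R + 3) / R) + 5), ∃ y' ∈ halfBall (Real.log ((R + 3) / R) + 5),
      polar R y = x ∧ polar R y' = x' ∧ ‖y - y'‖ ≤ 3 / 2 * R⁻¹ * ‖x - x'‖ := by
  set S := Real.log ((R + 3) / R) with hS
  set z := toComplex x
  set z' := toComplex x'
  have hz : ‖z‖ = ‖x‖ := norm_toComplex x
  have hz0 : z ≠ 0 := norm_pos_iff.1 (by rw [hz]; linarith)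
  have hz' : ‖z'‖ = ‖x'‖ := norm_toComplex x'
  have hz'0 : z' ≠ 0 := norm_pos_iff.1 (by rw [hz']; linarith)
  have hdz : ‖z' - z‖ = ‖x - x'‖ := by rw [← toComplex_sub, norm_toComplex, norm_sub_rev]
  have hRc : (R : ℂ) ≠ 0 := by exact_mod_cast hR.ne'
  set ζ := Complex.log (1 + (z' - z) / z) with hζ
  have hratio : ‖(z' - z) / z‖ ≤ R⁻¹ * ‖x - x'‖ := by
    rw [norm_div, hdz, hz, div_eq_inv_mul]
    gcongr
  have hhalf : ‖(z' - z) / z‖ ≤ 1 / 2 := hratio.trans (by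
    rw [inv_mul_le_iff₀ hR]; linarith)
  have hζn : ‖ζ‖ ≤ 3 / 2 * R⁻¹ * ‖x - x'‖ :=
    (Complex.norm_log_one_add_half_le_self hhalf).trans (by rw [mul_assoc]; gcongr)
  have hone : 1 + (z' - z) / z = z' / z := by field_simp; ring
  have hexp : Complex.exp ζ = z' / z := by
    rw [hζ, hone]; exact Complex.exp_log (div_ne_zero hz'0 hz0)
  have hexp0 : Complex.exp (Complex.log (z / R)) = z / R := Complex.exp_log (div_ne_zero hz0 hRc)
  set y := ofComplex (Complex.log (z / R)) with hy
  -- The second preimage is obtained by adding the small logarithm `ζ` of `z' / z`, not by taking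
  -- the principal logarithm of `z' / R`, which could lie across the branch cut. Then `|y₁| ≤ π < 4`
  -- and `|y'₁| ≤ 5`, whence the `5` in the radius.
  set y' := ofComplex (Complex.log (z / R) + ζ) with hy'
  have hPy : polar R y = x := toComplex_injective (by
    rw [toComplex_polar, hy, toComplex_ofComplex, hexp0]; field_simp; rfl)
  have hPy' : polar R y' = x' := toComplex_injective (by
    rw [toComplex_polar, hy', toComplex_ofComplex, Complex.exp_add, hexp0, hexp]
    change (R : ℂ) * (z / R * (z' / z)) = z'
    field_simp)
  have hdist : ‖y - y'‖ = ‖ζ‖ := by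
    rw [← norm_toComplex, toComplex_sub, hy, hy', toComplex_ofComplex, toComplex_ofComplex,
      sub_add_cancel_left, norm_neg]
  have hzero : ∀ u : Plane, R < ‖polar R u‖ → ‖polar R u‖ ≤ R + 3 → 0 < u 0 ∧ u 0 ≤ S := fun u h1 h2 => by
    rw [norm_polar hR] at h1 h2
    constructor
    · by_contra! h
      have := Real.exp_le_one_iff.2 h
      nlinarith
    · rw [hS, Real.le_log_iff_exp_le (by positivity), le_div_iff₀ hR]
      linarith
  have hy0 := hzero y (by rwa [hPy]) (by rwa [hPy])
  have hy'0 := hzero y' (by rwa [hPy']) (by rwa [hPy'])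
  have hn : ∀ u : Plane, ‖u‖ ≤ |u 0| + |u 1| := fun u => by
    refine abs_le_of_sq_le_sq' ?_ (by positivity) |>.2
    rw [normSq_eq]
    nlinarith [abs_nonneg (u 0), abs_nonneg (u 1), sq_abs (u 0), sq_abs (u 1)]
  have hy1 : |y 1| ≤ 4 := by
    have h1 : y 1 = Complex.arg (z / R) := by
      rw [hy]; simp [ofComplex, Complex.log_im]
    rw [h1]
    exact (Complex.abs_arg_le_pi _).trans (by linarith [Real.pi_lt_four])
  have hy'1 : |y' 1| ≤ 5 := by
    have h1 := abs_coord_le_norm (y' - y) 1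
    rw [norm_sub_rev, hdist] at h1
    have h2 : ‖ζ‖ ≤ 1 := (Complex.norm_log_one_add_half_le_self hhalf).trans (by linarith)
    have h3 : |y' 1| ≤ |y 1| + |(y' - y) 1| := by
      have := abs_add_le (y 1) ((y' - y) 1)
      simpa using this
    linarith
  refine ⟨y, ⟨hy0.1, (hn y).trans ?_⟩, y', ⟨hy'0.1, (hn y').trans ?_⟩, hPy, hPy', hdist ▸ hζn⟩
  · rw [abs_of_pos hy0.1]; linarith [hy0.2]
  · rw [abs_of_pos hy'0.1]; linarith [hy'0.2]

/-! ### Second derivative bounds up to the boundary -/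

lemma exists_common_mul_bound {ι : Type*} [Fintype ι] {α : ℝ} (hα : 0 < α) (hα1 : α < 1)
    {q : ι → Plane → ℝ} (hq : ∀ i, ContDiff ℝ 1 (q i)) (ρ : ℝ) : ∃ L : ℝ, 0 ≤ L ∧
      ∀ i (f : Plane → ℝ) (m : ℝ), 0 ≤ m → HolderBoundOn α m (halfBall ρ) f →
        HolderBoundOn α (L * m) (halfBall ρ) fun y => q i y * f y := by
  have h := fun i => exists_holderBoundOn hα hα1 (hq i) ρ
  choose L hL0 hL using h
  have hs : 0 ≤ ∑ i, L i := Finset.sum_nonneg fun i _ => hL0 i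
  refine ⟨2 * ∑ i, L i, by positivity, fun i f m hm hf => ?_⟩
  exact (((hL i).mono (Finset.single_le_sum (f := L) (fun i _ => hL0 i) (Finset.mem_univ i))).mono_set
    (halfBall_subset_closedBall ρ)).mul hf hs hm

/-- Hölder bounds for a function and its first and second derivatives. -/
structure C2BoundOn (α m : ℝ) (S : Set Plane) (f : Plane → ℝ) : Prop where
  value : HolderBoundOn α m S f
  grad : ∀ k, HolderBoundOn α m S (pd k f)
  hess : ∀ j k, HolderBoundOn α m S (pd j (pd k f))

lemma exists_mul_c2Bound {α : ℝ} (hα : 0 < α) (hα1 : α < 1) {q : Plane → ℝ} (hq : ContDiff ℝ ∞ q)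
    (ρ : ℝ) : ∃ L : ℝ, 0 ≤ L ∧ ∀ (f : Plane → ℝ) (m : ℝ), 0 ≤ m → ContDiffOn ℝ 2 f upperHalf →
      C2BoundOn α m (halfBall ρ) f → C2BoundOn α (L * m) (halfBall ρ) fun y => q y * f y := by
  have h1 : ∀ {h : Plane → ℝ}, ContDiff ℝ ∞ h → ContDiff ℝ 1 h := fun hh => hh.of_le (by norm_cast)
  obtain ⟨L0, hL0, b0⟩ := exists_common_mul_bound hα hα1 (q := fun _ : Unit => q) (fun _ => h1 hq) ρ
  obtain ⟨L1, hL1, b1⟩ := exists_common_mul_bound hα hα1 (q := fun k : Fin 2 => pd k q)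
    (fun k => h1 (contDiff_infty_pd hq k)) ρ
  obtain ⟨L2, hL2, b2⟩ := exists_common_mul_bound hα hα1 (q := fun k : Fin 2 × Fin 2 => pd k.1 (pd k.2 q))
    (fun k => h1 (contDiff_infty_pd (contDiff_infty_pd hq k.2) k.1)) ρ
  refine ⟨L0 + 2 * L1 + L2, by positivity, fun f m hm hf hb => ?_⟩
  have hfat : ∀ y ∈ halfBall ρ, ContDiffAt ℝ 2 f y := fun y hy =>
    hf.contDiffAt (isOpen_upperHalf.mem_nhds hy.1)
  have hq2 := contDiff_two_of_infty hq
  have m0 : 0 ≤ L0 * m := by positivity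
  have m1 : 0 ≤ L1 * m := by positivity
  have m2 : 0 ≤ L2 * m := by positivity
  refine ⟨(b0 () f m hm hb.value).mono (by linarith), fun k => ?_, fun j k => ?_⟩
  · refine (((b1 k f m hm hb.value).add (b0 () _ m hm (hb.grad k))).congr fun y hy =>
      pd_mul (hq2.differentiable (by norm_num) y) ((hfat y hy).differentiableAt (by norm_num)) k).mono ?_
    linarith
  · refine (((((b2 (j, k) f m hm hb.value).add (b1 k _ m hm (hb.grad j))).add
      (b1 j _ m hm (hb.grad k))).add (b0 () _ m hm (hb.hess j k))).congr fun y hy =>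
        pd_pd_mul hq2.contDiffAt (hfat y hy) j k).mono ?_
    linarith

/-- Chain rule twice, with smooth coefficients from the inverse differential of `polar`. The
estimates stay in the polar variable, so no inverse map is needed. -/
lemma exists_polar_transfer {α R : ℝ} (hα : 0 < α) (hα1 : α < 1) (hR : 0 < R) (ρ : ℝ) : ∃ C : ℝ,
    0 ≤ C ∧ ∀ (v : Plane → ℝ) (m : ℝ), 0 ≤ m → ContDiffOn ℝ 2 v (exteriorInterior R) →
      C2BoundOn α m (halfBall ρ) (fun y => v (polar R y)) →
      (∀ k, HolderBoundOn α (C * m) (halfBall ρ) fun y => pd k v (polar R y)) ∧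
      ∀ j k, HolderBoundOn α (C * m) (halfBall ρ) fun y => pd j (pd k v) (polar R y) := by
  obtain ⟨L0, hL0, b0⟩ := exists_common_mul_bound hα hα1
    (q := fun k : Fin 2 × Fin 2 => polarCoef R k.1 k.2) (fun k => contDiff_polarCoef R _ _) ρ
  obtain ⟨L1, hL1, b1⟩ := exists_common_mul_bound hα hα1
    (q := fun k : Fin 2 × Fin 2 × Fin 2 => pd k.1 (polarCoef R k.2.1 k.2.2))
    (fun k => contDiff_pd (contDiff_polarCoef R _ _ (n := 2)) (by norm_num) _) ρ
  refine ⟨2 * L0 + 2 * (L0 * (2 * L0 + 2 * L1)), by positivity, fun v m hm hv hb => ?_⟩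
  set V : Plane → ℝ := fun y => v (polar R y) with hV
  have hvat : ∀ y ∈ upperHalf, ContDiffAt ℝ 2 v (polar R y) := fun y hy =>
    hv.contDiffAt ((isOpen_exteriorInterior R).mem_nhds (polar_mem hR hy))
  have hg : ∀ k, ∀ y ∈ upperHalf, pd k v (polar R y) =
      polarCoef R k 0 y * pd 0 V y + polarCoef R k 1 y * pd 1 V y := fun k y hy =>
    pd_eq_comp_polar hR ((hvat y hy).differentiableAt (by norm_num)) k
  have hVat : ∀ y ∈ upperHalf, ContDiffAt ℝ 2 V y := fun y hy =>
    (hvat y hy).comp y (contDiff_polar R).contDiffAt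
  have hdV : ∀ k, ∀ y ∈ upperHalf, DifferentiableAt ℝ (pd k V) y := fun k y hy =>
    (contDiffAt_pd (hVat y hy) (m := 1) (by norm_num) k).differentiableAt (by norm_num)
  have hdc : ∀ k l y, DifferentiableAt ℝ (polarCoef R k l) y := fun k l y =>
    (contDiff_polarCoef R k l (n := 1)).differentiable (by norm_num) y
  have hgl : ∀ k l, ∀ y ∈ upperHalf, pd l (fun y => pd k v (polar R y)) y =
      (pd l (polarCoef R k 0) y * pd 0 V y + polarCoef R k 0 y * pd l (pd 0 V) y) +
        (pd l (polarCoef R k 1) y * pd 1 V y + polarCoef R k 1 y * pd l (pd 1 V) y) := by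
    intro k l y hy
    have hev : (fun y => pd k v (polar R y)) =ᶠ[𝓝 y]
        fun y => polarCoef R k 0 y * pd 0 V y + polarCoef R k 1 y * pd 1 V y := by
      filter_upwards [isOpen_upperHalf.mem_nhds hy] with z hz
      exact hg k z hz
    rw [pd_congr hev, pd_add ((hdc k 0 y).fun_mul (hdV 0 y hy)) ((hdc k 1 y).fun_mul (hdV 1 y hy)),
      pd_mul (hdc k 0 y) (hdV 0 y hy), pd_mul (hdc k 1 y) (hdV 1 y hy)]
  have hh : ∀ j k, ∀ y ∈ upperHalf, pd j (pd k v) (polar R y) =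
      polarCoef R j 0 y * pd 0 (fun y => pd k v (polar R y)) y +
        polarCoef R j 1 y * pd 1 (fun y => pd k v (polar R y)) y := fun j k y hy =>
    pd_eq_comp_polar hR ((contDiffAt_pd (hvat y hy) (m := 1) (by norm_num) k).differentiableAt
      (by norm_num)) j
  have m0 : 0 ≤ L0 * m := by positivity
  have m1 : 0 ≤ L1 * m := by positivity
  have m2 : 0 ≤ L0 * (2 * L0 + 2 * L1) * m := by positivity
  constructor
  · intro k
    refine (((b0 (k, 0) _ m hm (hb.grad 0)).add (b0 (k, 1) _ m hm (hb.grad 1))).congr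
      fun y hy => hg k y hy.1).mono ?_
    linarith
  · intro j k
    have hl : ∀ l, HolderBoundOn α ((2 * L0 + 2 * L1) * m) (halfBall ρ)
        (pd l fun y => pd k v (polar R y)) := fun l => by
      refine ((((b1 (l, k, 0) _ m hm (hb.grad 0)).add (b0 (k, 0) _ m hm (hb.hess l 0))).add
        ((b1 (l, k, 1) _ m hm (hb.grad 1)).add (b0 (k, 1) _ m hm (hb.hess l 1)))).congr
          fun y hy => hgl k l y hy.1).mono ?_
      linarith
    refine (((b0 (j, 0) _ _ (by positivity) (hl 0)).add (b0 (j, 1) _ _ (by positivity) (hl 1))).congr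
      fun y hy => hh j k y hy.1).mono ?_
    linarith

lemma abs_sub_le_of_pd_le {f : Plane → ℝ} {S : Set Plane} {m : ℝ} (hS : Convex ℝ S)
    (hf : ∀ y ∈ S, DifferentiableAt ℝ f y) (hb : ∀ k, ∀ y ∈ S, |pd k f y| ≤ m) {x y : Plane}
    (hx : x ∈ S) (hy : y ∈ S) : |f x - f y| ≤ 2 * m * ‖x - y‖ := by
  have := hS.norm_image_sub_le_of_norm_fderiv_le (𝕜 := ℝ) hf
    (fun z hz => norm_fderiv_le_of_pd fun k => hb k z hz) hy hx
  rwa [Real.norm_eq_abs] at this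

/-- Schauder estimate at a flat boundary, given a bound for the gradient. -/
lemma exists_flat_c2Bound {α : ℝ} (hα : 0 < α) (hα1 : α < 1) : ∃ C : ℝ, 0 < C ∧
    ∀ (w : Plane → ℝ) (m ρ : ℝ), VanishesOnBoundary w → 0 ≤ m →
      (∀ y ∈ halfBall (ρ + 3), |w y| ≤ m) → (∀ k, ∀ y ∈ halfBall (ρ + 3), |pd k w y| ≤ m) →
      HolderBoundOn α m (halfBall (ρ + 3)) (lap w) → C2BoundOn α (C * m) (halfBall ρ) w := by
  obtain ⟨C, hC, h⟩ := exists_flat_hessian_bound hα hα1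
  refine ⟨4 + 4 * C + 2, by positivity, fun w m ρ hw hm h0 h1 h2 => ?_⟩
  have hsub : halfBall ρ ⊆ halfBall (ρ + 3) := halfBall_mono (by linarith)
  have hess := h w m ρ hw hm h0 h2
  have hat : ∀ y ∈ halfBall ρ, ContDiffAt ℝ 2 w y := fun y hy =>
    hw.contDiffOn.contDiffAt (isOpen_upperHalf.mem_nhds hy.1)
  have m0 : 0 ≤ C * m := by positivity
  refine ⟨(HolderBoundOn.of_lipschitz (m := 2 * m) hα hα1 (by positivity)
      (fun y hy => (h0 y (hsub hy)).trans (by linarith)) fun x hx y hy => ?_).mono ?_,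
    fun k => (HolderBoundOn.of_lipschitz (m := m + 2 * (C * m)) hα hα1 (by positivity)
      (fun y hy => (h1 k y (hsub hy)).trans (by linarith)) fun x hx y hy => ?_).mono ?_,
    fun j k => (hess j k).mono ?_⟩
  · exact abs_sub_le_of_pd_le (convex_halfBall ρ) (fun z hz => (hat z hz).differentiableAt (by norm_num))
      (fun k z hz => h1 k z (hsub hz)) hx hy
  · linarith
  · refine (abs_sub_le_of_pd_le (convex_halfBall ρ) (fun z hz => (contDiffAt_pd (hat z hz) (m := 1)
      (by norm_num) k).differentiableAt (by norm_num)) (fun j z hz => (hess j k).sup z hz) hx hy).trans ?_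
    gcongr
    linarith
  · linarith
  · linarith

/-- The weight `exp (-|x|² / 8)` in logarithmic polar coordinates, with the coefficients of the
transformed equation. -/
lemma lap_halfGauss_mul_comp_polar {R : ℝ} (hR : 0 < R) {v : Plane → ℝ} {y : Plane}
    (hv : ContDiffAt ℝ 2 v (polar R y)) :
    lap (fun y => halfGauss (polar R y) * v (polar R y)) y =
      (R * Real.exp (y 0)) ^ 2 * halfGauss (polar R y) * ou v (polar R y) -
        (R * Real.exp (y 0)) ^ 2 * (1 - (R * Real.exp (y 0)) ^ 2 / 16) *
          (halfGauss (polar R y) * v (polar R y)) := by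
  rw [lap_comp_polar (h := fun x => halfGauss x * v x) (contDiff_halfGauss.contDiffAt.mul hv),
    lap_halfGauss_mul hv, norm_polar hR]
  ring

/-- Vanishing of order `|x| - R` becomes vanishing of order `y₀`, because `R (e^{y₀} - 1) ≤ R e^ρ
y₀`. The bound on the Laplacian is then read off the driftless equation. -/
lemma vanishesOnBoundary_comp_polar {R M : ℝ} (hR : 0 < R) {v : Plane → ℝ}
    (hv : ContDiffOn ℝ 2 v (exteriorInterior R))
    (hlin : ∀ ρ : ℝ, ∃ K, ∀ x, R < ‖x‖ → ‖x‖ ≤ ρ → |v x| ≤ K * (‖x‖ - R))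
    (hE : ∀ x, R < ‖x‖ → |ou v x| ≤ M) :
    VanishesOnBoundary fun y => halfGauss (polar R y) * v (polar R y) := by
  have hlin' : ∀ ρ : ℝ, ∃ K, ∀ y, 0 < y 0 → ‖y‖ ≤ ρ →
      |halfGauss (polar R y) * v (polar R y)| ≤ K * y 0 := fun ρ => by
    obtain ⟨K, hK⟩ := hlin (R * Real.exp ρ)
    refine ⟨|K| * (R * Real.exp ρ), fun y hy hyρ => ?_⟩
    have hy0ρ : y 0 ≤ ρ := (le_abs_self _).trans ((abs_coord_le_norm y 0).trans hyρ)
    have h1 := hK (polar R y) (polar_mem hR hy) (by rw [norm_polar hR]; gcongr)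
    rw [norm_polar hR] at h1
    have h2 : R * Real.exp (y 0) - R ≤ R * Real.exp ρ * y 0 := by
      have h3 : Real.exp (y 0) - 1 ≤ Real.exp (y 0) * y 0 := by
        have h4 := Real.add_one_le_exp (-y 0)
        have h5 : Real.exp (y 0) * Real.exp (-y 0) = 1 := by rw [← Real.exp_add]; simp
        nlinarith [Real.exp_pos (y 0)]
      have h6 : Real.exp (y 0) ≤ Real.exp ρ := Real.exp_le_exp.2 hy0ρ
      calc R * Real.exp (y 0) - R = R * (Real.exp (y 0) - 1) := by ring
        _ ≤ R * (Real.exp ρ * y 0) := by gcongr; exact h3.trans (by gcongr)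
        _ = _ := by ring
    have h7 : 0 ≤ R * Real.exp (y 0) - R := by
      have := Real.one_lt_exp_iff.2 hy
      nlinarith
    rw [abs_mul, abs_of_pos (halfGauss_pos _)]
    calc _ ≤ 1 * (|K| * (R * Real.exp (y 0) - R)) := by
          gcongr
          · exact halfGauss_le_one _
          · exact h1.trans (by gcongr; exact le_abs_self K)
      _ ≤ |K| * (R * Real.exp ρ * y 0) := by rw [one_mul]; gcongr
      _ = _ := by ring
  refine ⟨(contDiff_halfGauss.comp (contDiff_polar R)).contDiffOn.mul
    (hv.comp (contDiff_polar R).contDiffOn fun y hy => polar_mem hR hy), hlin', fun ρ => ?_⟩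
  obtain ⟨K, hK⟩ := hlin' ρ
  refine ⟨(R * Real.exp ρ) ^ 2 * |M| + (R * Real.exp ρ) ^ 2 * (1 + (R * Real.exp ρ) ^ 2) * (|K| * |ρ|),
    fun y hy hyρ => ?_⟩
  have hy0ρ : y 0 ≤ ρ := (le_abs_self _).trans ((abs_coord_le_norm y 0).trans hyρ)
  have hr : (R * Real.exp (y 0)) ^ 2 ≤ (R * Real.exp ρ) ^ 2 := by gcongr
  set r2 := (R * Real.exp (y 0)) ^ 2 with hr2
  have hr0 : 0 ≤ r2 := by positivity
  rw [lap_halfGauss_mul_comp_polar hR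
    (hv.contDiffAt ((isOpen_exteriorInterior R).mem_nhds (polar_mem hR hy)))]
  refine (abs_sub _ _).trans (add_le_add ?_ ?_)
  · rw [abs_mul, abs_mul, abs_of_nonneg hr0, abs_of_pos (halfGauss_pos _)]
    calc _ ≤ (R * Real.exp ρ) ^ 2 * 1 * |M| :=
          mul_le_mul (mul_le_mul hr (halfGauss_le_one _) (halfGauss_pos _).le (by positivity))
            ((hE _ (polar_mem hR hy)).trans (le_abs_self M)) (abs_nonneg _) (by positivity)
      _ = _ := by ring
  · rw [abs_mul, abs_mul, abs_of_nonneg hr0]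
    have h1 : |1 - r2 / 16| ≤ 1 + (R * Real.exp ρ) ^ 2 := by
      rw [abs_le]; constructor <;> linarith
    have h2 : |halfGauss (polar R y) * v (polar R y)| ≤ |K| * |ρ| := by
      refine (hK y hy hyρ).trans ?_
      calc K * y 0 ≤ |K| * y 0 := by gcongr; exact le_abs_self K
        _ ≤ |K| * |ρ| := by gcongr; exact hy0ρ.trans (le_abs_self ρ)
    gcongr

/-! ### The estimate near the boundary circle -/

lemma exists_lipschitz_polar (R ρ : ℝ) : ∃ L : ℝ, 0 ≤ L ∧ ∀ y ∈ halfBall ρ, ∀ y' ∈ halfBall ρ,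
    ‖polar R y - polar R y'‖ ≤ L * ‖y - y'‖ := by
  obtain ⟨L0, hL0, h0⟩ := exists_lipschitz_bound (contDiff_polarComp R 0) ρ
  obtain ⟨L1, hL1, h1⟩ := exists_lipschitz_bound (contDiff_polarComp R 1) ρ
  refine ⟨L0 + L1, by positivity, fun y hy y' hy' => ?_⟩
  have g0 := (h0 y y' hy.2 hy'.2).2
  have g1 := (h1 y y' hy.2 hy'.2).2
  have hs : ‖polar R y - polar R y'‖ ^ 2 =
      (polarComp R 0 y - polarComp R 0 y') ^ 2 + (polarComp R 1 y - polarComp R 1 y') ^ 2 := by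
    rw [EuclideanSpace.norm_sq_eq, Fin.sum_univ_two, Real.norm_eq_abs, Real.norm_eq_abs, sq_abs, sq_abs]
    rfl
  calc _ ≤ |polarComp R 0 y - polarComp R 0 y'| + |polarComp R 1 y - polarComp R 1 y'| := by
        refine abs_le_of_sq_le_sq' ?_ (by positivity) |>.2
        rw [hs, ← sq_abs (polarComp R 0 y - _), ← sq_abs (polarComp R 1 y - _)]
        nlinarith [abs_nonneg (polarComp R 0 y - polarComp R 0 y'),
          abs_nonneg (polarComp R 1 y - polarComp R 1 y')]
    _ ≤ _ := by linarith

lemma exists_holderBoundOn_comp_polar {α R : ℝ} (hα : 0 < α) (hR : 0 < R) (ρ : ℝ) : ∃ C : ℝ, 0 ≤ C ∧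
    ∀ (f : Plane → ℝ) (M : ℝ), 0 ≤ M → HomBound α R M f →
      HolderBoundOn α (C * M) (halfBall ρ) fun y => f (polar R y) := by
  obtain ⟨L, hL, h⟩ := exists_lipschitz_polar R ρ
  refine ⟨R⁻¹ + 2 * R ^ (-1 - α) * L ^ α, by positivity, fun f M hM hf => ⟨fun y hy => ?_,
    fun y hy y' hy' => ?_⟩⟩
  · have hm := polar_mem hR hy.1
    calc _ ≤ M * ‖polar R y‖⁻¹ := hf.sup _ hm
      _ ≤ M * R⁻¹ := by gcongr; exact (show R < ‖polar R y‖ from hm).le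
      _ ≤ _ := by
        have : 0 ≤ 2 * R ^ (-1 - α) * L ^ α * M := by positivity
        linarith
  · have hd : ∀ z ∈ halfBall ρ, ‖polar R z‖ ^ (-1 - α) ≤ R ^ (-1 - α) := fun z hz =>
      Real.rpow_le_rpow_of_nonpos hR (show R < ‖polar R z‖ from polar_mem hR hz.1).le (by linarith)
    have h1 := hd y hy
    have h2 := hd y' hy'
    calc _ ≤ M * (‖polar R y‖ ^ (-1 - α) + ‖polar R y'‖ ^ (-1 - α)) * ‖polar R y - polar R y'‖ ^ α :=
          hf.holder _ _ (polar_mem hR hy.1) (polar_mem hR hy'.1)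
      _ ≤ M * (R ^ (-1 - α) + R ^ (-1 - α)) * (L * ‖y - y'‖) ^ α := by
          gcongr
          exact h y hy y' hy'
      _ = 2 * R ^ (-1 - α) * L ^ α * M * ‖y - y'‖ ^ α := by
          rw [Real.mul_rpow hL (norm_nonneg _)]; ring
      _ ≤ _ := by
        gcongr
        have : 0 ≤ R⁻¹ := by positivity
        linarith

/-- Points at distance at most `R / 2` have preimages at comparable distance (`exists_polar_pair`);
for more distant pairs the pointwise bounds are enough. -/
lemma exists_annulusBound_of_polar {α R : ℝ} (hα : 0 < α) (hR : 0 < R) : ∃ C : ℝ, 0 ≤ C ∧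
    ∀ (v : Plane → ℝ) (m : ℝ), 0 ≤ m →
      (∀ y ∈ halfBall (Real.log ((R + 3) / R) + 5), |v (polar R y)| ≤ m) →
      (∀ k, HolderBoundOn α m (halfBall (Real.log ((R + 3) / R) + 5)) fun y => pd k v (polar R y)) →
      (∀ j k, HolderBoundOn α m (halfBall (Real.log ((R + 3) / R) + 5))
        fun y => pd j (pd k v) (polar R y)) → AnnulusBound α R (C * m) v := by
  refine ⟨1 + (3 / 2 * R⁻¹) ^ α + 2 * (2 / R) ^ α, by positivity, fun v m hm h0 h1 h2 => ?_⟩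
  have hq1 : 0 ≤ (3 / 2 * R⁻¹) ^ α := by positivity
  have hq2 : 0 ≤ (2 / R) ^ α := by positivity
  have hp1 : 0 ≤ (3 / 2 * R⁻¹) ^ α * m := by positivity
  have hp2 : 0 ≤ 2 * (2 / R) ^ α * m := by positivity
  have hsup : ∀ {f : Plane → ℝ}, (∀ y ∈ halfBall (Real.log ((R + 3) / R) + 5), |f (polar R y)| ≤ m) →
      ∀ x, R < ‖x‖ → ‖x‖ ≤ R + 3 → |f x| ≤ m := fun {f} hf x hx hx3 => by
    obtain ⟨y, hy, -, -, rfl, -, -⟩ := exists_polar_pair hR hx hx3 hx hx3 (by simp; positivity)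
    exact hf y hy
  refine ⟨fun x hx hx3 => (hsup h0 x hx hx3).trans (by linarith),
    fun k x hx hx3 => (hsup (h1 k).sup x hx hx3).trans (by linarith),
    fun k j x hx hx3 => (hsup (h2 j k).sup x hx hx3).trans (by linarith),
    fun k j x x' hx hx3 hx' hx'3 => ?_⟩
  by_cases hd : ‖x - x'‖ ≤ R / 2
  · obtain ⟨y, hy, y', hy', rfl, rfl, hyy⟩ := exists_polar_pair hR hx hx3 hx' hx'3 hd
    calc _ ≤ m * ‖y - y'‖ ^ α := (h2 j k).holder y hy y' hy'
      _ ≤ m * (3 / 2 * R⁻¹ * ‖polar R y - polar R y'‖) ^ α := by gcongr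
      _ = (3 / 2 * R⁻¹) ^ α * m * ‖polar R y - polar R y'‖ ^ α := by
        rw [Real.mul_rpow (by positivity) (norm_nonneg _)]; ring
      _ ≤ _ := by gcongr; linarith
  · have hd1 : 1 ≤ (2 / R) ^ α * ‖x - x'‖ ^ α := by
      rw [← Real.mul_rpow (by positivity) (norm_nonneg _)]
      refine Real.one_le_rpow ?_ hα.le
      rw [div_mul_eq_mul_div, one_le_div hR]
      linarith
    have s1 := hsup (h2 j k).sup x hx hx3
    have s2 := hsup (h2 j k).sup x' hx' hx'3
    calc _ ≤ 2 * m * 1 := by linarith [abs_sub (pd j (pd k v) x) (pd j (pd k v) x')]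
      _ ≤ 2 * m * ((2 / R) ^ α * ‖x - x'‖ ^ α) := by gcongr
      _ = 2 * (2 / R) ^ α * m * ‖x - x'‖ ^ α := by ring
      _ ≤ _ := by gcongr; linarith

lemma HomBound.mono {α R M M' : ℝ} {f : Plane → ℝ} (h : HomBound α R M f) (hM : M ≤ M') :
    HomBound α R M' f :=
  ⟨fun x hx => (h.sup x hx).trans (by gcongr), fun x y hx hy => (h.holder x y hx hy).trans (by gcongr)⟩

lemma AnnulusBound.mono {α R M M' : ℝ} {v : Plane → ℝ} (h : AnnulusBound α R M v) (hM : M ≤ M') :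
    AnnulusBound α R M' v :=
  ⟨fun x hx hx3 => (h.value x hx hx3).trans hM, fun i x hx hx3 => (h.grad i x hx hx3).trans hM,
    fun i j x hx hx3 => (h.hess i j x hx hx3).trans hM,
    fun i j x y hx hx3 hy hy3 => (h.holder i j x y hx hx3 hy hy3).trans (by gcongr)⟩

/-- Schauder estimate up to the boundary for functions that vanish on the boundary circle. -/
lemma exists_boundary_bound {α R : ℝ} (hα : 0 < α) (hα1 : α < 1) (hR : 0 < R) : ∃ C : ℝ, 0 < C ∧
    ∀ (v : Plane → ℝ) (M : ℝ), 0 ≤ M → ContDiffOn ℝ 2 v (exteriorInterior R) →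
      (∀ ρ : ℝ, ∃ K, ∀ x, R < ‖x‖ → ‖x‖ ≤ ρ → |v x| ≤ K * (‖x‖ - R)) →
      HomBound α R M (ou v) → (∀ x, R < ‖x‖ → |v x| ≤ M * ‖x‖) → AnnulusBound α R (C * M) v := by
  -- The half ball of radius `ρ` covers the annulus in logarithmic polar coordinates. The Hessian
  -- bound loses `3` in the radius and the gradient bound before it loses `1`, so data are used up
  -- to `ρ + 4`.
  set ρ := Real.log ((R + 3) / R) + 5 with hρ
  obtain ⟨Ce, hCe, he⟩ := exists_holderBoundOn_comp_polar (α := α) hα hR (ρ + 4)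
  have hr : ContDiff ℝ 1 fun y : Plane => (R * Real.exp (y 0)) ^ 2 :=
    (contDiff_const.mul (contDiff_coord 0).exp).pow 2
  have hgp : ContDiff ℝ 1 fun y : Plane => halfGauss (polar R y) :=
    contDiff_halfGauss.comp (contDiff_polar R)
  set q : Fin 2 → Plane → ℝ := ![fun y => (R * Real.exp (y 0)) ^ 2 * halfGauss (polar R y),
    fun y => (R * Real.exp (y 0)) ^ 2 * (1 - (R * Real.exp (y 0)) ^ 2 / 16)] with hq
  have hqc : ∀ i, ContDiff ℝ 1 (q i) := fun i => by
    fin_cases i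
    · exact hr.mul hgp
    · exact hr.mul (contDiff_const.sub (hr.div_const 16))
  obtain ⟨L, hL, hLq⟩ := exists_lipschitz_bound hr (ρ + 4)
  obtain ⟨Lq, hLq0, hmul⟩ := exists_common_mul_bound hα hα1 hqc (ρ + 3)
  obtain ⟨Cg, hCg, hgrad⟩ := exists_flat_gradient_bound
  obtain ⟨Cf, hCf, hflat⟩ := exists_flat_c2Bound hα hα1
  have hqi : ContDiff ℝ ∞ fun y : Plane => (halfGauss (polar R y))⁻¹ :=
    (contDiff_halfGauss.comp (contDiff_polar R)).inv fun y => (halfGauss_pos _).ne'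
  obtain ⟨Li, hLi, hinv⟩ := exists_mul_c2Bound hα hα1 hqi ρ
  obtain ⟨Ct, hCt, htr⟩ := exists_polar_transfer hα hα1 hR ρ
  obtain ⟨Ca, hCa, hann⟩ := exists_annulusBound_of_polar hα hR
  set s := R * Real.exp (ρ + 4) with hs
  have hs0 : 0 < s := by positivity
  -- Up to the factor `M`: `A` bounds `w` and its Laplacian, `G` also the gradient of `w`, and `D`
  -- also the Hölder norm of the Laplacian.
  set A := s + s ^ 2 * Ce + s ^ 2 * (1 + s ^ 2) * s with hA
  have hA0 : 0 < A := by positivity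
  set G := A + Cg * A with hG
  set D := G + Lq * Ce + Lq * (4 * G) with hD
  refine ⟨Ca * ((1 + Ct) * (Li * (Cf * D))) + 1, by positivity, fun v M hM hv hlin hE hvM => ?_⟩
  -- The Gaussian weight removes the drift: the Laplacian of `w` involves only the source and `w`
  -- itself. A gradient bound then already makes it Hölder continuous, and no absorption or
  -- iteration is needed.
  set w : Plane → ℝ := fun y => halfGauss (polar R y) * v (polar R y) with hw
  have hEs : ∀ x, R < ‖x‖ → |ou v x| ≤ M * R⁻¹ := fun x hx => (hE.sup x hx).trans (by gcongr)
  have hvan : VanishesOnBoundary w := vanishesOnBoundary_comp_polar hR hv hlin hEs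
  have hlap : ∀ y ∈ upperHalf, lap w y = q 0 y * ou v (polar R y) - q 1 y * w y := fun y hy => by
    rw [hw, lap_halfGauss_mul_comp_polar hR
      (hv.contDiffAt ((isOpen_exteriorInterior R).mem_nhds (polar_mem hR hy)))]
    simp [hq]
  have heM := he (ou v) M hM hE
  have hexp : ∀ y ∈ halfBall (ρ + 4), R * Real.exp (y 0) ≤ s := fun y hy => by
    rw [hs]
    gcongr
    exact (le_abs_self _).trans ((abs_coord_le_norm y 0).trans hy.2)
  have hw0 : ∀ y ∈ halfBall (ρ + 4), |w y| ≤ s * M := fun y hy => by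
    have h1 := hvM _ (polar_mem hR hy.1)
    rw [norm_polar hR] at h1
    rw [hw, abs_mul, abs_of_pos (halfGauss_pos _)]
    calc _ ≤ 1 * (M * s) := mul_le_mul (halfGauss_le_one _)
          (h1.trans (mul_le_mul_of_nonneg_left (hexp y hy) hM)) (abs_nonneg _) zero_le_one
      _ = _ := by ring
  have hl0 : ∀ y ∈ halfBall (ρ + 4), |lap w y| ≤ (s ^ 2 * Ce + s ^ 2 * (1 + s ^ 2) * s) * M := by
    intro y hy
    have hr2 : (R * Real.exp (y 0)) ^ 2 ≤ s ^ 2 := by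
      have := hexp y hy
      gcongr
    have hr0 : 0 ≤ (R * Real.exp (y 0)) ^ 2 := by positivity
    rw [hlap y hy.1, add_mul]
    refine (abs_sub _ _).trans (add_le_add ?_ ?_)
    · rw [abs_mul, mul_assoc]
      refine mul_le_mul ?_ (heM.sup y hy) (abs_nonneg _) (by positivity)
      simp only [hq, Matrix.cons_val_zero]
      rw [abs_mul, abs_of_nonneg hr0, abs_of_pos (halfGauss_pos _), ← mul_one (s ^ 2)]
      exact mul_le_mul hr2 (halfGauss_le_one _) (halfGauss_pos _).le (by positivity)
    · rw [abs_mul, mul_assoc]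
      refine mul_le_mul ?_ (hw0 y hy) (abs_nonneg _) (by positivity)
      simp only [hq, Matrix.cons_val_one, Matrix.cons_val_zero]
      rw [abs_mul, abs_of_nonneg hr0]
      refine mul_le_mul hr2 ?_ (abs_nonneg _) (by positivity)
      rw [abs_le]
      constructor <;> linarith
  have n1 : 0 ≤ s * M := by positivity
  have n2 : 0 ≤ s ^ 2 * Ce * M := by positivity
  have n3 : 0 ≤ s ^ 2 * (1 + s ^ 2) * s * M := by positivity
  have nA : 0 ≤ A * M := by positivity
  have nC : 0 ≤ Cg * A * M := by positivity
  have nG : 0 ≤ G * M := by positivity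
  have nE : 0 ≤ Lq * Ce * M := by positivity
  have nF : 0 ≤ Lq * (4 * G) * M := by positivity
  have hAM : A * M = s * M + s ^ 2 * Ce * M + s ^ 2 * (1 + s ^ 2) * s * M := by rw [hA]; ring
  have hGM : G * M = A * M + Cg * A * M := by rw [hG]; ring
  have hDM : D * M = G * M + Lq * Ce * M + Lq * (4 * G) * M := by rw [hD]; ring
  have h34 : ρ + 3 + 1 = ρ + 4 := by ring
  have hw1 : ∀ k, ∀ y ∈ halfBall (ρ + 3), |pd k w y| ≤ Cg * (A * M) :=
    hgrad w (A * M) (ρ + 3) hvan nA (by rw [h34]; exact fun y hy => (hw0 y hy).trans (by linarith))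
      (by rw [h34]; exact fun y hy => (hl0 y hy).trans (by linarith))
  have hsub : halfBall (ρ + 3) ⊆ halfBall (ρ + 4) := halfBall_mono (by linarith)
  have hw1' : ∀ k, ∀ y ∈ halfBall (ρ + 3), |pd k w y| ≤ G * M := fun k y hy =>
    (hw1 k y hy).trans (by linarith)
  have hw0' : ∀ y ∈ halfBall (ρ + 3), |w y| ≤ G * M := fun y hy =>
    (hw0 y (hsub hy)).trans (by linarith)
  have hwH : HolderBoundOn α (4 * G * M) (halfBall (ρ + 3)) w := by
    refine (HolderBoundOn.of_lipschitz (m := 2 * (G * M)) hα hα1 (by positivity)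
      (fun y hy => (hw0' y hy).trans (by linarith)) fun x hx y hy =>
        abs_sub_le_of_pd_le (convex_halfBall _) (fun z hz => (hvan.contDiffOn.contDiffAt
          (isOpen_upperHalf.mem_nhds hz.1)).differentiableAt (by norm_num)) hw1' hx hy).mono ?_
    linarith
  have hlapH : HolderBoundOn α (Lq * (Ce * M) + Lq * (4 * G * M)) (halfBall (ρ + 3)) (lap w) :=
    ((hmul 0 _ _ (by positivity) (heM.mono_set hsub)).sub (hmul 1 _ _ (by positivity) hwH)).congr
      fun y hy => hlap y hy.1
  have hc2 := hflat w (D * M) ρ hvan (by positivity) (fun y hy => (hw0' y hy).trans (by linarith))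
    (fun k y hy => (hw1' k y hy).trans (by linarith)) (hlapH.mono (by linarith))
  have hc2v := hinv w (Cf * (D * M)) (by positivity) hvan.contDiffOn hc2
  have hvw : (fun y => (halfGauss (polar R y))⁻¹ * w y) = fun y => v (polar R y) := by
    funext y
    simp only [hw]
    rw [← mul_assoc, inv_mul_cancel₀ (halfGauss_pos _).ne', one_mul]
  rw [hvw] at hc2v
  set m := Li * (Cf * (D * M)) with hm
  have hm0 : 0 ≤ m := by positivity
  obtain ⟨t1, t2⟩ := htr v m hm0 hv hc2v
  have hCm : 0 ≤ Ct * m := by positivity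
  refine (hann v ((1 + Ct) * m) (by positivity) (fun y hy => (hc2v.value.sup y hy).trans (by linarith))
    (fun k => (t1 k).mono (by linarith)) (fun j k => (t2 j k).mono (by linarith))).mono ?_
  rw [hm]
  linarith

/-! ### Derivatives on the exterior domain -/

lemma interior_subset_exteriorDomain (R : ℝ) : exteriorInterior R ⊆ exteriorDomain R :=
  fun _ hx => le_of_lt (show R < _ from hx)

lemma exteriorDomain_mem_nhds {R : ℝ} {x : Plane} (hx : R < ‖x‖) : exteriorDomain R ∈ 𝓝 x :=
  mem_of_superset ((isOpen_exteriorInterior R).mem_nhds hx) (interior_subset_exteriorDomain R)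

lemma isClosed_exteriorDomain (R : ℝ) : IsClosed (exteriorDomain R) :=
  isClosed_le continuous_const continuous_norm

lemma partialD_eq_pd {R : ℝ} {x : Plane} (hx : R < ‖x‖) (i : Fin 2) (f : Plane → ℝ) :
    partialD (exteriorDomain R) i f x = pd i f x := by
  rw [partialD, pd, fderivWithin_of_mem_nhds (exteriorDomain_mem_nhds hx)]

lemma partialD₂_eq_pd {R : ℝ} {x : Plane} (hx : R < ‖x‖) (i j : Fin 2) (f : Plane → ℝ) :
    partialD₂ (exteriorDomain R) i j f x = pd i (pd j f) x := by
  rw [partialD₂, partialD_eq_pd hx]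
  refine pd_congr ?_ i
  filter_upwards [(isOpen_exteriorInterior R).mem_nhds hx] with y hy
  exact partialD_eq_pd hy j f

lemma opL_eq_ou {R : ℝ} {x : Plane} (hx : R < ‖x‖) (f : Plane → ℝ) :
    opL (exteriorDomain R) f x = ou f x := by
  simp only [opL, ou, lap, partialD_eq_pd hx, partialD₂_eq_pd hx]

/-- Through each `x` passes the half plane `{y | R |x| ≤ ⟨x, y⟩}`, contained in the domain by
Cauchy-Schwarz; it is convex with nonempty interior. This makes the derivative within the closed
domain well defined and continuous up to the circle. -/
lemma uniqueDiffOn_exteriorDomain {R : ℝ} (hR : 0 < R) : UniqueDiffOn ℝ (exteriorDomain R) := by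
  intro x hx
  have hx' : R ≤ ‖x‖ := hx
  have hx0 : 0 < ‖x‖ := hR.trans_le hx'
  set H : Set Plane := {y | R * ‖x‖ ≤ inner ℝ x y} with hH
  have hc : Convex ℝ H := convex_halfSpace_ge (innerSL ℝ x).toLinearMap.isLinear _
  have ho : IsOpen {y : Plane | R * ‖x‖ < inner ℝ x y} :=
    isOpen_lt continuous_const (innerSL ℝ x).continuous
  have hi : (interior H).Nonempty := by
    refine ⟨(2 : ℝ) • x, interior_maximal (fun y (hy : R * ‖x‖ < inner ℝ x y) => hy.le) ho ?_⟩
    show R * ‖x‖ < inner ℝ x ((2 : ℝ) • x)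
    rw [inner_smul_right, real_inner_self_eq_norm_sq]
    nlinarith
  have hxH : x ∈ H := by
    show R * ‖x‖ ≤ inner ℝ x x
    rw [real_inner_self_eq_norm_sq]
    nlinarith
  refine (uniqueDiffWithinAt_convex hc hi (subset_closure hxH)).mono fun y hy => ?_
  have h1 : R * ‖x‖ ≤ ‖x‖ * ‖y‖ := (show R * ‖x‖ ≤ inner ℝ x y from hy).trans (real_inner_le_norm x y)
  show R ≤ ‖y‖
  nlinarith

lemma isCompact_annulus (R ρ : ℝ) : IsCompact (exteriorDomain R ∩ Metric.closedBall 0 ρ) :=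
  (isCompact_closedBall _ _).inter_left (isClosed_exteriorDomain R)

lemma MemHolderLoc.continuousOn {α : ℝ≥0} (hα : 0 < α) {R : ℝ} {f : Plane → ℝ}
    (hf : MemHolderLoc α (exteriorDomain R) f) : ContinuousOn f (exteriorDomain R) := by
  intro x hx
  obtain ⟨C, hC⟩ := hf _ inter_subset_left (isCompact_annulus R (‖x‖ + 1))
  refine ((hC.continuousOn hα) x ⟨hx, by simp⟩).mono_of_mem_nhdsWithin (inter_mem self_mem_nhdsWithin
    (mem_nhdsWithin_of_mem_nhds (mem_of_superset (Metric.isOpen_ball.mem_nhds ?_)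
      Metric.ball_subset_closedBall)))
  simp

lemma exists_bound_fderivWithin {R : ℝ} (hR : 0 < R) {v : Plane → ℝ}
    (hv : ContDiffOn ℝ 2 v (exteriorDomain R)) (ρ : ℝ) :
    ∃ K, ∀ x, R ≤ ‖x‖ → ‖x‖ ≤ ρ → ‖fderivWithin ℝ v (exteriorDomain R) x‖ ≤ K := by
  obtain ⟨K, hK⟩ := (isCompact_annulus R ρ).exists_bound_of_continuousOn
    ((hv.continuousOn_fderivWithin (uniqueDiffOn_exteriorDomain hR) (by norm_num)).mono inter_subset_left)
  exact ⟨K, fun x hx hxρ => hK x ⟨hx, mem_closedBall_zero_iff.2 hxρ⟩⟩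

/-- A function that vanishes on the boundary circle does so linearly. -/
lemma exists_linear_bound {R : ℝ} (hR : 0 < R) {v : Plane → ℝ}
    (hv : ContDiffOn ℝ 2 v (exteriorDomain R)) (h0 : ∀ x : Plane, ‖x‖ = R → v x = 0) (ρ : ℝ) :
    ∃ K, ∀ x, R < ‖x‖ → ‖x‖ ≤ ρ → |v x| ≤ K * (‖x‖ - R) := by
  obtain ⟨K, hK⟩ := exists_bound_fderivWithin hR hv ρ
  refine ⟨K, fun x hx hxρ => ?_⟩
  have hx0 : 0 < ‖x‖ := hR.trans hx
  -- The mean value inequality is applied along the radial segment from the boundary point `b • x`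
  -- to `x`, which stays in the nonconvex domain and has length `|x| - R`.
  set b := R / ‖x‖ with hb
  have hb0 : 0 < b := by positivity
  have hbx : b * ‖x‖ = R := div_mul_cancel₀ _ hx0.ne'
  have hb1 : b ≤ 1 := (div_le_one hx0).2 hx.le
  have hseg : ∀ z ∈ segment ℝ (b • x) x, R ≤ ‖z‖ ∧ ‖z‖ ≤ ρ := by
    rintro z ⟨c, d, hc, hd, hcd, rfl⟩
    have h1 : c • b • x + d • x = (c * b + d) • x := by rw [smul_smul, ← add_smul]
    have h2 : 0 ≤ c * b + d := by positivity
    rw [h1, norm_smul, Real.norm_eq_abs, abs_of_nonneg h2]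
    constructor
    · calc R = (c + d) * (b * ‖x‖) := by rw [hcd, hbx, one_mul]
        _ ≤ _ := by nlinarith [mul_nonneg (mul_nonneg hd (sub_nonneg.2 hb1)) hx0.le]
    · refine le_trans ?_ hxρ
      nlinarith [mul_nonneg (mul_nonneg hc (sub_nonneg.2 hb1)) hx0.le]
  have hd := (convex_segment (𝕜 := ℝ) (b • x) x).norm_image_sub_le_of_norm_hasFDerivWithin_le
    (fun z hz => ((hv.differentiableOn (by norm_num) z (hseg z hz).1).hasFDerivWithinAt.mono
      fun y hy => (hseg y hy).1)) (fun z hz => hK z (hseg z hz).1 (hseg z hz).2)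
    (left_mem_segment ℝ _ _) (right_mem_segment ℝ _ _)
  have hn : ‖b • x‖ = R := by rw [norm_smul, Real.norm_eq_abs, abs_of_pos hb0, hbx]
  rw [h0 _ hn, sub_zero, Real.norm_eq_abs] at hd
  refine hd.trans (le_of_eq ?_)
  have h1 : x - b • x = (1 - b) • x := by rw [sub_smul, one_smul]
  rw [h1, norm_smul, Real.norm_eq_abs, abs_of_nonneg (by linarith), sub_mul, hbx, one_mul]

/-- Qualitative: compactness of the closed annulus gives a constant depending on `v`. That suffices
for membership in the weighted space, without any boundary condition, but not for the uniform
estimate. -/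
lemma exists_annulusBound {α : ℝ≥0} (hα : 0 < α) {R : ℝ} (hR : 0 < R) {v : Plane → ℝ}
    (hv : MemHolderLoc₂ α (exteriorDomain R) v) : ∃ M : ℝ, 0 ≤ M ∧ AnnulusBound α R M v := by
  have hK := isCompact_annulus R (R + 3)
  have hmem : ∀ x : Plane, R < ‖x‖ → ‖x‖ ≤ R + 3 → x ∈ exteriorDomain R ∩ Metric.closedBall 0 (R + 3) :=
    fun x hx hx3 => ⟨hx.le, mem_closedBall_zero_iff.2 hx3⟩
  obtain ⟨A, hA⟩ := hK.exists_bound_of_continuousOn (hv.1.continuousOn.mono inter_subset_left)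
  obtain ⟨G, hG⟩ := exists_bound_fderivWithin hR hv.1 (R + 3)
  have hH : ∀ k : Fin 2 × Fin 2, ∃ B, ∀ x ∈ exteriorDomain R ∩ Metric.closedBall 0 (R + 3),
      ‖partialD₂ (exteriorDomain R) k.1 k.2 v x‖ ≤ B := fun k =>
    hK.exists_bound_of_continuousOn (((hv.2 k.1 k.2).continuousOn hα).mono inter_subset_left)
  choose B hB using hH
  have hL := fun k : Fin 2 × Fin 2 => hv.2 k.1 k.2 _ inter_subset_left hK
  choose L hL using hL
  set M := |A| + |G| + ∑ k, (|B k| + (L k : ℝ)) with hM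
  have hs : ∀ k, |B k| + (L k : ℝ) ≤ ∑ k, (|B k| + (L k : ℝ)) := fun k =>
    Finset.single_le_sum (f := fun k => |B k| + (L k : ℝ)) (fun i _ => by positivity) (Finset.mem_univ k)
  have hs0 : 0 ≤ ∑ k, (|B k| + (L k : ℝ)) := Finset.sum_nonneg fun i _ => by positivity
  have a1 := abs_nonneg A
  have a2 := abs_nonneg G
  refine ⟨M, by positivity, fun x hx hx3 => ?_, fun i x hx hx3 => ?_, fun i j x hx hx3 => ?_,
    fun i j x y hx hx3 hy hy3 => ?_⟩
  · exact (hA x (hmem x hx hx3)).trans (by linarith [le_abs_self A])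
  · refine (abs_pd_le_norm_fderiv i v x).trans ?_
    rw [← fderivWithin_of_mem_nhds (exteriorDomain_mem_nhds hx)]
    exact (hG x hx.le hx3).trans (by linarith [le_abs_self G])
  · rw [← partialD₂_eq_pd hx]
    refine (hB (j, i) x (hmem x hx hx3)).trans ?_
    have := hs (j, i)
    have := (L (j, i)).coe_nonneg
    linarith [le_abs_self (B (j, i))]
  · rw [← partialD₂_eq_pd hx, ← partialD₂_eq_pd hy, ← Real.dist_eq, ← dist_eq_norm]
    refine ((hL (j, i)).dist_le (hmem x hx hx3) (hmem y hy hy3)).trans ?_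
    have := hs (j, i)
    gcongr
    linarith [abs_nonneg (B (j, i))]

/-! ### The weighted norm -/

lemma homBound_of_homNorm {α : ℝ≥0} {R : ℝ} (hR : 0 < R) {f : Plane → ℝ}
    (hf : homNorm α 1 (exteriorDomain R) f ≠ ⊤) :
    HomBound α R (homNorm α 1 (exteriorDomain R) f).toReal f := by
  constructor
  · intro x hx
    have h1 : ENNReal.ofReal (‖x‖ ^ 1 * |f x|) ≤ homNorm α 1 (exteriorDomain R) f :=
      (le_iSup₂_of_le (f := fun x (_ : x ∈ exteriorDomain R) => ENNReal.ofReal (‖x‖ ^ 1 * |f x|))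
        x hx.le le_rfl).trans le_add_self
    have h2 := (ENNReal.ofReal_le_iff_le_toReal hf).1 h1
    have hx0 : 0 < ‖x‖ := hR.trans hx
    rw [pow_one] at h2
    rw [← div_eq_mul_inv, le_div_iff₀ hx0, mul_comm]
    exact h2
  · intro x y hx hy
    rcases eq_or_ne x y with rfl | hxy
    · rw [sub_self, abs_zero]; positivity
    have h1 : ENNReal.ofReal (1 / (‖x‖ ^ (-((1 : ℕ) : ℝ) - (α : ℝ)) + ‖y‖ ^ (-((1 : ℕ) : ℝ) - (α : ℝ))) *
        (|f x - f y| / ‖x - y‖ ^ (α : ℝ))) ≤ homNorm α 1 (exteriorDomain R) f := by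
      refine le_trans ?_ (le_self_add : homSeminorm α 1 (exteriorDomain R) f ≤ _)
      exact le_iSup₂_of_le x hx.le (le_iSup₂_of_le y hy.le (le_iSup_of_le hxy le_rfl))
    have h2 := (ENNReal.ofReal_le_iff_le_toReal hf).1 h1
    have hx0 : 0 < ‖x‖ := hR.trans hx
    have hy0 : 0 < ‖y‖ := hR.trans hy
    have hd : 0 < ‖x - y‖ := norm_pos_iff.2 (sub_ne_zero.2 hxy)
    rw [Nat.cast_one, one_div, inv_mul_le_iff₀ (by positivity), div_le_iff₀ (by positivity)] at h2
    linarith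

/-- Interior bounds pass to the circle by continuity along the dilations `t • x` as `t` decreases to
`1`. The factor `2` appears because the norm is the sum of two suprema, each at most `M`. -/
lemma homNorm_le_of_homBound {α : ℝ≥0} {R M : ℝ} (hR : 0 < R) (hM : 0 ≤ M) {f : Plane → ℝ}
    (hc : ContinuousOn f (exteriorDomain R)) (hf : HomBound α R M f) :
    homNorm α 1 (exteriorDomain R) f ≤ ENNReal.ofReal (2 * M) := by
  have hm : ∀ x ∈ exteriorDomain R, ∀ t : ℝ, 1 < t → R < ‖t • x‖ := fun x hx t ht => by
    have hx' : R ≤ ‖x‖ := hx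
    rw [norm_smul, Real.norm_eq_abs, abs_of_pos (by linarith)]
    nlinarith
  have hsm : ∀ x : Plane, Tendsto (fun t : ℝ => t • x) (𝓝[>] 1) (𝓝 x) := fun x => by
    have : ContinuousAt (fun t : ℝ => t • x) 1 := by fun_prop
    simpa using this.tendsto.mono_left nhdsWithin_le_nhds
  have hft : ∀ x ∈ exteriorDomain R, Tendsto (fun t : ℝ => f (t • x)) (𝓝[>] 1) (𝓝 (f x)) := by
    intro x hx
    refine (hc x hx).tendsto.comp (tendsto_nhdsWithin_iff.2 ⟨hsm x, ?_⟩)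
    filter_upwards [self_mem_nhdsWithin] with t ht
    exact (hm x hx t ht).le
  have hpos : ∀ x ∈ exteriorDomain R, 0 < ‖x‖ := fun x hx => hR.trans_le hx
  have hsup : ∀ x ∈ exteriorDomain R, |f x| ≤ M * ‖x‖⁻¹ := fun x hx => by
    refine le_of_tendsto_of_tendsto (hft x hx).abs
      (((hsm x).norm.inv₀ (hpos x hx).ne').const_mul M) ?_
    filter_upwards [self_mem_nhdsWithin] with t ht
    exact hf.sup _ (hm x hx t ht)
  have hhol : ∀ x ∈ exteriorDomain R, ∀ y ∈ exteriorDomain R, |f x - f y| ≤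
      M * (‖x‖ ^ (-1 - (α : ℝ)) + ‖y‖ ^ (-1 - (α : ℝ))) * ‖x - y‖ ^ (α : ℝ) := fun x hx y hy => by
    refine le_of_tendsto_of_tendsto ((hft x hx).sub (hft y hy)).abs
      (((((hsm x).norm.rpow_const (Or.inl (hpos x hx).ne')).add
        ((hsm y).norm.rpow_const (Or.inl (hpos y hy).ne'))).const_mul M).mul
        (((hsm x).sub (hsm y)).norm.rpow_const (Or.inr α.coe_nonneg))) ?_
    filter_upwards [self_mem_nhdsWithin] with t ht
    exact hf.holder _ _ (hm x hx t ht) (hm y hy t ht)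
  rw [two_mul, ENNReal.ofReal_add hM hM, homNorm]
  refine add_le_add ?_ (iSup₂_le fun x hx => ENNReal.ofReal_le_ofReal ?_)
  · refine iSup₂_le fun x hx => iSup₂_le fun y hy => iSup_le fun hxy => ENNReal.ofReal_le_ofReal ?_
    have hd : 0 < ‖x - y‖ := norm_pos_iff.2 (sub_ne_zero.2 hxy)
    have h1 := hpos x hx
    have h2 := hpos y hy
    rw [Nat.cast_one, one_div, inv_mul_le_iff₀ (by positivity), div_le_iff₀ (by positivity)]
    linarith [hhol x hx y hy]
  · have := hsup x hx
    rw [← div_eq_mul_inv, le_div_iff₀ (hpos x hx)] at this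
    rw [pow_one]
    linarith

/-! ### Solutions -/

section Solution

variable {α : ℝ≥0} {R : ℝ} {E v : Plane → ℝ}

lemma HomBound.congr {α R M : ℝ} {f g : Plane → ℝ} (h : HomBound α R M f)
    (hfg : ∀ x, R < ‖x‖ → g x = f x) : HomBound α R M g :=
  ⟨fun x hx => by rw [hfg x hx]; exact h.sup x hx,
    fun x y hx hy => by rw [hfg x hx, hfg y hy]; exact h.holder x y hx hy⟩

lemma IsSolution.contDiffOn_interior (h : IsSolution α R E v) : ContDiffOn ℝ 2 v (exteriorInterior R) :=
  h.2.1.1.mono (interior_subset_exteriorDomain R)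

lemma IsSolution.homBound_ou (h : IsSolution α R E v) (hR : 0 < R)
    (hE : MemHom α 1 (exteriorDomain R) E) :
    HomBound α R (homNorm α 1 (exteriorDomain R) E).toReal (ou v) :=
  (homBound_of_homNorm hR hE.2.ne).congr fun x hx => by rw [← opL_eq_ou hx, h.2.2 x hx.le]

lemma IsSolution.exists_growth (h : IsSolution α R E v) (hR : 0 < R)
    (hE : MemHom α 1 (exteriorDomain R) E) :
    ∃ B : ℝ, 0 ≤ B ∧ ∀ x, R + 1 ≤ ‖x‖ → |v x| ≤ B * Real.exp (5 / 32 * ‖x‖ ^ 2) ∧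
      ∀ i, |pd i v x| ≤ B * Real.exp (5 / 32 * ‖x‖ ^ 2) :=
  ExteriorOU.exists_growth (M := (homNorm α 1 (exteriorDomain R) E).toReal * R⁻¹) hR.le
    h.contDiffOn_interior (fun x hx => ((h.homBound_ou hR hE).sup x hx).trans (by gcongr)) h.1.1
    (lt_add_one R)

lemma IsSolution.homNorm_le (h : IsSolution α R E v) (hα : 0 < α) (hR : 0 < R) {M : ℝ} (hM : 0 ≤ M)
    {i j : Fin 2} (hb : HomBound α R M (pd i (pd j v))) :
    homNorm α 1 (exteriorDomain R) (partialD₂ (exteriorDomain R) i j v) ≤ ENNReal.ofReal (2 * M) :=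
  homNorm_le_of_homBound hR hM ((h.2.1.2 i j).continuousOn hα)
    (hb.congr fun _ hx => partialD₂_eq_pd hx i j v)

/-- Second derivatives of solutions lie in the weighted Hölder space. -/
lemma IsSolution.memHom_partialD₂ (h : IsSolution α R E v) (hα : 0 < α) (hα1 : α < 1) (hR : 0 < R)
    (hE : MemHom α 1 (exteriorDomain R) E) (i j : Fin 2) :
    MemHom α 1 (exteriorDomain R) (partialD₂ (exteriorDomain R) i j v) := by
  obtain ⟨M, hM, hA⟩ := exists_annulusBound hα hR h.2.1
  obtain ⟨C, hC, hb⟩ := exists_homBound (α := α) (by exact_mod_cast hα) (by exact_mod_cast hα1) hR j i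
  have := hb v (max M (homNorm α 1 (exteriorDomain R) E).toReal) (hM.trans (le_max_left _ _))
    h.contDiffOn_interior ((h.homBound_ou hR hE).mono (le_max_right _ _)) (hA.mono (le_max_left _ _))
    (h.exists_growth hR hE)
  exact ⟨h.2.1.2 i j, (h.homNorm_le hα hR (by positivity) this).trans_lt ENNReal.ofReal_lt_top⟩

/-- The maximum principle: a solution that vanishes on the boundary grows at most linearly. -/
lemma IsSolution.abs_le_mul_norm (h : IsSolution α R E v) (hR : 1 < R)
    (hE : MemHom α 1 (exteriorDomain R) E) (h0 : ∀ x : Plane, ‖x‖ = R → v x = 0) (x : Plane)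
    (hx : R < ‖x‖) :
    |v x| ≤ (homNorm α 1 (exteriorDomain R) E).toReal / ((R ^ 2 - 1) / 2) * ‖x‖ := by
  have hR0 : 0 < R := by linarith
  obtain ⟨B, -, hB⟩ := h.exists_growth hR0 hE
  have hR2 : 0 < R ^ 2 - 1 := by nlinarith
  set M := (homNorm α 1 (exteriorDomain R) E).toReal with hM
  have hM0 : 0 ≤ M := ENNReal.toReal_nonneg
  have ha : (1 + R ^ 2) / 2 - 1 = (R ^ 2 - 1) / 2 := by ring
  have hK : 0 ≤ M / ((R ^ 2 - 1) / 2) := by positivity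
  -- `a` is the midpoint of `1` and `R²`: above `1` for the supersolution property, below `R²` for
  -- positivity of the barrier on the domain. This is the place where `R > 1` is indispensable to
  -- the argument.
  have key := abs_le_barrier (a := (1 + R ^ 2) / 2) (ρ := R) (M := M) (K := M / ((R ^ 2 - 1) / 2))
    (B := B) (by linarith) hR0 (by linarith) hK (by rw [ha, div_mul_cancel₀ _ (by positivity)])
    h.2.1.1.continuousOn h.contDiffOn_interior
    (fun y hy => ((h.homBound_ou hR0 hE).sup y hy).trans_eq (div_eq_mul_inv _ _).symm)
    (fun y hy => by
      rw [h0 y hy, abs_zero]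
      refine mul_nonneg hK ?_
      rw [barrier, hy, sub_nonneg, div_le_iff₀ hR0]
      nlinarith)
    (fun y hy => (hB y hy).1) x hx.le
  refine key.trans (mul_le_mul_of_nonneg_left ?_ hK)
  have : 0 ≤ (1 + R ^ 2) / 2 / ‖x‖ := by positivity
  rw [barrier]
  linarith

/-- The global estimate for solutions that vanish on a circle of radius larger than one. -/
lemma exists_homNorm_le (hα : 0 < α) (hα1 : α < 1) (hR : 1 < R) :
    ∃ C : ℝ≥0, 0 < C ∧ ∀ E v : Plane → ℝ, MemHom α 1 (exteriorDomain R) E → IsSolution α R E v →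
      (∀ x : Plane, ‖x‖ = R → v x = 0) → ∀ i j : Fin 2,
        homNorm α 1 (exteriorDomain R) (partialD₂ (exteriorDomain R) i j v) ≤
          C * homNorm α 1 (exteriorDomain R) E := by
  have hR0 : 0 < R := by linarith
  have hR2 : 0 < R ^ 2 - 1 := by nlinarith
  have hα' : (0 : ℝ) < α := by exact_mod_cast hα
  have hα1' : (α : ℝ) < 1 := by exact_mod_cast hα1
  obtain ⟨Cb, hCb, hbd⟩ := exists_boundary_bound hα' hα1' hR0
  have hhom := fun k : Fin 2 × Fin 2 => exists_homBound hα' hα1' hR0 k.2 k.1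
  choose Ch hCh hhom using hhom
  -- One constant for both inputs of the boundary estimate: the norm of `E` itself, and the linear
  -- growth bound from the maximum principle.
  set D := 1 + 1 / ((R ^ 2 - 1) / 2) with hD
  have hD0 : 0 < 1 / ((R ^ 2 - 1) / 2) := by positivity
  set S := ∑ k, Ch k with hS
  have hS0 : 0 < S := Finset.sum_pos (fun k _ => hCh k) Finset.univ_nonempty
  set C := 2 * (S * ((1 + Cb) * D)) with hC
  have hC0 : 0 < C := by positivity
  refine ⟨C.toNNReal, Real.toNNReal_pos.2 hC0, fun E v hE h h0 i j => ?_⟩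
  set M := (homNorm α 1 (exteriorDomain R) E).toReal with hM
  have hM0 : 0 ≤ M := ENNReal.toReal_nonneg
  have hDM : M ≤ D * M := by nlinarith [mul_nonneg hD0.le hM0]
  have hE' := h.homBound_ou hR0 hE
  have hA := hbd v (D * M) (by positivity) h.contDiffOn_interior (exists_linear_bound hR0 h.2.1.1 h0)
    (hE'.mono hDM) fun x hx => (h.abs_le_mul_norm hR hE h0 x hx).trans (by
      gcongr
      rw [← hM, hD, div_eq_mul_one_div, add_mul, one_mul, mul_comm]
      linarith)
  have hCbM : 0 ≤ Cb * (D * M) := by positivity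
  have hH := hhom (i, j) v ((1 + Cb) * (D * M)) (by positivity) h.contDiffOn_interior
    (hE'.mono (by linarith)) (hA.mono (by linarith [hM0])) (h.exists_growth hR0 hE)
  have hle : Ch (i, j) ≤ S := Finset.single_le_sum (f := Ch) (fun k _ => (hCh k).le) (Finset.mem_univ _)
  have hfin := h.homNorm_le hα hR0 (M := S * ((1 + Cb) * (D * M))) (by positivity)
    (hH.mono (by gcongr))
  refine hfin.trans (le_of_eq ?_)
  rw [show 2 * (S * ((1 + Cb) * (D * M))) = C * M by rw [hC]; ring, ENNReal.ofReal_mul hC0.le, hM,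
    ENNReal.ofReal_toReal hE.2.ne]
  rfl

end Solution

end ExteriorOU

end

theorem mainTheorem4 (α : ℝ≥0) (hα₀ : 0 < α) (hα₁ : α < 1) :
    (∀ R : ℝ, 0 < R → ∀ E v : ExteriorOU.Plane → ℝ,
      ExteriorOU.MemHom α 1 (ExteriorOU.exteriorDomain R) E →
      ExteriorOU.IsSolution α R E v →
      ∀ i j : Fin 2, ExteriorOU.MemHom α 1 (ExteriorOU.exteriorDomain R)
        (ExteriorOU.partialD₂ (ExteriorOU.exteriorDomain R) i j v)) ∧
    (∀ R : ℝ, 1 < R → ∃ C : ℝ≥0, 0 < C ∧ ∀ E v : ExteriorOU.Plane → ℝ,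
      ExteriorOU.MemHom α 1 (ExteriorOU.exteriorDomain R) E →
      ExteriorOU.IsSolution α R E v →
      (∀ x : ExteriorOU.Plane, ‖x‖ = R → v x = 0) →
      ∀ i j : Fin 2,
        ExteriorOU.homNorm α 1 (ExteriorOU.exteriorDomain R)
            (ExteriorOU.partialD₂ (ExteriorOU.exteriorDomain R) i j v) ≤
          (C : ℝ≥0∞) * ExteriorOU.homNorm α 1 (ExteriorOU.exteriorDomain R) E) := by
  exact ⟨fun R hR E v hE h i j => h.memHom_partialD₂ hα₀ hα₁ hR hE i j,
    fun R hR => ExteriorOU.exists_homNorm_le hα₀ hα₁ hR⟩
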